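/- **Setting.** Let $(M,g)$ be a smooth $n$-dimensional Riemannian manifold with Levi-Civita connection $\mathring\nabla$ (Christoffel symbols $\Gamma^i_{jk}$) and let $H$ be a closed 3-form on $M$. For a vector $u$ and a covector $\eta$ write $u^*=g(u,\cdot)$ and $\eta^*=\eta_ig^{ij}\partial_j$. Let $\mathcal O\in\Gamma(\mathrm{End}\,TM)$ be smooth and $g$-orthogonal, and suppose that its graph $D=\{(\mathrm{id}-\mathcal O)a\oplus((\mathrm{id}+\mathcal O)a)^*\}\subset TM\oplus T^*M$ is a Dirac structure: $D$ is isotropic of rank $n$, and its sections are closed under the $H$-twisted Courant bracket $$[v\oplus\eta,w\oplus\zeta]=[v,w]\oplus\big(\mathcal L_v\zeta-\mathcal L_w\eta-\tfrac12 d(\iota_v\zeta-\iota_w\eta)-\iota_v\iota_wH\big),\qquad \iota_v\iota_wH=H(w,v,\cdot).$$ Let $\Sigma$ be an oriented surface with a Lorentzian metric $h$ and Hodge operator $*$ on 1-forms ($\alpha\wedge *\beta=h^{-1}(\alpha,\beta)\,\mathrm{vol}_h$, so $*^2=1$), and let $\hat\Sigma$ be an oriented 3-manifold with boundary $\partial\hat\Sigma=\Sigma$.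 For a smooth map $X:\hat\Sigma\to M$ (restricted to $\Sigma$ wherever it occurs there) and $\mathfrak a\in\Omega^1(\Sigma,X^*TM)$ put $v=(\mathrm{id}-\mathcal O)\mathfrak a$, $\eta=((\mathrm{id}+\mathcal O)\mathfrak a)^*$, $\mathrm DX=dX-v$, and $$S[X,\mathfrak a]=\int_\Sigma\Big(\tfrac12 g_{ij}\,\mathrm DX^i\wedge *\mathrm DX^j+\eta_i\wedge dX^i-\tfrac12\eta_i\wedge v^i\Big)+\int_{\hat\Sigma}X^*H .$$ If $\Sigma$ or $\hat\Sigma$ is not compact, the integrals are taken over compact sets $K\subset\Sigma$, $K'\subset\hat\Sigma$ such that the parameter $\varepsilon$ below vanishes outside $K$ and the variation of $X$ on $\hat\Sigma$ vanishes outside $K'$. **Theorem.** 1. At every point, the operator $\Theta=\tfrac14(\mathrm{id}+\mathcal O^{-1})+\tfrac14(\mathrm{id}-\mathcal O^{-1})*$ on $T^*\Sigma\otimes X^*TM$ is the two-sided inverse of $(\mathrm{id}+\mathcal O)+(\mathrm{id}-\mathcal O)*$. 2. In every coordinate chart of $M$, the local sections $\mathfrak u_i=(\mathrm{id}-\mathcal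 O)^l{}_i\,\partial_l\oplus g_{lm}(\mathrm{id}+\mathcal O)^m{}_i\,dx^l$ of $D$ satisfy $[\mathfrak u_j,\mathfrak u_k]=C^i_{jk}\,\mathfrak u_i$ for the twisted Courant bracket, where, with weighted antisymmetrization $A_{[j}B_{k]}=\tfrac12(A_jB_k-A_kB_j)$, $$C^i_{jk}=2(\mathrm{id}-\mathcal O)^l{}_{[j}\Gamma^i_{k]l}+g^{il}g_{mq}\,\mathcal O^q{}_{[j}\mathring\nabla_l\mathcal O^m{}_{k]}+\tfrac12 g^{il}H_{lmq}(\mathrm{id}-\mathcal O)^m{}_j(\mathrm{id}-\mathcal O)^q{}_k .$$ 3. The action is gauge invariant: for all $X$, $\mathfrak a$ and every $\varepsilon\in\Gamma(X^*TM)$ as above, $\frac{d}{dt}\big|_{t=0}S[X_t,\mathfrak a_t]=0$ for every smooth one-parameter family $(X_t,\mathfrak a_t)$ through $(X,\mathfrak a)$, with $X_t=X$ outside $K'$, whose velocity at $t=0$ is, on $\Sigma$, $$\delta_\varepsilon X=(\mathrm{id}-\mathcal O)\varepsilon,$$ $$\delta_\varepsilon\mathfrak a=\mathring\nabla^*\varepsilon-g\big(\mathcal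 O^{-1}\mathring\nabla(\mathcal O)\mathfrak a,\varepsilon\big)^*+\tfrac12H\big((\mathrm{id}-\mathcal O)\mathfrak a,(\mathrm{id}-\mathcal O)\varepsilon,\cdot\big)^*+\Theta\Big(\tfrac12H\big(\mathrm DX,(\mathrm{id}-\mathcal O)\varepsilon,\cdot\big)^*+(1-*)\mathring\nabla_{\mathrm DX}(\mathcal O)\varepsilon\Big).$$ Here $\mathring\nabla^*\varepsilon=(d\varepsilon^i+\Gamma^i_{jk}dX^j\varepsilon^k)\partial_i$, the first $(\cdot)^*$ is applied to the covector $w\mapsto g(\mathcal O^{-1}\mathring\nabla_w(\mathcal O)\mathfrak a,\varepsilon)$, and the variation of $\mathfrak a$ is the covariant one, $\delta_\varepsilon\mathfrak a=(\delta_\varepsilon\mathfrak a^i+\Gamma^i_{jk}\mathfrak a^j\delta_\varepsilon X^k)\partial_i$. -/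

import Mathlib

open scoped Manifold ContDiff
open MeasureTheory Set

noncomputable section

namespace DiracSigma

/-! ### Charts, coordinate frames, integration of top-degree forms -/

section Charts

variable {d : ℕ} {B : Type*} [TopologicalSpace B]
  (I : ModelWithCorners ℝ (EuclideanSpace ℝ (Fin d)) B)
  {Q : Type*} [TopologicalSpace Q] [ChartedSpace B Q]

/-- The differential at `p` of the inverse of the chart around `x₀`: it sends `cⁱ` to `cⁱ ∂ᵢ`. -/
def frameAt (x₀ : Q) (p : EuclideanSpace ℝ (Fin d)) :
    EuclideanSpace ℝ (Fin d) →L[ℝ] TangentSpace I ((extChartAt I x₀).symm p) :=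
  mfderivWithin 𝓘(ℝ, EuclideanSpace ℝ (Fin d)) I (extChartAt I x₀).symm (range I) p

/-- The differential at `y` of the chart around `x₀`: it sends `cⁱ ∂ᵢ` to `cⁱ`. -/
def coframe (x₀ y : Q) : TangentSpace I y →L[ℝ] EuclideanSpace ℝ (Fin d) :=
  mfderiv I 𝓘(ℝ, EuclideanSpace ℝ (Fin d)) (extChartAt I x₀) y

/-- The tangent vector `cⁱ ∂ᵢ` at `x`, in the coordinates of the chart around `x`. -/
def ofCoord (x : Q) (c : Fin d → ℝ) : TangentSpace I x :=
  frameAt I x (extChartAt I x x) (WithLp.toLp 2 c)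

/-- The components `wⁱ` of a tangent vector `w` at `x`, in the chart around `x`. -/
def coord (x : Q) (w : TangentSpace I x) (i : Fin d) : ℝ := coframe I x x w i

/-- The coordinate vector `∂ᵢ` at `x`, in the chart around `x`. -/
def basisVec (x : Q) (i : Fin d) : TangentSpace I x := ofCoord I x (Pi.single i 1)

/-- The coefficient `α(∂₁, …, ∂_d)` of a top-degree form `α` in the chart around `x₀`. -/
def topCoeff (α : ∀ x : Q, (Fin d → TangentSpace I x) → ℝ) (x₀ : Q)
    (p : EuclideanSpace ℝ (Fin d)) : ℝ :=
  α ((extChartAt I x₀).symm p) fun i => frameAt I x₀ p (EuclideanSpace.single i 1)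

open Classical in
/-- The measure `|vol|` of a volume form: `Q` is cut into countably many disjoint Borel pieces,
each of them inside one chart, and on each piece the measure is `|vol(∂₁, …, ∂_d)| dx¹ ⋯ dx^d`.
(A sequence of charts that covers `Q` exists when `Q` is non-empty and second countable, and the
measure does not depend on the choice.) -/
def volMeasure [MeasurableSpace Q] (vol : ∀ x : Q, (Fin d → TangentSpace I x) → ℝ) : Measure Q :=
  if h : ∃ c : ℕ → Q, ⋃ k, (extChartAt I (c k)).source = univ then
    Measure.sum fun k =>
      ((((volume.restrict (extChartAt I (h.choose k)).target).withDensity fun p =>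
          ENNReal.ofReal |topCoeff I vol (h.choose k) p|).map
            (extChartAt I (h.choose k)).symm).restrict
        (disjointed (fun l => (extChartAt I (h.choose l)).source) k))
  else 0

/-- The integral over `K` of the top-degree form `α` on a manifold that is oriented by the volume
form `vol`: write `α = f vol` and integrate `f` against `|vol|`. -/
def integralForm [MeasurableSpace Q] (vol : ∀ x : Q, (Fin d → TangentSpace I x) → ℝ) (K : Set Q)
    (α : ∀ x : Q, (Fin d → TangentSpace I x) → ℝ) : ℝ :=
  ∫ x in K, α x (basisVec I x) / vol x (basisVec I x) ∂(volMeasure I vol)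

end Charts

/-! ### Tensor calculus on the target space -/

section Target

variable {n : ℕ} {M : Type*} [TopologicalSpace M] [ChartedSpace (EuclideanSpace ℝ (Fin n)) M]

/-- The components `O^i_j` of an endomorphism field in the chart around `x₀`. -/
def endCoord (O : ∀ x : M, TangentSpace (𝓡 n) x →L[ℝ] TangentSpace (𝓡 n) x) (x₀ : M)
    (p : EuclideanSpace ℝ (Fin n)) : Matrix (Fin n) (Fin n) ℝ :=
  Matrix.of fun i j =>
    coframe (𝓡 n) x₀ ((extChartAt (𝓡 n) x₀).symm p) (O ((extChartAt (𝓡 n) x₀).symm p)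
      (frameAt (𝓡 n) x₀ p (EuclideanSpace.single j 1))) i

def IsSmoothEnd (O : ∀ x : M, TangentSpace (𝓡 n) x →L[ℝ] TangentSpace (𝓡 n) x) : Prop :=
  ∀ (x₀ : M) (i j : Fin n),
    ContDiffOn ℝ ∞ (fun p => endCoord O x₀ p i j) (extChartAt (𝓡 n) x₀).target

/-- A 3-form in the chart around `x₀`. -/
def formCoord (H : ∀ x : M, TangentSpace (𝓡 n) x [⋀^Fin 3]→L[ℝ] ℝ) (x₀ : M)
    (p : EuclideanSpace ℝ (Fin n)) : EuclideanSpace ℝ (Fin n) [⋀^Fin 3]→L[ℝ] ℝ :=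
  (H ((extChartAt (𝓡 n) x₀).symm p)).compContinuousLinearMap (frameAt (𝓡 n) x₀ p)

/-- `H` is a smooth 3-form with `dH = 0`. -/
structure IsClosedThreeForm (H : ∀ x : M, TangentSpace (𝓡 n) x [⋀^Fin 3]→L[ℝ] ℝ) : Prop where
  smooth : ∀ x₀ : M, ContDiffOn ℝ ∞ (formCoord H x₀) (extChartAt (𝓡 n) x₀).target
  closed : ∀ x₀ : M, ∀ p ∈ (extChartAt (𝓡 n) x₀).target, extDeriv (formCoord H x₀) p = 0

/-! #### The twisted Courant bracket and Dirac structures -/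

/-- `(𝓛_v ζ)_i = v^m ∂_m ζ_i + ζ_m ∂_i v^m`. -/
def lieForm (v : EuclideanSpace ℝ (Fin n) → EuclideanSpace ℝ (Fin n))
    (ζ : EuclideanSpace ℝ (Fin n) → EuclideanSpace ℝ (Fin n) →L[ℝ] ℝ)
    (p : EuclideanSpace ℝ (Fin n)) : EuclideanSpace ℝ (Fin n) →L[ℝ] ℝ :=
  fderiv ℝ ζ p (v p) + (ζ p).comp (fderiv ℝ v p)

/-- The covector `H(v, w, ·)`. -/
def contract (H : EuclideanSpace ℝ (Fin n) [⋀^Fin 3]→L[ℝ] ℝ) (v w : EuclideanSpace ℝ (Fin n)) :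
    EuclideanSpace ℝ (Fin n) →L[ℝ] ℝ :=
  H.toContinuousMultilinearMap.toContinuousLinearMap ![v, w, 0] 2

/-- The 1-form part of the `H`-twisted Courant bracket `[v ⊕ η, w ⊕ ζ]` in a chart,
`𝓛_v ζ - 𝓛_w η - ½ d(ι_v ζ - ι_w η) - ι_v ι_w H`, where `ι_v ι_w H = H(w, v, ·)`. The vector part
of the bracket is the Lie bracket `[v, w]`. -/
def courantForm (H : EuclideanSpace ℝ (Fin n) → EuclideanSpace ℝ (Fin n) [⋀^Fin 3]→L[ℝ] ℝ)
    (v : EuclideanSpace ℝ (Fin n) → EuclideanSpace ℝ (Fin n))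
    (η : EuclideanSpace ℝ (Fin n) → EuclideanSpace ℝ (Fin n) →L[ℝ] ℝ)
    (w : EuclideanSpace ℝ (Fin n) → EuclideanSpace ℝ (Fin n))
    (ζ : EuclideanSpace ℝ (Fin n) → EuclideanSpace ℝ (Fin n) →L[ℝ] ℝ)
    (p : EuclideanSpace ℝ (Fin n)) : EuclideanSpace ℝ (Fin n) →L[ℝ] ℝ :=
  lieForm v ζ p - lieForm w η p - (1 / 2 : ℝ) • fderiv ℝ (fun q => ζ q (v q) - η q (w q)) p
    - contract (H p) (w p) (v p)

/-- `v ⊕ η`, given by its components in the chart around `x₀`, lies in `D` at the point with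
coordinates `p`. -/
def MemCoord
    (D : ∀ x : M, Submodule ℝ (TangentSpace (𝓡 n) x × (TangentSpace (𝓡 n) x →L[ℝ] ℝ))) (x₀ : M)
    (p v : EuclideanSpace ℝ (Fin n)) (η : EuclideanSpace ℝ (Fin n) →L[ℝ] ℝ) : Prop :=
  (frameAt (𝓡 n) x₀ p v, η.comp (coframe (𝓡 n) x₀ ((extChartAt (𝓡 n) x₀).symm p))) ∈
    D ((extChartAt (𝓡 n) x₀).symm p)

/-- `D ⊂ TM ⊕ T*M` is a Dirac structure in the `H`-twisted standard Courant algebroid: it is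
isotropic, of the maximal possible rank `n`, and its local sections are closed under the `H`-twisted
Courant bracket. -/
structure IsDirac (H : ∀ x : M, TangentSpace (𝓡 n) x [⋀^Fin 3]→L[ℝ] ℝ)
    (D : ∀ x : M, Submodule ℝ (TangentSpace (𝓡 n) x × (TangentSpace (𝓡 n) x →L[ℝ] ℝ))) :
    Prop where
  isotropic : ∀ x, ∀ ξ ∈ D x, ∀ ξ' ∈ D x, ξ'.2 ξ.1 + ξ.2 ξ'.1 = 0
  rank : ∀ x, Module.finrank ℝ (D x) = n
  involutive : ∀ (x₀ : M) (U : Set (EuclideanSpace ℝ (Fin n))), IsOpen U →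
    U ⊆ (extChartAt (𝓡 n) x₀).target →
    ∀ (v w : EuclideanSpace ℝ (Fin n) → EuclideanSpace ℝ (Fin n))
      (η ζ : EuclideanSpace ℝ (Fin n) → EuclideanSpace ℝ (Fin n) →L[ℝ] ℝ),
      ContDiffOn ℝ ∞ v U → ContDiffOn ℝ ∞ η U → ContDiffOn ℝ ∞ w U → ContDiffOn ℝ ∞ ζ U →
      (∀ p ∈ U, MemCoord D x₀ p (v p) (η p)) → (∀ p ∈ U, MemCoord D x₀ p (w p) (ζ p)) →
      ∀ p ∈ U, MemCoord D x₀ p (VectorField.lieBracket ℝ v w p)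
        (courantForm (formCoord H x₀) v η w ζ p)

variable [IsManifold (𝓡 n) ∞ M]
  (g : Bundle.ContMDiffRiemannianMetric (𝓡 n) ∞ (EuclideanSpace ℝ (Fin n))
    (fun x : M => TangentSpace (𝓡 n) x))
  (H : ∀ x : M, TangentSpace (𝓡 n) x [⋀^Fin 3]→L[ℝ] ℝ)
  (O : ∀ x : M, TangentSpace (𝓡 n) x →L[ℝ] TangentSpace (𝓡 n) x)

/-- The subbundle of all `(id - O) a ⊕ ((id + O) a)^*`, where `u^* = g(u, ·)`. -/
def graph (x : M) : Submodule ℝ (TangentSpace (𝓡 n) x × (TangentSpace (𝓡 n) x →L[ℝ] ℝ)) :=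
  LinearMap.range (LinearMap.prod
    ((ContinuousLinearMap.id ℝ (TangentSpace (𝓡 n) x) - O x).toLinearMap)
    (((g.inner x).comp (ContinuousLinearMap.id ℝ (TangentSpace (𝓡 n) x) + O x)).toLinearMap))

/-! #### Levi-Civita connection -/

/-- The components `g_ij` of the metric in the chart around `x₀`. -/
def metricCoord (x₀ : M) (p : EuclideanSpace ℝ (Fin n)) : Matrix (Fin n) (Fin n) ℝ :=
  Matrix.of fun i j =>
    g.inner ((extChartAt (𝓡 n) x₀).symm p)
      (frameAt (𝓡 n) x₀ p (EuclideanSpace.single i 1))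
      (frameAt (𝓡 n) x₀ p (EuclideanSpace.single j 1))

/-- The partial derivative `∂_i f` at `p`. -/
def pd (i : Fin n) (f : EuclideanSpace ℝ (Fin n) → ℝ) (p : EuclideanSpace ℝ (Fin n)) : ℝ :=
  fderiv ℝ f p (EuclideanSpace.single i 1)

/-- The Christoffel symbol `Γ^i_jk` of the Levi-Civita connection in the chart around `x₀`. -/
def christoffel (x₀ : M) (p : EuclideanSpace ℝ (Fin n)) (i j k : Fin n) : ℝ :=
  (1 / 2) * ∑ l, (metricCoord g x₀ p)⁻¹ i l *
    (pd j (fun q => metricCoord g x₀ q l k) p + pd k (fun q => metricCoord g x₀ q l j) p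
      - pd l (fun q => metricCoord g x₀ q j k) p)

/-- The components `∇_l O^m_k` in the chart around `x₀`. -/
def nablaEndCoord (x₀ : M) (p : EuclideanSpace ℝ (Fin n)) (l m k : Fin n) : ℝ :=
  pd l (fun q => endCoord O x₀ q m k) p
    + ∑ r, christoffel g x₀ p m l r * endCoord O x₀ p r k
    - ∑ r, christoffel g x₀ p r l k * endCoord O x₀ p m r

/-- `∇_w(O) u` at `x`. -/
def nablaEnd (x : M) (w u : TangentSpace (𝓡 n) x) : TangentSpace (𝓡 n) x :=
  ofCoord (𝓡 n) x fun m => ∑ l, ∑ k, coord (𝓡 n) x w l *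
    nablaEndCoord g O x (extChartAt (𝓡 n) x x) l m k * coord (𝓡 n) x u k

/-- The vector `η^* = η_j g^{ij} ∂_i` of a covector `η` at `x`. -/
def sharp (x : M) (η : TangentSpace (𝓡 n) x → ℝ) : TangentSpace (𝓡 n) x :=
  ofCoord (𝓡 n) x fun i => ∑ j,
    (metricCoord g x (extChartAt (𝓡 n) x x))⁻¹ i j * η (basisVec (𝓡 n) x j)

/-- The covariant derivative at time `0`, along a curve `γ` in `M`, of vectors `V t` at `γ t`:
the vector with components `dV^i/dt + Γ^i_jk V^j dγ^k/dt`. -/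
def covAlong (γ : ℝ → M) (V : ∀ t, TangentSpace (𝓡 n) (γ t)) : TangentSpace (𝓡 n) (γ 0) :=
  ofCoord (𝓡 n) (γ 0) fun i =>
    deriv (fun t => coframe (𝓡 n) (γ 0) (γ t) (V t) i) 0
      + ∑ j, ∑ k, christoffel g (γ 0) (extChartAt (𝓡 n) (γ 0) (γ 0)) i j k *
          coord (𝓡 n) (γ 0) (V 0) j *
          coord (𝓡 n) (γ 0) (mfderiv 𝓘(ℝ, ℝ) (𝓡 n) γ 0 (1 : ℝ)) k

/-! #### Structure functions of a Dirac structure -/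

/-- The vector part `(id - O)^l_i ∂_l` of the local section `u_i`, in the chart around `x₀`. -/
def secVec (x₀ : M) (i : Fin n) (p : EuclideanSpace ℝ (Fin n)) : EuclideanSpace ℝ (Fin n) :=
  WithLp.toLp 2 fun l => (1 - endCoord O x₀ p) l i

/-- The 1-form part `g_lm (id + O)^m_i dx^l` of the local section `u_i`, in the chart around
`x₀`. -/
def secForm (x₀ : M) (i : Fin n) (p : EuclideanSpace ℝ (Fin n)) :
    EuclideanSpace ℝ (Fin n) →L[ℝ] ℝ :=
  ∑ l, (metricCoord g x₀ p * (1 + endCoord O x₀ p)) l i •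
    (EuclideanSpace.proj l : EuclideanSpace ℝ (Fin n) →L[ℝ] ℝ)

/-- `H_lmn` in the chart around `x₀`. -/
def formComp (x₀ : M) (p : EuclideanSpace ℝ (Fin n)) (i j k : Fin n) : ℝ :=
  formCoord H x₀ p
    ![EuclideanSpace.single i 1, EuclideanSpace.single j 1, EuclideanSpace.single k 1]

/-- `2 (id - O)^l_[j Γ^i_k]l + g^il g_mq O^q_[j ∇_l O^m_k] + ½ H^i_mq (id - O)^m_j (id - O)^q_k`,
with weighted antisymmetrization `A_[j B_k] = ½ (A_j B_k - A_k B_j)`. -/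
def structureFun (x₀ : M) (p : EuclideanSpace ℝ (Fin n)) (i j k : Fin n) : ℝ :=
  ∑ l, ((1 - endCoord O x₀ p) l j * christoffel g x₀ p i k l
      - (1 - endCoord O x₀ p) l k * christoffel g x₀ p i j l)
  + ∑ l, ∑ m, ∑ q, (metricCoord g x₀ p)⁻¹ i l * metricCoord g x₀ p m q *
      ((1 / 2) * (endCoord O x₀ p q j * nablaEndCoord g O x₀ p l m k
        - endCoord O x₀ p q k * nablaEndCoord g O x₀ p l m j))
  + (1 / 2) * ∑ l, ∑ m, ∑ q, (metricCoord g x₀ p)⁻¹ i l * formComp H x₀ p l m q *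
      (1 - endCoord O x₀ p) m j * (1 - endCoord O x₀ p) q k

end Target

/-! ### The world sheet -/

/-- An oriented Lorentzian metric on a surface: a smooth metric of signature `(1, 1)` and its
area form, i.e. a smooth 2-form with `area(u, v)² = -det h|_{u, v}`. -/
structure LorentzianSurface (S : Type*) [TopologicalSpace S]
    [ChartedSpace (EuclideanSpace ℝ (Fin 2)) S] where
  metric : ∀ σ : S, TangentSpace (𝓡 2) σ →L[ℝ] TangentSpace (𝓡 2) σ →L[ℝ] ℝ
  symm : ∀ σ u v, metric σ u v = metric σ v u
  exists_neg : ∀ σ, ∃ u, metric σ u u < 0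
  exists_pos : ∀ σ, ∃ u, 0 < metric σ u u
  metric_smooth : ∀ (σ₀ : S) (i j : Fin 2), ContDiffOn ℝ ∞
    (fun p => metric ((extChartAt (𝓡 2) σ₀).symm p)
      (frameAt (𝓡 2) σ₀ p (EuclideanSpace.single i 1))
      (frameAt (𝓡 2) σ₀ p (EuclideanSpace.single j 1))) (extChartAt (𝓡 2) σ₀).target
  area : ∀ σ : S, TangentSpace (𝓡 2) σ →L[ℝ] TangentSpace (𝓡 2) σ →L[ℝ] ℝ
  area_self : ∀ σ u, area σ u u = 0
  area_sq : ∀ σ u v, area σ u v ^ 2 = metric σ u v ^ 2 - metric σ u u * metric σ v v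
  area_smooth : ∀ (σ₀ : S) (i j : Fin 2), ContDiffOn ℝ ∞
    (fun p => area ((extChartAt (𝓡 2) σ₀).symm p)
      (frameAt (𝓡 2) σ₀ p (EuclideanSpace.single i 1))
      (frameAt (𝓡 2) σ₀ p (EuclideanSpace.single j 1))) (extChartAt (𝓡 2) σ₀).target

section Surface

variable {S : Type*} [TopologicalSpace S] [ChartedSpace (EuclideanSpace ℝ (Fin 2)) S]
  (L : LorentzianSurface S)

/-- The derivative `df(v)` at `σ` of a function `f` on the surface. -/
def dirDeriv (f : S → ℝ) (σ : S) (v : TangentSpace (𝓡 2) σ) : ℝ :=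
  mfderiv (𝓡 2) 𝓘(ℝ, ℝ) f σ v

/-- The vector `J v` with `h(J v, u) = area(u, v)` for all `u`, i.e. with `h(J v, ·) = -area(v, ·)`.
(`inverse` is the genuine inverse of `v ↦ h(v, ·)`, since `h` is non-degenerate.) -/
def LorentzianSurface.rot (σ : S) (v : TangentSpace (𝓡 2) σ) : TangentSpace (𝓡 2) σ :=
  -(L.metric σ).inverse (L.area σ v)

/-- The Hodge dual of a (vector-valued) 1-form at `σ`, i.e. `(∗β)(v) = β(J v)`. It is characterized
by `α ∧ ∗β = h⁻¹(α, β) area` for real-valued 1-forms `α`, `β`. -/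
def LorentzianSurface.star {σ : S} {W : Type*} (β : TangentSpace (𝓡 2) σ → W) :
    TangentSpace (𝓡 2) σ → W :=
  fun v => β (L.rot σ v)

/-- The area form as a top-degree form. -/
def LorentzianSurface.areaForm (σ : S) (w : Fin 2 → TangentSpace (𝓡 2) σ) : ℝ :=
  L.area σ (w 0) (w 1)

variable {n : ℕ} {M : Type*} [TopologicalSpace M] [ChartedSpace (EuclideanSpace ℝ (Fin n)) M]

/-- The operator `(id + O) + (id - O) ∗` on 1-forms at `σ` with values in `T_x M`. -/
def opT (O : ∀ x : M, TangentSpace (𝓡 n) x →L[ℝ] TangentSpace (𝓡 n) x) (σ : S) (x : M)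
    (β : TangentSpace (𝓡 2) σ → TangentSpace (𝓡 n) x) :
    TangentSpace (𝓡 2) σ → TangentSpace (𝓡 n) x :=
  fun v => (β v + O x (β v)) + (L.star β v - O x (L.star β v))

/-- The operator `Θ = ¼ (id + O⁻¹) + ¼ (id - O⁻¹) ∗` on 1-forms at `σ` with values in `T_x M`. -/
def opTheta (O : ∀ x : M, TangentSpace (𝓡 n) x →L[ℝ] TangentSpace (𝓡 n) x) (σ : S) (x : M)
    (β : TangentSpace (𝓡 2) σ → TangentSpace (𝓡 n) x) :
    TangentSpace (𝓡 2) σ → TangentSpace (𝓡 n) x :=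
  fun v => (1 / 4 : ℝ) • (β v + (O x).inverse (β v))
    + (1 / 4 : ℝ) • (L.star β v - (O x).inverse (L.star β v))

variable [IsManifold (𝓡 n) ∞ M]
  (g : Bundle.ContMDiffRiemannianMetric (𝓡 n) ∞ (EuclideanSpace ℝ (Fin n))
    (fun x : M => TangentSpace (𝓡 n) x))
  (H : ∀ x : M, TangentSpace (𝓡 n) x [⋀^Fin 3]→L[ℝ] ℝ)
  (O : ∀ x : M, TangentSpace (𝓡 n) x →L[ℝ] TangentSpace (𝓡 n) x)

/-- `∇^*_v ε`, for the pull-back along `X` of the Levi-Civita connection and a section `ε` of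
`X^*TM`: the vector with components `dε^i(v) + Γ^i_jk dX^j(v) ε^k`. -/
def covPull (X : S → M) (ε : ∀ σ, TangentSpace (𝓡 n) (X σ)) (σ : S) (v : TangentSpace (𝓡 2) σ) :
    TangentSpace (𝓡 n) (X σ) :=
  ofCoord (𝓡 n) (X σ) fun i =>
    dirDeriv (fun τ => coframe (𝓡 n) (X σ) (X τ) (ε τ) i) σ v
      + ∑ j, ∑ k, christoffel g (X σ) (extChartAt (𝓡 n) (X σ) (X σ)) i j k *
          coord (𝓡 n) (X σ) (mfderiv (𝓡 2) (𝓡 n) X σ v) j * coord (𝓡 n) (X σ) (ε σ) k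

/-- `DX = dX - (id - O) 𝔞`. -/
def covDiff (X : S → M) (a : ∀ σ, TangentSpace (𝓡 2) σ →L[ℝ] TangentSpace (𝓡 n) (X σ)) (σ : S)
    (v : TangentSpace (𝓡 2) σ) : TangentSpace (𝓡 n) (X σ) :=
  mfderiv (𝓡 2) (𝓡 n) X σ v - (a σ v - O (X σ) (a σ v))

/-- The 2-form `g_ij α^i ∧ β^j` at `σ`. -/
def wedge {σ : S} {x : M} (α β : TangentSpace (𝓡 2) σ → TangentSpace (𝓡 n) x)
    (w : Fin 2 → TangentSpace (𝓡 2) σ) : ℝ :=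
  g.inner x (α (w 0)) (β (w 1)) - g.inner x (α (w 1)) (β (w 0))

/-- The 2-form `½ g_ij DX^i ∧ ∗DX^j + η_i ∧ dX^i - ½ η_i ∧ v^i` on the world sheet, where
`v = (id - O) 𝔞` and `η = ((id + O) 𝔞)^*`. -/
def lagrangian (X : S → M) (a : ∀ σ, TangentSpace (𝓡 2) σ →L[ℝ] TangentSpace (𝓡 n) (X σ)) (σ : S)
    (w : Fin 2 → TangentSpace (𝓡 2) σ) : ℝ :=
  (1 / 2) * wedge g (covDiff O X a σ) (L.star (covDiff O X a σ)) w
    + wedge g (fun u => a σ u + O (X σ) (a σ u)) (fun u => mfderiv (𝓡 2) (𝓡 n) X σ u) w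
    - (1 / 2) * wedge g (fun u => a σ u + O (X σ) (a σ u)) (fun u => a σ u - O (X σ) (a σ u)) w

/-- The argument of `Θ`: `½ H(DX, (id - O) ε, ·)^* + (1 - ∗) ∇_{DX}(O) ε`. -/
def gaugeInner (X : S → M) (a : ∀ σ, TangentSpace (𝓡 2) σ →L[ℝ] TangentSpace (𝓡 n) (X σ))
    (ε : ∀ σ, TangentSpace (𝓡 n) (X σ)) (σ : S) (v : TangentSpace (𝓡 2) σ) :
    TangentSpace (𝓡 n) (X σ) :=
  (1 / 2 : ℝ) • sharp g (X σ)
      (fun w => H (X σ) ![covDiff O X a σ v, ε σ - O (X σ) (ε σ), w])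
    + (nablaEnd g O (X σ) (covDiff O X a σ v) (ε σ)
      - L.star (fun u => nablaEnd g O (X σ) (covDiff O X a σ u) (ε σ)) v)

/-- The gauge transformation `δ𝔞` of the gauge field:
`∇^*ε - g(O⁻¹ ∇(O) 𝔞, ε)^* + ½ H((id - O) 𝔞, (id - O) ε, ·)^*
  + Θ(½ H(DX, (id - O) ε, ·)^* + (1 - ∗) ∇_{DX}(O) ε)`. -/
def gaugeVar (X : S → M) (a : ∀ σ, TangentSpace (𝓡 2) σ →L[ℝ] TangentSpace (𝓡 n) (X σ))
    (ε : ∀ σ, TangentSpace (𝓡 n) (X σ)) (σ : S) (v : TangentSpace (𝓡 2) σ) :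
    TangentSpace (𝓡 n) (X σ) :=
  covPull g X ε σ v
    - sharp g (X σ) (fun w =>
        g.inner (X σ) ((O (X σ)).inverse (nablaEnd g O (X σ) w (a σ v))) (ε σ))
    + (1 / 2 : ℝ) • sharp g (X σ)
        (fun w => H (X σ) ![a σ v - O (X σ) (a σ v), ε σ - O (X σ) (ε σ), w])
    + opTheta L O σ (X σ) (gaugeInner L g H O X a ε σ) v

end Surface

/-! ### The membrane world volume and the action -/

/-- A 3-manifold `N` with boundary, oriented by the volume form `vol`, whose oriented boundary is
the world sheet, embedded by `ι`. The boundary orientation is "outward normal first"; a tangent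
vector at a boundary point is outward if its component `0` is negative, since the charts take values
in the half-space of all `x` with `0 ≤ x 0`. -/
structure IsFilling {S : Type*} [TopologicalSpace S] [ChartedSpace (EuclideanSpace ℝ (Fin 2)) S]
    (L : LorentzianSurface S) {N : Type*} [TopologicalSpace N]
    [ChartedSpace (EuclideanHalfSpace 3) N]
    (vol : ∀ y : N, TangentSpace (𝓡∂ 3) y [⋀^Fin 3]→L[ℝ] ℝ) (ι : S → N) : Prop where
  vol_smooth : ∀ y₀ : N,
    ContDiffOn ℝ ∞ (topCoeff (𝓡∂ 3) (fun y w => vol y w) y₀) (extChartAt (𝓡∂ 3) y₀).target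
  vol_ne_zero : ∀ y : N, vol y ≠ 0
  smooth : ContMDiff (𝓡 2) (𝓡∂ 3) ∞ ι
  isEmbedding : Topology.IsEmbedding ι
  injective_mfderiv : ∀ σ, Function.Injective (mfderiv (𝓡 2) (𝓡∂ 3) ι σ)
  range_eq : range ι = (𝓡∂ 3).boundary N
  orientation : ∀ (σ : S) (w : TangentSpace (𝓡∂ 3) (ι σ)) (u v : TangentSpace (𝓡 2) σ),
    coord (𝓡∂ 3) (ι σ) w 0 < 0 → 0 < L.area σ u v →
      0 < vol (ι σ) ![w, mfderiv (𝓡 2) (𝓡∂ 3) ι σ u, mfderiv (𝓡 2) (𝓡∂ 3) ι σ v]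

/-- The action of the Dirac sigma model, computed over the regions `K` of the world sheet and `K'`
of the membrane world volume, of a map `X'` on the world volume and a gauge field `a` along the
restriction of `X'` to the world sheet: the integral of the 2-form `lagrangian` over `K` plus the
integral of `X'^* H` over `K'`. -/
def action {n : ℕ} {M : Type*} [TopologicalSpace M] [ChartedSpace (EuclideanSpace ℝ (Fin n)) M]
    [IsManifold (𝓡 n) ∞ M]
    (g : Bundle.ContMDiffRiemannianMetric (𝓡 n) ∞ (EuclideanSpace ℝ (Fin n))
      (fun x : M => TangentSpace (𝓡 n) x))
    (H : ∀ x : M, TangentSpace (𝓡 n) x [⋀^Fin 3]→L[ℝ] ℝ)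
    (O : ∀ x : M, TangentSpace (𝓡 n) x →L[ℝ] TangentSpace (𝓡 n) x)
    {S : Type*} [TopologicalSpace S] [ChartedSpace (EuclideanSpace ℝ (Fin 2)) S]
    [MeasurableSpace S] (L : LorentzianSurface S)
    {N : Type*} [TopologicalSpace N] [ChartedSpace (EuclideanHalfSpace 3) N] [MeasurableSpace N]
    (vol : ∀ y : N, TangentSpace (𝓡∂ 3) y [⋀^Fin 3]→L[ℝ] ℝ) (ι : S → N)
    (K : Set S) (K' : Set N) (X' : N → M)
    (a : ∀ σ, TangentSpace (𝓡 2) σ →L[ℝ] TangentSpace (𝓡 n) (X' (ι σ))) : ℝ :=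
  integralForm (𝓡 2) L.areaForm K (lagrangian L g O (fun σ => X' (ι σ)) a)
    + integralForm (𝓡∂ 3) (fun y w => vol y w) K'
        (fun y w => H (X' y) fun i => mfderiv (𝓡∂ 3) (𝓡 n) X' y (w i))

end DiracSigma

end

/-!
The operator `∗` squares to the identity (`LorentzianSurface.rot_rot`) and commutes with the
orthogonal, hence invertible, endomorphism `O`; so `Θ` is checked to be the two-sided inverse of
`(id + O) + (id - O) ∗` by expanding the products (`opT_opTheta`, `opTheta_opT`).

For the brackets, the sections `(id - O) a ⊕ g((id + O) a)` of the graph are taken with constant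
components `a` in a chart. Since `D` is involutive, the bracket of two of them is again of this
form at every point, with some components `c` (`exists_bracket_eq`). The bracket itself follows
from the definition, on using that the Christoffel symbols are torsion free and metric
(`courantForm_graph`). Adding its vector part to its form part, raised by `g`, gives `2 c`, which
identifies `c` with the structure functions (`structureFun_eq`). Pairing the same sum with
`(id - O) b` instead gives the integrability condition on `O`: the cyclic sum of
`g(O⁻¹ ∇_{(id - O) a}(O) b, c)` is `½ H((id - O) a, (id - O) b, (id - O) c)` (`integrability`).

For gauge invariance, write `δX = (id - O) ε`. The derivative of the Lagrangian contains the
variation `δ𝔞` only through `(id + O) δ𝔞 + (id - O) ∗ δ𝔞` (`lagrangian_variation`), and this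
combination removes `Θ` from the gauge variation (`opT_gaugeVar`). What remains is linear algebra
at a point, settled by the integrability condition (`gauge_identity`): on the world sheet
`δL + H(δX, dX, dX) = d g((id + O) ε, dX)` (`isPrimitive_gaugeForm`). In the bulk, `dH = 0` gives
`δ(X^* H) = d H(δX, dX, dX)` (`isPrimitive_fluxForm`). All forms have compact support, so Stokes'
theorem on the world volume (`integral_eq_integral_boundaryRatio`) turns the variation of the bulk
term into the integral over the world sheet of `H(δX, dX, dX)`, and Stokes' theorem on the world
sheet (`integral_eq_zero_of_isPrimitive`) makes the total vanish (`hasDerivAt_action`).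

Stokes' theorem is derived here for forms of top degree minus one, written through their chart
components, from the divergence theorem on boxes, smooth cutoff functions summing to one on the
support, and the change of variables for the measure `volMeasure` of a volume form
(`setIntegral_volMeasure_eq`). The integrals are differentiated in the parameter by
`IsSmoothFamily.hasDerivAt_integral`.
-/


namespace DiracSigma

set_option linter.unusedSectionVars false

/-! ### Coordinate frames -/

section Frames

variable {d : ℕ} {B : Type*} [TopologicalSpace B]
  (I : ModelWithCorners ℝ (EuclideanSpace ℝ (Fin d)) B)
  {Q : Type*} [TopologicalSpace Q] [ChartedSpace B Q]

instance (x : Q) : FiniteDimensional ℝ (TangentSpace I x) :=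
  inferInstanceAs (FiniteDimensional ℝ (EuclideanSpace ℝ (Fin d)))

variable [IsManifold I ∞ Q]

lemma coframe_frameAt (x₀ : Q) {p : EuclideanSpace ℝ (Fin d)}
    (hp : p ∈ (extChartAt I x₀).target) (c : EuclideanSpace ℝ (Fin d)) :
    coframe I x₀ ((extChartAt I x₀).symm p) (frameAt I x₀ p c) = c := by
  have : IsManifold I 1 Q := IsManifold.of_le (n := ∞) (by norm_num)
  exact DFunLike.congr_fun (mfderiv_extChartAt_comp_mfderivWithin_extChartAt_symm hp) c

lemma frameAt_coframe (x₀ : Q) {p : EuclideanSpace ℝ (Fin d)}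
    (hp : p ∈ (extChartAt I x₀).target) (w : TangentSpace I ((extChartAt I x₀).symm p)) :
    frameAt I x₀ p (coframe I x₀ ((extChartAt I x₀).symm p) w) = w := by
  have : IsManifold I 1 Q := IsManifold.of_le (n := ∞) (by norm_num)
  exact DFunLike.congr_fun (mfderivWithin_extChartAt_symm_comp_mfderiv_extChartAt hp) w

lemma coframe_frameAt' (x₀ : Q) {y : Q}
    (hy : y ∈ (extChartAt I x₀).source) (c : EuclideanSpace ℝ (Fin d)) :
    coframe I x₀ y (frameAt I x₀ (extChartAt I x₀ y) c : TangentSpace I y) = c := by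
  have : IsManifold I 1 Q := IsManifold.of_le (n := ∞) (by norm_num)
  exact DFunLike.congr_fun (mfderiv_extChartAt_comp_mfderivWithin_extChartAt_symm' hy) c

lemma frameAt_coframe' (x₀ : Q) {y : Q}
    (hy : y ∈ (extChartAt I x₀).source) (w : TangentSpace I y) :
    (frameAt I x₀ (extChartAt I x₀ y) (coframe I x₀ y w) : TangentSpace I y) = w := by
  have : IsManifold I 1 Q := IsManifold.of_le (n := ∞) (by norm_num)
  exact DFunLike.congr_fun (mfderivWithin_extChartAt_symm_comp_mfderiv_extChartAt' hy) w

lemma coframe_ofCoord (x : Q) (c : Fin d → ℝ) :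
    coframe I x x (ofCoord I x c) = WithLp.toLp 2 c :=
  coframe_frameAt' I x (mem_extChartAt_source x) _

lemma coframe_basisVec (x : Q) (i : Fin d) :
    coframe I x x (basisVec I x i) = EuclideanSpace.single i 1 :=
  coframe_ofCoord I x _

/-- The coordinate frame `∂₁, …, ∂_d` of the chart around `x₀`, as a basis. -/
noncomputable def frameBasis (x₀ : Q) {p : EuclideanSpace ℝ (Fin d)}
    (hp : p ∈ (extChartAt I x₀).target) :
    Module.Basis (Fin d) ℝ (TangentSpace I ((extChartAt I x₀).symm p)) :=
  (EuclideanSpace.basisFun (Fin d) ℝ).toBasis.map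
    (LinearEquiv.ofLinearMap (frameAt I x₀ p).toLinearMap
      (coframe I x₀ ((extChartAt I x₀).symm p)).toLinearMap
      (by ext w : 1; exact frameAt_coframe I x₀ hp w)
      (by ext w : 1; exact coframe_frameAt I x₀ hp w))

lemma frameBasis_apply (x₀ : Q) {p : EuclideanSpace ℝ (Fin d)}
    (hp : p ∈ (extChartAt I x₀).target) (i : Fin d) :
    frameBasis I x₀ hp i = frameAt I x₀ p (EuclideanSpace.single i 1) := by
  rw [frameBasis, Module.Basis.map_apply, OrthonormalBasis.coe_toBasis,
    EuclideanSpace.basisFun_apply]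
  rfl

/-- The coordinate frame at the centre of a chart, as a basis. -/
noncomputable def basisVecBasis (x : Q) : Module.Basis (Fin d) ℝ (TangentSpace I x) :=
  (EuclideanSpace.basisFun (Fin d) ℝ).toBasis.map
    (LinearEquiv.ofLinearMap
      (frameAt I x (extChartAt I x x) :
        EuclideanSpace ℝ (Fin d) →L[ℝ] TangentSpace I x).toLinearMap
      (coframe I x x).toLinearMap
      (by ext w : 1; exact frameAt_coframe' I x (mem_extChartAt_source x) w)
      (by ext w : 1; exact coframe_frameAt' I x (mem_extChartAt_source x) w))

lemma basisVecBasis_apply (x : Q) (i : Fin d) : basisVecBasis I x i = basisVec I x i := by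
  rw [basisVecBasis, Module.Basis.map_apply, OrthonormalBasis.coe_toBasis,
    EuclideanSpace.basisFun_apply]
  rfl

lemma ratio_eq_ratio_of_basis {V : Type*} [AddCommGroup V] [Module ℝ V]
    (b b' : Module.Basis (Fin d) ℝ V) (f f' : V [⋀^Fin d]→ₗ[ℝ] ℝ) : f b / f' b = f b' / f' b' := by
  have key : ∀ φ : V [⋀^Fin d]→ₗ[ℝ] ℝ, φ b = φ b' * b'.det b := by
    intro φ
    conv_lhs => rw [AlternatingMap.eq_smul_basis_det b' φ]
    rw [AlternatingMap.smul_apply, smul_eq_mul]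
  rw [key f, key f', mul_div_mul_right _ _ (b'.isUnit_det b).ne_zero]

variable {I} in
/-- The quotient of two top-degree forms does not depend on the frame. -/
lemma ratio_eq_topCoeff_ratio {α : ∀ x : Q, (Fin d → TangentSpace I x) → ℝ}
    {vol : ∀ x : Q, (Fin d → TangentSpace I x) → ℝ} (x₀ : Q) {p : EuclideanSpace ℝ (Fin d)}
    (hp : p ∈ (extChartAt I x₀).target)
    (hα : ∃ f : TangentSpace I ((extChartAt I x₀).symm p) [⋀^Fin d]→ₗ[ℝ] ℝ,
      ∀ w, α ((extChartAt I x₀).symm p) w = f w)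
    (hvol : ∃ f : TangentSpace I ((extChartAt I x₀).symm p) [⋀^Fin d]→ₗ[ℝ] ℝ,
      ∀ w, vol ((extChartAt I x₀).symm p) w = f w) :
    α ((extChartAt I x₀).symm p) (basisVec I _) / vol ((extChartAt I x₀).symm p) (basisVec I _)
      = topCoeff I α x₀ p / topCoeff I vol x₀ p := by
  obtain ⟨f, hf⟩ := hα
  obtain ⟨f', hf'⟩ := hvol
  have h1 : basisVec I ((extChartAt I x₀).symm p) = basisVecBasis I _ := by
    funext i; exact (basisVecBasis_apply I _ i).symm
  have h2 : (fun i => frameAt I x₀ p (EuclideanSpace.single i 1)) = frameBasis I x₀ hp := by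
    funext i; exact (frameBasis_apply I x₀ hp i).symm
  rw [topCoeff, topCoeff, h2, hf, hf', hf, hf', h1, ratio_eq_ratio_of_basis]

end Frames

/-! ### Maps in charts -/

section ChartMaps

variable {d : ℕ} {B : Type*} [TopologicalSpace B]
  {I : ModelWithCorners ℝ (EuclideanSpace ℝ (Fin d)) B}
  {Q : Type*} [TopologicalSpace Q] [ChartedSpace B Q] [IsManifold I ∞ Q]
  {n : ℕ} {M : Type*} [TopologicalSpace M] [ChartedSpace (EuclideanSpace ℝ (Fin n)) M]
  [IsManifold (𝓡 n) ∞ M]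

variable (I) in
/-- The set `ℝ × range I` on which coordinate expressions of families of maps are differentiated. -/
def timeRange : Set (ℝ × EuclideanSpace ℝ (Fin d)) := univ ×ˢ range I

lemma uniqueDiffOn_timeRange : UniqueDiffOn ℝ (timeRange I) :=
  uniqueDiffOn_univ.prod I.uniqueDiffOn

omit [IsManifold I ∞ Q] in
lemma mem_timeRange {x₀ : Q} {t : ℝ} {p : EuclideanSpace ℝ (Fin d)}
    (hp : p ∈ (extChartAt I x₀).target) : (t, p) ∈ timeRange I :=
  ⟨mem_univ _, extChartAt_target_subset_range x₀ hp⟩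

variable (I) in
/-- The coordinate expression `Y(t, p)` of a family `X t` of maps. -/
noncomputable def chartMap (X : ℝ → Q → M) (x₀ : Q) (x₁ : M)
    (q : ℝ × EuclideanSpace ℝ (Fin d)) : EuclideanSpace ℝ (Fin n) :=
  extChartAt (𝓡 n) x₁ (X q.1 ((extChartAt I x₀).symm q.2))

lemma contMDiffWithinAt_id_prod_symm (x₀ : Q) {t : ℝ} {p : EuclideanSpace ℝ (Fin d)}
    (hp : p ∈ (extChartAt I x₀).target) :
    ContMDiffWithinAt 𝓘(ℝ, ℝ × EuclideanSpace ℝ (Fin d)) (𝓘(ℝ, ℝ).prod I) ∞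
      (fun q : ℝ × EuclideanSpace ℝ (Fin d) => (q.1, (extChartAt I x₀).symm q.2))
      (timeRange I) (t, p) := by
  have h2 : ContMDiffWithinAt 𝓘(ℝ, ℝ × EuclideanSpace ℝ (Fin d)) I ∞
      (fun q : ℝ × EuclideanSpace ℝ (Fin d) => (extChartAt I x₀).symm q.2)
      (timeRange I) (t, p) :=
    (contMDiffWithinAt_extChartAt_symm_range x₀ hp).comp (t, p)
      (ContDiff.contMDiff contDiff_snd _).contMDiffWithinAt (fun q hq => hq.2)
  exact ContMDiffWithinAt.prodMk
    (ContDiff.contMDiff contDiff_fst _).contMDiffWithinAt h2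

lemma contDiffWithinAt_chartMap {X : ℝ → Q → M}
    (hX : ContMDiff (𝓘(ℝ, ℝ).prod I) (𝓡 n) ∞ (fun q : ℝ × Q => X q.1 q.2))
    (x₀ : Q) (x₁ : M) {t : ℝ} {p : EuclideanSpace ℝ (Fin d)}
    (hp : p ∈ (extChartAt I x₀).target)
    (h1 : X t ((extChartAt I x₀).symm p) ∈ (extChartAt (𝓡 n) x₁).source) :
    ContDiffWithinAt ℝ ∞ (chartMap (n := n) I X x₀ x₁) (timeRange I) (t, p) := by
  rw [← contMDiffWithinAt_iff_contDiffWithinAt]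
  rw [extChartAt_source] at h1
  have h3 : ContMDiffAt (𝓡 n) 𝓘(ℝ, EuclideanSpace ℝ (Fin n)) ∞ (extChartAt (𝓡 n) x₁)
      (X t ((extChartAt I x₀).symm p)) := contMDiffAt_extChartAt' h1
  have h4 := (hX (t, (extChartAt I x₀).symm p)).comp_contMDiffWithinAt (t, p)
    (contMDiffWithinAt_id_prod_symm x₀ hp)
  exact ContMDiffAt.comp_contMDiffWithinAt (t, p) h3 h4

lemma mfderiv_frameAt {E' : Type*} [NormedAddCommGroup E'] [NormedSpace ℝ E']
    {B' : Type*} [TopologicalSpace B'] {I' : ModelWithCorners ℝ E' B'}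
    {P : Type*} [TopologicalSpace P] [ChartedSpace B' P] {f : Q → P}
    {x₀ : Q} {p : EuclideanSpace ℝ (Fin d)} (hp : p ∈ (extChartAt I x₀).target)
    (hf : MDifferentiableAt I I' f ((extChartAt I x₀).symm p)) (c : EuclideanSpace ℝ (Fin d)) :
    mfderiv I I' f ((extChartAt I x₀).symm p) (frameAt I x₀ p c)
      = mfderivWithin 𝓘(ℝ, EuclideanSpace ℝ (Fin d)) I' (f ∘ (extChartAt I x₀).symm)
          (range I) p c := by
  have : IsManifold I 1 Q := IsManifold.of_le (n := ∞) (by norm_num)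
  rw [mfderiv_comp_mfderivWithin p hf (mdifferentiableWithinAt_extChartAt_symm hp)
    (I.uniqueMDiffOn _ (extChartAt_target_subset_range x₀ hp))]
  rfl

lemma mfderiv_frameAt_eq_fderivWithin {F : Type*} [NormedAddCommGroup F] [NormedSpace ℝ F]
    {f : Q → F} {x₀ : Q} {p : EuclideanSpace ℝ (Fin d)} (hp : p ∈ (extChartAt I x₀).target)
    (hf : MDifferentiableAt I 𝓘(ℝ, F) f ((extChartAt I x₀).symm p))
    (c : EuclideanSpace ℝ (Fin d)) :
    mfderiv I 𝓘(ℝ, F) f ((extChartAt I x₀).symm p) (frameAt I x₀ p c)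
      = fderivWithin ℝ (f ∘ (extChartAt I x₀).symm) (range I) p c := by
  rw [mfderiv_frameAt hp hf, mfderivWithin_eq_fderivWithin]
  rfl

lemma contMDiff_slice {X : ℝ → Q → M}
    (hX : ContMDiff (𝓘(ℝ, ℝ).prod I) (𝓡 n) ∞ (fun q : ℝ × Q => X q.1 q.2)) (t : ℝ) :
    ContMDiff I (𝓡 n) ∞ (X t) :=
  hX.comp (contMDiff_const.prodMk contMDiff_id : ContMDiff I (𝓘(ℝ, ℝ).prod I) ∞
    (fun y : Q => (t, y)))

lemma contMDiff_curve {X : ℝ → Q → M}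
    (hX : ContMDiff (𝓘(ℝ, ℝ).prod I) (𝓡 n) ∞ (fun q : ℝ × Q => X q.1 q.2)) (y : Q) :
    ContMDiff 𝓘(ℝ, ℝ) (𝓡 n) ∞ (fun t => X t y) :=
  hX.comp (contMDiff_id.prodMk contMDiff_const : ContMDiff 𝓘(ℝ, ℝ) (𝓘(ℝ, ℝ).prod I) ∞
    (fun t : ℝ => (t, y)))

lemma mdifferentiableAt_extChartAt_comp {P : Type*} [TopologicalSpace P] {B' : Type*}
    {E' : Type*} [NormedAddCommGroup E'] [NormedSpace ℝ E'] [TopologicalSpace B']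
    {I' : ModelWithCorners ℝ E' B'} [ChartedSpace B' P] {f : P → M} {z : P}
    (hf : MDifferentiableAt I' (𝓡 n) f z) (x₁ : M)
    (h1 : f z ∈ (extChartAt (𝓡 n) x₁).source) :
    MDifferentiableAt I' 𝓘(ℝ, EuclideanSpace ℝ (Fin n)) (extChartAt (𝓡 n) x₁ ∘ f) z ∧
    ∀ v, mfderiv I' 𝓘(ℝ, EuclideanSpace ℝ (Fin n)) (extChartAt (𝓡 n) x₁ ∘ f) z v
      = coframe (𝓡 n) x₁ (f z) (mfderiv I' (𝓡 n) f z v) := by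
  have : IsManifold (𝓡 n) 1 M := IsManifold.of_le (n := ∞) (by norm_num)
  rw [extChartAt_source] at h1
  have h2 := mdifferentiableAt_extChartAt (I := 𝓡 n) h1
  refine ⟨h2.comp z hf, fun v => ?_⟩
  rw [mfderiv_comp z h2 hf]
  rfl

/-- The spatial derivative of a family of maps, in charts. The derivative on the right is one-sided
at the boundary of the source, hence the restriction to `timeRange I`. -/
lemma coframe_mfderiv_frameAt {X : ℝ → Q → M}
    (hX : ContMDiff (𝓘(ℝ, ℝ).prod I) (𝓡 n) ∞ (fun q : ℝ × Q => X q.1 q.2))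
    (x₀ : Q) (x₁ : M) {t : ℝ} {p : EuclideanSpace ℝ (Fin d)}
    (hp : p ∈ (extChartAt I x₀).target)
    (h1 : X t ((extChartAt I x₀).symm p) ∈ (extChartAt (𝓡 n) x₁).source)
    (c : EuclideanSpace ℝ (Fin d)) :
    coframe (𝓡 n) x₁ (X t ((extChartAt I x₀).symm p))
        (mfderiv I (𝓡 n) (X t) ((extChartAt I x₀).symm p) (frameAt I x₀ p c))
      = fderivWithin ℝ (chartMap (n := n) I X x₀ x₁) (timeRange I) (t, p) (0, c) := by
  have hXt := (contMDiff_slice hX t).mdifferentiable (by norm_num) ((extChartAt I x₀).symm p)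
  obtain ⟨h2, h3⟩ := mdifferentiableAt_extChartAt_comp hXt x₁ h1
  rw [← h3, mfderiv_frameAt_eq_fderivWithin hp h2]
  have h4 := ((contDiffWithinAt_chartMap hX x₀ x₁ hp h1).differentiableWithinAt
    (by norm_num)).hasFDerivWithinAt
  have h5 : HasFDerivWithinAt (fun p' : EuclideanSpace ℝ (Fin d) => (t, p'))
      (ContinuousLinearMap.inr ℝ ℝ (EuclideanSpace ℝ (Fin d))) (range I) p :=
    (hasFDerivAt_prodMk_right t p).hasFDerivWithinAt
  have h6 := HasFDerivWithinAt.comp p h4 h5 (fun p' hp' => ⟨mem_univ _, hp'⟩)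
  have h7 := h6.fderivWithin (I.uniqueDiffOn _ (extChartAt_target_subset_range x₀ hp))
  calc _ = fderivWithin ℝ (chartMap (n := n) I X x₀ x₁ ∘ fun p' => (t, p')) (range I) p c := rfl
    _ = _ := by rw [h7]; rfl

/-- The velocity of a family of maps, in charts. -/
lemma coframe_mfderiv_time {X : ℝ → Q → M}
    (hX : ContMDiff (𝓘(ℝ, ℝ).prod I) (𝓡 n) ∞ (fun q : ℝ × Q => X q.1 q.2))
    (x₀ : Q) (x₁ : M) {t : ℝ} {p : EuclideanSpace ℝ (Fin d)}
    (hp : p ∈ (extChartAt I x₀).target)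
    (h1 : X t ((extChartAt I x₀).symm p) ∈ (extChartAt (𝓡 n) x₁).source) :
    coframe (𝓡 n) x₁ (X t ((extChartAt I x₀).symm p))
        (mfderiv 𝓘(ℝ, ℝ) (𝓡 n) (fun t => X t ((extChartAt I x₀).symm p)) t (1 : ℝ))
      = fderivWithin ℝ (chartMap (n := n) I X x₀ x₁) (timeRange I) (t, p) (1, 0) := by
  have hXt := (contMDiff_curve hX ((extChartAt I x₀).symm p)).mdifferentiable (by norm_num) t
  obtain ⟨h2, h3⟩ := mdifferentiableAt_extChartAt_comp hXt x₁ h1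
  refine (h3 (1 : ℝ)).symm.trans ?_
  have h4 := ((contDiffWithinAt_chartMap hX x₀ x₁ hp h1).differentiableWithinAt
    (by norm_num)).hasFDerivWithinAt
  have h5 : HasFDerivWithinAt (fun t' : ℝ => (t', p))
      (ContinuousLinearMap.inl ℝ ℝ (EuclideanSpace ℝ (Fin d))) univ t :=
    (hasFDerivAt_prodMk_left t p).hasFDerivWithinAt
  have h6 := HasFDerivWithinAt.comp t h4 h5
    (fun t' _ => (mem_timeRange hp : (t', p) ∈ timeRange I))
  rw [hasFDerivWithinAt_univ] at h6
  have h7 := h6.fderiv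
  rw [mfderiv_eq_fderiv]
  calc _ = fderiv ℝ (chartMap (n := n) I X x₀ x₁ ∘ fun t' => (t', p)) t 1 := rfl
    _ = _ := by rw [h7]; rfl

/-- The coordinates of a smooth map into the tangent bundle are smooth. -/
lemma contMDiffWithinAt_coframe {E₀ : Type*} [NormedAddCommGroup E₀] [NormedSpace ℝ E₀]
    {B₀ : Type*} [TopologicalSpace B₀] {I₀ : ModelWithCorners ℝ E₀ B₀}
    {P : Type*} [TopologicalSpace P] [ChartedSpace B₀ P]
    {f : P → TangentBundle (𝓡 n) M} {s : Set P} {q : P}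
    (hf : ContMDiffWithinAt I₀ (𝓡 n).tangent ∞ f s q) (x₁ : M)
    (h1 : (f q).proj ∈ (extChartAt (𝓡 n) x₁).source) :
    ContMDiffWithinAt I₀ 𝓘(ℝ, EuclideanSpace ℝ (Fin n)) ∞
      (fun q' => coframe (𝓡 n) x₁ (f q').proj (f q').snd) s q := by
  have : IsManifold (𝓡 n) 1 M := IsManifold.of_le (n := ∞) (by norm_num)
  rw [extChartAt_source] at h1
  have hT : ContMDiffWithinAt (𝓡 n).tangent 𝓘(ℝ, EuclideanSpace ℝ (Fin n)) ∞
      (fun z : TangentBundle (𝓡 n) M =>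
        (trivializationAt (EuclideanSpace ℝ (Fin n)) (TangentSpace (𝓡 n)) x₁ z).2)
      (trivializationAt (EuclideanSpace ℝ (Fin n)) (TangentSpace (𝓡 n)) x₁).source (f q) := by
    have := (Bundle.Trivialization.contMDiffOn (IB := 𝓡 n) (n := ∞)
      (trivializationAt (EuclideanSpace ℝ (Fin n))
      (TangentSpace (𝓡 n) : M → Type _) x₁)) (f q) (by
        rw [Bundle.Trivialization.mem_source]; simpa using h1)
    exact this.snd
  have hsrc : (trivializationAt (EuclideanSpace ℝ (Fin n)) (TangentSpace (𝓡 n) : M → Type _)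
      x₁).source ∈ nhds (f q) := by
    refine (trivializationAt (EuclideanSpace ℝ (Fin n))
      (TangentSpace (𝓡 n) : M → Type _) x₁).open_source.mem_nhds ?_
    rw [Bundle.Trivialization.mem_source]; simpa using h1
  have hT' := hT.contMDiffAt hsrc
  have h5 := hT'.comp_contMDiffWithinAt q hf
  have hev : ∀ᶠ q' in nhdsWithin q s,
      (f q').proj ∈ (chartAt (EuclideanSpace ℝ (Fin n)) x₁).source := by
    have hc : ContinuousWithinAt (fun q' => (f q').proj) s q :=
      (FiberBundle.continuous_proj (EuclideanSpace ℝ (Fin n))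
        (TangentSpace (𝓡 n) : M → Type _)).continuousAt.comp_continuousWithinAt
          hf.continuousWithinAt
    exact hc.eventually ((chartAt (EuclideanSpace ℝ (Fin n)) x₁).open_source.mem_nhds h1)
  have key : ∀ z : TangentBundle (𝓡 n) M,
      z.proj ∈ (chartAt (EuclideanSpace ℝ (Fin n)) x₁).source →
      coframe (𝓡 n) x₁ z.proj z.snd
        = (trivializationAt (EuclideanSpace ℝ (Fin n)) (TangentSpace (𝓡 n)) x₁ z).2 := by
    intro z hz
    rw [coframe, ← TangentBundle.continuousLinearMapAt_trivializationAt hz,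
      Bundle.Trivialization.continuousLinearMapAt_apply,
      Bundle.Trivialization.coe_linearMapAt_of_mem _ (by simpa using hz)]
  refine h5.congr_of_eventuallyEq ?_ (key _ h1)
  filter_upwards [hev] with q' hq' using key _ hq'

end ChartMaps

/-! ### Tensor fields of the target space in charts -/

section TargetCharts

variable {n : ℕ} {M : Type*} [TopologicalSpace M] [ChartedSpace (EuclideanSpace ℝ (Fin n)) M]
  [IsManifold (𝓡 n) ∞ M]
  (g : Bundle.ContMDiffRiemannianMetric (𝓡 n) ∞ (EuclideanSpace ℝ (Fin n))
    (fun x : M => TangentSpace (𝓡 n) x))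
  (H : ∀ x : M, TangentSpace (𝓡 n) x [⋀^Fin 3]→L[ℝ] ℝ)
  (O : ∀ x : M, TangentSpace (𝓡 n) x →L[ℝ] TangentSpace (𝓡 n) x)

/-- The metric in the chart around `x₁`, as a field of bilinear forms. -/
noncomputable def metricForm (x₁ : M) (p : EuclideanSpace ℝ (Fin n)) :
    EuclideanSpace ℝ (Fin n) →L[ℝ] EuclideanSpace ℝ (Fin n) →L[ℝ] ℝ :=
  ((ContinuousLinearMap.precomp ℝ (frameAt (𝓡 n) x₁ p)).comp
    (g.inner ((extChartAt (𝓡 n) x₁).symm p))).comp (frameAt (𝓡 n) x₁ p)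

/-- The endomorphism field `O` in the chart around `x₁`. -/
noncomputable def endForm (x₁ : M) (p : EuclideanSpace ℝ (Fin n)) :
    EuclideanSpace ℝ (Fin n) →L[ℝ] EuclideanSpace ℝ (Fin n) :=
  (coframe (𝓡 n) x₁ ((extChartAt (𝓡 n) x₁).symm p)).comp
    ((O ((extChartAt (𝓡 n) x₁).symm p)).comp (frameAt (𝓡 n) x₁ p))

lemma metricForm_apply (x₁ : M) (p u w : EuclideanSpace ℝ (Fin n)) :
    metricForm g x₁ p u w = g.inner ((extChartAt (𝓡 n) x₁).symm p)
      (frameAt (𝓡 n) x₁ p u) (frameAt (𝓡 n) x₁ p w) := rfl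

lemma metricCoord_eq (x₁ : M) (p : EuclideanSpace ℝ (Fin n)) (i j : Fin n) :
    metricCoord g x₁ p i j
      = metricForm g x₁ p (EuclideanSpace.single i 1) (EuclideanSpace.single j 1) := rfl

lemma endCoord_eq (x₁ : M) (p : EuclideanSpace ℝ (Fin n)) (i j : Fin n) :
    endCoord O x₁ p i j = endForm O x₁ p (EuclideanSpace.single j 1) i := rfl

variable {x₁ : M}

lemma inner_eq_metricForm {y : M} (hy : y ∈ (extChartAt (𝓡 n) x₁).source)
    (u w : TangentSpace (𝓡 n) y) :
    g.inner y u w = metricForm g x₁ (extChartAt (𝓡 n) x₁ y) (coframe (𝓡 n) x₁ y u)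
      (coframe (𝓡 n) x₁ y w) := by
  obtain ⟨p, hp, rfl⟩ : ∃ p ∈ (extChartAt (𝓡 n) x₁).target, (extChartAt (𝓡 n) x₁).symm p = y :=
    ⟨_, (extChartAt (𝓡 n) x₁).map_source hy, (extChartAt (𝓡 n) x₁).left_inv hy⟩
  rw [(extChartAt (𝓡 n) x₁).right_inv hp, metricForm_apply, frameAt_coframe _ _ hp,
    frameAt_coframe _ _ hp]

lemma coframe_endForm {y : M} (hy : y ∈ (extChartAt (𝓡 n) x₁).source)
    (u : TangentSpace (𝓡 n) y) :
    coframe (𝓡 n) x₁ y (O y u)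
      = endForm O x₁ (extChartAt (𝓡 n) x₁ y) (coframe (𝓡 n) x₁ y u) := by
  obtain ⟨p, hp, rfl⟩ : ∃ p ∈ (extChartAt (𝓡 n) x₁).target, (extChartAt (𝓡 n) x₁).symm p = y :=
    ⟨_, (extChartAt (𝓡 n) x₁).map_source hy, (extChartAt (𝓡 n) x₁).left_inv hy⟩
  rw [(extChartAt (𝓡 n) x₁).right_inv hp, endForm, ContinuousLinearMap.comp_apply,
    ContinuousLinearMap.comp_apply, frameAt_coframe _ _ hp]

lemma form_eq_formCoord {y : M} (hy : y ∈ (extChartAt (𝓡 n) x₁).source)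
    (w : Fin 3 → TangentSpace (𝓡 n) y) :
    H y w = formCoord H x₁ (extChartAt (𝓡 n) x₁ y) (fun i => coframe (𝓡 n) x₁ y (w i)) := by
  obtain ⟨p, hp, rfl⟩ : ∃ p ∈ (extChartAt (𝓡 n) x₁).target, (extChartAt (𝓡 n) x₁).symm p = y :=
    ⟨_, (extChartAt (𝓡 n) x₁).map_source hy, (extChartAt (𝓡 n) x₁).left_inv hy⟩
  rw [(extChartAt (𝓡 n) x₁).right_inv hp, formCoord,
    ContinuousAlternatingMap.compContinuousLinearMap_apply]
  congr 1
  funext i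
  exact (frameAt_coframe _ _ hp _).symm

lemma metricForm_symm (p u w : EuclideanSpace ℝ (Fin n)) :
    metricForm g x₁ p u w = metricForm g x₁ p w u :=
  g.symm _ _ _

lemma metricForm_self_ne_zero {p u : EuclideanSpace ℝ (Fin n)}
    (hp : p ∈ (extChartAt (𝓡 n) x₁).target) (hu : u ≠ 0) : metricForm g x₁ p u u ≠ 0 := by
  refine (g.pos _ _ fun h => hu ?_).ne'
  have h' := coframe_frameAt (𝓡 n) x₁ hp u
  rw [← h']
  exact (congrArg _ h).trans (map_zero _)

lemma eq_of_metricForm_eq {p u u' : EuclideanSpace ℝ (Fin n)}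
    (hp : p ∈ (extChartAt (𝓡 n) x₁).target)
    (h : ∀ w, metricForm g x₁ p u w = metricForm g x₁ p u' w) : u = u' := by
  by_contra hne
  refine metricForm_self_ne_zero g hp (sub_ne_zero.2 hne) ?_
  rw [map_sub (metricForm g x₁ p) u u', sub_apply, h, sub_self]

lemma metricForm_endForm (hOg : ∀ (x : M) (u v : TangentSpace (𝓡 n) x),
    g.inner x (O x u) (O x v) = g.inner x u v) {p : EuclideanSpace ℝ (Fin n)}
    (hp : p ∈ (extChartAt (𝓡 n) x₁).target) (u w : EuclideanSpace ℝ (Fin n)) :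
    metricForm g x₁ p (endForm O x₁ p u) (endForm O x₁ p w) = metricForm g x₁ p u w := by
  simp only [metricForm_apply, endForm, ContinuousLinearMap.comp_apply, frameAt_coframe _ _ hp]
  exact hOg _ _ _

/-- Coordinate vector fields are smooth. -/
lemma contMDiffWithinAt_frameAt {p : EuclideanSpace ℝ (Fin n)}
    (hp : p ∈ (extChartAt (𝓡 n) x₁).target) (u : EuclideanSpace ℝ (Fin n)) :
    ContMDiffWithinAt 𝓘(ℝ, EuclideanSpace ℝ (Fin n)) (𝓡 n).tangent ∞
      (fun q => (⟨(extChartAt (𝓡 n) x₁).symm q, frameAt (𝓡 n) x₁ q u⟩ : TangentBundle (𝓡 n) M))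
      (extChartAt (𝓡 n) x₁).target p := by
  have h0 : ContMDiffOn 𝓘(ℝ, EuclideanSpace ℝ (Fin n)) (𝓡 n) ∞ (extChartAt (𝓡 n) x₁).symm
      (extChartAt (𝓡 n) x₁).target := contMDiffOn_extChartAt_symm x₁
  have h1 := h0.contMDiffOn_tangentMapWithin (m := ∞) (by norm_num)
    ((isOpen_extChartAt_target x₁).uniqueMDiffOn)
  have h2 : ContMDiffWithinAt 𝓘(ℝ, EuclideanSpace ℝ (Fin n))
      𝓘(ℝ, EuclideanSpace ℝ (Fin n)).tangent ∞
      (fun q => (⟨q, u⟩ : TangentBundle 𝓘(ℝ, EuclideanSpace ℝ (Fin n))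
        (EuclideanSpace ℝ (Fin n)))) (extChartAt (𝓡 n) x₁).target p := by
    rw [Bundle.contMDiffWithinAt_totalSpace]
    refine ⟨contMDiffWithinAt_id, ?_⟩
    simp
    exact contMDiffWithinAt_const
  have h3 := (h1 ⟨p, u⟩ hp).comp p h2 (fun q hq => hq)
  refine h3.congr_of_mem (fun q hq => ?_) hp
  have h4 : mfderivWithin 𝓘(ℝ, EuclideanSpace ℝ (Fin n)) (𝓡 n) (extChartAt (𝓡 n) x₁).symm
      (range (𝓡 n)) q = mfderivWithin 𝓘(ℝ, EuclideanSpace ℝ (Fin n)) (𝓡 n)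
        (extChartAt (𝓡 n) x₁).symm (extChartAt (𝓡 n) x₁).target q := by
    rw [mfderivWithin_of_isOpen (isOpen_extChartAt_target x₁) hq,
      mfderivWithin_of_isOpen (by simp) (by simp)]
  simp only [Function.comp_apply, tangentMapWithin, frameAt, h4]
  rfl

lemma contDiffOn_metricForm :
    ContDiffOn ℝ ∞ (metricForm g x₁) (extChartAt (𝓡 n) x₁).target := by
  refine contDiffOn_clm_apply.2 fun u => contDiffOn_clm_apply.2 fun w => ?_
  intro p hp
  have h4 : ContMDiffWithinAt 𝓘(ℝ, EuclideanSpace ℝ (Fin n)) ((𝓡 n).prod 𝓘(ℝ)) ∞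
      (fun q => Bundle.TotalSpace.mk' ℝ (E := Bundle.Trivial M ℝ) ((extChartAt (𝓡 n) x₁).symm q)
        (g.inner ((extChartAt (𝓡 n) x₁).symm q) (frameAt (𝓡 n) x₁ q u) (frameAt (𝓡 n) x₁ q w)))
      (extChartAt (𝓡 n) x₁).target p := by
    apply ContMDiffWithinAt.clm_bundle_apply₂ (F₁ := EuclideanSpace ℝ (Fin n))
      (F₂ := EuclideanSpace ℝ (Fin n))
    · exact ContMDiffAt.comp_contMDiffWithinAt p (g.contMDiff _)
        (contMDiffOn_extChartAt_symm x₁ p hp)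
    · exact contMDiffWithinAt_frameAt hp u
    · exact contMDiffWithinAt_frameAt hp w
  rw [Bundle.contMDiffWithinAt_totalSpace] at h4
  exact contMDiffWithinAt_iff_contDiffWithinAt.1 h4.2

end TargetCharts

/-! ### The Levi-Civita connection in charts -/

section Euclidean

variable {n : ℕ}

lemma sum_smul_single (z : EuclideanSpace ℝ (Fin n)) :
    z = ∑ j, z j • EuclideanSpace.single j (1 : ℝ) := by
  ext i
  simp [Finset.sum_apply, Pi.single_apply]

lemma apply_eq_sum {F : Type*} [AddCommMonoid F] [Module ℝ F] [TopologicalSpace F]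
    (T : EuclideanSpace ℝ (Fin n) →L[ℝ] F) (z : EuclideanSpace ℝ (Fin n)) :
    T z = ∑ j, z j • T (EuclideanSpace.single j (1 : ℝ)) := by
  conv_lhs => rw [sum_smul_single z]
  simp only [map_sum, map_smul]

lemma apply₂_eq_sum (T : EuclideanSpace ℝ (Fin n) →L[ℝ] EuclideanSpace ℝ (Fin n) →L[ℝ] ℝ)
    (z u : EuclideanSpace ℝ (Fin n)) :
    T z u = ∑ j, ∑ k, z j * u k *
      T (EuclideanSpace.single j (1 : ℝ)) (EuclideanSpace.single k (1 : ℝ)) := by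
  rw [apply_eq_sum T z, sum_apply]
  refine Finset.sum_congr rfl fun j _ => ?_
  rw [smul_apply, apply_eq_sum (T _) u, Finset.smul_sum]
  refine Finset.sum_congr rfl fun k _ => ?_
  simp only [smul_eq_mul, mul_assoc]

lemma apply₃_eq_sum (T : EuclideanSpace ℝ (Fin n) →L[ℝ] EuclideanSpace ℝ (Fin n) →L[ℝ]
      EuclideanSpace ℝ (Fin n) →L[ℝ] ℝ) (z u w : EuclideanSpace ℝ (Fin n)) :
    T z u w = ∑ j, ∑ k, ∑ m, z j * u k * w m * T (EuclideanSpace.single j (1 : ℝ))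
      (EuclideanSpace.single k (1 : ℝ)) (EuclideanSpace.single m (1 : ℝ)) := by
  rw [apply_eq_sum T z, sum_apply, sum_apply]
  refine Finset.sum_congr rfl fun j _ => ?_
  rw [smul_apply, smul_apply, apply₂_eq_sum, Finset.smul_sum]
  refine Finset.sum_congr rfl fun k _ => ?_
  rw [Finset.smul_sum]
  refine Finset.sum_congr rfl fun m _ => ?_
  simp only [smul_eq_mul, mul_assoc]

end Euclidean

section Connection

variable {n : ℕ} {M : Type*} [TopologicalSpace M] [ChartedSpace (EuclideanSpace ℝ (Fin n)) M]
  [IsManifold (𝓡 n) ∞ M]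
  (g : Bundle.ContMDiffRiemannianMetric (𝓡 n) ∞ (EuclideanSpace ℝ (Fin n))
    (fun x : M => TangentSpace (𝓡 n) x))
  (O : ∀ x : M, TangentSpace (𝓡 n) x →L[ℝ] TangentSpace (𝓡 n) x)
  {x₁ : M}

lemma mulVec_metricCoord (p u : EuclideanSpace ℝ (Fin n)) (i : Fin n) :
    ((metricCoord g x₁ p).mulVec u) i = metricForm g x₁ p (EuclideanSpace.single i 1) u := by
  rw [apply_eq_sum (metricForm g x₁ p _) u]
  simp [Matrix.mulVec, dotProduct, metricCoord_eq, mul_comm]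

lemma isUnit_metricCoord {p : EuclideanSpace ℝ (Fin n)}
    (hp : p ∈ (extChartAt (𝓡 n) x₁).target) : IsUnit (metricCoord g x₁ p) := by
  rw [← Matrix.mulVec_injective_iff_isUnit]
  intro u w h
  have : WithLp.toLp 2 u = WithLp.toLp 2 w := by
    refine eq_of_metricForm_eq g hp fun z => ?_
    rw [metricForm_symm, metricForm_symm g _ _ z, apply_eq_sum _ z]
    simp only [sum_apply, smul_apply]
    refine Finset.sum_congr rfl fun i _ => ?_
    have := congrFun h i
    have h1 := mulVec_metricCoord g (x₁ := x₁) p (WithLp.toLp 2 u) i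
    have h2 := mulVec_metricCoord g (x₁ := x₁) p (WithLp.toLp 2 w) i
    rw [← h1, ← h2]
    exact congrArg _ this
  exact congrArg WithLp.ofLp this

/-- Raising an index with the inverse of the metric. -/
lemma metricForm_inv {p : EuclideanSpace ℝ (Fin n)} (hp : p ∈ (extChartAt (𝓡 n) x₁).target)
    (c : Fin n → ℝ) (w : EuclideanSpace ℝ (Fin n)) :
    metricForm g x₁ p (WithLp.toLp 2 fun i => ∑ l, (metricCoord g x₁ p)⁻¹ i l * c l) w
      = ∑ l, c l * w l := by
  rw [metricForm_symm, apply_eq_sum (metricForm g x₁ p) w, sum_apply]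
  refine Finset.sum_congr rfl fun l _ => ?_
  rw [smul_apply, ← mulVec_metricCoord, smul_eq_mul, mul_comm]
  congr 1
  have h1 : (metricCoord g x₁ p).mulVec ((metricCoord g x₁ p)⁻¹.mulVec c) = c := by
    rw [Matrix.mulVec_mulVec, Matrix.mul_nonsing_inv _
      ((Matrix.isUnit_iff_isUnit_det _).1 (isUnit_metricCoord g hp)), Matrix.one_mulVec]
  exact congrFun h1 l

/-- `Γ(u, w)` in the chart around `x₁`, the vector with components `Γ^i_jk u^j w^k`. -/
noncomputable def christoffelMap (x₁ : M) (p u w : EuclideanSpace ℝ (Fin n)) :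
    EuclideanSpace ℝ (Fin n) :=
  WithLp.toLp 2 fun i => ∑ j, ∑ k, christoffel g x₁ p i j k * u j * w k

lemma differentiableAt_metricForm {p : EuclideanSpace ℝ (Fin n)}
    (hp : p ∈ (extChartAt (𝓡 n) x₁).target) : DifferentiableAt ℝ (metricForm g x₁) p :=
  ((contDiffOn_metricForm g).contDiffAt
    ((isOpen_extChartAt_target x₁).mem_nhds hp)).differentiableAt (by norm_num)

lemma pd_metricCoord {p : EuclideanSpace ℝ (Fin n)} (hp : p ∈ (extChartAt (𝓡 n) x₁).target)
    (l i j : Fin n) :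
    pd l (fun q => metricCoord g x₁ q i j) p = fderiv ℝ (metricForm g x₁) p
      (EuclideanSpace.single l 1) (EuclideanSpace.single i 1) (EuclideanSpace.single j 1) := by
  have h := (differentiableAt_metricForm g hp).hasFDerivAt
  have h2 := (h.clm_apply (hasFDerivAt_const (EuclideanSpace.single i (1 : ℝ)) p)).clm_apply
    (hasFDerivAt_const (EuclideanSpace.single j (1 : ℝ)) p)
  rw [pd]
  simp only [metricCoord_eq]
  rw [h2.fderiv]
  simp

lemma fderiv_metricForm_symm {p : EuclideanSpace ℝ (Fin n)}
    (hp : p ∈ (extChartAt (𝓡 n) x₁).target) (z u w : EuclideanSpace ℝ (Fin n)) :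
    fderiv ℝ (metricForm g x₁) p z u w = fderiv ℝ (metricForm g x₁) p z w u := by
  have h := (differentiableAt_metricForm g hp).hasFDerivAt
  have h2 : ∀ u w, HasFDerivAt (fun q => metricForm g x₁ q u w) _ p := fun u w =>
    (h.clm_apply (hasFDerivAt_const u p)).clm_apply (hasFDerivAt_const w p)
  have h3 : (fun q => metricForm g x₁ q u w) = fun q => metricForm g x₁ q w u := by
    funext q; exact metricForm_symm g q u w
  have h4 := h2 u w
  rw [h3] at h4
  have := DFunLike.congr_fun (h4.unique (h2 w u)) z
  simpa using this

/-- The Koszul formula for the connection with the coefficients `christoffel`. -/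
lemma metricForm_christoffelMap {p : EuclideanSpace ℝ (Fin n)}
    (hp : p ∈ (extChartAt (𝓡 n) x₁).target) (z u w : EuclideanSpace ℝ (Fin n)) :
    metricForm g x₁ p (christoffelMap g x₁ p z u) w =
      (1 / 2) * (fderiv ℝ (metricForm g x₁) p z w u + fderiv ℝ (metricForm g x₁) p u w z
        - fderiv ℝ (metricForm g x₁) p w z u) := by
  have h1 : christoffelMap g x₁ p z u = WithLp.toLp 2 fun i => ∑ l, (metricCoord g x₁ p)⁻¹ i l *
      ∑ j, ∑ k, z j * u k * ((1 / 2) * (pd j (fun q => metricCoord g x₁ q l k) p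
        + pd k (fun q => metricCoord g x₁ q l j) p
        - pd l (fun q => metricCoord g x₁ q j k) p)) := by
    rw [christoffelMap]
    congr 1
    funext i
    simp only [christoffel, Finset.mul_sum, Finset.sum_mul]
    refine (Finset.sum_congr rfl fun j _ => Finset.sum_comm).trans (Finset.sum_comm.trans ?_)
    refine Finset.sum_congr rfl fun l _ => Finset.sum_congr rfl fun j _ =>
      Finset.sum_congr rfl fun k _ => ?_
    ring
  have e1 := (apply₃_eq_sum (fderiv ℝ (metricForm g x₁) p) z w u).trans Finset.sum_comm
  have e2 := ((apply₃_eq_sum (fderiv ℝ (metricForm g x₁) p) u w z).trans Finset.sum_comm).trans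
    (Finset.sum_congr rfl fun l _ => Finset.sum_comm)
  have e3 := apply₃_eq_sum (fderiv ℝ (metricForm g x₁) p) w z u
  rw [h1, metricForm_inv g hp, e1, e2, e3]
  simp only [pd_metricCoord g hp, Finset.mul_sum, Finset.sum_mul, ← Finset.sum_add_distrib,
    ← Finset.sum_sub_distrib]
  refine Finset.sum_congr rfl fun l _ => Finset.sum_congr rfl fun j _ =>
    Finset.sum_congr rfl fun k _ => ?_
  ring

/-- The Levi-Civita connection is torsion-free. -/
lemma christoffelMap_symm {p : EuclideanSpace ℝ (Fin n)}
    (hp : p ∈ (extChartAt (𝓡 n) x₁).target) (z u : EuclideanSpace ℝ (Fin n)) :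
    christoffelMap g x₁ p z u = christoffelMap g x₁ p u z := by
  refine eq_of_metricForm_eq g hp fun w => ?_
  rw [metricForm_christoffelMap g hp, metricForm_christoffelMap g hp,
    fderiv_metricForm_symm g hp w z u]
  ring

/-- The Levi-Civita connection is metric. -/
lemma fderiv_metricForm {p : EuclideanSpace ℝ (Fin n)}
    (hp : p ∈ (extChartAt (𝓡 n) x₁).target) (z u w : EuclideanSpace ℝ (Fin n)) :
    fderiv ℝ (metricForm g x₁) p z u w = metricForm g x₁ p (christoffelMap g x₁ p z u) w
      + metricForm g x₁ p u (christoffelMap g x₁ p z w) := by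
  rw [metricForm_symm g p u, metricForm_christoffelMap g hp, metricForm_christoffelMap g hp,
    fderiv_metricForm_symm g hp z u w, fderiv_metricForm_symm g hp u w z,
    fderiv_metricForm_symm g hp w z u]
  ring

lemma christoffelMap_add_right (p z u w : EuclideanSpace ℝ (Fin n)) :
    christoffelMap g x₁ p z (u + w) = christoffelMap g x₁ p z u + christoffelMap g x₁ p z w := by
  ext i
  simp [christoffelMap, mul_add, Finset.sum_add_distrib]

lemma christoffelMap_smul_right (p z u : EuclideanSpace ℝ (Fin n)) (c : ℝ) :
    christoffelMap g x₁ p z (c • u) = c • christoffelMap g x₁ p z u := by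
  ext i
  simp only [christoffelMap, PiLp.smul_apply, smul_eq_mul, Finset.mul_sum]
  refine Finset.sum_congr rfl fun j _ => Finset.sum_congr rfl fun k _ => ?_
  ring

lemma christoffelMap_sub_right (p z u w : EuclideanSpace ℝ (Fin n)) :
    christoffelMap g x₁ p z (u - w) = christoffelMap g x₁ p z u - christoffelMap g x₁ p z w := by
  rw [sub_eq_add_neg, ← neg_one_smul ℝ w, christoffelMap_add_right, christoffelMap_smul_right,
    neg_one_smul, sub_eq_add_neg]

variable (hO : IsSmoothEnd O)

include hO in
lemma contDiffOn_endForm : ContDiffOn ℝ ∞ (endForm O x₁) (extChartAt (𝓡 n) x₁).target := by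
  refine contDiffOn_clm_apply.2 fun u => contDiffOn_euclidean.2 fun i => ?_
  have : (fun p => (endForm O x₁ p u) i) = fun p => ∑ j, u j * endCoord O x₁ p i j := by
    funext p
    rw [apply_eq_sum (endForm O x₁ p) u]
    simp [endCoord_eq]
  rw [this]
  exact ContDiffOn.sum fun j _ => contDiffOn_const.mul (hO x₁ i j)

include hO in
lemma differentiableAt_endForm {p : EuclideanSpace ℝ (Fin n)}
    (hp : p ∈ (extChartAt (𝓡 n) x₁).target) : DifferentiableAt ℝ (endForm O x₁) p :=
  ((contDiffOn_endForm O hO).contDiffAt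
    ((isOpen_extChartAt_target x₁).mem_nhds hp)).differentiableAt (by norm_num)

/-- `∇_z(O) u` in the chart around `x₁`. -/
noncomputable def nablaEndMap (x₁ : M) (p z u : EuclideanSpace ℝ (Fin n)) :
    EuclideanSpace ℝ (Fin n) :=
  fderiv ℝ (endForm O x₁) p z u + christoffelMap g x₁ p z (endForm O x₁ p u)
    - endForm O x₁ p (christoffelMap g x₁ p z u)

include hO in
lemma pd_endCoord {p : EuclideanSpace ℝ (Fin n)} (hp : p ∈ (extChartAt (𝓡 n) x₁).target)
    (l m k : Fin n) :
    pd l (fun q => endCoord O x₁ q m k) p = (fderiv ℝ (endForm O x₁) p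
      (EuclideanSpace.single l 1) (EuclideanSpace.single k 1)) m := by
  have h := (differentiableAt_endForm O hO hp).hasFDerivAt
  have h2 := h.clm_apply (hasFDerivAt_const (EuclideanSpace.single k (1 : ℝ)) p)
  have h3 := (EuclideanSpace.proj (𝕜 := ℝ) m).hasFDerivAt.comp p h2
  have h4 : (fun q => endCoord O x₁ q m k) = (EuclideanSpace.proj (𝕜 := ℝ) m) ∘ fun q =>
      endForm O x₁ q (EuclideanSpace.single k (1 : ℝ)) := rfl
  rw [pd, h4, h3.fderiv]
  simp

lemma endForm_apply (p u : EuclideanSpace ℝ (Fin n)) (i : Fin n) :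
    endForm O x₁ p u i = ∑ j, endCoord O x₁ p i j * u j := by
  rw [apply_eq_sum (endForm O x₁ p) u]
  simp [endCoord_eq, mul_comm]

include hO in
lemma sum_nablaEndCoord {p : EuclideanSpace ℝ (Fin n)} (hp : p ∈ (extChartAt (𝓡 n) x₁).target)
    (z u : EuclideanSpace ℝ (Fin n)) (m : Fin n) :
    ∑ l, ∑ k, z l * nablaEndCoord g O x₁ p l m k * u k = nablaEndMap g O x₁ p z u m := by
  have h1 : (fderiv ℝ (endForm O x₁) p z u) m = ∑ l, ∑ k, z l *
      (fderiv ℝ (endForm O x₁) p (EuclideanSpace.single l 1) (EuclideanSpace.single k 1)) m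
        * u k := by
    rw [apply_eq_sum (fderiv ℝ (endForm O x₁) p) z, sum_apply, WithLp.ofLp_sum, Finset.sum_apply]
    refine Finset.sum_congr rfl fun l _ => ?_
    rw [smul_apply, apply_eq_sum _ u]
    simp only [WithLp.ofLp_smul, WithLp.ofLp_sum, Pi.smul_apply, Finset.sum_apply, smul_eq_mul,
      Finset.mul_sum]
    refine Finset.sum_congr rfl fun k _ => ?_
    ring
  have h2 : christoffelMap g x₁ p z (endForm O x₁ p u) m = ∑ l, ∑ k, z l *
      (∑ r, christoffel g x₁ p m l r * endCoord O x₁ p r k) * u k := by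
    simp only [christoffelMap, endForm_apply, Finset.mul_sum, Finset.sum_mul]
    refine Finset.sum_congr rfl fun l _ => Finset.sum_comm.trans ?_
    refine Finset.sum_congr rfl fun k _ => Finset.sum_congr rfl fun r _ => ?_
    ring
  have h3 : endForm O x₁ p (christoffelMap g x₁ p z u) m = ∑ l, ∑ k, z l *
      (∑ r, christoffel g x₁ p r l k * endCoord O x₁ p m r) * u k := by
    simp only [christoffelMap, endForm_apply, Finset.mul_sum, Finset.sum_mul]
    refine Finset.sum_comm.trans (Finset.sum_congr rfl fun l _ => Finset.sum_comm.trans ?_)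
    refine Finset.sum_congr rfl fun k _ => Finset.sum_congr rfl fun r _ => ?_
    ring
  simp only [nablaEndMap, WithLp.ofLp_add, WithLp.ofLp_sub, Pi.add_apply, Pi.sub_apply]
  rw [h1, h2, h3]
  simp only [← Finset.sum_add_distrib, ← Finset.sum_sub_distrib]
  refine Finset.sum_congr rfl fun l _ => Finset.sum_congr rfl fun k _ => ?_
  rw [nablaEndCoord, pd_endCoord O hO hp]
  ring

end Connection

/-! ### The integrability condition and the structure functions -/

/-- The algebraic part of the computation of the Courant bracket of `(a - O a) ⊕ (a + O a)^*` and
`(b - O b) ⊕ (b + O b)^*`, paired with `z`. With `v = a - O a` and `w = b - O b`, the letters stand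
for `A₁ = Γ(v, b)`, `A₂ = Γ(v, O b)`, `B₁ = Γ(w, a)`, `B₂ = Γ(w, O a)`, `Za = Γ(z, a)`,
`Zoa = Γ(z, O a)`, `Nab = ∇_v(O) b`, `Nba = ∇_w(O) a`, `Nza = ∇_z(O) a`, and similarly for `Zb`,
`Zob`, `Nzb`; the hypothesis on them is that the connection is torsion-free. -/
lemma bracket_identity {V : Type*} [NormedAddCommGroup V] [NormedSpace ℝ V]
    (G : V →L[ℝ] V →L[ℝ] ℝ) (O : V →L[ℝ] V) (hG : ∀ u w, G u w = G w u)
    (hO : ∀ u w, G (O u) (O w) = G u w) (a b z A₁ A₂ B₁ B₂ Za Zoa Zb Zob Nab Nba Nza Nzb : V)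
    (hΓ : A₁ - A₂ = B₁ - B₂) :
    -- the vector part
    (-G (Nab - A₂ + O A₁) z + G (Nba - B₂ + O B₁) z)
      -- the form part
      + ((G (A₁ + A₂) z + G (b + O b) (Za - Zoa) + G (Nab - A₂ + O A₁) z)
        - G (b + O b) (Nza - Zoa + O Za)
        - ((G (B₁ + B₂) z + G (a + O a) (Zb - Zob) + G (Nba - B₂ + O B₁) z)
          - G (a + O a) (Nzb - Zob + O Zb))
        - (1 / 2) * (((G (Zb + Zob) (a - O a) + G (b + O b) (Za - Zoa))
            + G (Nzb - Zob + O Zb) (a - O a) - G (b + O b) (Nza - Zoa + O Za))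
          - ((G (Za + Zoa) (b - O b) + G (a + O a) (Zb - Zob))
            + G (Nza - Zoa + O Za) (b - O b) - G (a + O a) (Nzb - Zob + O Zb))))
      = 2 * G (A₁ - B₁) z + (G (O a) Nzb - G (O b) Nza) := by
  have h1 : A₂ = A₁ - B₁ + B₂ := by rw [← sub_eq_zero] at hΓ ⊢; rw [← neg_eq_zero, ← hΓ]; abel
  subst h1
  have e1 := hO a Zb
  have e2 := hO b Za
  have e3 := hO Za b
  have e4 := hO Zb a
  simp only [map_add, map_sub, add_apply, sub_apply] at *
  rw [hG Zb, hG Zob, hG Nzb, hG (O Zb), hG Za, hG Zoa, hG Nza, hG (O Za)] at *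
  simp only [hG Zb, hG Zob, hG Nzb, hG (O Zb), hG Za, hG Zoa, hG Nza, hG (O Za)] at *
  linarith

section Bracket

variable {n : ℕ} {M : Type*} [TopologicalSpace M] [ChartedSpace (EuclideanSpace ℝ (Fin n)) M]
  [IsManifold (𝓡 n) ∞ M]
  (g : Bundle.ContMDiffRiemannianMetric (𝓡 n) ∞ (EuclideanSpace ℝ (Fin n))
    (fun x : M => TangentSpace (𝓡 n) x))
  (H : ∀ x : M, TangentSpace (𝓡 n) x [⋀^Fin 3]→L[ℝ] ℝ)
  (O : ∀ x : M, TangentSpace (𝓡 n) x →L[ℝ] TangentSpace (𝓡 n) x)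
  {x₁ : M}

/-- The vector part `(id - O) a` of the section of the graph with constant components `a`. -/
noncomputable def graphVec (x₁ : M) (a p : EuclideanSpace ℝ (Fin n)) : EuclideanSpace ℝ (Fin n) :=
  a - endForm O x₁ p a

/-- The 1-form part `((id + O) a)^*` of the section of the graph with constant components `a`. -/
noncomputable def graphForm (x₁ : M) (a p : EuclideanSpace ℝ (Fin n)) :
    EuclideanSpace ℝ (Fin n) →L[ℝ] ℝ :=
  metricForm g x₁ p (a + endForm O x₁ p a)

lemma secVec_eq_graphVec (i : Fin n) :
    secVec O x₁ i = graphVec O x₁ (EuclideanSpace.single i 1) := by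
  funext p
  ext l
  simp [secVec, graphVec, endCoord_eq, Matrix.one_apply]

lemma secForm_eq_graphForm (i : Fin n) :
    secForm g O x₁ i = graphForm g O x₁ (EuclideanSpace.single i 1) := by
  funext p
  refine ContinuousLinearMap.ext fun w => ?_
  rw [secForm, graphForm, metricForm_symm, apply_eq_sum (metricForm g x₁ p) w]
  simp only [sum_apply, smul_apply, PiLp.proj_apply, smul_eq_mul]
  refine Finset.sum_congr rfl fun l _ => ?_
  rw [← mulVec_metricCoord, mul_comm, Matrix.mul_apply]
  congr 1
  refine Finset.sum_congr rfl fun m _ => ?_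
  simp [endCoord_eq, Matrix.one_apply]

variable (hO : IsSmoothEnd O)

include hO in
lemma hasFDerivAt_graphVec {p : EuclideanSpace ℝ (Fin n)}
    (hp : p ∈ (extChartAt (𝓡 n) x₁).target) (a : EuclideanSpace ℝ (Fin n)) :
    HasFDerivAt (graphVec O x₁ a) (-(fderiv ℝ (endForm O x₁) p).flip a) p := by
  have h := (differentiableAt_endForm O hO hp).hasFDerivAt
  have h2 := (hasFDerivAt_const a p).sub (h.clm_apply (hasFDerivAt_const a p))
  refine h2.congr_fderiv ?_
  ext z
  simp

include hO in
lemma hasFDerivAt_graphForm {p : EuclideanSpace ℝ (Fin n)}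
    (hp : p ∈ (extChartAt (𝓡 n) x₁).target) (a : EuclideanSpace ℝ (Fin n)) :
    HasFDerivAt (graphForm g O x₁ a) ((metricForm g x₁ p).comp
      ((fderiv ℝ (endForm O x₁) p).flip a) +
        (fderiv ℝ (metricForm g x₁) p).flip (a + endForm O x₁ p a)) p := by
  have h := (differentiableAt_endForm O hO hp).hasFDerivAt
  have h1 := (differentiableAt_metricForm g hp).hasFDerivAt
  have h2 := h1.clm_apply ((hasFDerivAt_const a p).add (h.clm_apply (hasFDerivAt_const a p)))
  refine h2.congr_fderiv ?_
  ext z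
  simp

lemma fderiv_endForm (p z u : EuclideanSpace ℝ (Fin n)) :
    fderiv ℝ (endForm O x₁) p z u = nablaEndMap g O x₁ p z u
      - christoffelMap g x₁ p z (endForm O x₁ p u)
      + endForm O x₁ p (christoffelMap g x₁ p z u) := by
  rw [nablaEndMap]; abel

variable (hOg : ∀ (x : M) (u v : TangentSpace (𝓡 n) x), g.inner x (O x u) (O x v) = g.inner x u v)

include hO hOg in
/-- `O⁻¹ ∇_z(O)` is skew-symmetric. -/
lemma metricForm_nablaEndMap {p : EuclideanSpace ℝ (Fin n)}
    (hp : p ∈ (extChartAt (𝓡 n) x₁).target) (z u w : EuclideanSpace ℝ (Fin n)) :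
    metricForm g x₁ p (nablaEndMap g O x₁ p z u) (endForm O x₁ p w)
      + metricForm g x₁ p (endForm O x₁ p u) (nablaEndMap g O x₁ p z w) = 0 := by
  have h := (differentiableAt_endForm O hO hp).hasFDerivAt
  have h1 := (differentiableAt_metricForm g hp).hasFDerivAt
  have h2 := (h1.clm_apply (h.clm_apply (hasFDerivAt_const u p))).clm_apply
    (h.clm_apply (hasFDerivAt_const w p))
  have h3 := (h1.clm_apply (hasFDerivAt_const u p)).clm_apply (hasFDerivAt_const w p)
  have h4 := h3.congr_of_eventuallyEq (f₁ := fun q => metricForm g x₁ q (endForm O x₁ q u)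
    (endForm O x₁ q w)) (by
      filter_upwards [(isOpen_extChartAt_target x₁).mem_nhds hp] with q hq
      exact metricForm_endForm g O hOg hq u w)
  have h5 := DFunLike.congr_fun (h2.unique h4) z
  simp only [fderiv_endForm g O, fderiv_metricForm g hp, add_apply, ContinuousLinearMap.comp_apply,
    ContinuousLinearMap.flip_apply, map_add, map_sub, zero_apply, map_zero, sub_apply] at h5
  have h6 := metricForm_endForm g O hOg hp (christoffelMap g x₁ p z u) w
  have h7 := metricForm_endForm g O hOg hp u (christoffelMap g x₁ p z w)
  simp at h5
  linarith

include hO in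
lemma lieBracket_graphVec {p : EuclideanSpace ℝ (Fin n)}
    (hp : p ∈ (extChartAt (𝓡 n) x₁).target) (a b : EuclideanSpace ℝ (Fin n)) :
    VectorField.lieBracket ℝ (graphVec O x₁ a) (graphVec O x₁ b) p =
      fderiv ℝ (endForm O x₁) p (graphVec O x₁ b p) a
        - fderiv ℝ (endForm O x₁) p (graphVec O x₁ a p) b := by
  rw [VectorField.lieBracket, (hasFDerivAt_graphVec O hO hp a).fderiv,
    (hasFDerivAt_graphVec O hO hp b).fderiv]
  simp only [neg_apply, ContinuousLinearMap.flip_apply]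
  abel

lemma alternating_swap_left {V : Type*} [AddCommGroup V] [Module ℝ V] [TopologicalSpace V]
    (h : V [⋀^Fin 3]→L[ℝ] ℝ) (u v w : V) : h ![u, v, w] = -h ![v, u, w] := by
  have := h.toAlternatingMap.map_swap ![v, u, w] (i := 0) (j := 1) (by decide)
  rw [← ContinuousAlternatingMap.coe_toAlternatingMap, ← this]
  congr 1
  funext i
  fin_cases i <;> rfl

lemma alternating_swap_right {V : Type*} [AddCommGroup V] [Module ℝ V] [TopologicalSpace V]
    (h : V [⋀^Fin 3]→L[ℝ] ℝ) (u v w : V) : h ![u, v, w] = -h ![u, w, v] := by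
  have := h.toAlternatingMap.map_swap ![u, w, v] (i := 1) (j := 2) (by decide)
  rw [← ContinuousAlternatingMap.coe_toAlternatingMap, ← this]
  congr 1
  funext i
  fin_cases i <;> rfl

lemma contract_apply (h : EuclideanSpace ℝ (Fin n) [⋀^Fin 3]→L[ℝ] ℝ)
    (u v w : EuclideanSpace ℝ (Fin n)) : contract h u v w = h ![u, v, w] := by
  rw [contract]
  change h (Function.update ![u, v, 0] 2 w) = _
  congr 1
  funext i
  fin_cases i <;> rfl

set_option maxHeartbeats 400000 in
include hO hOg in
/-- The sum of the two parts of the Courant bracket of two sections of the graph, the vector part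
being lowered with the metric. In this sum the derivatives of `O` along the two sections cancel. -/
lemma courantForm_graph {p : EuclideanSpace ℝ (Fin n)}
    (hp : p ∈ (extChartAt (𝓡 n) x₁).target) (a b z : EuclideanSpace ℝ (Fin n)) :
    metricForm g x₁ p (VectorField.lieBracket ℝ (graphVec O x₁ a) (graphVec O x₁ b) p) z
      + courantForm (formCoord H x₁) (graphVec O x₁ a) (graphForm g O x₁ a) (graphVec O x₁ b)
        (graphForm g O x₁ b) p z =
      2 * metricForm g x₁ p (christoffelMap g x₁ p b (graphVec O x₁ a p)
        - christoffelMap g x₁ p a (graphVec O x₁ b p)) z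
      + (metricForm g x₁ p (endForm O x₁ p a) (nablaEndMap g O x₁ p z b)
        - metricForm g x₁ p (endForm O x₁ p b) (nablaEndMap g O x₁ p z a))
      + formCoord H x₁ p ![z, graphVec O x₁ a p, graphVec O x₁ b p] := by
  have hv := hasFDerivAt_graphVec O hO hp
  have hf := hasFDerivAt_graphForm g O hO hp
  have hd : HasFDerivAt (fun q => graphForm g O x₁ b q (graphVec O x₁ a q)
      - graphForm g O x₁ a q (graphVec O x₁ b q)) _ p :=
    ((hf b).clm_apply (hv a)).sub ((hf a).clm_apply (hv b))
  have hH : contract (formCoord H x₁ p) (graphVec O x₁ b p) (graphVec O x₁ a p) z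
      = -formCoord H x₁ p ![z, graphVec O x₁ a p, graphVec O x₁ b p] := by
    rw [contract_apply, alternating_swap_right, alternating_swap_left, alternating_swap_right,
      neg_neg]
  have hΓ : christoffelMap g x₁ p (graphVec O x₁ a p) b
      - christoffelMap g x₁ p (graphVec O x₁ a p) (endForm O x₁ p b)
      = christoffelMap g x₁ p (graphVec O x₁ b p) a
        - christoffelMap g x₁ p (graphVec O x₁ b p) (endForm O x₁ p a) := by
    rw [← christoffelMap_sub_right, ← christoffelMap_sub_right]
    exact christoffelMap_symm g hp _ _
  have hz : ∀ c, christoffelMap g x₁ p (graphVec O x₁ c p) z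
      = christoffelMap g x₁ p z c - christoffelMap g x₁ p z (endForm O x₁ p c) := by
    intro c
    rw [christoffelMap_symm g hp, graphVec, christoffelMap_sub_right]
  have key := bracket_identity (metricForm g x₁ p) (endForm O x₁ p) (metricForm_symm g p)
    (metricForm_endForm g O hOg hp) a b z _ _ _ _ (christoffelMap g x₁ p z a)
    (christoffelMap g x₁ p z (endForm O x₁ p a)) (christoffelMap g x₁ p z b)
    (christoffelMap g x₁ p z (endForm O x₁ p b))
    (nablaEndMap g O x₁ p (graphVec O x₁ a p) b) (nablaEndMap g O x₁ p (graphVec O x₁ b p) a)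
    (nablaEndMap g O x₁ p z a) (nablaEndMap g O x₁ p z b) hΓ
  rw [courantForm, lieBracket_graphVec O hO hp, sub_apply, hH, sub_apply, sub_apply, smul_apply,
    hd.fderiv, lieForm, lieForm, (hv a).fderiv, (hv b).fderiv, (hf a).fderiv, (hf b).fderiv,
    christoffelMap_symm g hp b, christoffelMap_symm g hp a]
  simp only [add_apply, sub_apply, neg_apply, ContinuousLinearMap.comp_apply,
    ContinuousLinearMap.flip_apply, fderiv_endForm g O, fderiv_metricForm g hp, smul_eq_mul,
    hz, map_neg] at key ⊢
  simp only [graphForm, map_add, map_sub, add_apply, sub_apply, christoffelMap_sub_right,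
    christoffelMap_add_right, graphVec] at key ⊢
  clear hd hf hv hH hΓ
  -- Both sides are now polynomials in the values of `G`, `O`, `Γ` and `∇O` at `p`.
  generalize metricForm g x₁ p = G at *
  generalize endForm O x₁ p = T at *
  generalize christoffelMap g x₁ p = Γ at *
  generalize nablaEndMap g O x₁ p = N at *
  clear hz
  linear_combination (exp := 1) key

end Bracket

section Slots

variable {V : Type*} [AddCommGroup V] [Module ℝ V] [TopologicalSpace V]
  (h : V [⋀^Fin 3]→L[ℝ] ℝ)

/-- The three partial maps of a 3-form, as linear maps. -/
noncomputable def formSlot (i : Fin 3) (m : Fin 3 → V) : V →L[ℝ] ℝ :=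
  h.toContinuousMultilinearMap.toContinuousLinearMap m i

lemma formSlot_zero (u v w : V) : h ![u, v, w] = formSlot h 0 ![0, v, w] u := by
  change _ = h (Function.update ![0, v, w] 0 u)
  congr 1
  funext i
  fin_cases i <;> rfl

lemma formSlot_one (u v w : V) : h ![u, v, w] = formSlot h 1 ![u, 0, w] v := by
  change _ = h (Function.update ![u, 0, w] 1 v)
  congr 1
  funext i
  fin_cases i <;> rfl

lemma formSlot_two (u v w : V) : h ![u, v, w] = formSlot h 2 ![u, v, 0] w := by
  change _ = h (Function.update ![u, v, 0] 2 w)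
  congr 1
  funext i
  fin_cases i <;> rfl

lemma form_add_mid (u v v' w : V) : h ![u, v + v', w] = h ![u, v, w] + h ![u, v', w] := by
  simp only [formSlot_one h, map_add]

lemma form_add_right (u v w w' : V) : h ![u, v, w + w'] = h ![u, v, w] + h ![u, v, w'] := by
  simp only [formSlot_two h, map_add]

end Slots

section Integrability

variable {n : ℕ} {M : Type*} [TopologicalSpace M] [ChartedSpace (EuclideanSpace ℝ (Fin n)) M]
  [IsManifold (𝓡 n) ∞ M]
  (g : Bundle.ContMDiffRiemannianMetric (𝓡 n) ∞ (EuclideanSpace ℝ (Fin n))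
    (fun x : M => TangentSpace (𝓡 n) x))
  (H : ∀ x : M, TangentSpace (𝓡 n) x [⋀^Fin 3]→L[ℝ] ℝ)
  (O : ∀ x : M, TangentSpace (𝓡 n) x →L[ℝ] TangentSpace (𝓡 n) x)
  {x₁ : M} (hO : IsSmoothEnd O)
  (hOg : ∀ (x : M) (u v : TangentSpace (𝓡 n) x), g.inner x (O x u) (O x v) = g.inner x u v)
  (hD : IsDirac H (graph g O))

lemma memCoord_graph {p : EuclideanSpace ℝ (Fin n)}
    (hp : p ∈ (extChartAt (𝓡 n) x₁).target) (a : EuclideanSpace ℝ (Fin n)) :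
    MemCoord (graph g O) x₁ p (graphVec O x₁ a p) (graphForm g O x₁ a p) := by
  have hOf : frameAt (𝓡 n) x₁ p (endForm O x₁ p a)
      = O ((extChartAt (𝓡 n) x₁).symm p) (frameAt (𝓡 n) x₁ p a) := frameAt_coframe _ _ hp _
  refine ⟨frameAt (𝓡 n) x₁ p a, Prod.ext ?_ ?_⟩
  · change frameAt (𝓡 n) x₁ p a - O _ (frameAt (𝓡 n) x₁ p a)
      = frameAt (𝓡 n) x₁ p (a - endForm O x₁ p a)
    rw [map_sub, hOf]
  · refine ContinuousLinearMap.ext fun w => ?_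
    change g.inner _ (frameAt (𝓡 n) x₁ p a + O _ (frameAt (𝓡 n) x₁ p a)) w
      = metricForm g x₁ p (a + endForm O x₁ p a) (coframe (𝓡 n) x₁ _ w)
    rw [metricForm_apply, frameAt_coframe _ _ hp, map_add (frameAt (𝓡 n) x₁ p), hOf]

lemma exists_of_memCoord_graph {p v : EuclideanSpace ℝ (Fin n)}
    {η : EuclideanSpace ℝ (Fin n) →L[ℝ] ℝ}
    (hp : p ∈ (extChartAt (𝓡 n) x₁).target) (h : MemCoord (graph g O) x₁ p v η) :
    ∃ c, v = graphVec O x₁ c p ∧ η = graphForm g O x₁ c p := by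
  obtain ⟨c, hc⟩ := h
  have h1 : c - O _ c = frameAt (𝓡 n) x₁ p v := congrArg Prod.fst hc
  have h2 := congrArg Prod.snd hc
  have hcf : frameAt (𝓡 n) x₁ p (coframe (𝓡 n) x₁ _ c) = c := frameAt_coframe _ _ hp _
  have hOc : endForm O x₁ p (coframe (𝓡 n) x₁ _ c) = coframe (𝓡 n) x₁ _ (O _ c) := by
    simp only [endForm, ContinuousLinearMap.comp_apply, hcf]
  refine ⟨coframe (𝓡 n) x₁ _ c, ?_, ?_⟩
  · rw [graphVec, hOc, ← map_sub, h1, coframe_frameAt _ _ hp]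
  · refine ContinuousLinearMap.ext fun w => ?_
    have h3 : g.inner _ (c + O _ c) (frameAt (𝓡 n) x₁ p w)
        = η (coframe (𝓡 n) x₁ _ (frameAt (𝓡 n) x₁ p w)) := DFunLike.congr_fun h2 _
    rw [coframe_frameAt _ _ hp] at h3
    rw [← h3, graphForm, metricForm_apply, hOc, ← map_add, frameAt_coframe _ _ hp]

include hO hD in
/-- The Courant bracket of two sections of the graph is a section of the graph. -/
lemma exists_bracket_eq {p : EuclideanSpace ℝ (Fin n)}
    (hp : p ∈ (extChartAt (𝓡 n) x₁).target) (a b : EuclideanSpace ℝ (Fin n)) :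
    ∃ c, VectorField.lieBracket ℝ (graphVec O x₁ a) (graphVec O x₁ b) p = graphVec O x₁ c p ∧
      courantForm (formCoord H x₁) (graphVec O x₁ a) (graphForm g O x₁ a) (graphVec O x₁ b)
        (graphForm g O x₁ b) p = graphForm g O x₁ c p := by
  have hv : ∀ a, ContDiffOn ℝ ∞ (graphVec O x₁ a) (extChartAt (𝓡 n) x₁).target := fun a =>
    contDiffOn_const.sub ((contDiffOn_endForm O hO).clm_apply contDiffOn_const)
  have hf : ∀ a, ContDiffOn ℝ ∞ (graphForm g O x₁ a) (extChartAt (𝓡 n) x₁).target := fun a =>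
    (contDiffOn_metricForm g).clm_apply
      (contDiffOn_const.add ((contDiffOn_endForm O hO).clm_apply contDiffOn_const))
  exact exists_of_memCoord_graph g O hp (hD.involutive x₁ _ (isOpen_extChartAt_target x₁)
    subset_rfl _ _ _ _ (hv a) (hf a) (hv b) (hf b) (fun q hq => memCoord_graph g O hq a)
    (fun q hq => memCoord_graph g O hq b) p hp)

include hO hOg hD in
/-- The integrability condition on `O`: the cyclic sum of `g(O⁻¹ ∇_{(id - O) a}(O) b, c)` is
`½ H((id - O) a, (id - O) b, (id - O) c)`. -/
lemma integrability {p : EuclideanSpace ℝ (Fin n)}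
    (hp : p ∈ (extChartAt (𝓡 n) x₁).target) (a b c : EuclideanSpace ℝ (Fin n)) :
    metricForm g x₁ p (nablaEndMap g O x₁ p (graphVec O x₁ a p) b) (endForm O x₁ p c)
      + metricForm g x₁ p (nablaEndMap g O x₁ p (graphVec O x₁ b p) c) (endForm O x₁ p a)
      + metricForm g x₁ p (nablaEndMap g O x₁ p (graphVec O x₁ c p) a) (endForm O x₁ p b)
      = (1 / 2) * formCoord H x₁ p ![graphVec O x₁ a p, graphVec O x₁ b p, graphVec O x₁ c p] := by
  obtain ⟨e, he1, he2⟩ := exists_bracket_eq g H O hO hD hp a b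
  have h1 := courantForm_graph g H O hO hOg hp a b (graphVec O x₁ c p)
  -- The sum of the two parts of the bracket is `2 e`, where `e` are its components; paired with
  -- `(id - O) c` it can be written in terms of the vector part `(id - O) e` alone.
  have h2 : metricForm g x₁ p (graphVec O x₁ e p) (graphVec O x₁ c p)
      + graphForm g O x₁ e p (graphVec O x₁ c p)
      + 2 * metricForm g x₁ p (graphVec O x₁ e p) (endForm O x₁ p c) = 0 := by
    have := metricForm_endForm g O hOg hp e c
    simp only [graphVec, graphForm, map_add, map_sub, add_apply, sub_apply]
    linarith
  rw [he2] at h1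
  rw [← he1] at h2
  have hΓ : metricForm g x₁ p (christoffelMap g x₁ p (graphVec O x₁ a p) (graphVec O x₁ b p))
      = metricForm g x₁ p (christoffelMap g x₁ p (graphVec O x₁ b p) (graphVec O x₁ a p)) := by
    rw [christoffelMap_symm g hp]
  have hΓ' := DFunLike.congr_fun hΓ (endForm O x₁ p c)
  have hV : metricForm g x₁ p (VectorField.lieBracket ℝ (graphVec O x₁ a) (graphVec O x₁ b) p)
      (endForm O x₁ p c) =
      metricForm g x₁ p (nablaEndMap g O x₁ p (graphVec O x₁ b p) a) (endForm O x₁ p c)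
      - metricForm g x₁ p (christoffelMap g x₁ p (graphVec O x₁ b p) (endForm O x₁ p a))
        (endForm O x₁ p c)
      + metricForm g x₁ p (christoffelMap g x₁ p (graphVec O x₁ b p) a) c
      - (metricForm g x₁ p (nablaEndMap g O x₁ p (graphVec O x₁ a p) b) (endForm O x₁ p c)
      - metricForm g x₁ p (christoffelMap g x₁ p (graphVec O x₁ a p) (endForm O x₁ p b))
        (endForm O x₁ p c)
      + metricForm g x₁ p (christoffelMap g x₁ p (graphVec O x₁ a p) b) c) := by
    rw [lieBracket_graphVec O hO hp]
    simp only [fderiv_endForm g O, map_add, map_sub, add_apply, sub_apply,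
      metricForm_endForm g O hOg hp]
  have a1 := metricForm_nablaEndMap g O hO hOg hp (graphVec O x₁ c p) a b
  have a2 := metricForm_nablaEndMap g O hO hOg hp (graphVec O x₁ b p) a c
  rw [metricForm_symm g p (endForm O x₁ p a)] at a1 a2
  rw [metricForm_symm g p (endForm O x₁ p a), metricForm_symm g p (endForm O x₁ p b),
    christoffelMap_symm g hp b, christoffelMap_symm g hp a] at h1
  have hH : formCoord H x₁ p ![graphVec O x₁ c p, graphVec O x₁ a p, graphVec O x₁ b p]
      = formCoord H x₁ p ![graphVec O x₁ a p, graphVec O x₁ b p, graphVec O x₁ c p] := by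
    rw [alternating_swap_left, alternating_swap_right, neg_neg]
  rw [hH] at h1
  clear hH he1 he2 hΓ
  have s1 : ∀ u, metricForm g x₁ p (christoffelMap g x₁ p u (graphVec O x₁ a p)) (endForm O x₁ p c)
      = metricForm g x₁ p (christoffelMap g x₁ p u a) (endForm O x₁ p c)
      - metricForm g x₁ p (christoffelMap g x₁ p u (endForm O x₁ p a)) (endForm O x₁ p c) := by
    intro u; rw [graphVec, christoffelMap_sub_right, map_sub, sub_apply]
  have s2 : ∀ u, metricForm g x₁ p (christoffelMap g x₁ p u (graphVec O x₁ b p)) (endForm O x₁ p c)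
      = metricForm g x₁ p (christoffelMap g x₁ p u b) (endForm O x₁ p c)
      - metricForm g x₁ p (christoffelMap g x₁ p u (endForm O x₁ p b)) (endForm O x₁ p c) := by
    intro u; rw [graphVec, christoffelMap_sub_right, map_sub, sub_apply]
  have s3 : ∀ u, metricForm g x₁ p u (graphVec O x₁ c p)
      = metricForm g x₁ p u c - metricForm g x₁ p u (endForm O x₁ p c) := by
    intro u; rw [graphVec, map_sub]
  rw [s1, s2] at hΓ'
  rw [map_sub, sub_apply, s3 (christoffelMap g x₁ p _ _), s3 (christoffelMap g x₁ p _ _)] at h1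
  linarith

include hO in
lemma nablaEndCoord_eq {p : EuclideanSpace ℝ (Fin n)}
    (hp : p ∈ (extChartAt (𝓡 n) x₁).target) (l m k : Fin n) :
    nablaEndCoord g O x₁ p l m k = nablaEndMap g O x₁ p (EuclideanSpace.single l 1)
      (EuclideanSpace.single k 1) m := by
  rw [← sum_nablaEndCoord g O hO hp]
  simp

include hO in
lemma nablaEndMap_eq_sum {p : EuclideanSpace ℝ (Fin n)}
    (hp : p ∈ (extChartAt (𝓡 n) x₁).target) (z u : EuclideanSpace ℝ (Fin n)) :
    nablaEndMap g O x₁ p z u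
      = ∑ l, z l • nablaEndMap g O x₁ p (EuclideanSpace.single l 1) u := by
  ext m
  simp only [WithLp.ofLp_sum, WithLp.ofLp_smul, Finset.sum_apply, Pi.smul_apply,
    ← sum_nablaEndCoord g O hO hp, smul_eq_mul, Finset.mul_sum]
  refine Finset.sum_congr rfl fun l _ => ?_
  simp [mul_assoc]

include hO hOg hD in
/-- The coefficients of the bracket of two coordinate sections are the structure functions. -/
lemma structureFun_eq {p : EuclideanSpace ℝ (Fin n)}
    (hp : p ∈ (extChartAt (𝓡 n) x₁).target) (j k : Fin n) {c : EuclideanSpace ℝ (Fin n)}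
    (hc : VectorField.lieBracket ℝ (graphVec O x₁ (EuclideanSpace.single j 1))
      (graphVec O x₁ (EuclideanSpace.single k 1)) p = graphVec O x₁ c p)
    (hc' : courantForm (formCoord H x₁) (graphVec O x₁ (EuclideanSpace.single j 1))
      (graphForm g O x₁ (EuclideanSpace.single j 1)) (graphVec O x₁ (EuclideanSpace.single k 1))
      (graphForm g O x₁ (EuclideanSpace.single k 1)) p = graphForm g O x₁ c p) :
    c = WithLp.toLp 2 fun i => structureFun g H O x₁ p i j k := by
  set a : EuclideanSpace ℝ (Fin n) := EuclideanSpace.single j 1 with ha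
  set b : EuclideanSpace ℝ (Fin n) := EuclideanSpace.single k 1 with hb
  have hA : ∀ l i, (1 - endCoord O x₁ p) l i = graphVec O x₁ (EuclideanSpace.single i 1) p l := by
    intro l i; rw [← secVec_eq_graphVec]; rfl
  have hX1 : ∀ i j k : Fin n, ∑ l, (1 - endCoord O x₁ p) l j * christoffel g x₁ p i k l
      = christoffelMap g x₁ p (EuclideanSpace.single k 1)
        (graphVec O x₁ (EuclideanSpace.single j 1) p) i := by
    intro i j k
    simp [christoffelMap, hA, mul_comm]
  -- The second and the third term of the structure functions, with the index `l` not yet raised.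
  let c2 : Fin n → ℝ := fun l => (1 / 2) *
    (metricForm g x₁ p (endForm O x₁ p a) (nablaEndMap g O x₁ p (EuclideanSpace.single l 1) b)
      - metricForm g x₁ p (endForm O x₁ p b) (nablaEndMap g O x₁ p (EuclideanSpace.single l 1) a))
  have hc2 : ∀ l, c2 l = ∑ m, ∑ q, metricCoord g x₁ p m q *
      ((1 / 2) * (endCoord O x₁ p q j * nablaEndCoord g O x₁ p l m k
        - endCoord O x₁ p q k * nablaEndCoord g O x₁ p l m j)) := by
    intro l
    simp only [c2]
    rw [metricForm_symm, metricForm_symm g p (endForm O x₁ p b), apply₂_eq_sum, apply₂_eq_sum,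
      ← Finset.sum_sub_distrib, Finset.mul_sum]
    refine Finset.sum_congr rfl fun m _ => ?_
    rw [← Finset.sum_sub_distrib, Finset.mul_sum]
    refine Finset.sum_congr rfl fun q _ => ?_
    rw [nablaEndCoord_eq g O hO hp, nablaEndCoord_eq g O hO hp, endCoord_eq, endCoord_eq,
      metricCoord_eq]
    ring
  let c3 : Fin n → ℝ := fun l => (1 / 2) *
    formCoord H x₁ p ![EuclideanSpace.single l 1, graphVec O x₁ a p, graphVec O x₁ b p]
  have hc3 : ∀ l, c3 l = (1 / 2) * ∑ m, ∑ q, formComp H x₁ p l m q *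
      (1 - endCoord O x₁ p) m j * (1 - endCoord O x₁ p) q k := by
    intro l
    simp only [c3]
    congr 1
    rw [formSlot_one, apply_eq_sum]
    refine Finset.sum_congr rfl fun m _ => ?_
    rw [← formSlot_one, formSlot_two, apply_eq_sum, Finset.smul_sum]
    refine Finset.sum_congr rfl fun q _ => ?_
    rw [← formSlot_two, hA, hA, formComp]
    simp only [smul_eq_mul]
    ring
  have hS : (WithLp.toLp 2 fun i => structureFun g H O x₁ p i j k) =
      christoffelMap g x₁ p b (graphVec O x₁ a p) - christoffelMap g x₁ p a (graphVec O x₁ b p)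
      + (WithLp.toLp 2 fun i => ∑ l, (metricCoord g x₁ p)⁻¹ i l * c2 l)
      + (WithLp.toLp 2 fun i => ∑ l, (metricCoord g x₁ p)⁻¹ i l * c3 l) := by
    ext i
    simp only [WithLp.ofLp_add, WithLp.ofLp_sub, Pi.add_apply, Pi.sub_apply, hc2, hc3,
      structureFun, Finset.sum_sub_distrib, hX1]
    congr 1
    · congr 1
      refine Finset.sum_congr rfl fun l _ => ?_
      rw [Finset.mul_sum]
      refine Finset.sum_congr rfl fun m _ => ?_
      rw [Finset.mul_sum]
      refine Finset.sum_congr rfl fun q _ => ?_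
      ring
    · rw [Finset.mul_sum]
      refine Finset.sum_congr rfl fun l _ => ?_
      simp only [Finset.mul_sum]
      refine Finset.sum_congr rfl fun m _ => Finset.sum_congr rfl fun q _ => ?_
      ring
  -- The two parts of a section with components `c` add up to `2 c`, which the metric detects.
  refine eq_of_metricForm_eq g hp fun z => ?_
  have h2 := courantForm_graph g H O hO hOg hp a b z
  have h3 : metricForm g x₁ p (graphVec O x₁ c p) z + graphForm g O x₁ c p z
      = 2 * metricForm g x₁ p c z := by
    simp only [graphVec, graphForm, map_add, map_sub, add_apply, sub_apply]
    ring
  rw [hc, hc', h3] at h2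
  have e2 : ∑ l, c2 l * z l = (1 / 2) * (metricForm g x₁ p (endForm O x₁ p a)
      (nablaEndMap g O x₁ p z b) - metricForm g x₁ p (endForm O x₁ p b)
        (nablaEndMap g O x₁ p z a)) := by
    rw [nablaEndMap_eq_sum g O hO hp z, nablaEndMap_eq_sum g O hO hp z]
    simp only [map_sum, map_smul, ← Finset.sum_sub_distrib, Finset.mul_sum, c2, smul_eq_mul]
    refine Finset.sum_congr rfl fun l _ => ?_
    ring
  have e3 : ∑ l, c3 l * z l
      = (1 / 2) * formCoord H x₁ p ![z, graphVec O x₁ a p, graphVec O x₁ b p] := by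
    rw [formSlot_zero, apply_eq_sum _ z, Finset.mul_sum]
    refine Finset.sum_congr rfl fun l _ => ?_
    rw [← formSlot_zero]
    simp only [c3, smul_eq_mul]
    ring
  rw [hS, map_add (metricForm g x₁ p), map_add (metricForm g x₁ p), add_apply, add_apply,
    metricForm_inv g hp, metricForm_inv g hp, e2, e3]
  linarith

include hO hOg hD in
/-- The coordinate sections of the graph close under the Courant bracket, with the structure
functions as coefficients. -/
lemma bracket_eq_structureFun {p : EuclideanSpace ℝ (Fin n)}
    (hp : p ∈ (extChartAt (𝓡 n) x₁).target) (j k : Fin n) :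
    VectorField.lieBracket ℝ (secVec O x₁ j) (secVec O x₁ k) p
        = ∑ i, structureFun g H O x₁ p i j k • secVec O x₁ i p ∧
      courantForm (formCoord H x₁) (secVec O x₁ j) (secForm g O x₁ j)
          (secVec O x₁ k) (secForm g O x₁ k) p
        = ∑ i, structureFun g H O x₁ p i j k • secForm g O x₁ i p := by
  obtain ⟨c, h1, h2⟩ := exists_bracket_eq g H O hO hD hp (EuclideanSpace.single j 1)
    (EuclideanSpace.single k 1)
  have hc := structureFun_eq g H O hO hOg hD hp j k h1 h2
  simp only [secVec_eq_graphVec, secForm_eq_graphForm]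
  have hci : ∀ i, structureFun g H O x₁ p i j k = c i := fun i => by rw [hc]
  simp only [hci]
  rw [h1, h2]
  constructor
  · conv_lhs => rw [graphVec, apply_eq_sum (endForm O x₁ p) c, sum_smul_single c]
    simp only [graphVec, smul_sub, Finset.sum_sub_distrib]
    simp [Pi.single_apply]
  · have : c + endForm O x₁ p c = ∑ i, c i • (EuclideanSpace.single i (1 : ℝ)
        + endForm O x₁ p (EuclideanSpace.single i 1)) := by
      simp only [smul_add, Finset.sum_add_distrib]
      rw [← sum_smul_single c, ← apply_eq_sum]
    rw [graphForm, this]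
    simp only [graphForm, map_sum, map_smul]

end Integrability

/-! ### Linear algebra of the Lorentzian world sheet -/

section WorldSheet

instance {d : ℕ} {B : Type*} [TopologicalSpace B]
    (I : ModelWithCorners ℝ (EuclideanSpace ℝ (Fin d)) B) {Q : Type*} [TopologicalSpace Q]
    [ChartedSpace B Q] (x : Q) : T2Space (TangentSpace I x) :=
  inferInstanceAs (T2Space (EuclideanSpace ℝ (Fin d)))

variable {S : Type*} [TopologicalSpace S] [ChartedSpace (EuclideanSpace ℝ (Fin 2)) S]
  (L : LorentzianSurface S)

lemma LorentzianSurface.area_swap (σ : S) (u v : TangentSpace (𝓡 2) σ) :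
    L.area σ u v = -L.area σ v u := by
  have h := L.area_self σ (u + v)
  rw [map_add, map_add, add_apply, add_apply, L.area_self, L.area_self] at h
  linarith

lemma basis_expand {V : Type*} [AddCommGroup V] [Module ℝ V] (f : Module.Basis (Fin 2) ℝ V)
    (u : V) : ∃ x y : ℝ, u = x • f 0 + y • f 1 :=
  ⟨f.repr u 0, f.repr u 1, by rw [← Fin.sum_univ_two (fun i => f.repr u i • f i), f.sum_repr]⟩

/-- The area form does not vanish: otherwise the Gram determinant of the metric would be zero, and
the metric semi-definite, against the presence of vectors of both signs. -/
lemma LorentzianSurface.area_ne_zero {σ : S} (f : Module.Basis (Fin 2) ℝ (TangentSpace (𝓡 2) σ)) :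
    L.area σ (f 0) (f 1) ≠ 0 := by
  intro h0
  have h1 := L.area_sq σ (f 0) (f 1)
  obtain ⟨u, hu⟩ := L.exists_neg σ
  obtain ⟨w, hw⟩ := L.exists_pos σ
  have hq : ∀ x y : ℝ, L.metric σ (x • f 0 + y • f 1) (x • f 0 + y • f 1)
      = L.metric σ (f 0) (f 0) * x ^ 2 + 2 * L.metric σ (f 0) (f 1) * x * y
        + L.metric σ (f 1) (f 1) * y ^ 2 := by
    intro x y
    simp only [map_add, map_smul, add_apply, smul_apply, smul_eq_mul, L.symm σ (f 1) (f 0)]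
    ring
  obtain ⟨x, y, rfl⟩ := basis_expand f u
  obtain ⟨x', y', rfl⟩ := basis_expand f w
  rw [hq] at hu hw
  rw [h0] at h1
  generalize L.metric σ (f 0) (f 0) = a at *
  generalize L.metric σ (f 0) (f 1) = b at *
  generalize L.metric σ (f 1) (f 1) = c at *
  have hb : b ^ 2 = a * c := by linarith
  have key : ∀ x y : ℝ, 0 ≤ a * (a * x ^ 2 + 2 * b * x * y + c * y ^ 2) ∧
      0 ≤ c * (a * x ^ 2 + 2 * b * x * y + c * y ^ 2) := by
    intro x y
    constructor
    · have : a * (a * x ^ 2 + 2 * b * x * y + c * y ^ 2) = (a * x + b * y) ^ 2 := by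
        linear_combination -y ^ 2 * hb
      rw [this]; positivity
    · have : c * (a * x ^ 2 + 2 * b * x * y + c * y ^ 2) = (b * x + c * y) ^ 2 := by
        linear_combination -x ^ 2 * hb
      rw [this]; positivity
  have ha : a = 0 := le_antisymm (nonpos_of_mul_nonneg_left (key x y).1 hu)
    (nonneg_of_mul_nonneg_left (key x' y').1 hw)
  have hc : c = 0 := le_antisymm (nonpos_of_mul_nonneg_left (key x y).2 hu)
    (nonneg_of_mul_nonneg_left (key x' y').2 hw)
  have hb' : b = 0 := by
    rw [ha, zero_mul] at hb; exact pow_eq_zero_iff (two_ne_zero) |>.1 hb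
  rw [ha, hb', hc] at hu
  simp at hu

variable [IsManifold (𝓡 2) ∞ S]

/-- The inverse in the definition of the Hodge operator is not a junk value: the metric is
non-degenerate. -/
lemma LorentzianSurface.inverse_metric (σ : S) (u : TangentSpace (𝓡 2) σ) :
    (L.metric σ).inverse (L.metric σ u) = u := by
  set f := basisVecBasis (𝓡 2) σ
  have hω := L.area_ne_zero f
  have h1 := L.area_sq σ (f 0) (f 1)
  have hD : L.metric σ (f 0) (f 1) ^ 2 - L.metric σ (f 0) (f 0) * L.metric σ (f 1) (f 1) ≠ 0 := by
    rw [← h1]; exact pow_ne_zero 2 hω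
  have hext : ∀ φ ψ : TangentSpace (𝓡 2) σ →L[ℝ] ℝ, φ (f 0) = ψ (f 0) → φ (f 1) = ψ (f 1) →
      φ = ψ := by
    intro φ ψ h0 h1
    refine ContinuousLinearMap.ext fun w => ?_
    obtain ⟨x, y, rfl⟩ := basis_expand f w
    simp only [map_add, map_smul, h0, h1]
  have hinj : Function.Injective (L.metric σ) := by
    intro u w h
    rw [← sub_eq_zero] at h ⊢
    rw [← map_sub] at h
    obtain ⟨x, y, hxy⟩ := basis_expand f (u - w)
    rw [hxy] at h ⊢
    have e0 := DFunLike.congr_fun h (f 0)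
    have e1 := DFunLike.congr_fun h (f 1)
    simp only [map_add, map_smul, add_apply, smul_apply, smul_eq_mul, L.symm σ (f 1) (f 0),
      zero_apply] at e0 e1
    have hx : x = 0 := by
      refine (mul_eq_zero.1 (?_ : x * _ = 0)).resolve_right hD
      linear_combination L.metric σ (f 0) (f 1) * e1 - L.metric σ (f 1) (f 1) * e0
    have hy : y = 0 := by
      refine (mul_eq_zero.1 (?_ : y * _ = 0)).resolve_right hD
      linear_combination L.metric σ (f 0) (f 1) * e0 - L.metric σ (f 0) (f 0) * e1
    rw [hx, hy]; simp
  have hsurj : Function.Surjective (L.metric σ) := by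
    intro φ
    generalize hD' : L.metric σ (f 0) (f 1) ^ 2
      - L.metric σ (f 0) (f 0) * L.metric σ (f 1) (f 1) = D at hD
    refine ⟨D⁻¹ • ((L.metric σ (f 0) (f 1) * φ (f 1) - L.metric σ (f 1) (f 1) * φ (f 0)) • f 0
      + (L.metric σ (f 0) (f 1) * φ (f 0) - L.metric σ (f 0) (f 0) * φ (f 1)) • f 1),
      hext _ _ ?_ ?_⟩
    · simp only [map_add, map_smul, add_apply, smul_apply, smul_eq_mul, L.symm σ (f 1) (f 0)]
      field_simp
      rw [← hD']; ring
    · simp only [map_add, map_smul, add_apply, smul_apply, smul_eq_mul]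
      field_simp
      rw [← hD']; ring
  let e := (LinearEquiv.ofBijective (L.metric σ).toLinearMap ⟨hinj, hsurj⟩).toContinuousLinearEquiv
  have he : L.metric σ = e := ContinuousLinearMap.ext fun w => rfl
  rw [he, ContinuousLinearMap.inverse_equiv]
  exact e.symm_apply_apply u

/-- The matrix of `J` in a frame. -/
lemma LorentzianSurface.rot_basis {σ : S} (f : Module.Basis (Fin 2) ℝ (TangentSpace (𝓡 2) σ)) :
    L.rot σ (f 0) = (-(L.metric σ (f 0) (f 1)) / L.area σ (f 0) (f 1)) • f 0
      + (L.metric σ (f 0) (f 0) / L.area σ (f 0) (f 1)) • f 1 ∧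
    L.rot σ (f 1) = (-(L.metric σ (f 1) (f 1)) / L.area σ (f 0) (f 1)) • f 0
      + (L.metric σ (f 0) (f 1) / L.area σ (f 0) (f 1)) • f 1 := by
  have hω := L.area_ne_zero f
  have h1 := L.area_sq σ (f 0) (f 1)
  have hext : ∀ φ ψ : TangentSpace (𝓡 2) σ →L[ℝ] ℝ, φ (f 0) = ψ (f 0) → φ (f 1) = ψ (f 1) →
      φ = ψ := by
    intro φ ψ h0 h1
    refine ContinuousLinearMap.ext fun w => ?_
    obtain ⟨x, y, rfl⟩ := basis_expand f w
    simp only [map_add, map_smul, h0, h1]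
  have key : ∀ v r : TangentSpace (𝓡 2) σ, L.metric σ r (f 0) = -L.area σ v (f 0) →
      L.metric σ r (f 1) = -L.area σ v (f 1) → L.rot σ v = r := by
    intro v r h0 h1
    have : L.area σ v = L.metric σ (-r) := by
      refine hext _ _ ?_ ?_
      · rw [map_neg, neg_apply, h0, neg_neg]
      · rw [map_neg, neg_apply, h1, neg_neg]
    rw [LorentzianSurface.rot, this, L.inverse_metric, neg_neg]
  constructor
  · refine key _ _ ?_ ?_
    · simp only [map_add, map_smul, add_apply, smul_apply, smul_eq_mul, L.symm σ (f 1) (f 0),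
        L.area_self]
      field_simp
      ring
    · simp only [map_add, map_smul, add_apply, smul_apply, smul_eq_mul]
      field_simp
      rw [h1]; ring
  · refine key _ _ ?_ ?_
    · simp only [map_add, map_smul, add_apply, smul_apply, smul_eq_mul, L.symm σ (f 1) (f 0),
        L.area_swap σ (f 1) (f 0)]
      field_simp
      rw [h1]; ring
    · simp only [map_add, map_smul, add_apply, smul_apply, smul_eq_mul,
        L.area_self]
      field_simp
      ring

lemma LorentzianSurface.rot_add (σ : S) (u v : TangentSpace (𝓡 2) σ) :
    L.rot σ (u + v) = L.rot σ u + L.rot σ v := by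
  simp only [LorentzianSurface.rot, map_add, neg_add]

lemma LorentzianSurface.rot_smul (σ : S) (c : ℝ) (u : TangentSpace (𝓡 2) σ) :
    L.rot σ (c • u) = c • L.rot σ u := by
  simp only [LorentzianSurface.rot, map_smul, smul_neg]

/-- `∗² = 1`. -/
lemma LorentzianSurface.rot_rot (σ : S) (u : TangentSpace (𝓡 2) σ) :
    L.rot σ (L.rot σ u) = u := by
  set f := basisVecBasis (𝓡 2) σ
  have hω := L.area_ne_zero f
  have h1 := L.area_sq σ (f 0) (f 1)
  obtain ⟨h2, h3⟩ := L.rot_basis f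
  have e0 : L.rot σ (L.rot σ (f 0)) = f 0 := by
    conv_lhs => rw [h2]
    rw [L.rot_add, L.rot_smul, L.rot_smul, h2, h3]
    match_scalars
    · field_simp
      rw [h1]; ring
    · field_simp
      ring
  have e1 : L.rot σ (L.rot σ (f 1)) = f 1 := by
    conv_lhs => rw [h3]
    rw [L.rot_add, L.rot_smul, L.rot_smul, h2, h3]
    match_scalars
    · field_simp
      ring
    · field_simp
      rw [h1]; ring
  obtain ⟨x, y, rfl⟩ := basis_expand f u
  simp only [L.rot_add, L.rot_smul, e0, e1]

end WorldSheet

/-! ### The operator `Θ` -/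

section Theta

variable {n : ℕ} {M : Type*} [TopologicalSpace M] [ChartedSpace (EuclideanSpace ℝ (Fin n)) M]
  [IsManifold (𝓡 n) ∞ M]
  (g : Bundle.ContMDiffRiemannianMetric (𝓡 n) ∞ (EuclideanSpace ℝ (Fin n))
    (fun x : M => TangentSpace (𝓡 n) x))
  (O : ∀ x : M, TangentSpace (𝓡 n) x →L[ℝ] TangentSpace (𝓡 n) x)
  (hOg : ∀ (x : M) (u v : TangentSpace (𝓡 n) x), g.inner x (O x u) (O x v) = g.inner x u v)

include hOg in
/-- An orthogonal endomorphism of a finite-dimensional space is invertible. -/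
lemma end_inverse (x : M) (u : TangentSpace (𝓡 n) x) :
    (O x).inverse (O x u) = u ∧ O x ((O x).inverse u) = u := by
  have hinj : Function.Injective (O x).toLinearMap := by
    rw [← LinearMap.ker_eq_bot, LinearMap.ker_eq_bot']
    intro w hw
    by_contra hne
    have h1 := g.pos x w hne
    have h2 := hOg x w w
    have h3 : O x w = 0 := hw
    rw [h3, map_zero] at h2
    exact h1.ne h2
  let e := (LinearEquiv.ofInjectiveEndo (O x).toLinearMap hinj).toContinuousLinearEquiv
  have he : O x = e := ContinuousLinearMap.ext fun w => rfl
  rw [he, ContinuousLinearMap.inverse_equiv]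
  exact ⟨e.symm_apply_apply u, e.apply_symm_apply u⟩

variable {S : Type*} [TopologicalSpace S] [ChartedSpace (EuclideanSpace ℝ (Fin 2)) S]
  [IsManifold (𝓡 2) ∞ S] (L : LorentzianSurface S)

include hOg in
lemma opT_opTheta (σ : S) (x : M) (β : TangentSpace (𝓡 2) σ → TangentSpace (𝓡 n) x) :
    opT L O σ x (opTheta L O σ x β) = β := by
  funext v
  simp only [opT, opTheta, LorentzianSurface.star, L.rot_rot, map_add, map_smul, map_sub,
    (end_inverse g O hOg x _).2]
  match_scalars <;> norm_num

include hOg in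
lemma opTheta_opT (σ : S) (x : M) (β : TangentSpace (𝓡 2) σ → TangentSpace (𝓡 n) x) :
    opTheta L O σ x (opT L O σ x β) = β := by
  funext v
  simp only [opT, opTheta, LorentzianSurface.star, L.rot_rot, map_add, map_sub,
    (end_inverse g O hOg x _).1]
  match_scalars <;> norm_num

end Theta

/-! ### The pointwise variation of the Lagrangian -/

section GaugeAlgebra

variable {V : Type*} [NormedAddCommGroup V] [NormedSpace ℝ V]
  (G : V →L[ℝ] V →L[ℝ] ℝ) (O : V →L[ℝ] V) (N : V →ₗ[ℝ] V →ₗ[ℝ] V)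
  (h : V [⋀^Fin 3]→L[ℝ] ℝ)

/-- The covariant variation of the local Lagrangian, rearranged so that the variation `d` of the
gauge field enters only through `(id + O) d + (id - O) ∗ d`, the combination that undoes `Θ`.
Indices `0`, `1` denote the components along the coordinate vectors of the world sheet, `α`, `β`,
`γ` are the coefficients of `∗`, `z` is `DX`, `a` the gauge field, `y` the variation of `dX`, and
`N e = ∇_e(O)` for the velocity `e` of `X`. -/
lemma lagrangian_variation (hG : ∀ u w, G u w = G w u) (hO : ∀ u w, G (O u) (O w) = G u w)
    (α β γ : ℝ) (z₀ z₁ a₀ a₁ e d₀ d₁ y₀ y₁ δz₀ δz₁ : V)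
    (hδ₀ : δz₀ = y₀ - (d₀ - (N e a₀ + O d₀))) (hδ₁ : δz₁ = y₁ - (d₁ - (N e a₁ + O d₁))) :
    (1 / 2) * ((G δz₀ (γ • z₀ - α • z₁) + G z₀ (γ • δz₀ - α • δz₁))
        - (G δz₁ (α • z₀ + β • z₁) + G z₁ (α • δz₀ + β • δz₁)))
      + ((G (d₀ + (N e a₀ + O d₀)) (z₁ + (a₁ - O a₁)) + G (a₀ + O a₀) y₁)
        - (G (d₁ + (N e a₁ + O d₁)) (z₀ + (a₀ - O a₀)) + G (a₁ + O a₁) y₀))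
      - (1 / 2) * ((G (d₀ + (N e a₀ + O d₀)) (a₁ - O a₁)
          + G (a₀ + O a₀) (d₁ - (N e a₁ + O d₁)))
        - (G (d₁ + (N e a₁ + O d₁)) (a₀ - O a₀) + G (a₁ + O a₁) (d₀ - (N e a₀ + O d₀))))
      = (G (d₀ + O d₀ + (α • d₀ + β • d₁) - O (α • d₀ + β • d₁)) z₁
          - G (d₁ + O d₁ + (γ • d₀ - α • d₁) - O (γ • d₀ - α • d₁)) z₀)
        + (G (N e a₀ - (α • N e a₀ + β • N e a₁)) z₁ - G (N e a₁ - (γ • N e a₀ - α • N e a₁)) z₀)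
        - (G (α • y₀ + β • y₁) z₁ - G (γ • y₀ - α • y₁) z₀)
        + (G (a₀ + O a₀) y₁ - G (a₁ + O a₁) y₀)
        + (G (O a₀) (N e a₁) - G (O a₁) (N e a₀)) := by
  have o1 := hO a₀ d₁
  have o2 := hO a₁ d₀
  subst hδ₀ hδ₁
  simp only [map_add, map_sub, map_smul, add_apply, sub_apply, smul_apply, smul_eq_mul]
  simp only [hG] at o1 o2 ⊢
  linear_combination (exp := 1) o1 - o2

set_option maxHeartbeats 1000000 in
/-- The pointwise content of gauge invariance. In the notation of `lagrangian_variation`, `O ζ` is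
`DX`, `x` is `dX`, `ε₀` and `ε₁` are the components of `∇ε`, `b` is the part of the variation of the
gauge field without `Θ`, `r` is dual to `H(DX, (id - O) ε, ·)`, and `q = H((id - O) ε, ·, ·)`.
The hypotheses are the symmetry of the metric, the orthogonality of `O`, the skew-symmetry of
`O⁻¹ ∇(O)`, and the integrability condition contracted with `ε`; the conclusion is that the
variation of the Lagrangian and `H(δX, dX, dX)` add up to the differential of
`g((id + O) ε, dX)`. -/
lemma gauge_identity (q : V →ₗ[ℝ] V →ₗ[ℝ] ℝ) (ε : V)
    (hG : ∀ u w, G u w = G w u) (hO : ∀ u w, G (O u) (O w) = G u w)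
    (hN : ∀ z u w, G (N z u) (O w) + G (O u) (N z w) = 0)
    (hq : ∀ u w, q u w = -q w u)
    (hC : ∀ a b, G (N (ε - O ε) a) (O b) + G (N (a - O a) b) (O ε) + G (N (b - O b) ε) (O a)
      = (1 / 2) * q (a - O a) (b - O b))
    (α β γ : ℝ) (ζ₀ ζ₁ a₀ a₁ d₀ d₁ b₀ b₁ r₀ r₁ x₀ x₁ ε₀ ε₁ y₀ y₁ : V)
    (hx₀ : x₀ = O ζ₀ + (a₀ - O a₀)) (hx₁ : x₁ = O ζ₁ + (a₁ - O a₁))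
    (hy₀ : y₀ = ε₀ - (N x₀ ε + O ε₀)) (hy₁ : y₁ = ε₁ - (N x₁ ε + O ε₁))
    (hb₀ : ∀ w, G b₀ w = G ε₀ w - G (N w a₀) (O ε) - (1 / 2) * q (a₀ - O a₀) w)
    (hb₁ : ∀ w, G b₁ w = G ε₁ w - G (N w a₁) (O ε) - (1 / 2) * q (a₁ - O a₁) w)
    (hr₀ : ∀ w, G r₀ w = -q (O ζ₀) w) (hr₁ : ∀ w, G r₁ w = -q (O ζ₁) w)
    (hd₀ : d₀ + O d₀ + (α • d₀ + β • d₁) - O (α • d₀ + β • d₁)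
      = b₀ + O b₀ + (α • b₀ + β • b₁) - O (α • b₀ + β • b₁)
        + ((1 / 2 : ℝ) • r₀ + (N (O ζ₀) ε - (α • N (O ζ₀) ε + β • N (O ζ₁) ε))))
    (hd₁ : d₁ + O d₁ + (γ • d₀ - α • d₁) - O (γ • d₀ - α • d₁)
      = b₁ + O b₁ + (γ • b₀ - α • b₁) - O (γ • b₀ - α • b₁)
        + ((1 / 2 : ℝ) • r₁ + (N (O ζ₁) ε - (γ • N (O ζ₀) ε - α • N (O ζ₁) ε)))) :
    (G (d₀ + O d₀ + (α • d₀ + β • d₁) - O (α • d₀ + β • d₁)) (O ζ₁)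
          - G (d₁ + O d₁ + (γ • d₀ - α • d₁) - O (γ • d₀ - α • d₁)) (O ζ₀))
        + (G (N (ε - O ε) a₀ - (α • N (ε - O ε) a₀ + β • N (ε - O ε) a₁)) (O ζ₁)
          - G (N (ε - O ε) a₁ - (γ • N (ε - O ε) a₀ - α • N (ε - O ε) a₁)) (O ζ₀))
        - (G (α • y₀ + β • y₁) (O ζ₁) - G (γ • y₀ - α • y₁) (O ζ₀))
        + (G (a₀ + O a₀) y₁ - G (a₁ + O a₁) y₀)
        + (G (O a₀) (N (ε - O ε) a₁) - G (O a₁) (N (ε - O ε) a₀))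
        + q x₀ x₁
      = G (ε₀ + (N x₀ ε + O ε₀)) x₁ - G (ε₁ + (N x₁ ε + O ε₁)) x₀ := by
  -- The instances `i0`, …, `i4` of integrability and `i5`, …, `i24` of skew-symmetry suffice: both
  -- sides are linear in the values of `G`, `N` and `q` on the vectors at hand, and the coefficients
  -- of the final combination solve the resulting linear system.
  have i0 := hC a₀ a₁
  have i1 := hC a₀ ζ₀
  have i2 := hC a₀ ζ₁
  have i3 := hC a₁ ζ₀
  have i4 := hC a₁ ζ₁
  have i5 := hN ε a₀ a₁
  have i6 := hN (O ε) a₀ a₁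
  have i7 := hN a₀ ε a₁
  have i8 := hN a₀ ε ζ₀
  have i9 := hN a₀ ε ζ₁
  have i10 := hN (O a₀) ε a₁
  have i11 := hN (O a₀) ε ζ₀
  have i12 := hN (O a₀) ε ζ₁
  have i13 := hN a₁ ε ζ₀
  have i14 := hN a₁ ε ζ₁
  have i15 := hN (O a₁) ε ζ₀
  have i16 := hN (O a₁) ε ζ₁
  have i17 := hN ζ₀ ε a₀
  have i18 := hN ζ₀ ε a₁
  have i19 := hN (O ζ₀) ε a₀
  have i20 := hN (O ζ₀) ε a₁
  have i21 := hN ζ₁ ε a₀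
  have i22 := hN ζ₁ ε a₁
  have i23 := hN (O ζ₁) ε a₀
  have i24 := hN (O ζ₁) ε a₁
  have hb₀' := hb₀ (O ζ₁)
  have hb₀'' := hb₀ ζ₁
  have hb₀s := hb₀ (O ζ₀)
  have hb₀t := hb₀ ζ₀
  have hb₁' := hb₁ (O ζ₀)
  have hb₁'' := hb₁ ζ₀
  have hb₁s := hb₁ (O ζ₁)
  have hb₁t := hb₁ ζ₁
  have k₀ := hr₀ (O ζ₁)
  have k₁ := hr₁ (O ζ₀)
  have q₁ := hq (O ζ₀) a₁
  have q₂ := hq (O ζ₀) (O a₁)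
  have q₃ := hq (O ζ₁) (O ζ₀)
  rw [hd₀, hd₁]
  subst hx₀ hx₁
  subst hy₀ hy₁
  clear hd₀ hd₁ hb₀ hb₁ hr₀ hr₁ hC
  simp only [map_add, map_sub, map_smul, add_apply, sub_apply, smul_apply, smul_eq_mul, hO,
    LinearMap.add_apply, LinearMap.sub_apply] at k₀ k₁ q₁ q₂ ⊢
  simp only [map_sub, LinearMap.sub_apply] at hb₀' hb₀'' hb₀s hb₀t hb₁' hb₁'' hb₁s hb₁t
  simp only [map_sub, sub_apply, LinearMap.sub_apply] at i0 i1 i2 i3 i4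
  simp only [hG] at i0 i1 i2 i3 i4 i5 i6 i7 i8 i9 i10 i11 i12 i13 i14 i15 i16 i17 i18
  simp only [hG] at i19 i20 i21 i22 i23 i24
  simp only [hG] at hb₀' hb₀'' hb₀s hb₀t hb₁' hb₁'' hb₁s hb₁t ⊢
  linear_combination (exp := 1) hb₀' + hb₀'' + α * (hb₀' - hb₀'') + β * (hb₁s - hb₁t) - hb₁' -
    hb₁'' - γ * (hb₀s - hb₀t) + α * (hb₁' - hb₁'') + (1 / 2) * k₀ - (1 / 2) * k₁ + q₁ - q₂ + (1 /
    2) * q₃ - 2 * i0 + γ * i1 + i2 - α * i2 - i3 - α * i3 - β * i4 + i5 - i6 + 2 * i7 - γ * i8 -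
    i9 + α * i9 - 2 * i10 + γ * i11 + i12 - α * i12 + i13 + α * i13 + β * i14 - i15 - α * i15 - β
    * i16 - γ * i17 + i18 + α * i18 + γ * i19 + i20 - α * i20 - i21 + α * i21 + β * i22 - i23 - α
    * i23 - β * i24

end GaugeAlgebra

/-! ### Covariant calculus along curves -/

section LocalLagrangian

variable {V : Type*} [NormedAddCommGroup V] [NormedSpace ℝ V]

/-- The coefficient of the Lagrangian 2-form, as a function of the metric `G`, the endomorphism
`O`, the coefficients `α, β, γ` of the Hodge operator and the components `yᵢ` of `dX` and `aᵢ` of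
the gauge field. -/
noncomputable def localLagrangian (G : V →L[ℝ] V →L[ℝ] ℝ) (O : V →L[ℝ] V) (α β γ : ℝ)
    (y₀ y₁ a₀ a₁ : V) : ℝ :=
  (1 / 2) * (G (y₀ - (a₀ - O a₀)) (γ • (y₀ - (a₀ - O a₀)) - α • (y₁ - (a₁ - O a₁)))
      - G (y₁ - (a₁ - O a₁)) (α • (y₀ - (a₀ - O a₀)) + β • (y₁ - (a₁ - O a₁))))
    + (G (a₀ + O a₀) y₁ - G (a₁ + O a₁) y₀)
    - (1 / 2) * (G (a₀ + O a₀) (a₁ - O a₁) - G (a₁ + O a₁) (a₀ - O a₀))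

end LocalLagrangian

section Covariant

variable {n : ℕ} {M : Type*} [TopologicalSpace M] [ChartedSpace (EuclideanSpace ℝ (Fin n)) M]
  [IsManifold (𝓡 n) ∞ M]
  (g : Bundle.ContMDiffRiemannianMetric (𝓡 n) ∞ (EuclideanSpace ℝ (Fin n))
    (fun x : M => TangentSpace (𝓡 n) x))
  (H : ∀ x : M, TangentSpace (𝓡 n) x [⋀^Fin 3]→L[ℝ] ℝ)
  (O : ∀ x : M, TangentSpace (𝓡 n) x →L[ℝ] TangentSpace (𝓡 n) x)
  {x₁ : M}

lemma christoffelMap_add_left {p : EuclideanSpace ℝ (Fin n)}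
    (hp : p ∈ (extChartAt (𝓡 n) x₁).target) (z z' u : EuclideanSpace ℝ (Fin n)) :
    christoffelMap g x₁ p (z + z') u = christoffelMap g x₁ p z u + christoffelMap g x₁ p z' u := by
  simp only [christoffelMap_symm g hp _ u, christoffelMap_add_right]

lemma christoffelMap_smul_left {p : EuclideanSpace ℝ (Fin n)}
    (hp : p ∈ (extChartAt (𝓡 n) x₁).target) (c : ℝ) (z u : EuclideanSpace ℝ (Fin n)) :
    christoffelMap g x₁ p (c • z) u = c • christoffelMap g x₁ p z u := by
  simp only [christoffelMap_symm g hp _ u, christoffelMap_smul_right]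

/-- The covariant derivative `(z, u) ↦ (∇_z O) u` as a bilinear map. -/
noncomputable def nablaEndBilin {p : EuclideanSpace ℝ (Fin n)}
    (hp : p ∈ (extChartAt (𝓡 n) x₁).target) :
    EuclideanSpace ℝ (Fin n) →ₗ[ℝ] EuclideanSpace ℝ (Fin n) →ₗ[ℝ] EuclideanSpace ℝ (Fin n) :=
  LinearMap.mk₂ ℝ (nablaEndMap g O x₁ p)
    (fun z z' u => by
      simp only [nablaEndMap, map_add, add_apply, christoffelMap_add_left g hp]; abel)
    (fun c z u => by
      simp only [nablaEndMap, map_smul, smul_apply, christoffelMap_smul_left g hp, smul_sub,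
        smul_add])
    (fun z u u' => by
      simp only [nablaEndMap, map_add, christoffelMap_add_right]; abel)
    (fun c z u => by
      simp only [nablaEndMap, map_smul, christoffelMap_smul_right, smul_sub, smul_add])

lemma nablaEndBilin_apply {p : EuclideanSpace ℝ (Fin n)}
    (hp : p ∈ (extChartAt (𝓡 n) x₁).target) (z u : EuclideanSpace ℝ (Fin n)) :
    nablaEndBilin g O hp z u = nablaEndMap g O x₁ p z u := rfl

/-- `Du` is the covariant derivative at time `t₀`, along the curve `y` with velocity `e` at `t₀`, of
the vector field `u`, everything being written in the chart around `x₁`. -/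
def HasCovDerivAt (x₁ : M) (y u : ℝ → EuclideanSpace ℝ (Fin n))
    (e Du : EuclideanSpace ℝ (Fin n)) (t₀ : ℝ) : Prop :=
  HasDerivAt u (Du - christoffelMap g x₁ (y t₀) e (u t₀)) t₀

variable {g O} {y u w : ℝ → EuclideanSpace ℝ (Fin n)} {e Du Dw : EuclideanSpace ℝ (Fin n)} {t₀ : ℝ}

lemma HasCovDerivAt.add (hu : HasCovDerivAt g x₁ y u e Du t₀)
    (hw : HasCovDerivAt g x₁ y w e Dw t₀) :
    HasCovDerivAt g x₁ y (fun t => u t + w t) e (Du + Dw) t₀ := by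
  refine (HasDerivAt.add hu hw).congr_deriv ?_
  rw [christoffelMap_add_right]; abel

lemma HasCovDerivAt.sub (hu : HasCovDerivAt g x₁ y u e Du t₀)
    (hw : HasCovDerivAt g x₁ y w e Dw t₀) :
    HasCovDerivAt g x₁ y (fun t => u t - w t) e (Du - Dw) t₀ := by
  refine (HasDerivAt.sub hu hw).congr_deriv ?_
  rw [christoffelMap_sub_right]; abel

lemma HasCovDerivAt.smul (c : ℝ) (hu : HasCovDerivAt g x₁ y u e Du t₀) :
    HasCovDerivAt g x₁ y (fun t => c • u t) e (c • Du) t₀ := by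
  refine (HasDerivAt.const_smul c hu).congr_deriv ?_
  rw [christoffelMap_smul_right, smul_sub]

/-- The Leibniz rule `D(O u) = (∇_e O) u + O Du`. -/
lemma HasCovDerivAt.endForm (hO : IsSmoothEnd O) (hp : y t₀ ∈ (extChartAt (𝓡 n) x₁).target)
    (hy : HasDerivAt y e t₀) (hu : HasCovDerivAt g x₁ y u e Du t₀) :
    HasCovDerivAt g x₁ y (fun t => endForm O x₁ (y t) (u t)) e
      (nablaEndMap g O x₁ (y t₀) e (u t₀) + endForm O x₁ (y t₀) Du) t₀ := by
  have h1 := (differentiableAt_endForm O hO hp).hasFDerivAt.comp_hasDerivAt t₀ hy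
  refine (h1.clm_apply hu).congr_deriv ?_
  rw [fderiv_endForm g O, map_sub]
  simp only [Function.comp_apply]
  abel

/-- The metric is parallel: `(G u w)' = G Du w + G u Dw`. -/
lemma HasCovDerivAt.metricForm (hp : y t₀ ∈ (extChartAt (𝓡 n) x₁).target)
    (hy : HasDerivAt y e t₀) (hu : HasCovDerivAt g x₁ y u e Du t₀)
    (hw : HasCovDerivAt g x₁ y w e Dw t₀) :
    HasDerivAt (fun t => metricForm g x₁ (y t) (u t) (w t))
      (metricForm g x₁ (y t₀) Du (w t₀) + metricForm g x₁ (y t₀) (u t₀) Dw) t₀ := by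
  have h1 : HasDerivAt (fun t => DiracSigma.metricForm g x₁ (y t))
      (fderiv ℝ (DiracSigma.metricForm g x₁) (y t₀) e) t₀ :=
    HasFDerivAt.comp_hasDerivAt (l := DiracSigma.metricForm g x₁)
      (l' := fderiv ℝ (DiracSigma.metricForm g x₁) (y t₀)) t₀
      (differentiableAt_metricForm g hp).hasFDerivAt hy
  refine ((h1.clm_apply hu).clm_apply hw).congr_deriv ?_
  simp only [add_apply, map_sub, sub_apply, fderiv_metricForm g hp]
  ring

/-- The variation of the Lagrangian, in terms of the covariant variations `uᵢ` of `dX` and `dᵢ` of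
the gauge field. Since the metric is parallel, no Christoffel symbols appear. -/
lemma hasDerivAt_localLagrangian (hO : IsSmoothEnd O)
    {y₀ y₁ a₀ a₁ : ℝ → EuclideanSpace ℝ (Fin n)} {u₀ u₁ d₀ d₁ : EuclideanSpace ℝ (Fin n)}
    (hOg : ∀ (x : M) (u v : TangentSpace (𝓡 n) x), g.inner x (O x u) (O x v) = g.inner x u v)
    (hp : y t₀ ∈ (extChartAt (𝓡 n) x₁).target) (hy : HasDerivAt y e t₀) (α β γ : ℝ)
    (hy₀ : HasCovDerivAt g x₁ y y₀ e u₀ t₀) (hy₁ : HasCovDerivAt g x₁ y y₁ e u₁ t₀)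
    (ha₀ : HasCovDerivAt g x₁ y a₀ e d₀ t₀) (ha₁ : HasCovDerivAt g x₁ y a₁ e d₁ t₀) :
    let G := DiracSigma.metricForm g x₁ (y t₀)
    let P := DiracSigma.endForm O x₁ (y t₀)
    let N := nablaEndMap g O x₁ (y t₀)
    let z₀ := y₀ t₀ - (a₀ t₀ - P (a₀ t₀))
    let z₁ := y₁ t₀ - (a₁ t₀ - P (a₁ t₀))
    HasDerivAt (fun t => localLagrangian (DiracSigma.metricForm g x₁ (y t))
        (DiracSigma.endForm O x₁ (y t)) α β γ (y₀ t) (y₁ t) (a₀ t) (a₁ t))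
      ((G (d₀ + P d₀ + (α • d₀ + β • d₁) - P (α • d₀ + β • d₁)) z₁
          - G (d₁ + P d₁ + (γ • d₀ - α • d₁) - P (γ • d₀ - α • d₁)) z₀)
        + (G (N e (a₀ t₀) - (α • N e (a₀ t₀) + β • N e (a₁ t₀))) z₁
          - G (N e (a₁ t₀) - (γ • N e (a₀ t₀) - α • N e (a₁ t₀))) z₀)
        - (G (α • u₀ + β • u₁) z₁ - G (γ • u₀ - α • u₁) z₀)
        + (G (a₀ t₀ + P (a₀ t₀)) u₁ - G (a₁ t₀ + P (a₁ t₀)) u₀)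
        + (G (P (a₀ t₀)) (N e (a₁ t₀)) - G (P (a₁ t₀)) (N e (a₀ t₀)))) t₀ := by
  intro G P N z₀ z₁
  have p₀ := ha₀.endForm hO hp hy
  have p₁ := ha₁.endForm hO hp hy
  have v₀ := ha₀.sub p₀
  have v₁ := ha₁.sub p₁
  have w₀ := ha₀.add p₀
  have w₁ := ha₁.add p₁
  have q₀ := hy₀.sub v₀
  have q₁ := hy₁.sub v₁
  have s₀ := (q₀.smul α).add (q₁.smul β)
  have s₁ := (q₀.smul γ).sub (q₁.smul α)
  have key := ((((q₀.metricForm hp hy s₁).sub (q₁.metricForm hp hy s₀)).const_mul (1 / 2)).add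
    ((w₀.metricForm hp hy hy₁).sub (w₁.metricForm hp hy hy₀))).sub
    (((w₀.metricForm hp hy v₁).sub (w₁.metricForm hp hy v₀)).const_mul (1 / 2))
  refine key.congr_deriv ?_
  refine (Eq.trans ?_ (lagrangian_variation G P (nablaEndBilin g O hp) (metricForm_symm g _)
    (metricForm_endForm g O hOg hp) α β γ z₀ z₁ (a₀ t₀) (a₁ t₀) e d₀ d₁ u₀ u₁ _ _ rfl rfl))
  simp only [nablaEndBilin_apply, z₀, z₁, sub_add_cancel]
  rfl

end Covariant

/-! ### The gauge transformation in coordinates -/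

section Centred

variable {n : ℕ} {M : Type*} [TopologicalSpace M] [ChartedSpace (EuclideanSpace ℝ (Fin n)) M]
  [IsManifold (𝓡 n) ∞ M]
  (g : Bundle.ContMDiffRiemannianMetric (𝓡 n) ∞ (EuclideanSpace ℝ (Fin n))
    (fun x : M => TangentSpace (𝓡 n) x))
  (H : ∀ x : M, TangentSpace (𝓡 n) x [⋀^Fin 3]→L[ℝ] ℝ)
  (O : ∀ x : M, TangentSpace (𝓡 n) x →L[ℝ] TangentSpace (𝓡 n) x)

lemma coframe_nablaEnd (hO : IsSmoothEnd O) (x : M) (w u : TangentSpace (𝓡 n) x) :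
    coframe (𝓡 n) x x (nablaEnd g O x w u) = nablaEndMap g O x (extChartAt (𝓡 n) x x)
      (coframe (𝓡 n) x x w) (coframe (𝓡 n) x x u) := by
  rw [nablaEnd, coframe_ofCoord]
  ext m
  exact sum_nablaEndCoord g O hO (mem_extChartAt_target x) _ _ m

lemma metricForm_coframe_sharp (x : M) {η : TangentSpace (𝓡 n) x → ℝ}
    {l : EuclideanSpace ℝ (Fin n) →ₗ[ℝ] ℝ} (h : ∀ u, η u = l (coframe (𝓡 n) x x u))
    (w : EuclideanSpace ℝ (Fin n)) :
    metricForm g x (extChartAt (𝓡 n) x x) (coframe (𝓡 n) x x (sharp g x η)) w = l w := by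
  rw [sharp, coframe_ofCoord, metricForm_inv g (mem_extChartAt_target x)]
  conv_rhs => rw [sum_smul_single w, map_sum]
  refine Finset.sum_congr rfl fun j _ => ?_
  rw [h, coframe_basisVec, map_smul, smul_eq_mul, mul_comm]

lemma christoffelMap_apply (x : M) (p z u : EuclideanSpace ℝ (Fin n)) (i : Fin n) :
    christoffelMap g x p z u i = ∑ j, ∑ k, christoffel g x p i j k * z j * u k := by
  rw [christoffelMap]

/-- In the chart around `γ 0`, a vector field along `γ` has covariant derivative `covAlong`. -/
lemma hasCovDerivAt_covAlong {c : ℝ → M} {V : ∀ t, TangentSpace (𝓡 n) (c t)}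
    (hV : DifferentiableAt ℝ (fun t => coframe (𝓡 n) (c 0) (c t) (V t)) 0) :
    HasCovDerivAt g (c 0) (fun t => extChartAt (𝓡 n) (c 0) (c t))
      (fun t => coframe (𝓡 n) (c 0) (c t) (V t))
      (coframe (𝓡 n) (c 0) (c 0) (mfderiv 𝓘(ℝ, ℝ) (𝓡 n) c 0 (1 : ℝ)))
      (coframe (𝓡 n) (c 0) (c 0) (covAlong g c V)) 0 := by
  refine hV.hasDerivAt.congr_deriv ?_
  rw [eq_sub_iff_add_eq, christoffelMap_symm g (mem_extChartAt_target _), covAlong, coframe_ofCoord]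
  ext i
  rw [PiLp.add_apply, christoffelMap_apply]
  congr 1
  exact (((EuclideanSpace.proj (𝕜 := ℝ) i).hasFDerivAt.comp_hasDerivAt (0 : ℝ)
    hV.hasDerivAt).deriv).symm

end Centred

section WorldSheetCharts

variable {n : ℕ} {M : Type*} [TopologicalSpace M] [ChartedSpace (EuclideanSpace ℝ (Fin n)) M]
  [IsManifold (𝓡 n) ∞ M]
  (g : Bundle.ContMDiffRiemannianMetric (𝓡 n) ∞ (EuclideanSpace ℝ (Fin n))
    (fun x : M => TangentSpace (𝓡 n) x))
  (H : ∀ x : M, TangentSpace (𝓡 n) x [⋀^Fin 3]→L[ℝ] ℝ)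
  (O : ∀ x : M, TangentSpace (𝓡 n) x →L[ℝ] TangentSpace (𝓡 n) x)
  {S : Type*} [TopologicalSpace S] [ChartedSpace (EuclideanSpace ℝ (Fin 2)) S]
  [IsManifold (𝓡 2) ∞ S] (L : LorentzianSurface S)

/-- The coordinate vector `∂ᵢ` of the chart around `s₀`, at the point with coordinates `p`. -/
noncomputable abbrev frameVec (s₀ : S) (p : EuclideanSpace ℝ (Fin 2)) (i : Fin 2) :
    TangentSpace (𝓡 2) ((extChartAt (𝓡 2) s₀).symm p) :=
  frameAt (𝓡 2) s₀ p (EuclideanSpace.single i 1)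

/-- The metric coefficient `h(∂ᵢ, ∂ⱼ)` of the world sheet. -/
noncomputable def LorentzianSurface.metricCoeff (s₀ : S) (i j : Fin 2)
    (p : EuclideanSpace ℝ (Fin 2)) : ℝ :=
  L.metric ((extChartAt (𝓡 2) s₀).symm p) (frameVec s₀ p i) (frameVec s₀ p j)

/-- The coefficient `area(∂₀, ∂₁)` of the area form. -/
noncomputable def LorentzianSurface.areaCoeff (s₀ : S) (p : EuclideanSpace ℝ (Fin 2)) : ℝ :=
  L.area ((extChartAt (𝓡 2) s₀).symm p) (frameVec s₀ p 0) (frameVec s₀ p 1)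

variable {s₀ : S} {p : EuclideanSpace ℝ (Fin 2)}

lemma LorentzianSurface.areaCoeff_ne_zero (hp : p ∈ (extChartAt (𝓡 2) s₀).target) :
    L.areaCoeff s₀ p ≠ 0 := by
  have := L.area_ne_zero (frameBasis (𝓡 2) s₀ hp)
  rwa [frameBasis_apply, frameBasis_apply] at this

lemma LorentzianSurface.rot_frameVec (hp : p ∈ (extChartAt (𝓡 2) s₀).target) :
    L.rot _ (frameVec s₀ p 0) = (-L.metricCoeff s₀ 0 1 p / L.areaCoeff s₀ p) • frameVec s₀ p 0
      + (L.metricCoeff s₀ 0 0 p / L.areaCoeff s₀ p) • frameVec s₀ p 1 ∧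
    L.rot _ (frameVec s₀ p 1) = (-L.metricCoeff s₀ 1 1 p / L.areaCoeff s₀ p) • frameVec s₀ p 0
      - (-L.metricCoeff s₀ 0 1 p / L.areaCoeff s₀ p) • frameVec s₀ p 1 := by
  have := L.rot_basis (frameBasis (𝓡 2) s₀ hp)
  rw [frameBasis_apply, frameBasis_apply] at this
  refine ⟨this.1, this.2.trans ?_⟩
  rw [neg_div, neg_div, neg_div, sub_eq_add_neg, ← neg_smul, neg_neg]
  rfl

lemma LorentzianSurface.contDiffOn_metricCoeff (i j : Fin 2) :
    ContDiffOn ℝ ∞ (L.metricCoeff s₀ i j) (extChartAt (𝓡 2) s₀).target :=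
  L.metric_smooth s₀ i j

lemma LorentzianSurface.contDiffOn_areaCoeff :
    ContDiffOn ℝ ∞ (L.areaCoeff s₀) (extChartAt (𝓡 2) s₀).target :=
  L.area_smooth s₀ 0 1

/-- The Lagrangian in charts. The coefficients of `localLagrangian` are the matrix entries of the
Hodge operator, see `LorentzianSurface.rot_frameVec`. -/
lemma topCoeff_lagrangian {X : S → M}
    {a : ∀ σ, TangentSpace (𝓡 2) σ →L[ℝ] TangentSpace (𝓡 n) (X σ)} {x₁ : M}
    (hp : p ∈ (extChartAt (𝓡 2) s₀).target)
    (hx : X ((extChartAt (𝓡 2) s₀).symm p) ∈ (extChartAt (𝓡 n) x₁).source) :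
    topCoeff (𝓡 2) (lagrangian L g O X a) s₀ p = localLagrangian
      (metricForm g x₁ (extChartAt (𝓡 n) x₁ (X ((extChartAt (𝓡 2) s₀).symm p))))
      (endForm O x₁ (extChartAt (𝓡 n) x₁ (X ((extChartAt (𝓡 2) s₀).symm p))))
      (-L.metricCoeff s₀ 0 1 p / L.areaCoeff s₀ p) (L.metricCoeff s₀ 0 0 p / L.areaCoeff s₀ p)
      (-L.metricCoeff s₀ 1 1 p / L.areaCoeff s₀ p)
      (coframe (𝓡 n) x₁ _ (mfderiv (𝓡 2) (𝓡 n) X _ (frameVec s₀ p 0)))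
      (coframe (𝓡 n) x₁ _ (mfderiv (𝓡 2) (𝓡 n) X _ (frameVec s₀ p 1)))
      (coframe (𝓡 n) x₁ _ (a _ (frameVec s₀ p 0)))
      (coframe (𝓡 n) x₁ _ (a _ (frameVec s₀ p 1))) := by
  obtain ⟨r₀, r₁⟩ := L.rot_frameVec hp
  have hl : ∀ (c d : ℝ) u v, covDiff O X a ((extChartAt (𝓡 2) s₀).symm p) (c • u + d • v)
      = c • covDiff O X a _ u + d • covDiff O X a _ v := fun c d u v => by
    simp only [covDiff, map_add, map_smul]; module
  have hl' : ∀ (c d : ℝ) u v, covDiff O X a ((extChartAt (𝓡 2) s₀).symm p) (c • u - d • v)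
      = c • covDiff O X a _ u - d • covDiff O X a _ v := fun c d u v => by
    simp only [covDiff, map_sub, map_smul]; module
  have hz : ∀ u, coframe (𝓡 n) x₁ _ (covDiff O X a ((extChartAt (𝓡 2) s₀).symm p) u)
      = coframe (𝓡 n) x₁ _ (mfderiv (𝓡 2) (𝓡 n) X _ u) - (coframe (𝓡 n) x₁ _ (a _ u)
        - endForm O x₁ _ (coframe (𝓡 n) x₁ _ (a _ u))) := fun u => by
    rw [covDiff, map_sub, map_sub, coframe_endForm O hx]
  change (1 / 2) * (g.inner _ (covDiff O X a _ (frameVec s₀ p 0))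
      (covDiff O X a _ (L.rot _ (frameVec s₀ p 1))) - g.inner _ (covDiff O X a _ (frameVec s₀ p 1))
      (covDiff O X a _ (L.rot _ (frameVec s₀ p 0)))) + _ - _ = _
  rw [r₀, r₁, hl, hl']
  simp only [wedge, inner_eq_metricForm g hx, map_add (coframe (𝓡 n) x₁ _),
    map_sub (coframe (𝓡 n) x₁ _), map_smul (coframe (𝓡 n) x₁ _), hz, coframe_endForm O hx]
  rfl

lemma ContDiffAt.localLagrangian {V E : Type*} [NormedAddCommGroup V] [NormedSpace ℝ V]
    [NormedAddCommGroup E] [NormedSpace ℝ E] {G : E → V →L[ℝ] V →L[ℝ] ℝ} {P : E → V →L[ℝ] V}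
    {α β γ : E → ℝ} {y₀ y₁ a₀ a₁ : E → V} {q : E} (hG : ContDiffAt ℝ ∞ G q)
    (hP : ContDiffAt ℝ ∞ P q) (hα : ContDiffAt ℝ ∞ α q) (hβ : ContDiffAt ℝ ∞ β q)
    (hγ : ContDiffAt ℝ ∞ γ q) (hy₀ : ContDiffAt ℝ ∞ y₀ q) (hy₁ : ContDiffAt ℝ ∞ y₁ q)
    (ha₀ : ContDiffAt ℝ ∞ a₀ q) (ha₁ : ContDiffAt ℝ ∞ a₁ q) :
    ContDiffAt ℝ ∞ (fun r => localLagrangian (G r) (P r) (α r) (β r) (γ r) (y₀ r) (y₁ r)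
      (a₀ r) (a₁ r)) q := by
  have p₀ := hP.clm_apply ha₀
  have p₁ := hP.clm_apply ha₁
  have v₀ := ha₀.sub p₀
  have v₁ := ha₁.sub p₁
  have w₀ := ha₀.add p₀
  have w₁ := ha₁.add p₁
  have z₀ := hy₀.sub v₀
  have z₁ := hy₁.sub v₁
  have s₀ := (hα.smul z₀).add (hβ.smul z₁)
  have s₁ := (hγ.smul z₀).sub (hα.smul z₁)
  exact ((contDiffAt_const.mul (((hG.clm_apply z₀).clm_apply s₁).sub
    ((hG.clm_apply z₁).clm_apply s₀))).add (((hG.clm_apply w₀).clm_apply hy₁).sub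
    ((hG.clm_apply w₁).clm_apply hy₀))).sub (contDiffAt_const.mul
    (((hG.clm_apply w₀).clm_apply v₁).sub ((hG.clm_apply w₁).clm_apply v₀)))

variable {X : ℝ → S → M}
  (hX : ContMDiff (𝓘(ℝ, ℝ).prod (𝓡 2)) (𝓡 n) ∞ (fun q : ℝ × S => X q.1 q.2))
  {a : ∀ t σ, TangentSpace (𝓡 2) σ →L[ℝ] TangentSpace (𝓡 n) (X t σ)}
  (ha : ContMDiff (𝓘(ℝ, ℝ).prod (𝓡 2).tangent) (𝓡 n).tangent ∞
    (fun q : ℝ × TangentBundle (𝓡 2) S =>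
      (⟨X q.1 q.2.proj, a q.1 q.2.proj q.2.snd⟩ : TangentBundle (𝓡 n) M)))

lemma timeRange_euclidean (d : ℕ) : timeRange (𝓡 d) = univ := by simp [timeRange]

include hX in
lemma contDiffAt_chartMap {x₁ : M} {t : ℝ} (hp : p ∈ (extChartAt (𝓡 2) s₀).target)
    (hx : X t ((extChartAt (𝓡 2) s₀).symm p) ∈ (extChartAt (𝓡 n) x₁).source) :
    ContDiffAt ℝ ∞ (chartMap (n := n) (𝓡 2) X s₀ x₁) (t, p) := by
  have := contDiffWithinAt_chartMap hX s₀ x₁ hp hx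
  rwa [timeRange_euclidean, contDiffWithinAt_univ] at this

include hX in
lemma eventually_mem_source {x₁ : M} {t : ℝ} (hp : p ∈ (extChartAt (𝓡 2) s₀).target)
    (hx : X t ((extChartAt (𝓡 2) s₀).symm p) ∈ (extChartAt (𝓡 n) x₁).source) :
    ∀ᶠ q : ℝ × EuclideanSpace ℝ (Fin 2) in nhds (t, p), q.2 ∈ (extChartAt (𝓡 2) s₀).target ∧
      X q.1 ((extChartAt (𝓡 2) s₀).symm q.2) ∈ (extChartAt (𝓡 n) x₁).source := by
  have h1 : ContinuousAt (fun q : ℝ × EuclideanSpace ℝ (Fin 2) =>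
      X q.1 ((extChartAt (𝓡 2) s₀).symm q.2)) (t, p) :=
    ContinuousAt.comp (x := (t, p)) (g := fun q : ℝ × S => X q.1 q.2)
      (f := fun q : ℝ × EuclideanSpace ℝ (Fin 2) => (q.1, (extChartAt (𝓡 2) s₀).symm q.2))
      hX.continuous.continuousAt
      (continuousAt_fst.prodMk (ContinuousAt.comp (x := (t, p)) (f := Prod.snd)
        ((continuousOn_extChartAt_symm s₀).continuousAt
          ((isOpen_extChartAt_target s₀).mem_nhds hp)) continuousAt_snd))
  exact (continuousAt_snd.eventually ((isOpen_extChartAt_target s₀).mem_nhds hp)).and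
    (h1.eventually ((isOpen_extChartAt_source x₁).mem_nhds hx))

include ha in
lemma contDiffAt_coframe_gaugeField {x₁ : M} {t : ℝ} (hp : p ∈ (extChartAt (𝓡 2) s₀).target)
    (hx : X t ((extChartAt (𝓡 2) s₀).symm p) ∈ (extChartAt (𝓡 n) x₁).source)
    (c : EuclideanSpace ℝ (Fin 2)) :
    ContDiffAt ℝ ∞ (fun q : ℝ × EuclideanSpace ℝ (Fin 2) => coframe (𝓡 n) x₁
      (X q.1 ((extChartAt (𝓡 2) s₀).symm q.2))
      (a q.1 ((extChartAt (𝓡 2) s₀).symm q.2) (frameAt (𝓡 2) s₀ q.2 c))) (t, p) := by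
  have h1 := (contMDiffWithinAt_frameAt hp c).contMDiffAt
    ((isOpen_extChartAt_target s₀).mem_nhds hp)
  have h2 : ContMDiffAt 𝓘(ℝ, ℝ × EuclideanSpace ℝ (Fin 2)) (𝓘(ℝ, ℝ).prod (𝓡 2).tangent) ∞
      (fun q : ℝ × EuclideanSpace ℝ (Fin 2) => (q.1, (⟨(extChartAt (𝓡 2) s₀).symm q.2,
        frameAt (𝓡 2) s₀ q.2 c⟩ : TangentBundle (𝓡 2) S))) (t, p) :=
    ContMDiffAt.prodMk (ContDiff.contMDiff contDiff_fst).contMDiffAt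
      (ContMDiffAt.comp (t, p) (g := fun q' => (⟨(extChartAt (𝓡 2) s₀).symm q',
        frameAt (𝓡 2) s₀ q' c⟩ : TangentBundle (𝓡 2) S)) (f := Prod.snd) h1
        (ContDiff.contMDiff contDiff_snd).contMDiffAt)
  have h3 := contMDiffWithinAt_coframe (ha.contMDiffAt.comp (t, p) h2).contMDiffWithinAt x₁ hx
    (s := univ)
  exact (contMDiffWithinAt_univ.1 h3).contDiffAt

include hX ha in
/-- The Lagrangian of a family of fields is smooth in time and position. -/
lemma contDiffAt_topCoeff_lagrangian (hO : IsSmoothEnd O) (t : ℝ)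
    (hp : p ∈ (extChartAt (𝓡 2) s₀).target) :
    ContDiffAt ℝ ∞ (fun q : ℝ × EuclideanSpace ℝ (Fin 2) =>
      topCoeff (𝓡 2) (lagrangian L g O (X q.1) (a q.1)) s₀ q.2) (t, p) := by
  set x₁ := X t ((extChartAt (𝓡 2) s₀).symm p) with hx₁
  have hx : X t ((extChartAt (𝓡 2) s₀).symm p) ∈ (extChartAt (𝓡 n) x₁).source :=
    mem_extChartAt_source _
  have hY := contDiffAt_chartMap hX hp hx
  have hYt : chartMap (n := n) (𝓡 2) X s₀ x₁ (t, p) ∈ (extChartAt (𝓡 n) x₁).target :=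
    (extChartAt (𝓡 n) x₁).map_source hx
  have hn := (isOpen_extChartAt_target (I := 𝓡 n) x₁).mem_nhds hYt
  have hs := (isOpen_extChartAt_target (I := 𝓡 2) s₀).mem_nhds hp
  have hdY : ContDiffAt ℝ ∞ (fderiv ℝ (chartMap (n := n) (𝓡 2) X s₀ x₁)) (t, p) :=
    hY.fderiv_right (by norm_num)
  have har := ((L.contDiffOn_areaCoeff).contDiffAt hs).comp (t, p) contDiffAt_snd
  have hm := fun i j => ((L.contDiffOn_metricCoeff (s₀ := s₀) i j).contDiffAt hs).comp (t, p)
    contDiffAt_snd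
  have hne := L.areaCoeff_ne_zero hp
  refine ContDiffAt.congr_of_eventuallyEq (ContDiffAt.localLagrangian
    (((contDiffOn_metricForm g).contDiffAt hn).comp (t, p) hY)
    (((contDiffOn_endForm O hO).contDiffAt hn).comp (t, p) hY)
    ((hm 0 1).neg.div har hne) ((hm 0 0).div har hne) ((hm 1 1).neg.div har hne)
    (hdY.clm_apply (contDiffAt_const (c := (0, EuclideanSpace.single 0 1))))
    (hdY.clm_apply (contDiffAt_const (c := (0, EuclideanSpace.single 1 1))))
    (contDiffAt_coframe_gaugeField ha hp hx (EuclideanSpace.single 0 1))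
    (contDiffAt_coframe_gaugeField ha hp hx (EuclideanSpace.single 1 1))) ?_
  filter_upwards [eventually_mem_source hX hp hx] with q hq
  rw [topCoeff_lagrangian g O L hq.1 hq.2, coframe_mfderiv_frameAt hX s₀ x₁ hq.1 hq.2,
    coframe_mfderiv_frameAt hX s₀ x₁ hq.1 hq.2, timeRange_euclidean, fderivWithin_univ]
  rfl

end WorldSheetCharts

/-! ### Gauge invariance of the Lagrangian up to a divergence -/

section Variation

variable {n : ℕ} {M : Type*} [TopologicalSpace M] [ChartedSpace (EuclideanSpace ℝ (Fin n)) M]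
  [IsManifold (𝓡 n) ∞ M]
  (g : Bundle.ContMDiffRiemannianMetric (𝓡 n) ∞ (EuclideanSpace ℝ (Fin n))
    (fun x : M => TangentSpace (𝓡 n) x))
  (H : ∀ x : M, TangentSpace (𝓡 n) x [⋀^Fin 3]→L[ℝ] ℝ)
  (O : ∀ x : M, TangentSpace (𝓡 n) x →L[ℝ] TangentSpace (𝓡 n) x)
  {S : Type*} [TopologicalSpace S] [ChartedSpace (EuclideanSpace ℝ (Fin 2)) S]
  [IsManifold (𝓡 2) ∞ S] (L : LorentzianSurface S)

/-- The 1-form `g((id + O) ε, dX)` on the world sheet, whose differential is the variation of the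
Lagrangian and of the Wess-Zumino term. -/
noncomputable def gaugeOneForm (X : S → M) (ε : ∀ σ, TangentSpace (𝓡 n) (X σ)) (σ : S) :
    TangentSpace (𝓡 2) σ →L[ℝ] ℝ :=
  (g.inner (X σ) (ε σ + O (X σ) (ε σ))).comp (mfderiv (𝓡 2) (𝓡 n) X σ)

variable {X : ℝ → S → M}
  (hX : ContMDiff (𝓘(ℝ, ℝ).prod (𝓡 2)) (𝓡 n) ∞ (fun q : ℝ × S => X q.1 q.2))
  {a : ∀ t σ, TangentSpace (𝓡 2) σ →L[ℝ] TangentSpace (𝓡 n) (X t σ)}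
  (ha : ContMDiff (𝓘(ℝ, ℝ).prod (𝓡 2).tangent) (𝓡 n).tangent ∞
    (fun q : ℝ × TangentBundle (𝓡 2) S =>
      (⟨X q.1 q.2.proj, a q.1 q.2.proj q.2.snd⟩ : TangentBundle (𝓡 n) M)))
  {ε : ∀ σ, TangentSpace (𝓡 n) (X 0 σ)}
  (hε : ContMDiff (𝓡 2) (𝓡 n).tangent ∞
    (fun σ : S => (⟨X 0 σ, ε σ⟩ : TangentBundle (𝓡 n) M)))
  (hO : IsSmoothEnd O)
  (hOg : ∀ (x : M) (u v : TangentSpace (𝓡 n) x), g.inner x (O x u) (O x v) = g.inner x u v)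
  (hvel : ∀ σ, mfderiv 𝓘(ℝ, ℝ) (𝓡 n) (fun t => X t σ) 0 (1 : ℝ) = ε σ - O (X 0 σ) (ε σ))
  {s₀ : S} {p : EuclideanSpace ℝ (Fin 2)} {x₁ : M}

/-- The components of a section `ε` of `X^*TM` in charts. -/
noncomputable def sectionCoord (X : S → M) (ε : ∀ σ, TangentSpace (𝓡 n) (X σ)) (s₀ : S) (x₁ : M)
    (p : EuclideanSpace ℝ (Fin 2)) : EuclideanSpace ℝ (Fin n) :=
  coframe (𝓡 n) x₁ (X ((extChartAt (𝓡 2) s₀).symm p)) (ε ((extChartAt (𝓡 2) s₀).symm p))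

include hε in
lemma contDiffAt_sectionCoord (hp : p ∈ (extChartAt (𝓡 2) s₀).target)
    (hx : X 0 ((extChartAt (𝓡 2) s₀).symm p) ∈ (extChartAt (𝓡 n) x₁).source) :
    ContDiffAt ℝ ∞ (sectionCoord (X 0) ε s₀ x₁) p := by
  have h1 : ContMDiffAt 𝓘(ℝ, EuclideanSpace ℝ (Fin 2)) (𝓡 2) ∞ (extChartAt (𝓡 2) s₀).symm p :=
    (contMDiffOn_extChartAt_symm s₀).contMDiffAt ((isOpen_extChartAt_target s₀).mem_nhds hp)
  have h3 := contMDiffWithinAt_coframe (hε.contMDiffAt.comp p h1).contMDiffWithinAt x₁ hx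
    (s := univ)
  exact (contMDiffWithinAt_univ.1 h3).contDiffAt

include hX in
lemma coframe_mfderiv_frame (hp : p ∈ (extChartAt (𝓡 2) s₀).target) {t : ℝ}
    (hx : X t ((extChartAt (𝓡 2) s₀).symm p) ∈ (extChartAt (𝓡 n) x₁).source)
    (c : EuclideanSpace ℝ (Fin 2)) :
    coframe (𝓡 n) x₁ (X t ((extChartAt (𝓡 2) s₀).symm p))
        (mfderiv (𝓡 2) (𝓡 n) (X t) _ (frameAt (𝓡 2) s₀ p c))
      = fderiv ℝ (chartMap (n := n) (𝓡 2) X s₀ x₁) (t, p) (0, c) := by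
  rw [coframe_mfderiv_frameAt hX s₀ x₁ hp hx, timeRange_euclidean, fderivWithin_univ]

include hX hvel in
lemma fderiv_chartMap_time (hp : p ∈ (extChartAt (𝓡 2) s₀).target)
    (hx : X 0 ((extChartAt (𝓡 2) s₀).symm p) ∈ (extChartAt (𝓡 n) x₁).source) :
    fderiv ℝ (chartMap (n := n) (𝓡 2) X s₀ x₁) (0, p) (1, 0)
      = sectionCoord (X 0) ε s₀ x₁ p
        - endForm O x₁ (chartMap (𝓡 2) X s₀ x₁ (0, p)) (sectionCoord (X 0) ε s₀ x₁ p) := by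
  have h := coframe_mfderiv_time hX s₀ x₁ hp hx
  rw [timeRange_euclidean, fderivWithin_univ] at h
  rw [← h, hvel, map_sub, coframe_endForm O hx]
  rfl

include hε in
lemma coframe_covPull (hp : p ∈ (extChartAt (𝓡 2) s₀).target) (c : EuclideanSpace ℝ (Fin 2)) :
    coframe (𝓡 n) (X 0 ((extChartAt (𝓡 2) s₀).symm p)) _
        (covPull g (X 0) ε ((extChartAt (𝓡 2) s₀).symm p) (frameAt (𝓡 2) s₀ p c))
      = fderiv ℝ (sectionCoord (X 0) ε s₀ (X 0 ((extChartAt (𝓡 2) s₀).symm p))) p c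
        + christoffelMap g (X 0 ((extChartAt (𝓡 2) s₀).symm p))
          (extChartAt (𝓡 n) (X 0 ((extChartAt (𝓡 2) s₀).symm p))
            (X 0 ((extChartAt (𝓡 2) s₀).symm p)))
          (coframe (𝓡 n) (X 0 ((extChartAt (𝓡 2) s₀).symm p)) _
            (mfderiv (𝓡 2) (𝓡 n) (X 0) _ (frameAt (𝓡 2) s₀ p c)))
          (sectionCoord (X 0) ε s₀ (X 0 ((extChartAt (𝓡 2) s₀).symm p)) p) := by
  set σ := (extChartAt (𝓡 2) s₀).symm p with hσ
  have hx : X 0 σ ∈ (extChartAt (𝓡 n) (X 0 σ)).source := mem_extChartAt_source _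
  rw [covPull, coframe_ofCoord]
  ext i
  rw [PiLp.add_apply, christoffelMap_apply]
  have h3 := contMDiffWithinAt_coframe (hε.contMDiffAt (x := σ)).contMDiffWithinAt (X 0 σ) hx
    (s := univ)
  have h4 := ((contMDiffWithinAt_univ.1 h3).mdifferentiableAt (by norm_num))
  have h5 : MDifferentiableAt (𝓡 2) 𝓘(ℝ, ℝ)
      (fun τ => coframe (𝓡 n) (X 0 σ) (X 0 τ) (ε τ) i) σ :=
    ((EuclideanSpace.proj (𝕜 := ℝ) i).differentiableAt.mdifferentiableAt).comp σ h4
  have h6 := mfderiv_frameAt_eq_fderivWithin hp h5 c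
  rw [ModelWithCorners.range_eq_univ, fderivWithin_univ] at h6
  have h7 := ((contDiffAt_sectionCoord hε hp hx).differentiableAt (by norm_num)).hasFDerivAt
  have h8 := DFunLike.congr_fun
    ((EuclideanSpace.proj (𝕜 := ℝ) i).hasFDerivAt.comp p h7).fderiv c
  exact congrArg₂ (· + ·) (h6.trans h8) rfl

include hX hε hO in
lemma gaugeOneForm_frameAt (hp : p ∈ (extChartAt (𝓡 2) s₀).target)
    (hx : X 0 ((extChartAt (𝓡 2) s₀).symm p) ∈ (extChartAt (𝓡 n) x₁).source)
    (c : EuclideanSpace ℝ (Fin 2)) :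
    (fun q => gaugeOneForm g O (X 0) ε ((extChartAt (𝓡 2) s₀).symm q) (frameAt (𝓡 2) s₀ q c))
      =ᶠ[nhds p] (fun q => metricForm g x₁ (chartMap (𝓡 2) X s₀ x₁ (0, q))
        (sectionCoord (X 0) ε s₀ x₁ q
          + endForm O x₁ (chartMap (𝓡 2) X s₀ x₁ (0, q)) (sectionCoord (X 0) ε s₀ x₁ q))
        (fderiv ℝ (chartMap (n := n) (𝓡 2) X s₀ x₁) (0, q) (0, c))) ∧
    ContDiffAt ℝ ∞ (fun q => gaugeOneForm g O (X 0) ε ((extChartAt (𝓡 2) s₀).symm q)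
      (frameAt (𝓡 2) s₀ q c)) p := by
  have h1 : (fun q => gaugeOneForm g O (X 0) ε ((extChartAt (𝓡 2) s₀).symm q)
      (frameAt (𝓡 2) s₀ q c)) =ᶠ[nhds p]
      (fun q => metricForm g x₁ (chartMap (𝓡 2) X s₀ x₁ (0, q)) (sectionCoord (X 0) ε s₀ x₁ q
        + endForm O x₁ (chartMap (𝓡 2) X s₀ x₁ (0, q)) (sectionCoord (X 0) ε s₀ x₁ q))
        (fderiv ℝ (chartMap (n := n) (𝓡 2) X s₀ x₁) (0, q) (0, c))) := by
    have hc : ContinuousAt (fun q : EuclideanSpace ℝ (Fin 2) => ((0 : ℝ), q)) p := by fun_prop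
    filter_upwards [hc.eventually (eventually_mem_source hX hp hx)] with q hq
    simp only [gaugeOneForm, ContinuousLinearMap.comp_apply]
    rw [inner_eq_metricForm g hq.2, coframe_mfderiv_frame hX hq.1 hq.2, map_add,
      coframe_endForm O hq.2]
    rfl
  refine ⟨h1, ContDiffAt.congr_of_eventuallyEq ?_ h1⟩
  have hi : ContDiffAt ℝ ∞ (fun q : EuclideanSpace ℝ (Fin 2) => ((0 : ℝ), q)) p :=
    (contDiff_prodMk_right (0 : ℝ)).contDiffAt
  have hY := contDiffAt_chartMap hX hp hx
  have hYt : chartMap (n := n) (𝓡 2) X s₀ x₁ (0, p) ∈ (extChartAt (𝓡 n) x₁).target :=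
    (extChartAt (𝓡 n) x₁).map_source hx
  have hn := (isOpen_extChartAt_target (I := 𝓡 n) x₁).mem_nhds hYt
  have hdY : ContDiffAt ℝ ∞ (fderiv ℝ (chartMap (n := n) (𝓡 2) X s₀ x₁)) (0, p) :=
    hY.fderiv_right (by norm_num)
  have hY' := hY.comp p hi
  have hs := contDiffAt_sectionCoord hε hp hx
  exact ((((contDiffOn_metricForm g).contDiffAt hn).comp p hY').clm_apply
    (hs.add ((((contDiffOn_endForm O hO).contDiffAt hn).comp p hY').clm_apply hs))).clm_apply
    ((hdY.comp p hi).clm_apply contDiffAt_const)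

include hX hε hO hvel in
/-- The covariant derivatives of `dX` in time and of the 1-form `g((id + O) ε, dX)`. -/
lemma variation_calculus (hp : p ∈ (extChartAt (𝓡 2) s₀).target)
    (hx : X 0 ((extChartAt (𝓡 2) s₀).symm p) ∈ (extChartAt (𝓡 n) x₁).source) :
    let Y := chartMap (n := n) (𝓡 2) X s₀ x₁
    let E := sectionCoord (X 0) ε s₀ x₁ p
    let Yd := fun c => fderiv ℝ Y (0, p) (0, c)
    let Ed := fun c => fderiv ℝ (sectionCoord (X 0) ε s₀ x₁) p c
      + christoffelMap g x₁ (Y (0, p)) (Yd c) E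
    let Q := endForm O x₁ (Y (0, p))
    let N := nablaEndMap g O x₁ (Y (0, p))
    HasDerivAt (fun t => Y (t, p)) (E - Q E) 0 ∧
    (∀ c, HasCovDerivAt g x₁ (fun t => Y (t, p)) (fun t => fderiv ℝ Y (t, p) (0, c)) (E - Q E)
      (Ed c - (N (Yd c) E + Q (Ed c))) 0) ∧
    (∀ c c', fderiv ℝ (fun q => gaugeOneForm g O (X 0) ε ((extChartAt (𝓡 2) s₀).symm q)
          (frameAt (𝓡 2) s₀ q c')) p c
        - fderiv ℝ (fun q => gaugeOneForm g O (X 0) ε ((extChartAt (𝓡 2) s₀).symm q)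
          (frameAt (𝓡 2) s₀ q c)) p c'
      = metricForm g x₁ (Y (0, p)) (Ed c + (N (Yd c) E + Q (Ed c))) (Yd c')
        - metricForm g x₁ (Y (0, p)) (Ed c' + (N (Yd c') E + Q (Ed c'))) (Yd c)) := by
  intro Y E Yd Ed Q N
  have hY : ContDiffAt ℝ ∞ Y (0, p) := contDiffAt_chartMap hX hp hx
  have hYt : Y (0, p) ∈ (extChartAt (𝓡 n) x₁).target := (extChartAt (𝓡 n) x₁).map_source hx
  have hY1 : HasFDerivAt Y (fderiv ℝ Y (0, p)) (0, p) :=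
    (hY.differentiableAt (by norm_num)).hasFDerivAt
  have hdY : ContDiffAt ℝ ∞ (fderiv ℝ Y) (0, p) := hY.fderiv_right (by norm_num)
  have hY2 : HasFDerivAt (fderiv ℝ Y) (fderiv ℝ (fderiv ℝ Y) (0, p)) (0, p) :=
    (hdY.differentiableAt (by norm_num)).hasFDerivAt
  have hsymm : ∀ v w, fderiv ℝ (fderiv ℝ Y) (0, p) v w = fderiv ℝ (fderiv ℝ Y) (0, p) w v :=
    fun v w => (hY.isSymmSndFDerivAt (by
      rw [minSmoothness_of_isRCLikeNormedField]; exact ENat.LEInfty.out)).eq v w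
  have hE : HasFDerivAt (sectionCoord (X 0) ε s₀ x₁)
      (fderiv ℝ (sectionCoord (X 0) ε s₀ x₁) p) p :=
    ((contDiffAt_sectionCoord hε hp hx).differentiableAt (by norm_num)).hasFDerivAt
  have hvelp := fderiv_chartMap_time O hX hvel hp hx
  -- the time curve and the coordinate lines
  have ht : HasDerivAt (fun t : ℝ => (t, p)) ((1 : ℝ), (0 : EuclideanSpace ℝ (Fin 2))) 0 :=
    (hasDerivAt_id (0 : ℝ)).prodMk (hasDerivAt_const (0 : ℝ) p)
  have hl0 : ∀ c, HasDerivAt (fun s : ℝ => p + s • c) c 0 := fun c => by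
    simpa using ((hasDerivAt_id (0 : ℝ)).smul_const c).const_add p
  have hl : ∀ c, HasDerivAt (fun s : ℝ => ((0 : ℝ), p + s • c)) ((0 : ℝ), c) 0 := fun c =>
    (hasDerivAt_const (0 : ℝ) (0 : ℝ)).prodMk (hl0 c)
  have hpz : ∀ c, p + (0 : ℝ) • c = p := fun c => by simp
  have hyt : HasDerivAt (fun t => Y (t, p)) (E - Q E) 0 := by
    have := hY1.comp_hasDerivAt (0 : ℝ) ht
    exact this.congr_deriv hvelp
  have hys : ∀ c, HasDerivAt (fun s : ℝ => Y (0, p + s • c)) (Yd c) 0 := fun c =>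
    HasFDerivAt.comp_hasDerivAt_of_eq (0 : ℝ) hY1 (hl c) (by rw [hpz])
  have hEs : ∀ c, HasCovDerivAt g x₁ (fun s : ℝ => Y (0, p + s • c))
      (fun s : ℝ => sectionCoord (X 0) ε s₀ x₁ (p + s • c)) (Yd c) (Ed c) 0 := fun c => by
    refine (HasFDerivAt.comp_hasDerivAt_of_eq (0 : ℝ) hE (hl0 c) (by rw [hpz])).congr_deriv ?_
    simp only [hpz]
    exact (add_sub_cancel_right _ _).symm
  have hYt' : ∀ c : EuclideanSpace ℝ (Fin 2), Y (0, p + (0 : ℝ) • c) ∈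
      (extChartAt (𝓡 n) x₁).target := fun c => by rw [hpz]; exact hYt
  have hQs := fun c => (hEs c).endForm hO (hYt' c) (hys c)
  -- The mixed derivative of `Y`, from the derivative of the velocity `(id - O) ε` in direction `c`.
  have hmixed : ∀ c, fderiv ℝ (fderiv ℝ Y) (0, p) (0, c) (1, 0)
      = (Ed c - (N (Yd c) E + Q (Ed c))) - christoffelMap g x₁ (Y (0, p)) (Yd c) (E - Q E) := by
    intro c
    have h1 : HasDerivAt (fun s : ℝ => fderiv ℝ Y (0, p + s • c) (1, 0))
        (fderiv ℝ (fderiv ℝ Y) (0, p) (0, c) (1, 0)) 0 :=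
      ((HasFDerivAt.comp_hasDerivAt_of_eq (0 : ℝ) hY2 (hl c) (by rw [hpz])).clm_apply
        (hasDerivAt_const (0 : ℝ) ((1 : ℝ), (0 : EuclideanSpace ℝ (Fin 2))))).congr_deriv
        (by simp)
    have h2 := (hEs c).sub (hQs c)
    have h3 : (fun s : ℝ => fderiv ℝ Y (0, p + s • c) (1, 0)) =ᶠ[nhds 0] fun s =>
        sectionCoord (X 0) ε s₀ x₁ (p + s • c)
          - endForm O x₁ (Y (0, p + s • c)) (sectionCoord (X 0) ε s₀ x₁ (p + s • c)) := by
      have hc : ContinuousAt (fun s : ℝ => ((0 : ℝ), p + s • c)) 0 := (hl c).continuousAt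
      have hev := eventually_mem_source hX hp hx
      have hpz' : ((0 : ℝ), p) = (fun s : ℝ => ((0 : ℝ), p + s • c)) 0 := by simp
      rw [hpz'] at hev
      filter_upwards [hc.eventually hev] with s hs
      exact fderiv_chartMap_time O hX hvel hs.1 hs.2
    have h4 := h1.unique (HasDerivAt.congr_of_eventuallyEq h2 h3)
    rw [h4]
    simp only [hpz]
    rfl
  refine ⟨hyt, fun c => ?_, ?_⟩
  · have h1 : HasDerivAt (fun t : ℝ => fderiv ℝ Y (t, p) (0, c))
        (fderiv ℝ (fderiv ℝ Y) (0, p) (1, 0) (0, c)) 0 :=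
      ((HasFDerivAt.comp_hasDerivAt_of_eq (0 : ℝ) hY2 ht rfl).clm_apply
        (hasDerivAt_const (0 : ℝ) ((0 : ℝ), c))).congr_deriv (by simp)
    refine h1.congr_deriv ?_
    -- `∇_t ∂_c Y = ∇_c ∂_t Y`: second derivatives commute and the connection is torsion-free.
    rw [hsymm, hmixed, christoffelMap_symm g hYt]
  · have hder : ∀ c c', fderiv ℝ (fun q => gaugeOneForm g O (X 0) ε
        ((extChartAt (𝓡 2) s₀).symm q) (frameAt (𝓡 2) s₀ q c')) p c
        = metricForm g x₁ (Y (0, p)) (Ed c + (N (Yd c) E + Q (Ed c))) (Yd c')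
          + metricForm g x₁ (Y (0, p)) (E + Q E) (fderiv ℝ (fderiv ℝ Y) (0, p) (0, c) (0, c')
            + christoffelMap g x₁ (Y (0, p)) (Yd c) (Yd c')) := by
      intro c c'
      obtain ⟨h1, h2⟩ := gaugeOneForm_frameAt g O hX hε hO hp hx c'
      have h3 : HasCovDerivAt g x₁ (fun s : ℝ => Y (0, p + s • c))
          (fun s : ℝ => fderiv ℝ Y (0, p + s • c) (0, c')) (Yd c)
          (fderiv ℝ (fderiv ℝ Y) (0, p) (0, c) (0, c')
            + christoffelMap g x₁ (Y (0, p)) (Yd c) (Yd c')) 0 := by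
        refine ((HasFDerivAt.comp_hasDerivAt_of_eq (0 : ℝ) hY2 (hl c) (by rw [hpz])).clm_apply
          (hasDerivAt_const (0 : ℝ) ((0 : ℝ), c'))).congr_deriv ?_
        simp only [hpz]
        simp [Yd]
      have h4 := ((hEs c).add (hQs c)).metricForm (hYt' c) (hys c) h3
      have h5 := HasFDerivAt.comp_hasDerivAt_of_eq (0 : ℝ)
        (h2.differentiableAt (by norm_num)).hasFDerivAt (hl0 c) (hpz c).symm
      have hpz' : p = (fun s : ℝ => p + s • c) 0 := (hpz c).symm
      rw [hpz'] at h1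
      have h6 := ((hl0 c).continuousAt.eventually h1)
      have h7 := h5.unique (HasDerivAt.congr_of_eventuallyEq h4 h6)
      rw [h7]
      simp only [hpz]
      rfl
    intro c c'
    rw [hder, hder, hsymm, christoffelMap_symm g hYt (Yd c)]
    abel

end Variation

section GaugeInvariance

variable {n : ℕ} {M : Type*} [TopologicalSpace M] [ChartedSpace (EuclideanSpace ℝ (Fin n)) M]
  [IsManifold (𝓡 n) ∞ M]
  (g : Bundle.ContMDiffRiemannianMetric (𝓡 n) ∞ (EuclideanSpace ℝ (Fin n))
    (fun x : M => TangentSpace (𝓡 n) x))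
  (H : ∀ x : M, TangentSpace (𝓡 n) x [⋀^Fin 3]→L[ℝ] ℝ)
  (O : ∀ x : M, TangentSpace (𝓡 n) x →L[ℝ] TangentSpace (𝓡 n) x)
  {S : Type*} [TopologicalSpace S] [ChartedSpace (EuclideanSpace ℝ (Fin 2)) S]
  [IsManifold (𝓡 2) ∞ S] (L : LorentzianSurface S)
  {X : ℝ → S → M}
  (hX : ContMDiff (𝓘(ℝ, ℝ).prod (𝓡 2)) (𝓡 n) ∞ (fun q : ℝ × S => X q.1 q.2))
  {a : ∀ t σ, TangentSpace (𝓡 2) σ →L[ℝ] TangentSpace (𝓡 n) (X t σ)}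
  (ha : ContMDiff (𝓘(ℝ, ℝ).prod (𝓡 2).tangent) (𝓡 n).tangent ∞
    (fun q : ℝ × TangentBundle (𝓡 2) S =>
      (⟨X q.1 q.2.proj, a q.1 q.2.proj q.2.snd⟩ : TangentBundle (𝓡 n) M)))
  {ε : ∀ σ, TangentSpace (𝓡 n) (X 0 σ)}
  (hε : ContMDiff (𝓡 2) (𝓡 n).tangent ∞
    (fun σ : S => (⟨X 0 σ, ε σ⟩ : TangentBundle (𝓡 n) M)))
  (hO : IsSmoothEnd O)
  (hOg : ∀ (x : M) (u v : TangentSpace (𝓡 n) x), g.inner x (O x u) (O x v) = g.inner x u v)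
  (hD : IsDirac H (graph g O))
  (hvel : ∀ σ, mfderiv 𝓘(ℝ, ℝ) (𝓡 n) (fun t => X t σ) 0 (1 : ℝ) = ε σ - O (X 0 σ) (ε σ))
  (hcov : ∀ (σ : S) (v : TangentSpace (𝓡 2) σ),
    covAlong g (fun t => X t σ) (fun t => a t σ v) = gaugeVar L g H O (X 0) (a 0) ε σ v)
  {s₀ : S} {p : EuclideanSpace ℝ (Fin 2)}

/-- The bilinear form `(u, w) ↦ h(e, u, w)`. -/
noncomputable def contractFirst {V : Type*} [AddCommGroup V] [Module ℝ V] [TopologicalSpace V]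
    (h : V [⋀^Fin 3]→L[ℝ] ℝ) (e : V) : V →ₗ[ℝ] V →ₗ[ℝ] ℝ :=
  LinearMap.mk₂ ℝ (fun u w => h ![e, u, w]) (form_add_mid h e)
    (fun c u w => by
      simp only [formSlot_one, map_smul])
    (fun u w w' => form_add_right h e u w w')
    (fun c u w => by
      simp only [formSlot_two, map_smul])

lemma form_comp {V W : Type*} (f : V → W) (u v w : V) :
    (fun i => f ((![u, v, w] : Fin 3 → V) i)) = ![f u, f v, f w] := by
  funext i; fin_cases i <;> rfl

include hX ha hcov in
/-- The hypothesis on the variation of the gauge field, in the chart around `X 0 σ`. -/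
lemma hasCovDerivAt_gaugeField (hp : p ∈ (extChartAt (𝓡 2) s₀).target)
    {σ : S} (hσ : σ = (extChartAt (𝓡 2) s₀).symm p) (v : TangentSpace (𝓡 2) σ) :
    HasCovDerivAt g (X 0 σ) (fun t => extChartAt (𝓡 n) (X 0 σ) (X t σ))
      (fun t => coframe (𝓡 n) (X 0 σ) (X t σ) (a t σ v))
      (coframe (𝓡 n) (X 0 σ) (X 0 σ) (mfderiv 𝓘(ℝ, ℝ) (𝓡 n) (fun t => X t σ) 0 (1 : ℝ)))
      (coframe (𝓡 n) (X 0 σ) (X 0 σ) (gaugeVar L g H O (X 0) (a 0) ε σ v)) 0 := by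
  subst hσ
  rw [← hcov]
  refine hasCovDerivAt_covAlong g (c := fun t => X t ((extChartAt (𝓡 2) s₀).symm p))
    (V := fun t => a t ((extChartAt (𝓡 2) s₀).symm p) v) ?_
  have h1 := contDiffAt_coframe_gaugeField ha (t := 0) hp (mem_extChartAt_source _)
    (coframe (𝓡 2) s₀ _ v)
  have h2 := (h1.differentiableAt (by norm_num)).comp (0 : ℝ) (f := fun t : ℝ => (t, p))
    (by fun_prop)
  simp only [Function.comp_def, frameAt_coframe (𝓡 2) s₀ hp] at h2
  exact h2

include hX ha hcov in
/-- The gauge transformation is linear in the tangent vector, being the derivative of the linear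
maps `a t σ`. -/
lemma gaugeVar_linear (hp : p ∈ (extChartAt (𝓡 2) s₀).target)
    {σ : S} (hσ : σ = (extChartAt (𝓡 2) s₀).symm p) (c d : ℝ) (v w : TangentSpace (𝓡 2) σ) :
    coframe (𝓡 n) (X 0 σ) (X 0 σ) (gaugeVar L g H O (X 0) (a 0) ε σ (c • v + d • w))
      = c • coframe (𝓡 n) (X 0 σ) (X 0 σ) (gaugeVar L g H O (X 0) (a 0) ε σ v)
        + d • coframe (𝓡 n) (X 0 σ) (X 0 σ) (gaugeVar L g H O (X 0) (a 0) ε σ w) := by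
  have h := hasCovDerivAt_gaugeField g H O L hX ha hcov hp hσ
  have h1 := ((h v).smul c).add ((h w).smul d)
  have h2 := h (c • v + d • w)
  simp only [map_add, map_smul] at h2
  exact sub_left_injective (HasDerivAt.unique h2 h1)

/-- The part of the gauge transformation of the gauge field that does not involve `Θ`. -/
noncomputable def gaugeVarReduced (X : S → M)
    (a : ∀ σ, TangentSpace (𝓡 2) σ →L[ℝ] TangentSpace (𝓡 n) (X σ))
    (ε : ∀ σ, TangentSpace (𝓡 n) (X σ)) (σ : S) (v : TangentSpace (𝓡 2) σ) :
    TangentSpace (𝓡 n) (X σ) :=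
  covPull g X ε σ v
    - sharp g (X σ) (fun w =>
        g.inner (X σ) ((O (X σ)).inverse (nablaEnd g O (X σ) w (a σ v))) (ε σ))
    + (1 / 2 : ℝ) • sharp g (X σ)
        (fun w => H (X σ) ![a σ v - O (X σ) (a σ v), ε σ - O (X σ) (ε σ), w])

include hOg in
/-- Applying `(id + O) + (id - O) ∗` to the gauge transformation removes the operator `Θ`. -/
lemma opT_gaugeVar (X : S → M) (a : ∀ σ, TangentSpace (𝓡 2) σ →L[ℝ] TangentSpace (𝓡 n) (X σ))
    (ε : ∀ σ, TangentSpace (𝓡 n) (X σ)) (σ : S) (v : TangentSpace (𝓡 2) σ) :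
    opT L O σ (X σ) (gaugeVar L g H O X a ε σ) v
      = opT L O σ (X σ) (gaugeVarReduced g H O X a ε σ) v + gaugeInner L g H O X a ε σ v := by
  rw [← congrFun (opT_opTheta g O hOg L σ (X σ) (gaugeInner L g H O X a ε σ)) v]
  have h : ∀ v, gaugeVar L g H O X a ε σ v = gaugeVarReduced g H O X a ε σ v
    + opTheta L O σ (X σ) (gaugeInner L g H O X a ε σ) v := fun v => rfl
  simp only [opT, LorentzianSurface.star, h, map_add]
  abel

include hO hOg in
lemma metricForm_sharp_nablaEnd (x : M) (hPt : extChartAt (𝓡 n) x x ∈ (extChartAt (𝓡 n) x).target)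
    (u e : TangentSpace (𝓡 n) x) (w : EuclideanSpace ℝ (Fin n)) :
    metricForm g x (extChartAt (𝓡 n) x x) (coframe (𝓡 n) x x
        (sharp g x fun w => g.inner x ((O x).inverse (nablaEnd g O x w u)) e)) w
      = metricForm g x (extChartAt (𝓡 n) x x) (nablaEndBilin g O hPt w (coframe (𝓡 n) x x u))
        (endForm O x (extChartAt (𝓡 n) x x) (coframe (𝓡 n) x x e)) := by
  have hx : x ∈ (extChartAt (𝓡 n) x).source := mem_extChartAt_source _
  refine metricForm_coframe_sharp g x
    (l := ((metricForm g x (extChartAt (𝓡 n) x x)).flip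
      (endForm O x (extChartAt (𝓡 n) x x) (coframe (𝓡 n) x x e))).toLinearMap ∘ₗ
      (nablaEndBilin g O hPt).flip (coframe (𝓡 n) x x u)) (fun z => ?_) w
  rw [← hOg, (end_inverse g O hOg _ _).2, inner_eq_metricForm g hx, coframe_nablaEnd g O hO,
    coframe_endForm O hx]
  rfl

lemma metricForm_sharp_form (x : M) (u v : TangentSpace (𝓡 n) x) (w : EuclideanSpace ℝ (Fin n)) :
    metricForm g x (extChartAt (𝓡 n) x x) (coframe (𝓡 n) x x
        (sharp g x fun w => H x ![u, v, w])) w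
      = -contractFirst (formCoord H x (extChartAt (𝓡 n) x x)) (coframe (𝓡 n) x x v)
        (coframe (𝓡 n) x x u) w := by
  refine metricForm_coframe_sharp g x
    (l := -contractFirst (formCoord H x (extChartAt (𝓡 n) x x)) (coframe (𝓡 n) x x v)
        (coframe (𝓡 n) x x u)) (fun z => ?_) w
  rw [form_eq_formCoord H (mem_extChartAt_source x), form_comp, alternating_swap_left]
  rfl

include hX hε hO hOg in
/-- The reduced gauge transformation in charts. The base point `x` is a variable of its own, so that
terms whose types depend on it can be rewritten. -/
lemma metricForm_gaugeVarReduced (hp : p ∈ (extChartAt (𝓡 2) s₀).target)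
    (b : ∀ σ, TangentSpace (𝓡 2) σ →L[ℝ] TangentSpace (𝓡 n) (X 0 σ))
    (c : EuclideanSpace ℝ (Fin 2)) {x : M} (hx₁ : x = X 0 ((extChartAt (𝓡 2) s₀).symm p))
    {P : EuclideanSpace ℝ (Fin n)}
    (hP : P = chartMap (𝓡 2) X s₀ x (0, p)) (hPt : P ∈ (extChartAt (𝓡 n) x).target)
    {E : EuclideanSpace ℝ (Fin n)} (hE : E = sectionCoord (X 0) ε s₀ x p)
    {A : EuclideanSpace ℝ (Fin n)}
    (hA : A = coframe (𝓡 n) x _ (b ((extChartAt (𝓡 2) s₀).symm p) (frameAt (𝓡 2) s₀ p c)))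
    (w : EuclideanSpace ℝ (Fin n)) :
    metricForm g x P (coframe (𝓡 n) x _
        (gaugeVarReduced g H O (X 0) b ε ((extChartAt (𝓡 2) s₀).symm p) (frameAt (𝓡 2) s₀ p c))) w
      = metricForm g x P (fderiv ℝ (sectionCoord (X 0) ε s₀ x) p c
          + christoffelMap g x P (fderiv ℝ (chartMap (n := n) (𝓡 2) X s₀ x) (0, p) (0, c)) E) w
        - metricForm g x P (nablaEndBilin g O hPt w A) (endForm O x P E)
        - (1 / 2) * contractFirst (formCoord H x P) (E - endForm O x P E)
          (A - endForm O x P A) w := by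
  subst hx₁ hE hA
  have hx : X 0 ((extChartAt (𝓡 2) s₀).symm p) ∈
    (extChartAt (𝓡 n) (X 0 ((extChartAt (𝓡 2) s₀).symm p))).source := mem_extChartAt_source _
  rw [gaugeVarReduced, map_add, map_sub, map_smul, coframe_covPull g hε hp,
    coframe_mfderiv_frame hX hp hx]
  change P = extChartAt (𝓡 n) (X 0 ((extChartAt (𝓡 2) s₀).symm p))
    (X 0 ((extChartAt (𝓡 2) s₀).symm p)) at hP
  subst hP
  rw [map_add, map_sub, map_smul, add_apply, sub_apply, smul_apply,
    metricForm_sharp_nablaEnd g O hO hOg _ hPt, metricForm_sharp_form, map_sub, map_sub,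
    coframe_endForm O hx, coframe_endForm O hx, smul_eq_mul, mul_neg, ← sub_eq_add_neg]
  rfl

include hX hε hO hOg in
lemma gaugeVarReduced_linear (hp : p ∈ (extChartAt (𝓡 2) s₀).target)
    (b : ∀ σ, TangentSpace (𝓡 2) σ →L[ℝ] TangentSpace (𝓡 n) (X 0 σ))
    {x : M} (hx₁ : x = X 0 ((extChartAt (𝓡 2) s₀).symm p)) (k l : ℝ)
    (c d : EuclideanSpace ℝ (Fin 2)) :
    coframe (𝓡 n) x _ (gaugeVarReduced g H O (X 0) b ε ((extChartAt (𝓡 2) s₀).symm p)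
        (k • frameAt (𝓡 2) s₀ p c + l • frameAt (𝓡 2) s₀ p d))
      = k • coframe (𝓡 n) x _ (gaugeVarReduced g H O (X 0) b ε ((extChartAt (𝓡 2) s₀).symm p)
          (frameAt (𝓡 2) s₀ p c))
        + l • coframe (𝓡 n) x _ (gaugeVarReduced g H O (X 0) b ε ((extChartAt (𝓡 2) s₀).symm p)
          (frameAt (𝓡 2) s₀ p d)) := by
  have hx : X 0 ((extChartAt (𝓡 2) s₀).symm p) ∈ (extChartAt (𝓡 n) x).source := by
    rw [hx₁]; exact mem_extChartAt_source _
  have hPt : chartMap (n := n) (𝓡 2) X s₀ x (0, p) ∈ (extChartAt (𝓡 n) x).target :=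
    (extChartAt (𝓡 n) x).map_source hx
  have key := fun c => metricForm_gaugeVarReduced g H O hX hε hO hOg hp b c hx₁ rfl hPt rfl rfl
  refine eq_of_metricForm_eq g hPt fun w => ?_
  have h0 : ∀ k l : ℝ, ((0 : ℝ), k • c + l • d) = k • ((0 : ℝ), c) + l • ((0 : ℝ), d) := by
    intro k l; ext <;> simp
  rw [← map_smul, ← map_smul, ← map_add, key]
  simp only [map_add, map_smul, add_apply, smul_apply, key, h0, christoffelMap_add_left g hPt,
    christoffelMap_smul_left g hPt, map_sub, LinearMap.add_apply, LinearMap.smul_apply,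
    LinearMap.sub_apply, smul_eq_mul]
  ring

end GaugeInvariance

section GaugeInvariance

variable {n : ℕ} {M : Type*} [TopologicalSpace M] [ChartedSpace (EuclideanSpace ℝ (Fin n)) M]
  [IsManifold (𝓡 n) ∞ M]
  (g : Bundle.ContMDiffRiemannianMetric (𝓡 n) ∞ (EuclideanSpace ℝ (Fin n))
    (fun x : M => TangentSpace (𝓡 n) x))
  (H : ∀ x : M, TangentSpace (𝓡 n) x [⋀^Fin 3]→L[ℝ] ℝ)
  (O : ∀ x : M, TangentSpace (𝓡 n) x →L[ℝ] TangentSpace (𝓡 n) x)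
  {S : Type*} [TopologicalSpace S] [ChartedSpace (EuclideanSpace ℝ (Fin 2)) S]
  [IsManifold (𝓡 2) ∞ S] (L : LorentzianSurface S)
  {X : ℝ → S → M}
  (hX : ContMDiff (𝓘(ℝ, ℝ).prod (𝓡 2)) (𝓡 n) ∞ (fun q : ℝ × S => X q.1 q.2))
  {a : ∀ t σ, TangentSpace (𝓡 2) σ →L[ℝ] TangentSpace (𝓡 n) (X t σ)}
  (ha : ContMDiff (𝓘(ℝ, ℝ).prod (𝓡 2).tangent) (𝓡 n).tangent ∞
    (fun q : ℝ × TangentBundle (𝓡 2) S =>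
      (⟨X q.1 q.2.proj, a q.1 q.2.proj q.2.snd⟩ : TangentBundle (𝓡 n) M)))
  {ε : ∀ σ, TangentSpace (𝓡 n) (X 0 σ)}
  (hε : ContMDiff (𝓡 2) (𝓡 n).tangent ∞
    (fun σ : S => (⟨X 0 σ, ε σ⟩ : TangentBundle (𝓡 n) M)))
  (hO : IsSmoothEnd O)
  (hOg : ∀ (x : M) (u v : TangentSpace (𝓡 n) x), g.inner x (O x u) (O x v) = g.inner x u v)
  (hD : IsDirac H (graph g O))
  (hvel : ∀ σ, mfderiv 𝓘(ℝ, ℝ) (𝓡 n) (fun t => X t σ) 0 (1 : ℝ) = ε σ - O (X 0 σ) (ε σ))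
  (hcov : ∀ (σ : S) (v : TangentSpace (𝓡 2) σ),
    covAlong g (fun t => X t σ) (fun t => a t σ v) = gaugeVar L g H O (X 0) (a 0) ε σ v)
  {s₀ : S} {p : EuclideanSpace ℝ (Fin 2)}

include hX ha hε hO hOg hD hvel hcov in
/-- Under a gauge transformation, the variation of the Lagrangian and of the boundary term of the
Wess-Zumino term add up to the differential of `g((id + O) ε, dX)`. -/
theorem hasDerivAt_topCoeff_lagrangian (hp : p ∈ (extChartAt (𝓡 2) s₀).target) :
    HasDerivAt (fun t => topCoeff (𝓡 2) (lagrangian L g O (X t) (a t)) s₀ p)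
      (fderiv ℝ (fun q => gaugeOneForm g O (X 0) ε ((extChartAt (𝓡 2) s₀).symm q)
          (frameVec s₀ q 1)) p (EuclideanSpace.single 0 1)
        - fderiv ℝ (fun q => gaugeOneForm g O (X 0) ε ((extChartAt (𝓡 2) s₀).symm q)
          (frameVec s₀ q 0)) p (EuclideanSpace.single 1 1)
        - H (X 0 ((extChartAt (𝓡 2) s₀).symm p)) ![ε _ - O _ (ε _),
          mfderiv (𝓡 2) (𝓡 n) (X 0) _ (frameVec s₀ p 0),
          mfderiv (𝓡 2) (𝓡 n) (X 0) _ (frameVec s₀ p 1)]) 0 := by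
  -- All computations take place in the chart around the image point `x`.
  obtain ⟨x, hx₁⟩ : ∃ x, x = X 0 ((extChartAt (𝓡 2) s₀).symm p) := ⟨_, rfl⟩
  have hx : X 0 ((extChartAt (𝓡 2) s₀).symm p) ∈ (extChartAt (𝓡 n) x).source := by
    rw [hx₁]; exact mem_extChartAt_source _
  have hAd' : ∀ v, HasCovDerivAt g x (fun t => chartMap (n := n) (𝓡 2) X s₀ x (t, p))
      (fun t => coframe (𝓡 n) x (X t ((extChartAt (𝓡 2) s₀).symm p)) (a t _ v))
      (sectionCoord (X 0) ε s₀ x p - endForm O x (chartMap (n := n) (𝓡 2) X s₀ x (0, p))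
        (sectionCoord (X 0) ε s₀ x p))
      (coframe (𝓡 n) x _ (gaugeVar L g H O (X 0) (a 0) ε _ v)) 0 := by
    intro v
    have h1 := hasCovDerivAt_gaugeField g H O L hX ha hcov hp rfl v
    subst hx₁
    rw [hvel, map_sub, coframe_endForm O hx] at h1
    exact h1
  have hDlin : ∀ (k l : ℝ) v w, coframe (𝓡 n) x _ (gaugeVar L g H O (X 0) (a 0) ε
      ((extChartAt (𝓡 2) s₀).symm p) (k • v + l • w))
      = k • coframe (𝓡 n) x _ (gaugeVar L g H O (X 0) (a 0) ε _ v)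
        + l • coframe (𝓡 n) x _ (gaugeVar L g H O (X 0) (a 0) ε _ w) := by
    intro k l v w
    subst hx₁
    exact gaugeVar_linear g H O L hX ha hcov hp rfl k l v w
  have hBlin := gaugeVarReduced_linear g H O hX hε hO hOg hp (a 0) hx₁
  have hB := fun hPt c => metricForm_gaugeVarReduced g H O hX hε hO hOg hp (a 0) c hx₁ rfl hPt
    rfl rfl
  have hPt₀ : chartMap (n := n) (𝓡 2) X s₀ x (0, p) ∈ (extChartAt (𝓡 n) x).target :=
    (extChartAt (𝓡 n) x).map_source hx
  have hnab : ∀ w u, coframe (𝓡 n) x _ (nablaEnd g O (X 0 ((extChartAt (𝓡 2) s₀).symm p)) w u)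
      = nablaEndBilin g O hPt₀ (coframe (𝓡 n) x _ w) (coframe (𝓡 n) x _ u) := by
    intro w u
    subst hx₁
    exact coframe_nablaEnd g O hO _ w u
  have hsharp : ∀ u v w, metricForm g x (chartMap (n := n) (𝓡 2) X s₀ x (0, p))
      (coframe (𝓡 n) x _ (sharp g (X 0 ((extChartAt (𝓡 2) s₀).symm p)) fun w => H _ ![u, v, w])) w
      = -contractFirst (formCoord H x (chartMap (n := n) (𝓡 2) X s₀ x (0, p)))
        (coframe (𝓡 n) x _ v) (coframe (𝓡 n) x _ u) w := by
    intro u v w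
    subst hx₁
    exact metricForm_sharp_form g H _ u v w
  replace hB := hB hPt₀
  obtain ⟨hy, hYd, hγ⟩ := variation_calculus g O hX hε hO hvel hp hx
  rw [hγ]
  set P := chartMap (n := n) (𝓡 2) X s₀ x (0, p) with hP
  have hPt : P ∈ (extChartAt (𝓡 n) x).target := (extChartAt (𝓡 n) x).map_source hx
  set E := sectionCoord (X 0) ε s₀ x p with hE
  set Yd := fun c => fderiv ℝ (chartMap (n := n) (𝓡 2) X s₀ x) (0, p) (0, c) with hYd_def
  set Ed := fun c => fderiv ℝ (sectionCoord (X 0) ε s₀ x) p c + christoffelMap g x P (Yd c) E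
    with hEd
  set Q := endForm O x P with hQ
  set α := -L.metricCoeff s₀ 0 1 p / L.areaCoeff s₀ p with hα
  set β := L.metricCoeff s₀ 0 0 p / L.areaCoeff s₀ p with hβ
  set γ := -L.metricCoeff s₀ 1 1 p / L.areaCoeff s₀ p with hγ'
  obtain ⟨r₀, r₁⟩ := L.rot_frameVec hp
  set A := fun (t : ℝ) (i : Fin 2) => coframe (𝓡 n) x (X t ((extChartAt (𝓡 2) s₀).symm p))
    (a t _ (frameVec s₀ p i)) with hA
  set D := fun i : Fin 2 => coframe (𝓡 n) x (X 0 ((extChartAt (𝓡 2) s₀).symm p))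
    (gaugeVar L g H O (X 0) (a 0) ε _ (frameVec s₀ p i)) with hDi
  have hAd : ∀ i, HasCovDerivAt g x (fun t => chartMap (n := n) (𝓡 2) X s₀ x (t, p))
      (fun t => A t i) (E - Q E) (D i) 0 := by
    exact fun i => hAd' _
  have hlag : (fun t => topCoeff (𝓡 2) (lagrangian L g O (X t) (a t)) s₀ p) =ᶠ[nhds 0]
      fun t => localLagrangian (metricForm g x (chartMap (n := n) (𝓡 2) X s₀ x (t, p)))
        (endForm O x (chartMap (n := n) (𝓡 2) X s₀ x (t, p))) α β γ
        (fderiv ℝ (chartMap (n := n) (𝓡 2) X s₀ x) (t, p) (0, EuclideanSpace.single 0 1))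
        (fderiv ℝ (chartMap (n := n) (𝓡 2) X s₀ x) (t, p) (0, EuclideanSpace.single 1 1))
        (A t 0) (A t 1) := by
    have hc : ContinuousAt (fun t : ℝ => (t, p)) 0 := by fun_prop
    filter_upwards [hc.eventually (eventually_mem_source hX hp hx)] with t ht
    rw [topCoeff_lagrangian g O L ht.1 ht.2, coframe_mfderiv_frame hX ht.1 ht.2,
      coframe_mfderiv_frame hX ht.1 ht.2]
    rfl
  refine HasDerivAt.congr_of_eventuallyEq ?_ hlag
  refine (hasDerivAt_localLagrangian hO hOg hPt hy α β γ (hYd _) (hYd _) (hAd 0)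
    (hAd 1)).congr_deriv ?_
  -- the covariant derivative of the Lagrangian is given by the algebraic gauge identity
  have hz : ∀ i : Fin 2, ∃ ζ, Q ζ = Yd (EuclideanSpace.single i 1) - (A 0 i - Q (A 0 i)) ∧
      Q ζ = coframe (𝓡 n) x _ (covDiff O (X 0) (a 0) _ (frameVec s₀ p i)) := by
    intro i
    have h1 : coframe (𝓡 n) x _ (covDiff O (X 0) (a 0) _ (frameVec s₀ p i))
        = Yd (EuclideanSpace.single i 1) - (A 0 i - Q (A 0 i)) := by
      rw [covDiff, map_sub, map_sub, coframe_endForm O hx, coframe_mfderiv_frame hX hp hx]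
      rfl
    refine ⟨coframe (𝓡 n) x _ ((O _).inverse (covDiff O (X 0) (a 0) _ (frameVec s₀ p i))), ?_⟩
    have hQe := fun u => coframe_endForm O hx u
    have h2 : Q (coframe (𝓡 n) x _ ((O _).inverse (covDiff O (X 0) (a 0) _ (frameVec s₀ p i))))
        = coframe (𝓡 n) x _ (covDiff O (X 0) (a 0) _ (frameVec s₀ p i)) := by
      exact (hQe _).symm.trans (by rw [(end_inverse g O hOg _ _).2])
    exact ⟨h2.trans h1, h2⟩
  choose ζ hζ hζ' using hz
  set R := fun i : Fin 2 => coframe (𝓡 n) x _ (sharp g (X 0 ((extChartAt (𝓡 2) s₀).symm p))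
    fun w => H _ ![covDiff O (X 0) (a 0) _ (frameVec s₀ p i), ε _ - O _ (ε _), w]) with hR
  set B := fun i : Fin 2 => coframe (𝓡 n) x _ (gaugeVarReduced g H O (X 0) (a 0) ε
    ((extChartAt (𝓡 2) s₀).symm p) (frameVec s₀ p i)) with hBdef
  have hεx : coframe (𝓡 n) x _ (ε ((extChartAt (𝓡 2) s₀).symm p) - O _ (ε _)) = E - Q E := by
    rw [map_sub, coframe_endForm O hx]; rfl
  have hQe : ∀ u, coframe (𝓡 n) x _ (O (X 0 ((extChartAt (𝓡 2) s₀).symm p)) u)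
      = Q (coframe (𝓡 n) x _ u) := fun u => coframe_endForm O hx u
  have hEe : coframe (𝓡 n) x _ (ε ((extChartAt (𝓡 2) s₀).symm p)) = E := rfl
  have hDi' : ∀ i, coframe (𝓡 n) x _ (gaugeVar L g H O (X 0) (a 0) ε
    ((extChartAt (𝓡 2) s₀).symm p) (frameVec s₀ p i)) = D i := fun i => rfl
  have hBi' : ∀ i, coframe (𝓡 n) x _ (gaugeVarReduced g H O (X 0) (a 0) ε
    ((extChartAt (𝓡 2) s₀).symm p) (frameVec s₀ p i)) = B i := fun i => rfl
  have hRi' : ∀ i, coframe (𝓡 n) x _ (sharp g (X 0 ((extChartAt (𝓡 2) s₀).symm p))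
    fun w => H _ ![covDiff O (X 0) (a 0) _ (frameVec s₀ p i), ε _ - O _ (ε _), w]) = R i :=
    fun i => rfl
  -- `opT_gaugeVar` on a coordinate vector `f` with `∗f = k ∂₀ + l ∂₁`.
  have hd : ∀ (f : TangentSpace (𝓡 2) ((extChartAt (𝓡 2) s₀).symm p)) (i : Fin 2) (k l : ℝ),
      f = frameVec s₀ p i → L.rot _ f = k • frameVec s₀ p 0 + l • frameVec s₀ p 1 →
      D i + Q (D i) + (k • D 0 + l • D 1) - Q (k • D 0 + l • D 1)
        = B i + Q (B i) + (k • B 0 + l • B 1) - Q (k • B 0 + l • B 1)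
          + ((1 / 2 : ℝ) • R i + (nablaEndBilin g O hPt (Q (ζ i)) E
            - (k • nablaEndBilin g O hPt (Q (ζ 0)) E
              + l • nablaEndBilin g O hPt (Q (ζ 1)) E))) := by
    intro f i k l hf hrot
    have h1 := congrArg (coframe (𝓡 n) x _) (opT_gaugeVar g H O L hOg (X 0) (a 0) ε _ f)
    have hcd : covDiff O (X 0) (a 0) _ (k • frameVec s₀ p 0 + l • frameVec s₀ p 1)
        = k • covDiff O (X 0) (a 0) _ (frameVec s₀ p 0)
          + l • covDiff O (X 0) (a 0) _ (frameVec s₀ p 1) := by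
      simp only [covDiff, map_add, map_smul]; module
    subst hf
    simp only [opT, gaugeInner, LorentzianSurface.star, hrot, map_add, map_sub, map_smul,
      hQe, hDlin, hBlin, hnab, hcd, hEe, hDi', hBi', hRi', ← hζ', LinearMap.add_apply,
      LinearMap.smul_apply] at h1 ⊢
    refine Eq.trans ?_ (h1.trans ?_) <;> module
  have hq : ∀ u w, contractFirst (formCoord H x P) (E - Q E) u w
      = -contractFirst (formCoord H x P) (E - Q E) w u := fun u w =>
    alternating_swap_right (formCoord H x P) (E - Q E) u w
  have hH : H (X 0 ((extChartAt (𝓡 2) s₀).symm p)) ![ε _ - O _ (ε _),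
      mfderiv (𝓡 2) (𝓡 n) (X 0) _ (frameVec s₀ p 0), mfderiv (𝓡 2) (𝓡 n) (X 0) _ (frameVec s₀ p 1)]
      = contractFirst (formCoord H x P) (E - Q E) (Yd (EuclideanSpace.single 0 1))
        (Yd (EuclideanSpace.single 1 1)) := by
    rw [form_eq_formCoord H hx, form_comp, hεx, coframe_mfderiv_frame hX hp hx,
      coframe_mfderiv_frame hX hp hx]
    rfl
  have hd₀ := hd _ 0 α β rfl r₀
  have hd₁ := hd _ 1 γ (-α) rfl (by rw [r₁, neg_smul, ← sub_eq_add_neg])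
  simp only [neg_smul, ← sub_eq_add_neg] at hd₁
  have hyx : ∀ i, Yd (EuclideanSpace.single i 1) = Q (ζ i) + (A 0 i - Q (A 0 i)) := fun i => by
    rw [hζ, sub_add_cancel]
  have key := gauge_identity (metricForm g x P) Q (nablaEndBilin g O hPt)
    (contractFirst (formCoord H x P) (E - Q E)) E (metricForm_symm g P)
    (metricForm_endForm g O hOg hPt) (metricForm_nablaEndMap g O hO hOg hPt) hq
    (fun u w => integrability g H O hO hOg hD hPt E u w)
    α β γ (ζ 0) (ζ 1) (A 0 0) (A 0 1) (D 0) (D 1) (B 0) (B 1) (R 0) (R 1) _ _ (Ed _) (Ed _) _ _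
    (hyx 0) (hyx 1) rfl rfl (hB _) (hB _)
    (fun w => by rw [hR, hsharp, hεx, hζ']) (fun w => by rw [hR, hsharp, hεx, hζ']) hd₀ hd₁
  rw [hH, eq_sub_iff_add_eq]
  rw [← hζ 0, ← hζ 1]
  exact key

end GaugeInvariance

/-! ### The measure of a volume form -/

section VolMeasure

variable {d : ℕ} {B : Type*} [TopologicalSpace B]
  {I : ModelWithCorners ℝ (EuclideanSpace ℝ (Fin d)) B}
  {Q : Type*} [TopologicalSpace Q] [ChartedSpace B Q]

lemma measurableSet_chart_target (x₀ : Q) : MeasurableSet (extChartAt I x₀).target := by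
  rw [extChartAt_target]
  exact ((chartAt B x₀).open_target.preimage I.continuous_symm).measurableSet.inter
    I.isClosed_range.measurableSet

lemma measurableSet_symm_preimage_inter [MeasurableSpace Q] [BorelSpace Q] (x₀ : Q) {D : Set Q}
    (hD : MeasurableSet D) :
    MeasurableSet ((extChartAt I x₀).symm ⁻¹' D ∩ (extChartAt I x₀).target) := by
  have h1 : Measurable ((extChartAt I x₀).target.domRestrict (extChartAt I x₀).symm) :=
    (continuousOn_iff_continuous_domRestrict.1 (continuousOn_extChartAt_symm x₀)).measurable
  have h2 := (measurableSet_chart_target (I := I) x₀).subtype_image (h1 hD)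
  convert h2 using 1
  ext p
  simp [and_comm]

lemma exists_chart_cover [SecondCountableTopology Q] [Nonempty Q] :
    ∃ c : ℕ → Q, ⋃ k, (extChartAt I (c k)).source = univ := by
  obtain ⟨s, hs, hU⟩ := TopologicalSpace.countable_cover_nhds
    (fun x : Q => extChartAt_source_mem_nhds (I := I) x)
  obtain ⟨c, hc⟩ := hs.exists_eq_range (by
    by_contra h
    rw [not_nonempty_iff_eq_empty] at h
    subst h
    simp only [mem_empty_iff_false, iUnion_of_empty, iUnion_empty] at hU
    exact empty_ne_univ hU)
  refine ⟨c, ?_⟩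
  rw [← hU, hc, biUnion_range]

/-- Change of variables along an injective map `Φ` from a part `U` of a manifold to `ℝ^d`: if, in
every chart, the density `f |vol|` is the pull-back of the density `G dx` along `Φ`, then both have
the same integral. -/
lemma setLIntegral_volMeasure_eq [SecondCountableTopology Q] [MeasurableSpace Q] [BorelSpace Q]
    {vol : ∀ x : Q, (Fin d → TangentSpace I x) → ℝ}
    (hvol : ∀ x₀ : Q, ContinuousOn (topCoeff I vol x₀) (extChartAt I x₀).target)
    {U : Set Q} (hU : MeasurableSet U) {Φ : Q → EuclideanSpace ℝ (Fin d)} (hΦ : InjOn Φ U)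
    {f : Q → ENNReal} (hf : Measurable f) {G : EuclideanSpace ℝ (Fin d) → ENNReal}
    (h : ∀ x₀ : Q, ∀ p ∈ (extChartAt I x₀).target, (extChartAt I x₀).symm p ∈ U →
      ∃ A : EuclideanSpace ℝ (Fin d) →L[ℝ] EuclideanSpace ℝ (Fin d),
        HasFDerivWithinAt (Φ ∘ (extChartAt I x₀).symm) A (range I) p ∧
        f ((extChartAt I x₀).symm p) * ENNReal.ofReal |topCoeff I vol x₀ p|
          = G (Φ ((extChartAt I x₀).symm p)) * ENNReal.ofReal |A.det|) :
    MeasurableSet (Φ '' U) ∧ ∫⁻ x in U, f x ∂(volMeasure I vol) = ∫⁻ p in Φ '' U, G p := by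
  rcases isEmpty_or_nonempty Q with hQ | hQ
  · have : U = ∅ := Set.eq_empty_of_isEmpty U
    subst this
    simp
  choose! A hA using h
  have hc := exists_chart_cover (I := I) (Q := Q)
  set c := hc.choose with hcdef
  have hcover : ⋃ k, (extChartAt I (c k)).source = univ := hc.choose_spec
  have hvm : volMeasure I vol = Measure.sum fun k =>
      ((((volume.restrict (extChartAt I (c k)).target).withDensity fun p =>
          ENNReal.ofReal |topCoeff I vol (c k) p|).map
            (extChartAt I (c k)).symm).restrict
        (disjointed (fun l => (extChartAt I (c l)).source) k)) := by
    rw [volMeasure, dif_pos hc]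
  set D : ℕ → Set Q := disjointed (fun l => (extChartAt I (c l)).source) with hDdef
  have hDm : ∀ k, MeasurableSet (D k) := fun k =>
    MeasurableSet.disjointed (fun l => (isOpen_extChartAt_source (c l)).measurableSet) k
  have hDs : ∀ k, D k ⊆ (extChartAt I (c k)).source := fun k => disjointed_subset _ k
  have hDd : Pairwise (Function.onFun Disjoint D) := disjoint_disjointed _
  have hDU : ⋃ k, D k = univ := by rw [hDdef, iUnion_disjointed, hcover]
  -- The part of `U` that the definition of `volMeasure` assigns to the chart number `k`.
  set P : ℕ → Set (EuclideanSpace ℝ (Fin d)) := fun k =>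
    (extChartAt I (c k)).symm ⁻¹' (D k ∩ U) ∩ (extChartAt I (c k)).target with hPdef
  have hPm : ∀ k, MeasurableSet (P k) := fun k =>
    measurableSet_symm_preimage_inter (c k) ((hDm k).inter hU)
  have hder : ∀ k, ∀ p ∈ P k,
      HasFDerivWithinAt (Φ ∘ (extChartAt I (c k)).symm) (A (c k) p) (P k) p := fun k p hp =>
    (hA (c k) p hp.2 hp.1.2).1.mono fun q hq => extChartAt_target_subset_range _ hq.2
  have hinj : ∀ k, InjOn (Φ ∘ (extChartAt I (c k)).symm) (P k) := fun k p hp q hq hpq =>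
    (extChartAt I (c k)).symm.injOn hp.2 hq.2 (hΦ hp.1.2 hq.1.2 hpq)
  have himg : ∀ k, Φ ∘ (extChartAt I (c k)).symm '' P k = Φ '' (D k ∩ U) := by
    intro k
    rw [image_comp]
    congr 1
    ext y
    constructor
    · rintro ⟨p, hp, rfl⟩
      exact hp.1
    · intro hy
      have hy' := hDs k hy.1
      exact ⟨extChartAt I (c k) y, ⟨by
        rw [mem_preimage, (extChartAt I (c k)).left_inv hy']; exact hy,
        (extChartAt I (c k)).map_source hy'⟩, (extChartAt I (c k)).left_inv hy'⟩
  have himgm : ∀ k, MeasurableSet (Φ '' (D k ∩ U)) := fun k => by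
    rw [← himg k]
    exact measurable_image_of_fderivWithin (hPm k) (hder k) (hinj k)
  have hUU : ⋃ k, Φ '' (D k ∩ U) = Φ '' U := by
    rw [← image_iUnion, ← iUnion_inter, hDU, univ_inter]
  refine ⟨hUU ▸ MeasurableSet.iUnion himgm, ?_⟩
  rw [← hUU, lintegral_iUnion himgm, hvm, Measure.restrict_sum _ hU, lintegral_sum_measure]
  swap
  · intro k l hkl
    refine Set.disjoint_left.2 ?_
    rintro _ ⟨x, hx, rfl⟩ ⟨y, hy, hxy⟩
    have := hΦ hy.2 hx.2 hxy
    subst this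
    exact Set.disjoint_left.1 (hDd hkl) hx.1 hy.1
  congr 1
  funext k
  have hTm := measurableSet_chart_target (I := I) (c k)
  have hae : AEMeasurable (extChartAt I (c k)).symm
      ((volume.restrict (extChartAt I (c k)).target).withDensity fun p =>
          ENNReal.ofReal |topCoeff I vol (c k) p|) :=
    ((continuousOn_extChartAt_symm (c k)).aemeasurable hTm).mono_ac
      (withDensity_absolutelyContinuous _ _)
  have hρ : AEMeasurable (fun p => ENNReal.ofReal |topCoeff I vol (c k) p|)
      (volume.restrict (P k)) :=
    (((hvol (c k)).mono (inter_subset_right)).abs.aemeasurable (hPm k)).ennreal_ofReal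
  rw [Measure.restrict_restrict hU, inter_comm U, Measure.restrict_map_of_aemeasurable hae
    ((hDm k).inter hU), restrict_withDensity', Measure.restrict_restrict' hTm]
  have hsymm : AEMeasurable (extChartAt I (c k)).symm (volume.restrict (P k)) :=
    ((continuousOn_extChartAt_symm (c k)).mono inter_subset_right).aemeasurable (hPm k)
  rw [lintegral_map' hf.aemeasurable (hsymm.mono_ac (withDensity_absolutelyContinuous _ _)),
    (show (∫⁻ p, f ((extChartAt I (c k)).symm p) ∂_ : ENNReal) = _ from
      lintegral_withDensity_eq_lintegral_mul₀ hρ (hf.comp_aemeasurable hsymm)), ← himg k,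
    lintegral_image_eq_lintegral_abs_det_fderiv_mul volume (hPm k) (hder k) (hinj k)]
  refine setLIntegral_congr_fun (hPm k) fun p hp => ?_
  have := (hA (c k) p hp.2 hp.1.2).2
  simp only [Pi.mul_apply, Function.comp_apply]
  rw [mul_comm, this, mul_comm]

/-- Change of variables for real integrands. It needs no integrability: the two sides are integrable
at the same time. -/
lemma setIntegral_volMeasure_eq [SecondCountableTopology Q] [MeasurableSpace Q] [BorelSpace Q]
    {vol : ∀ x : Q, (Fin d → TangentSpace I x) → ℝ}
    (hvol : ∀ x₀ : Q, ContinuousOn (topCoeff I vol x₀) (extChartAt I x₀).target)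
    {U : Set Q} (hU : MeasurableSet U) {Φ : Q → EuclideanSpace ℝ (Fin d)} (hΦ : InjOn Φ U)
    {F : Q → ℝ} (hF : Measurable F) {G : EuclideanSpace ℝ (Fin d) → ℝ}
    (hG : ContinuousOn G (Φ '' U))
    (h : ∀ x₀ : Q, ∀ p ∈ (extChartAt I x₀).target, (extChartAt I x₀).symm p ∈ U →
      ∃ A : EuclideanSpace ℝ (Fin d) →L[ℝ] EuclideanSpace ℝ (Fin d),
        HasFDerivWithinAt (Φ ∘ (extChartAt I x₀).symm) A (range I) p ∧
        F ((extChartAt I x₀).symm p) * |topCoeff I vol x₀ p|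
          = G (Φ ((extChartAt I x₀).symm p)) * |A.det|) :
    MeasurableSet (Φ '' U) ∧ ∫ x in U, F x ∂(volMeasure I vol) = ∫ p in Φ '' U, G p := by
  -- Apply the previous lemma to the positive part, the negative part and the absolute value.
  have key : ∀ m : ℝ → ℝ, Measurable m → (∀ x r : ℝ, 0 ≤ r → m (x * r) = m x * r) →
      MeasurableSet (Φ '' U) ∧ ∫⁻ x in U, ENNReal.ofReal (m (F x)) ∂(volMeasure I vol)
        = ∫⁻ p in Φ '' U, ENNReal.ofReal (m (G p)) := by
    intro m hm hmul
    refine setLIntegral_volMeasure_eq hvol hU hΦ (hm.comp hF).ennreal_ofReal fun x₀ p hp hpU => ?_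
    obtain ⟨A, hA, he⟩ := h x₀ p hp hpU
    refine ⟨A, hA, ?_⟩
    rw [← ENNReal.ofReal_mul' (abs_nonneg _), ← ENNReal.ofReal_mul' (abs_nonneg _),
      Function.comp_apply, ← hmul _ _ (abs_nonneg _), ← hmul _ _ (abs_nonneg _), he]
  obtain ⟨hm, hpos⟩ := key id measurable_id fun _ _ _ => rfl
  obtain ⟨-, hneg⟩ := key (fun x => -x) measurable_neg fun x r _ => by ring
  obtain ⟨-, habs⟩ := key (fun x => |x|) measurable_id.abs fun x r hr => by
    rw [abs_mul, abs_of_nonneg hr]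
  refine ⟨hm, ?_⟩
  have hGm : AEStronglyMeasurable G (volume.restrict (Φ '' U)) := hG.aestronglyMeasurable hm
  have hint : Integrable F ((volMeasure I vol).restrict U) ↔
      Integrable G (volume.restrict (Φ '' U)) := by
    have h1 : ∀ {α : Type _} [MeasurableSpace α] {ν : Measure α} {f : α → ℝ},
        AEStronglyMeasurable f ν → (Integrable f ν ↔ ∫⁻ x, ENNReal.ofReal |f x| ∂ν < ⊤) := by
      intro α _ ν f hf
      rw [Integrable, and_iff_right hf, hasFiniteIntegral_iff_norm]
      rfl
    rw [h1 hGm, ← habs, Integrable, and_iff_right hF.aestronglyMeasurable,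
      hasFiniteIntegral_iff_norm]
    rfl
  by_cases hi : Integrable F ((volMeasure I vol).restrict U)
  · rw [integral_eq_lintegral_pos_part_sub_lintegral_neg_part hi,
      integral_eq_lintegral_pos_part_sub_lintegral_neg_part (hint.1 hi)]
    simp only [id] at hpos
    rw [hpos, hneg]
  · rw [integral_undef hi, integral_undef fun h => hi (hint.2 h)]

end VolMeasure

section ChartFormula

variable {d : ℕ} {B : Type*} [TopologicalSpace B]
  {I : ModelWithCorners ℝ (EuclideanSpace ℝ (Fin d)) B}
  {Q : Type*} [TopologicalSpace Q] [ChartedSpace B Q]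

/-- A continuous volume form: a field of non-zero alternating forms of top degree whose coefficients
in charts are continuous. -/
structure IsVolumeForm (vol : ∀ x : Q, (Fin d → TangentSpace I x) → ℝ) : Prop where
  alternating : ∀ x, ∃ f : TangentSpace I x [⋀^Fin d]→ₗ[ℝ] ℝ, ∀ w, vol x w = f w
  ne_zero : ∀ x₀ : Q, ∀ p ∈ (extChartAt I x₀).target, topCoeff I vol x₀ p ≠ 0
  continuousOn : ∀ x₀ : Q, ContinuousOn (topCoeff I vol x₀) (extChartAt I x₀).target

lemma alternating_comp_frame {V : Type*} [AddCommGroup V] [Module ℝ V]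
    (f : V [⋀^Fin d]→ₗ[ℝ] ℝ) (F : EuclideanSpace ℝ (Fin d) →ₗ[ℝ] V)
    (A : EuclideanSpace ℝ (Fin d) →L[ℝ] EuclideanSpace ℝ (Fin d)) :
    f (fun i => F (A (EuclideanSpace.single i 1)))
      = A.det * f fun i => F (EuclideanSpace.single i 1) := by
  have hb : ∀ i, (EuclideanSpace.basisFun (Fin d) ℝ).toBasis i = EuclideanSpace.single i (1 : ℝ) :=
    fun i => by simp
  have h1 := AlternatingMap.eq_smul_basis_det (EuclideanSpace.basisFun (Fin d) ℝ).toBasis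
    (f.compLinearMap F)
  have h2 := Module.Basis.det_comp (EuclideanSpace.basisFun (Fin d) ℝ).toBasis
    (A : EuclideanSpace ℝ (Fin d) →ₗ[ℝ] EuclideanSpace ℝ (Fin d))
    (fun i => EuclideanSpace.single i (1 : ℝ))
  have h3 := DFunLike.congr_fun h1 fun i => A (EuclideanSpace.single i 1)
  have h4 : (EuclideanSpace.basisFun (Fin d) ℝ).toBasis.det
      (fun i => EuclideanSpace.single i (1 : ℝ)) = 1 := by
    rw [← funext hb]
    exact Module.Basis.det_self _
  have h5 : (⇑(EuclideanSpace.basisFun (Fin d) ℝ).toBasis)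
      = fun i => EuclideanSpace.single i (1 : ℝ) := funext hb
  rw [h4, mul_one] at h2
  simp only [AlternatingMap.compLinearMap_apply, AlternatingMap.smul_apply, smul_eq_mul, h5] at h3
  rw [mul_comm]
  refine h3.trans ?_
  congr 1

variable [IsManifold I ∞ Q]

lemma frameAt_coframe_frameAt {x₀ x₁ : Q} {p : EuclideanSpace ℝ (Fin d)}
    (h1 : (extChartAt I x₁).symm p ∈ (extChartAt I x₀).source) (c : EuclideanSpace ℝ (Fin d)) :
    (frameAt I x₀ (extChartAt I x₀ ((extChartAt I x₁).symm p))
      (coframe I x₀ ((extChartAt I x₁).symm p) (frameAt I x₁ p c)) :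
        TangentSpace I ((extChartAt I x₁).symm p)) = frameAt I x₁ p c :=
  frameAt_coframe' I x₀ h1 _

/-- The differential of a change of charts. -/
lemma hasFDerivWithinAt_chart_change {x₀ x₁ : Q} {p : EuclideanSpace ℝ (Fin d)}
    (hp : p ∈ (extChartAt I x₁).target)
    (h1 : (extChartAt I x₁).symm p ∈ (extChartAt I x₀).source) :
    HasFDerivWithinAt (extChartAt I x₀ ∘ (extChartAt I x₁).symm)
      ((coframe I x₀ ((extChartAt I x₁).symm p)).comp (frameAt I x₁ p)) (range I) p := by
  have : IsManifold I 1 Q := IsManifold.of_le (n := ∞) (by norm_num)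
  have h2 : MDifferentiableAt I 𝓘(ℝ, EuclideanSpace ℝ (Fin d)) (extChartAt I x₀)
      ((extChartAt I x₁).symm p) := mdifferentiableAt_extChartAt (by rwa [extChartAt_source] at h1)
  have h3 := h2.hasMFDerivAt.comp_hasMFDerivWithinAt p
    (mdifferentiableWithinAt_extChartAt_symm hp).hasMFDerivWithinAt
  exact h3.hasFDerivWithinAt

/-- The same tangent frames, seen from two charts. -/
lemma alternating_frame_change {x₀ x₁ : Q} {p : EuclideanSpace ℝ (Fin d)}
    (h1 : (extChartAt I x₁).symm p ∈ (extChartAt I x₀).source)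
    (f : TangentSpace I ((extChartAt I x₁).symm p) [⋀^Fin d]→ₗ[ℝ] ℝ) :
    f (fun i => frameAt I x₁ p (EuclideanSpace.single i 1))
      = ((coframe I x₀ ((extChartAt I x₁).symm p)).comp (frameAt I x₁ p)).det *
        f (fun i => (frameAt I x₀ (extChartAt I x₀ ((extChartAt I x₁).symm p))
          (EuclideanSpace.single i 1) : TangentSpace I ((extChartAt I x₁).symm p))) := by
  let T : EuclideanSpace ℝ (Fin d) →L[ℝ] TangentSpace I ((extChartAt I x₁).symm p) :=
    (frameAt I x₀ (extChartAt I x₀ ((extChartAt I x₁).symm p)) :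
      EuclideanSpace ℝ (Fin d) →L[ℝ] EuclideanSpace ℝ (Fin d))
  have := alternating_comp_frame f (T : EuclideanSpace ℝ (Fin d) →ₗ[ℝ] _)
    ((coframe I x₀ ((extChartAt I x₁).symm p)).comp (frameAt I x₁ p))
  refine Eq.trans ?_ this
  congr 1
  funext i
  exact (frameAt_coframe_frameAt h1 _).symm

lemma topCoeff_apply_chart (α : ∀ x : Q, (Fin d → TangentSpace I x) → ℝ) {x₀ y : Q}
    (hy : y ∈ (extChartAt I x₀).source) :
    topCoeff I α x₀ (extChartAt I x₀ y) = α y fun i =>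
      (frameAt I x₀ (extChartAt I x₀ y) (EuclideanSpace.single i 1) : TangentSpace I y) := by
  unfold topCoeff
  rw [(extChartAt I x₀).left_inv hy]

/-- The coefficient of a top-degree form transforms with the Jacobian determinant. -/
lemma topCoeff_change {vol : ∀ x : Q, (Fin d → TangentSpace I x) → ℝ}
    {x₀ x₁ : Q} {p : EuclideanSpace ℝ (Fin d)}
    (hvol : ∃ f : TangentSpace I ((extChartAt I x₁).symm p) [⋀^Fin d]→ₗ[ℝ] ℝ,
      ∀ w, vol ((extChartAt I x₁).symm p) w = f w)
    (h1 : (extChartAt I x₁).symm p ∈ (extChartAt I x₀).source) :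
    topCoeff I vol x₁ p
      = ((coframe I x₀ ((extChartAt I x₁).symm p)).comp (frameAt I x₁ p)).det *
        topCoeff I vol x₀ (extChartAt I x₀ ((extChartAt I x₁).symm p)) := by
  obtain ⟨f, hf⟩ := hvol
  refine (hf _).trans ((alternating_frame_change h1 f).trans ?_)
  rw [topCoeff_apply_chart vol h1]
  exact congrArg _ (hf _).symm

variable [SecondCountableTopology Q] [MeasurableSpace Q] [BorelSpace Q]
  {vol : ∀ x : Q, (Fin d → TangentSpace I x) → ℝ}

/-- The integral of a function supported in a chart domain, in this chart. -/
lemma integral_volMeasure_chart (hvol : IsVolumeForm vol) (x₀ : Q) {F : Q → ℝ}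
    (hF : Continuous F) (hFs : Function.support F ⊆ (extChartAt I x₀).source) :
    ∫ x, F x ∂(volMeasure I vol) = ∫ p in (extChartAt I x₀).target,
      F ((extChartAt I x₀).symm p) * |topCoeff I vol x₀ p| := by
  have himg : extChartAt I x₀ '' (extChartAt I x₀).source = (extChartAt I x₀).target :=
    (extChartAt I x₀).image_source_eq_target
  have h := (setIntegral_volMeasure_eq hvol.continuousOn
    (isOpen_extChartAt_source (I := I) x₀).measurableSet (extChartAt I x₀).injOn hF.measurable
    (G := fun p => F ((extChartAt I x₀).symm p) * |topCoeff I vol x₀ p|) ?_ ?_).2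
  · rw [himg, setIntegral_eq_integral_of_forall_compl_eq_zero] at h
    · exact h
    · intro x hx
      by_contra h0
      exact hx (hFs h0)
  · rw [himg]
    exact (hF.comp_continuousOn (continuousOn_extChartAt_symm x₀)).mul (hvol.continuousOn x₀).abs
  · intro x₁ p hp hpU
    refine ⟨_, hasFDerivWithinAt_chart_change hp hpU, ?_⟩
    rw [(extChartAt I x₀).left_inv hpU, topCoeff_change (hvol.alternating _) hpU, abs_mul]
    ring

/-- Near a point, the measure is bounded by a multiple of Lebesgue measure in a ball of a chart. -/
lemma isFiniteMeasureOnCompacts_volMeasure (hvol : IsVolumeForm vol) :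
    IsFiniteMeasureOnCompacts (volMeasure I vol) := by
  have : IsLocallyFiniteMeasure (volMeasure I vol) := by
    refine ⟨fun x₀ => ?_⟩
    set C := |topCoeff I vol x₀ (extChartAt I x₀ x₀)| + 1 with hC
    set U : Set Q := (extChartAt I x₀).source ∩ {y | extChartAt I x₀ y ∈
      Metric.ball (extChartAt I x₀ x₀) 1 ∧ |topCoeff I vol x₀ (extChartAt I x₀ y)| < C} with hU
    have hcont : ContinuousOn (fun y => |topCoeff I vol x₀ (extChartAt I x₀ y)|)
        (extChartAt I x₀).source :=
      ((hvol.continuousOn x₀).comp (continuousOn_extChartAt x₀)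
        fun y hy => (extChartAt I x₀).map_source hy).abs
    have hopen : IsOpen U := by
      have h1 := (continuousOn_extChartAt (I := I) x₀).isOpen_inter_preimage
        (isOpen_extChartAt_source x₀) (Metric.isOpen_ball (x := extChartAt I x₀ x₀) (ε := 1))
      have h2 := hcont.isOpen_inter_preimage (isOpen_extChartAt_source x₀) (isOpen_Iio (a := C))
      convert h1.inter h2 using 1
      ext y
      simp only [hU, mem_inter_iff, mem_ofPred_eq, mem_preimage, mem_Iio]
      tauto
    have hx : x₀ ∈ U := ⟨mem_extChartAt_source x₀, Metric.mem_ball_self one_pos, by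
      rw [hC]; linarith⟩
    refine ⟨U, hopen.mem_nhds hx, ?_⟩
    have h := (setLIntegral_volMeasure_eq hvol.continuousOn hopen.measurableSet
      ((extChartAt I x₀).injOn.mono inter_subset_left) (f := fun _ => 1) measurable_const
      (G := fun p => ENNReal.ofReal |topCoeff I vol x₀ p|) ?_).2
    · rw [setLIntegral_one] at h
      rw [h]
      calc ∫⁻ p in extChartAt I x₀ '' U, ENNReal.ofReal |topCoeff I vol x₀ p|
          ≤ ∫⁻ p in extChartAt I x₀ '' U, ENNReal.ofReal C := by
            refine setLIntegral_mono measurable_const ?_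
            rintro _ ⟨y, hy, rfl⟩
            exact ENNReal.ofReal_le_ofReal hy.2.2.le
        _ ≤ ∫⁻ p in Metric.ball (extChartAt I x₀ x₀) 1, ENNReal.ofReal C := by
            refine lintegral_mono_set ?_
            rintro _ ⟨y, hy, rfl⟩
            exact hy.2.1
        _ < ⊤ := by
            rw [setLIntegral_const]
            exact ENNReal.mul_lt_top ENNReal.ofReal_lt_top measure_ball_lt_top
    · intro x₁ p hp hpU
      refine ⟨_, hasFDerivWithinAt_chart_change hp hpU.1, ?_⟩
      rw [topCoeff_change (hvol.alternating _) hpU.1, abs_mul, one_mul,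
        ENNReal.ofReal_mul (abs_nonneg _), mul_comm]
  infer_instance

end ChartFormula

/-! ### The divergence theorem -/

section Divergence

variable {k : ℕ}

/-- The divergence theorem for a field on `{x | a₀ ≤ x 0}` that vanishes outside of a cube. -/
lemma setIntegral_divergence_of_vanishing {c : Fin (k + 1) → EuclideanSpace ℝ (Fin (k + 1)) → ℝ}
    {D : EuclideanSpace ℝ (Fin (k + 1)) → ℝ} {a₀ R : ℝ}
    (ha : a₀ < R) (hR : 0 < R)
    (hc : ∀ i, ContinuousOn (c i) {x : EuclideanSpace ℝ (Fin (k + 1)) | a₀ ≤ x 0})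
    (hd : ∀ x : EuclideanSpace ℝ (Fin (k + 1)), a₀ < x 0 → ∀ i, DifferentiableAt ℝ (c i) x)
    (hD : ContinuousOn D {x : EuclideanSpace ℝ (Fin (k + 1)) | a₀ ≤ x 0})
    (hdiv : ∀ x : EuclideanSpace ℝ (Fin (k + 1)), a₀ < x 0 →
      D x = ∑ i, fderiv ℝ (c i) x (EuclideanSpace.single i 1))
    (hz : ∀ x : EuclideanSpace ℝ (Fin (k + 1)), a₀ ≤ x 0 → (∃ j, R ≤ |x j|) →
      (∀ i, c i x = 0) ∧ D x = 0) :
    ∫ x in {x : EuclideanSpace ℝ (Fin (k + 1)) | a₀ ≤ x 0}, D x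
      = -∫ z : Fin k → ℝ, c 0 (WithLp.toLp 2 (Fin.cons a₀ z : Fin (k + 1) → ℝ)) := by
  set a : Fin (k + 1) → ℝ := Fin.cons a₀ fun _ => -R with ha'
  set b : Fin (k + 1) → ℝ := fun _ => R with hb'
  have hab : a ≤ b := by
    intro i
    refine Fin.cases ?_ (fun j => ?_) i
    · simpa [ha', hb'] using ha.le
    · simp only [ha', hb', Fin.cons_succ]; linarith
  let V := EuclideanSpace ℝ (Fin (k + 1))
  set T : Set V := {x : V | a₀ ≤ x 0} with hT
  have hTm : MeasurableSet T :=
    (isClosed_le continuous_const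
      (EuclideanSpace.proj (𝕜 := ℝ) (0 : Fin (k + 1))).continuous).measurableSet
  have hTcont : Continuous (fun x : Fin (k + 1) → ℝ => (WithLp.toLp 2 x : V)) :=
    PiLp.continuous_toLp 2 _
  have hsub : Icc a b ⊆ (fun x : Fin (k + 1) → ℝ => (WithLp.toLp 2 x : V)) ⁻¹' T := by
    intro x hx
    have : a₀ ≤ x 0 := by simpa [ha'] using hx.1 0
    exact this
  have hinner : ∀ x ∈ Set.pi univ fun i => Ioo (a i) (b i), a₀ < (WithLp.toLp 2 x : V) 0 := by
    intro x hx
    simpa [ha'] using (hx 0 (mem_univ _)).1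
  have e1 : ∫ x in T, D x = ∫ x in Icc a b, D (WithLp.toLp 2 x) := by
    rw [← (PiLp.volume_preserving_toLp (Fin (k + 1))).setIntegral_preimage_emb
      (MeasurableEquiv.toLp 2 (Fin (k + 1) → ℝ)).measurableEmbedding]
    refine setIntegral_eq_of_subset_of_forall_sdiff_eq_zero (hTm.preimage hTcont.measurable) hsub ?_
    rintro x ⟨hx1, hx2⟩
    refine (hz _ hx1 ?_).2
    by_contra! hlt
    refine hx2 ⟨fun i => ?_, fun i => (abs_lt.1 (hlt i)).2.le⟩
    refine Fin.cases ?_ (fun j => ?_) i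
    · have : a₀ ≤ x 0 := hx1
      simpa [ha'] using this
    · simpa [ha'] using (abs_lt.1 (hlt j.succ)).1.le
  let f : (Fin (k + 1) → ℝ) → Fin (k + 1) → ℝ := fun x i => c i (WithLp.toLp 2 x)
  let f' : (Fin (k + 1) → ℝ) → (Fin (k + 1) → ℝ) →L[ℝ] Fin (k + 1) → ℝ := fun x =>
    ContinuousLinearMap.pi fun i => (fderiv ℝ (c i) (WithLp.toLp 2 x)).comp
      (PiLp.continuousLinearEquiv 2 ℝ (fun _ : Fin (k + 1) => ℝ)).symm.toContinuousLinearMap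
  have hf'e : ∀ x ∈ Set.pi univ fun i => Ioo (a i) (b i),
      ∑ i, f' x (Pi.single i 1) i = D (WithLp.toLp 2 x) := by
    intro x hx
    rw [hdiv _ (hinner x hx)]
    rfl
  have hIoo : MeasurableSet (Set.pi univ fun i => Ioo (a i) (b i)) :=
    MeasurableSet.univ_pi fun _ => measurableSet_Ioo
  have hae : (fun x => ∑ i, f' x (Pi.single i 1) i)
      =ᵐ[volume.restrict (Icc a b)] fun x => D (WithLp.toLp 2 x) := by
    rw [volume_pi, ← Measure.restrict_congr_set (Measure.univ_pi_Ioo_ae_eq_Icc (f := a) (g := b))]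
    exact ae_restrict_of_forall_mem hIoo hf'e
  have hDi : IntegrableOn (fun x : Fin (k + 1) → ℝ => D (WithLp.toLp 2 x)) (Icc a b) :=
    ContinuousOn.integrableOn_compact isCompact_Icc (hD.comp hTcont.continuousOn hsub)
  have hmain := integral_divergence_of_hasFDerivAt_off_countable a b hab f f' ∅ countable_empty
    (continuousOn_pi.2 fun i => (hc i).comp hTcont.continuousOn hsub)
    (fun x hx => hasFDerivAt_pi.2 fun i => by
      have h1 := (hd _ (hinner x hx.1) i).hasFDerivAt
      have h2 : HasFDerivAt (fun x : Fin (k + 1) → ℝ => (WithLp.toLp 2 x : V))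
          (PiLp.continuousLinearEquiv 2 ℝ fun _ : Fin (k + 1) => ℝ).symm.toContinuousLinearMap x :=
        ContinuousLinearMap.hasFDerivAt
          (PiLp.continuousLinearEquiv 2 ℝ (fun _ : Fin (k + 1) => ℝ)).symm.toContinuousLinearMap
      exact h1.comp x h2)
    (hDi.congr_fun_ae hae.symm)
  rw [integral_congr_ae hae] at hmain
  -- Only the back face in direction `0` contributes.
  have hfront : ∀ (i : Fin (k + 1)), ∀ x ∈ Icc (a ∘ i.succAbove) (b ∘ i.succAbove),
      f (i.insertNth (b i) x) i = 0 := by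
    intro i x hx
    refine (hz _ ?_ ⟨i, ?_⟩).1 i
    · have : a ≤ i.insertNth (b i) x :=
        Fin.le_insertNth_iff.2 ⟨hab i, hx.1⟩
      simpa [ha'] using this 0
    · simp only [Fin.insertNth_apply_same, hb']
      exact le_abs_self _
  have hback : ∀ (i : Fin k), ∀ x ∈ Icc (a ∘ i.succ.succAbove) (b ∘ i.succ.succAbove),
      f (i.succ.insertNth (a i.succ) x) i.succ = 0 := by
    intro i x hx
    refine (hz _ ?_ ⟨i.succ, ?_⟩).1 i.succ
    · have : a ≤ i.succ.insertNth (a i.succ) x :=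
        Fin.le_insertNth_iff.2 ⟨le_rfl, hx.1⟩
      simpa [ha'] using this 0
    · simp only [Fin.insertNth_apply_same, ha', Fin.cons_succ]
      rw [abs_neg]
      exact le_abs_self _
  have hback0 : ∫ x in Icc (a ∘ (0 : Fin (k + 1)).succAbove) (b ∘ (0 : Fin (k + 1)).succAbove),
      f ((0 : Fin (k + 1)).insertNth (a 0) x) 0
      = ∫ z : Fin k → ℝ, c 0 (WithLp.toLp 2 (Fin.cons a₀ z : Fin (k + 1) → ℝ)) := by
    have h0 : ∀ z : Fin k → ℝ, f ((0 : Fin (k + 1)).insertNth (a 0) z) 0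
        = c 0 (WithLp.toLp 2 (Fin.cons a₀ z : Fin (k + 1) → ℝ)) := by
      intro z
      rw [Fin.insertNth_zero']
      rfl
    simp only [h0]
    refine setIntegral_eq_integral_of_forall_compl_eq_zero fun z hz' => ?_
    refine (hz _ (by simp) ?_).1 0
    by_contra! hlt
    refine hz' ⟨fun j => ?_, fun j => ?_⟩
    · simpa [ha'] using (abs_lt.1 (hlt j.succ)).1.le
    · simpa [hb'] using (abs_lt.1 (hlt j.succ)).2.le
  rw [e1, hmain, Fin.sum_univ_succ, Finset.sum_eq_zero, add_zero, hback0,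
    setIntegral_eq_zero_of_forall_eq_zero (hfront 0), zero_sub]
  intro i _
  rw [setIntegral_eq_zero_of_forall_eq_zero (hfront i.succ),
    setIntegral_eq_zero_of_forall_eq_zero (hback i), sub_zero]

lemma exists_cube_of_isCompact {K : Set (EuclideanSpace ℝ (Fin (k + 1)))} (hK : IsCompact K) :
    ∃ R : ℝ, 0 < R ∧ ∀ x : EuclideanSpace ℝ (Fin (k + 1)), (∃ j, R ≤ |x j|) → x ∉ K := by
  obtain ⟨r, hr⟩ := hK.isBounded.exists_norm_le
  refine ⟨|r| + 1, by positivity, ?_⟩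
  rintro x ⟨j, hj⟩ hx
  have h1 := hr x hx
  have h2 : |x j| ≤ ‖x‖ := PiLp.norm_apply_le x j
  have h3 := le_abs_self r
  linarith

/-- The integral of the divergence of a compactly supported field on `ℝ^(k+1)`. -/
lemma integral_divergence_eq_zero {c : Fin (k + 1) → EuclideanSpace ℝ (Fin (k + 1)) → ℝ}
    {D : EuclideanSpace ℝ (Fin (k + 1)) → ℝ} {K : Set (EuclideanSpace ℝ (Fin (k + 1)))}
    (hK : IsCompact K) (hd : ∀ x i, DifferentiableAt ℝ (c i) x) (hD : Continuous D)
    (hdiv : ∀ x, D x = ∑ i, fderiv ℝ (c i) x (EuclideanSpace.single i 1))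
    (hz : ∀ x ∉ K, (∀ i, c i x = 0) ∧ D x = 0) : ∫ x, D x = 0 := by
  obtain ⟨R, hR, hRK⟩ := exists_cube_of_isCompact hK
  have h := setIntegral_divergence_of_vanishing (c := c) (D := D) (a₀ := -R) (R := R) (by linarith)
    hR (fun i x _ => (hd x i).continuousAt.continuousWithinAt) (fun x _ i => hd x i)
    hD.continuousOn (fun x _ => hdiv x) fun x _ hx => hz x (hRK x hx)
  rw [setIntegral_eq_integral_of_forall_compl_eq_zero] at h
  · rw [h]
    have : ∀ z : Fin k → ℝ, c 0 (WithLp.toLp 2 (Fin.cons (-R) z : Fin (k + 1) → ℝ)) = 0 := by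
      intro z
      refine (hz _ (hRK _ ⟨0, ?_⟩)).1 0
      simpa using le_abs_self R
    simp [this]
  · intro x hx
    refine (hz x (hRK x ⟨0, ?_⟩)).2
    have : x 0 < -R := not_le.1 hx
    rw [abs_of_neg (by linarith)]
    linarith

/-- The integral of the divergence of a compactly supported field on a half-space. -/
lemma setIntegral_halfSpace_divergence {c : Fin (k + 1) → EuclideanSpace ℝ (Fin (k + 1)) → ℝ}
    {D : EuclideanSpace ℝ (Fin (k + 1)) → ℝ} {K : Set (EuclideanSpace ℝ (Fin (k + 1)))}
    (hK : IsCompact K) (hc : ∀ i, ContinuousOn (c i) {x : EuclideanSpace ℝ (Fin (k + 1)) | 0 ≤ x 0})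
    (hd : ∀ x : EuclideanSpace ℝ (Fin (k + 1)), 0 < x 0 → ∀ i, DifferentiableAt ℝ (c i) x)
    (hD : ContinuousOn D {x : EuclideanSpace ℝ (Fin (k + 1)) | 0 ≤ x 0})
    (hdiv : ∀ x : EuclideanSpace ℝ (Fin (k + 1)), 0 < x 0 →
      D x = ∑ i, fderiv ℝ (c i) x (EuclideanSpace.single i 1))
    (hz : ∀ x ∉ K, (∀ i, c i x = 0) ∧ D x = 0) :
    ∫ x in {x : EuclideanSpace ℝ (Fin (k + 1)) | 0 ≤ x 0}, D x
      = -∫ z : Fin k → ℝ, c 0 (WithLp.toLp 2 (Fin.cons 0 z : Fin (k + 1) → ℝ)) := by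
  obtain ⟨R, hR, hRK⟩ := exists_cube_of_isCompact hK
  exact setIntegral_divergence_of_vanishing hR hR hc hd hD hdiv fun x _ hx => hz x (hRK x hx)

end Divergence

/-! ### Stokes' theorem in a chart -/

section LocalStokes

variable {k : ℕ} {B : Type*} [TopologicalSpace B]
  {I : ModelWithCorners ℝ (EuclideanSpace ℝ (Fin (k + 1))) B}
  {Q : Type*} [TopologicalSpace Q] [ChartedSpace B Q]

/-- The component `(-1)^i β(∂_0, …, ∂_{i-1}, ∂_{i+1}, …, ∂_k)` of a `k`-form on a manifold of
dimension `k + 1`, in the chart around `x₀`; the exterior derivative of `β` is the divergence of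
these components. -/
noncomputable def formComponent (β : ∀ x : Q, TangentSpace I x [⋀^Fin k]→ₗ[ℝ] ℝ) (x₀ : Q)
    (i : Fin (k + 1)) (p : EuclideanSpace ℝ (Fin (k + 1))) : ℝ :=
  (-1) ^ (i : ℕ) * β ((extChartAt I x₀).symm p)
    fun j => frameAt I x₀ p (EuclideanSpace.single (i.succAbove j) 1)

/-- `f vol` is the exterior derivative of the form `β`, which is `C¹` up to the boundary, at the
interior points. -/
structure IsPrimitive (vol : ∀ x : Q, (Fin (k + 1) → TangentSpace I x) → ℝ)
    (β : ∀ x : Q, TangentSpace I x [⋀^Fin k]→ₗ[ℝ] ℝ) (f : Q → ℝ) : Prop where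
  contDiffOn : ∀ x₀ i, ContDiffOn ℝ 1 (formComponent β x₀ i) (extChartAt I x₀).target
  divergence : ∀ x₀ : Q, ∀ p ∈ (extChartAt I x₀).target, p ∈ interior (range I) →
    ∑ i, fderiv ℝ (formComponent β x₀ i) p (EuclideanSpace.single i 1)
      = f ((extChartAt I x₀).symm p) * topCoeff I vol x₀ p

variable (I) in
/-- The differential of a function, as a covector. -/
noncomputable def scalarDiff (ρ : Q → ℝ) (x : Q) : TangentSpace I x →L[ℝ] ℝ :=
  mfderiv I 𝓘(ℝ, ℝ) ρ x

variable (I) in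
/-- The top-degree form `dρ ∧ β`. -/
noncomputable def diffWedge (ρ : Q → ℝ) (β : ∀ x : Q, TangentSpace I x [⋀^Fin k]→ₗ[ℝ] ℝ) (x : Q) :
    TangentSpace I x [⋀^Fin (k + 1)]→ₗ[ℝ] ℝ :=
  AlternatingMap.alternatizeUncurryFin
    ((scalarDiff I ρ x).toLinearMap.smulRight (β x))

lemma diffWedge_apply (ρ : Q → ℝ) (β : ∀ x : Q, TangentSpace I x [⋀^Fin k]→ₗ[ℝ] ℝ) (x : Q)
    (w : Fin (k + 1) → TangentSpace I x) :
    diffWedge I ρ β x w = ∑ i : Fin (k + 1), (-1) ^ (i : ℕ) *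
      (scalarDiff I ρ x (w i) * β x fun j => w (i.succAbove j)) := by
  rw [diffWedge, AlternatingMap.alternatizeUncurryFin_apply]
  refine Finset.sum_congr rfl fun i _ => ?_
  rw [← Int.cast_smul_eq_zsmul ℝ]
  push_cast
  rfl

/-- `d(ρ β) / vol`, when `f vol = dβ`. -/
noncomputable def cutoffRatio (vol : ∀ x : Q, (Fin (k + 1) → TangentSpace I x) → ℝ)
    (β : ∀ x : Q, TangentSpace I x [⋀^Fin k]→ₗ[ℝ] ℝ) (f ρ : Q → ℝ) (x : Q) : ℝ :=
  ρ x * f x + diffWedge I ρ β x (basisVec I x) / vol x (basisVec I x)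

lemma target_mem_nhdsWithin_range {x₀ : Q} {p : EuclideanSpace ℝ (Fin (k + 1))}
    (hp : p ∈ (extChartAt I x₀).target) : (extChartAt I x₀).target ∈ nhdsWithin p (range I) :=
  extChartAt_target_mem_nhdsWithin_of_mem hp

/-- The extension by zero of a function on a chart whose support is compact in the chart locally
agrees with the function or with zero. -/
lemma indicator_target_eventuallyEq {x₀ : Q} {p : EuclideanSpace ℝ (Fin (k + 1))}
    {g : EuclideanSpace ℝ (Fin (k + 1)) → ℝ} {K : Set (EuclideanSpace ℝ (Fin (k + 1)))}
    (hK : IsClosed K) (hKt : K ⊆ (extChartAt I x₀).target)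
    (hg : ∀ q ∈ (extChartAt I x₀).target, q ∉ K → g q = 0) :
    (p ∈ (extChartAt I x₀).target ∧
      (extChartAt I x₀).target.indicator g =ᶠ[nhdsWithin p (range I)] g) ∨
    (p ∉ (extChartAt I x₀).target ∧
      (extChartAt I x₀).target.indicator g =ᶠ[nhds p] fun _ => 0) := by
  by_cases hp : p ∈ (extChartAt I x₀).target
  · refine Or.inl ⟨hp, ?_⟩
    filter_upwards [target_mem_nhdsWithin_range hp] with q hq using indicator_of_mem hq g
  · refine Or.inr ⟨hp, ?_⟩
    filter_upwards [hK.isOpen_compl.mem_nhds fun h => hp (hKt h)] with q hq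
    by_cases hqt : q ∈ (extChartAt I x₀).target
    · rw [indicator_of_mem hqt, hg q hqt hq]
    · exact indicator_of_notMem hqt g

lemma continuousOn_indicator_target {x₀ : Q} {g : EuclideanSpace ℝ (Fin (k + 1)) → ℝ}
    {K : Set (EuclideanSpace ℝ (Fin (k + 1)))}
    (hK : IsClosed K) (hKt : K ⊆ (extChartAt I x₀).target)
    (hg : ∀ q ∈ (extChartAt I x₀).target, q ∉ K → g q = 0)
    (hgc : ContinuousOn g (extChartAt I x₀).target) :
    ContinuousOn ((extChartAt I x₀).target.indicator g) (range I) := by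
  intro p hpr
  rcases indicator_target_eventuallyEq (p := p) hK hKt hg with ⟨hp, h⟩ | ⟨hp, h⟩
  · exact ((hgc p hp).mono_of_mem_nhdsWithin (target_mem_nhdsWithin_range hp)).congr_of_eventuallyEq
      h (indicator_of_mem hp g)
  · exact (continuousAt_const.congr h.symm).continuousWithinAt

variable [IsManifold I ∞ Q]

lemma contDiffWithinAt_comp_chart_symm {ρ : Q → ℝ} (hρ : ContMDiff I 𝓘(ℝ, ℝ) ∞ ρ) {x₀ : Q}
    {p : EuclideanSpace ℝ (Fin (k + 1))} (hp : p ∈ (extChartAt I x₀).target) :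
    ContDiffWithinAt ℝ ∞ (ρ ∘ (extChartAt I x₀).symm) (range I) p := by
  rw [← contMDiffWithinAt_iff_contDiffWithinAt]
  exact (hρ _).comp_contMDiffWithinAt p (contMDiffWithinAt_extChartAt_symm_range x₀ hp)

lemma topCoeff_diffWedge {ρ : Q → ℝ} (hρ : ContMDiff I 𝓘(ℝ, ℝ) ∞ ρ)
    (β : ∀ x : Q, TangentSpace I x [⋀^Fin k]→ₗ[ℝ] ℝ) {x₀ : Q}
    {p : EuclideanSpace ℝ (Fin (k + 1))} (hp : p ∈ (extChartAt I x₀).target) :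
    topCoeff I (fun x w => diffWedge I ρ β x w) x₀ p
      = ∑ i, fderivWithin ℝ (ρ ∘ (extChartAt I x₀).symm) (range I) p (EuclideanSpace.single i 1) *
        formComponent β x₀ i p := by
  rw [topCoeff, diffWedge_apply]
  refine Finset.sum_congr rfl fun i _ => ?_
  have h : scalarDiff I ρ ((extChartAt I x₀).symm p) (frameAt I x₀ p (EuclideanSpace.single i 1))
      = fderivWithin ℝ (ρ ∘ (extChartAt I x₀).symm) (range I) p (EuclideanSpace.single i 1) :=
    mfderiv_frameAt_eq_fderivWithin hp ((hρ _).mdifferentiableAt (by norm_num)) _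
  rw [h, formComponent]
  ring

variable {vol : ∀ x : Q, (Fin (k + 1) → TangentSpace I x) → ℝ}
  {β : ∀ x : Q, TangentSpace I x [⋀^Fin k]→ₗ[ℝ] ℝ} {f ρ : Q → ℝ}

lemma cutoffRatio_mul_topCoeff (hvol : IsVolumeForm vol) (hρ : ContMDiff I 𝓘(ℝ, ℝ) ∞ ρ) {x₀ : Q}
    {p : EuclideanSpace ℝ (Fin (k + 1))} (hp : p ∈ (extChartAt I x₀).target) :
    cutoffRatio vol β f ρ ((extChartAt I x₀).symm p) * topCoeff I vol x₀ p
      = ρ ((extChartAt I x₀).symm p) * (f ((extChartAt I x₀).symm p) * topCoeff I vol x₀ p)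
        + ∑ i, fderivWithin ℝ (ρ ∘ (extChartAt I x₀).symm) (range I) p
          (EuclideanSpace.single i 1) * formComponent β x₀ i p := by
  have h := ratio_eq_topCoeff_ratio (α := fun x w => diffWedge I ρ β x w) (vol := vol) x₀ hp
    ⟨_, fun _ => rfl⟩ (hvol.alternating _)
  rw [cutoffRatio, h, topCoeff_diffWedge hρ β hp, add_mul, div_mul_cancel₀ _ (hvol.ne_zero x₀ p hp)]
  ring

lemma continuous_diffWedge_ratio (hvol : IsVolumeForm vol)
    (hβ : ∀ x₀ i, ContDiffOn ℝ 1 (formComponent β x₀ i) (extChartAt I x₀).target)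
    (hρ : ContMDiff I 𝓘(ℝ, ℝ) ∞ ρ) :
    Continuous fun x => diffWedge I ρ β x (basisVec I x) / vol x (basisVec I x) := by
  refine continuous_iff_continuousAt.2 fun x₀ => ?_
  have h1 : ContinuousOn (fun p => topCoeff I (fun x w => diffWedge I ρ β x w) x₀ p
      / topCoeff I vol x₀ p) (extChartAt I x₀).target := by
    refine ContinuousOn.div ?_ (hvol.continuousOn x₀) (hvol.ne_zero x₀)
    refine ContinuousOn.congr ?_ fun p hp => topCoeff_diffWedge hρ β hp
    refine continuousOn_finsetSum _ fun i _ => ContinuousOn.mul ?_ (hβ x₀ i).continuousOn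
    intro p hp
    have h2 := ((contDiffWithinAt_comp_chart_symm hρ hp).fderivWithin_right (m := 0)
      I.uniqueDiffOn (by norm_num) (extChartAt_target_subset_range x₀ hp)).continuousWithinAt
    exact (h2.clm_apply continuousWithinAt_const).mono (extChartAt_target_subset_range x₀)
  have h3 : ContinuousOn (fun x => diffWedge I ρ β x (basisVec I x) / vol x (basisVec I x))
      (extChartAt I x₀).source := by
    refine (h1.comp (continuousOn_extChartAt x₀) fun y hy => (extChartAt I x₀).map_source hy).congr
      fun y hy => ?_
    have h := ratio_eq_topCoeff_ratio (α := fun x w => diffWedge I ρ β x w) (vol := vol) x₀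
      ((extChartAt I x₀).map_source hy) ⟨_, fun _ => rfl⟩ (hvol.alternating _)
    rw [(extChartAt I x₀).left_inv hy] at h
    exact h
  exact h3.continuousAt (extChartAt_source_mem_nhds x₀)

lemma diffWedge_eq_zero {x : Q} (hx : β x = 0) : diffWedge I ρ β x = 0 := by
  ext w
  rw [diffWedge_apply, hx]
  exact Finset.sum_eq_zero fun i _ => by
    rw [AlternatingMap.zero_apply, mul_zero, mul_zero]

lemma scalarDiff_eq_zero {x : Q} (hx : x ∉ tsupport ρ) : scalarDiff I ρ x = 0 := by
  have h : ρ =ᶠ[nhds x] fun _ => 0 := by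
    filter_upwards [(isClosed_tsupport ρ).isOpen_compl.mem_nhds hx] with y hy
    exact image_eq_zero_of_notMem_tsupport hy
  rw [scalarDiff, h.mfderiv_eq]
  exact mfderiv_const

lemma diffWedge_eq_zero_of_notMem_tsupport {x : Q} (hx : x ∉ tsupport ρ) :
    diffWedge I ρ β x = 0 := by
  ext w
  rw [diffWedge_apply, scalarDiff_eq_zero hx]
  exact Finset.sum_eq_zero fun i _ => by
    rw [zero_apply, zero_mul, mul_zero]

/-- The components of `ρ β` in a chart, extended by zero. -/
noncomputable def cutoffComponent (β : ∀ x : Q, TangentSpace I x [⋀^Fin k]→ₗ[ℝ] ℝ) (ρ : Q → ℝ)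
    (x₀ : Q) (i : Fin (k + 1)) : EuclideanSpace ℝ (Fin (k + 1)) → ℝ :=
  (extChartAt I x₀).target.indicator
    fun p => ρ ((extChartAt I x₀).symm p) * formComponent β x₀ i p

variable [T2Space Q] [SecondCountableTopology Q] [MeasurableSpace Q] [BorelSpace Q]

/-- The components of `ρ β` in a chart form a compactly supported field whose divergence is the
density of `d(ρ β)`. The number `s` is the sign of the volume form in the chart, which is assumed to
be constant on the support of `ρ`. -/
lemma cutoff_fields (hvol : IsVolumeForm vol) (hβ : IsPrimitive vol β f) (hf : Continuous f)
    {C : Set Q} (hC : IsCompact C) (hβC : ∀ x ∉ C, β x = 0) (hfC : ∀ x ∉ C, f x = 0)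
    (hρ : ContMDiff I 𝓘(ℝ, ℝ) ∞ ρ) {x₀ : Q} (hρs : tsupport ρ ⊆ (extChartAt I x₀).source) {s : ℝ}
    (hs : ∀ y ∈ tsupport ρ, |topCoeff I vol x₀ (extChartAt I x₀ y)|
      = s * topCoeff I vol x₀ (extChartAt I x₀ y)) :
    ∃ (D : EuclideanSpace ℝ (Fin (k + 1)) → ℝ) (K : Set (EuclideanSpace ℝ (Fin (k + 1)))),
      IsCompact K ∧ ContinuousOn D (range I) ∧
      (∀ i, ContinuousOn (cutoffComponent β ρ x₀ i) (range I)) ∧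
      (∀ p ∈ interior (range I), ∀ i, DifferentiableAt ℝ (cutoffComponent β ρ x₀ i) p) ∧
      (∀ p ∈ interior (range I), D p
        = ∑ i, fderiv ℝ (cutoffComponent β ρ x₀ i) p (EuclideanSpace.single i 1)) ∧
      (∀ p ∉ K, (∀ i, cutoffComponent β ρ x₀ i p = 0) ∧ D p = 0) ∧
      ∫ x, cutoffRatio vol β f ρ x ∂(volMeasure I vol) = s * ∫ p in range I, D p := by
  set φ := extChartAt I x₀ with hφ
  set K := φ '' (tsupport ρ ∩ C) with hKdef
  have hKc : IsCompact K := (hC.inter_left (isClosed_tsupport ρ)).image_of_continuousOn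
    ((continuousOn_extChartAt x₀).mono fun y hy => hρs hy.1)
  have hKt : K ⊆ φ.target := by
    rintro _ ⟨y, hy, rfl⟩
    exact φ.map_source (hρs hy.1)
  have hnK : ∀ p ∈ φ.target, p ∉ K → φ.symm p ∉ tsupport ρ ∨ φ.symm p ∉ C := by
    intro p hp hpK
    by_contra! h
    exact hpK ⟨φ.symm p, h, φ.right_inv hp⟩
  have hcz : ∀ i, ∀ p ∈ φ.target, p ∉ K → ρ (φ.symm p) * formComponent β x₀ i p = 0 := by
    intro i p hp hpK
    rcases hnK p hp hpK with h | h
    · rw [image_eq_zero_of_notMem_tsupport h, zero_mul]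
    · rw [formComponent, hβC _ h, AlternatingMap.zero_apply, mul_zero, mul_zero]
  have hratio : ∀ x, x ∉ tsupport ρ ∨ x ∉ C → cutoffRatio vol β f ρ x = 0 := by
    intro x hx
    rw [cutoffRatio]
    rcases hx with h | h
    · rw [image_eq_zero_of_notMem_tsupport h, diffWedge_eq_zero_of_notMem_tsupport h]
      simp
    · rw [hfC _ h, diffWedge_eq_zero (hβC _ h)]
      simp
  have hDz : ∀ p ∈ φ.target, p ∉ K →
      cutoffRatio vol β f ρ (φ.symm p) * topCoeff I vol x₀ p = 0 := by
    intro p hp hpK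
    rw [hratio _ (hnK p hp hpK), zero_mul]
  have hcr : Continuous (cutoffRatio vol β f ρ) :=
    (hρ.continuous.mul hf).add (continuous_diffWedge_ratio hvol hβ.contDiffOn hρ)
  have hsupp : Function.support (cutoffRatio vol β f ρ) ⊆ φ.source := by
    intro x hx
    by_contra h
    exact hx (hratio x (Or.inl fun h' => h (hρs h')))
  have hρd : ∀ p ∈ φ.target, ContDiffWithinAt ℝ 1 (ρ ∘ φ.symm) (range I) p := fun p hp =>
    (contDiffWithinAt_comp_chart_symm hρ hp).of_le (by norm_num)
  have hβd : ∀ i, ∀ p ∈ φ.target, ContDiffWithinAt ℝ 1 (formComponent β x₀ i) (range I) p :=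
    fun i p hp => (hβ.contDiffOn x₀ i p hp).mono_of_mem_nhdsWithin (target_mem_nhdsWithin_range hp)
  -- At an interior point a one-sided derivative is a genuine derivative.
  have hint : ∀ p ∈ interior (range I), range I ∈ nhds p :=
    fun p hp => mem_interior_iff_mem_nhds.1 hp
  refine ⟨φ.target.indicator fun p => cutoffRatio vol β f ρ (φ.symm p) * topCoeff I vol x₀ p, K,
    hKc, ?_, fun i => ?_, fun p hp i => ?_, fun p hp => ?_, fun p hpK => ⟨fun i => ?_, ?_⟩, ?_⟩
  · exact continuousOn_indicator_target hKc.isClosed hKt hDz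
      ((hcr.comp_continuousOn (continuousOn_extChartAt_symm x₀)).mul (hvol.continuousOn x₀))
  · refine continuousOn_indicator_target hKc.isClosed hKt (hcz i) fun p hp => ?_
    exact ((hρd p hp).continuousWithinAt.mul (hβd i p hp).continuousWithinAt).mono
      (extChartAt_target_subset_range x₀)
  · rcases indicator_target_eventuallyEq (p := p) hKc.isClosed hKt (hcz i) with ⟨hpt, h⟩ | ⟨hpt, h⟩
    · rw [nhdsWithin_eq_nhds.2 (hint p hp)] at h
      have h1 := ((hρd p hpt).contDiffAt (hint p hp)).mul ((hβd i p hpt).contDiffAt (hint p hp))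
      exact (h1.differentiableAt (by norm_num)).congr_of_eventuallyEq h
    · exact (differentiableAt_const _).congr_of_eventuallyEq h
  · by_cases hpt : p ∈ φ.target
    · have hd : ∀ i, fderiv ℝ (cutoffComponent β ρ x₀ i) p (EuclideanSpace.single i 1)
          = ρ (φ.symm p) * fderiv ℝ (formComponent β x₀ i) p (EuclideanSpace.single i 1)
            + fderivWithin ℝ (ρ ∘ φ.symm) (range I) p (EuclideanSpace.single i 1)
              * formComponent β x₀ i p := by
        intro i
        rcases indicator_target_eventuallyEq (p := p) hKc.isClosed hKt (hcz i)
          with ⟨-, h⟩ | ⟨h, -⟩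
        · rw [nhdsWithin_eq_nhds.2 (hint p hp)] at h
          have h1 := ((hρd p hpt).contDiffAt (hint p hp)).differentiableAt (by norm_num)
          have h2 := ((hβd i p hpt).contDiffAt (hint p hp)).differentiableAt (by norm_num)
          rw [fderivWithin_of_mem_nhds (hint p hp)]
          have h3 : fderiv ℝ (cutoffComponent β ρ x₀ i) p
              = fderiv ℝ ((ρ ∘ φ.symm) * formComponent β x₀ i) p := h.fderiv_eq
          rw [h3, fderiv_mul h1 h2]
          simp only [add_apply, smul_apply, smul_eq_mul, Function.comp_apply]
          ring
        · exact absurd hpt h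
      rw [indicator_of_mem hpt, cutoffRatio_mul_topCoeff hvol hρ hpt,
        Finset.sum_congr rfl fun i _ => hd i, Finset.sum_add_distrib,
        ← Finset.mul_sum, hβ.divergence x₀ p hpt hp]
    · rw [indicator_of_notMem hpt]
      symm
      refine Finset.sum_eq_zero fun i _ => ?_
      rcases indicator_target_eventuallyEq (p := p) hKc.isClosed hKt (hcz i) with ⟨h, -⟩ | ⟨-, h⟩
      · exact absurd h hpt
      · have h3 : fderiv ℝ (cutoffComponent β ρ x₀ i) p = fderiv ℝ (fun _ => (0 : ℝ)) p :=
          h.fderiv_eq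
        rw [h3]
        simp
  · by_cases hpt : p ∈ φ.target
    · rw [cutoffComponent, indicator_of_mem hpt]
      exact hcz i p hpt hpK
    · exact indicator_of_notMem hpt _
  · by_cases hpt : p ∈ φ.target
    · rw [indicator_of_mem hpt]
      exact hDz p hpt hpK
    · exact indicator_of_notMem hpt _
  · rw [integral_volMeasure_chart hvol x₀ hcr hsupp,
      setIntegral_indicator (measurableSet_chart_target x₀),
      inter_eq_right.2 (extChartAt_target_subset_range x₀), ← integral_const_mul]
    refine setIntegral_congr_fun (measurableSet_chart_target x₀) fun p hp => ?_
    by_cases h : φ.symm p ∈ tsupport ρ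
    · have h1 := hs _ h
      rw [φ.right_inv hp] at h1
      simp only [h1]
      ring
    · simp only [← hφ, hratio _ (Or.inl h)]
      ring

end LocalStokes

/-! ### Localization by a partition of unity -/

section GlobalStokes

variable {k : ℕ} {B : Type*} [TopologicalSpace B]
  {I : ModelWithCorners ℝ (EuclideanSpace ℝ (Fin (k + 1))) B}
  {Q : Type*} [TopologicalSpace Q] [ChartedSpace B Q] [IsManifold I ∞ Q]
  [T2Space Q] [SecondCountableTopology Q]

variable (I) in
/-- Finitely many smooth functions, subordinate to a cover, that add up to `1` near a compact
set. -/
lemma exists_finite_cutoffs {C : Set Q} (hC : IsCompact C) {W : Q → Set Q}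
    (hW : ∀ y, IsOpen (W y)) (hyW : ∀ y, y ∈ W y) :
    ∃ (J : Finset Q) (ρ : Q → Q → ℝ) (U : Set Q),
      (∀ y, ContMDiff I 𝓘(ℝ, ℝ) ∞ (ρ y)) ∧ (∀ y, tsupport (ρ y) ⊆ W y) ∧
      IsOpen U ∧ C ⊆ U ∧ ∀ x ∈ U, ∑ y ∈ J, ρ y x = 1 := by
  have : LocallyCompactSpace Q := Manifold.locallyCompact_of_finiteDimensional I
  obtain ⟨P, hP⟩ := SmoothPartitionOfUnity.exists_isSubordinate I (s := (univ : Set Q))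
    isClosed_univ W hW fun y _ => mem_iUnion_of_mem y (hyW y)
  have hlf : LocallyFinite fun y => tsupport (P y) := P.locallyFinite.closure
  have hfin := hlf.finite_nonempty_inter_compact hC
  set J := hfin.toFinset with hJ
  refine ⟨J, fun y => P y, (⋃ y : {y // y ∉ J}, tsupport (P y))ᶜ, fun y => (P y).contMDiff, hP, ?_,
    ?_, ?_⟩
  · refine IsClosed.isOpen_compl (self := ?_)
    exact (hlf.comp_injective Subtype.val_injective).isClosed_iUnion fun y => isClosed_tsupport _
  · intro x hx hx'
    obtain ⟨⟨y, hy⟩, hxy⟩ := mem_iUnion.1 hx'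
    exact hy (hfin.mem_toFinset.2 ⟨x, hxy, hx⟩)
  · intro x hx
    have h1 : ∑ᶠ y, P y x = 1 := P.sum_eq_one (mem_univ x)
    rw [← h1]
    symm
    refine finsum_eq_sum_of_support_subset _ fun y hy => ?_
    by_contra hyJ
    exact hx (mem_iUnion.2 ⟨⟨y, hyJ⟩, subset_tsupport _ hy⟩)

omit [IsManifold I ∞ Q] [T2Space Q] [SecondCountableTopology Q] in
lemma scalarDiff_sum {J : Finset Q} {ρ : Q → Q → ℝ} {x : Q}
    (hρ : ∀ y, MDifferentiableAt I 𝓘(ℝ, ℝ) (ρ y) x) :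
    MDifferentiableAt I 𝓘(ℝ, ℝ) (fun z => ∑ y ∈ J, ρ y z) x ∧
    scalarDiff I (fun z => ∑ y ∈ J, ρ y z) x = ∑ y ∈ J, scalarDiff I (ρ y) x := by
  classical
  induction J using Finset.induction_on with
  | empty =>
    simp only [Finset.sum_empty]
    exact ⟨mdifferentiableAt_const, mfderiv_const⟩
  | insert a s ha ih =>
    simp only [Finset.sum_insert ha]
    refine ⟨(hρ a).add ih.1, ?_⟩
    rw [← ih.2]
    exact mfderiv_add (hρ a) ih.1

variable [MeasurableSpace Q] [BorelSpace Q]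
  {vol : ∀ x : Q, (Fin (k + 1) → TangentSpace I x) → ℝ}
  {β : ∀ x : Q, TangentSpace I x [⋀^Fin k]→ₗ[ℝ] ℝ} {f : Q → ℝ}

/-- Near the support of `f` and `β` the sum of the `ρ` is constant, so that the terms `dρ ∧ β`
cancel. -/
lemma integral_eq_sum_cutoffRatio (hvol : IsVolumeForm vol)
    (hβ : ∀ x₀ i, ContDiffOn ℝ 1 (formComponent β x₀ i) (extChartAt I x₀).target)
    (hf : Continuous f) {C : Set Q} (hC : IsCompact C) (hβC : ∀ x ∉ C, β x = 0)
    (hfC : ∀ x ∉ C, f x = 0) {J : Finset Q} {ρ : Q → Q → ℝ} {U : Set Q}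
    (hρ : ∀ y, ContMDiff I 𝓘(ℝ, ℝ) ∞ (ρ y)) (hU : IsOpen U) (hCU : C ⊆ U)
    (hsum : ∀ x ∈ U, ∑ y ∈ J, ρ y x = 1) :
    ∫ x, f x ∂(volMeasure I vol)
      = ∑ y ∈ J, ∫ x, cutoffRatio vol β f (ρ y) x ∂(volMeasure I vol) := by
  have := isFiniteMeasureOnCompacts_volMeasure hvol
  rw [← integral_finsetSum]
  · congr 1
    funext x
    by_cases hx : x ∈ C
    · have hd : ∑ y ∈ J, scalarDiff I (ρ y) x = 0 := by
        rw [← (scalarDiff_sum fun y => (hρ y x).mdifferentiableAt (by norm_num)).2, scalarDiff]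
        have h : (fun z => ∑ y ∈ J, ρ y z) =ᶠ[nhds x] fun _ => 1 := by
          filter_upwards [hU.mem_nhds (hCU hx)] with z hz using hsum z hz
        rw [h.mfderiv_eq]
        exact mfderiv_const
      have hw : ∑ y ∈ J, diffWedge I (ρ y) β x (basisVec I x) = 0 := by
        simp only [diffWedge_apply]
        rw [Finset.sum_comm]
        refine Finset.sum_eq_zero fun i _ => ?_
        rw [← Finset.mul_sum, ← Finset.sum_mul]
        have h2 : ∑ y ∈ J, scalarDiff I (ρ y) x (basisVec I x i) = 0 := by
          have := DFunLike.congr_fun hd (basisVec I x i)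
          rwa [sum_apply] at this
        rw [h2, zero_mul, mul_zero]
      simp only [cutoffRatio]
      rw [Finset.sum_add_distrib, ← Finset.sum_mul, ← Finset.sum_div, hw, hsum x (hCU hx)]
      ring
    · rw [hfC x hx]
      symm
      refine Finset.sum_eq_zero fun y _ => ?_
      rw [cutoffRatio, hfC x hx, diffWedge_eq_zero (hβC x hx), AlternatingMap.zero_apply]
      ring
  · intro y _
    refine Continuous.integrable_of_hasCompactSupport
      (((hρ y).continuous.mul hf).add (continuous_diffWedge_ratio hvol hβ (hρ y))) ?_
    refine HasCompactSupport.intro hC fun x hx => ?_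
    rw [cutoffRatio, hfC x hx, diffWedge_eq_zero (hβC x hx), AlternatingMap.zero_apply]
    ring

/-- The part of a chart domain on which the chart has the orientation that it has at its centre. -/
def orientedDomain (vol : ∀ x : Q, (Fin (k + 1) → TangentSpace I x) → ℝ) (y₀ : Q) : Set Q :=
  (extChartAt I y₀).source ∩ {y | 0 < topCoeff I vol y₀ (extChartAt I y₀ y₀) *
    topCoeff I vol y₀ (extChartAt I y₀ y)}

/-- The orientation of the chart around `y₀`. -/
noncomputable def chartSign (vol : ∀ x : Q, (Fin (k + 1) → TangentSpace I x) → ℝ) (y₀ : Q) : ℝ :=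
  SignType.sign (topCoeff I vol y₀ (extChartAt I y₀ y₀))

omit [IsManifold I ∞ Q] [T2Space Q] [SecondCountableTopology Q] [MeasurableSpace Q]
  [BorelSpace Q] in
lemma isOpen_orientedDomain (hvol : IsVolumeForm vol) (y₀ : Q) :
    IsOpen (orientedDomain vol y₀) ∧ y₀ ∈ orientedDomain vol y₀ := by
  constructor
  · have hc : ContinuousOn (fun y => topCoeff I vol y₀ (extChartAt I y₀ y₀) *
        topCoeff I vol y₀ (extChartAt I y₀ y)) (extChartAt I y₀).source :=
      continuousOn_const.mul ((hvol.continuousOn y₀).comp (continuousOn_extChartAt y₀)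
        fun y hy => (extChartAt I y₀).map_source hy)
    exact hc.isOpen_inter_preimage (isOpen_extChartAt_source y₀) isOpen_Ioi
  · exact ⟨mem_extChartAt_source y₀, mul_self_pos.2 (hvol.ne_zero y₀ _
      ((extChartAt I y₀).map_source (mem_extChartAt_source y₀)))⟩

omit [IsManifold I ∞ Q] [T2Space Q] [SecondCountableTopology Q] [MeasurableSpace Q]
  [BorelSpace Q] in
lemma abs_topCoeff_of_mem_orientedDomain {y₀ y : Q} (hy : y ∈ orientedDomain vol y₀) :
    |topCoeff I vol y₀ (extChartAt I y₀ y)|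
      = chartSign vol y₀ * topCoeff I vol y₀ (extChartAt I y₀ y) := by
  have h : 0 < topCoeff I vol y₀ (extChartAt I y₀ y₀) * topCoeff I vol y₀ (extChartAt I y₀ y) :=
    hy.2
  rcases pos_and_pos_or_neg_and_neg_of_mul_pos h with ⟨h1, h2⟩ | ⟨h1, h2⟩
  · rw [chartSign, sign_pos h1, abs_of_pos h2]; simp
  · rw [chartSign, sign_neg h1, abs_of_neg h2]; simp

/-- Stokes' theorem on a manifold without boundary. -/
theorem integral_eq_zero_of_isPrimitive (hI : range I = univ) (hvol : IsVolumeForm vol)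
    (hβ : IsPrimitive vol β f) (hf : Continuous f) {C : Set Q} (hC : IsCompact C)
    (hβC : ∀ x ∉ C, β x = 0) (hfC : ∀ x ∉ C, f x = 0) :
    ∫ x, f x ∂(volMeasure I vol) = 0 := by
  obtain ⟨J, ρ, U, hρ, hρs, hU, hCU, hsum⟩ := exists_finite_cutoffs I hC
    (fun y => (isOpen_orientedDomain hvol y).1) (fun y => (isOpen_orientedDomain hvol y).2)
  rw [integral_eq_sum_cutoffRatio hvol hβ.contDiffOn hf hC hβC hfC hρ hU hCU hsum]
  refine Finset.sum_eq_zero fun y _ => ?_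
  obtain ⟨D, K, hK, hD, -, hd, hdiv, hz, hint⟩ := cutoff_fields hvol hβ hf hC hβC hfC (hρ y)
    ((hρs y).trans inter_subset_left) (fun z hz => abs_topCoeff_of_mem_orientedDomain (hρs y hz))
  simp only [hI, interior_univ, mem_univ, forall_const, continuousOn_univ] at hD hd hdiv
  rw [hint, hI, setIntegral_univ, integral_divergence_eq_zero hK hd hD hdiv hz, mul_zero]

/-- Stokes' theorem on a manifold with boundary, for a cut-off form. The flux through the boundary
is written in the chart. -/
lemma integral_cutoffRatio_halfSpace (hI : range I = {p | 0 ≤ p 0}) (hvol : IsVolumeForm vol)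
    (hβ : IsPrimitive vol β f) (hf : Continuous f) {C : Set Q} (hC : IsCompact C)
    (hβC : ∀ x ∉ C, β x = 0) (hfC : ∀ x ∉ C, f x = 0) {ρ : Q → ℝ} {y : Q}
    (hρ : ContMDiff I 𝓘(ℝ, ℝ) ∞ ρ) (hρs : tsupport ρ ⊆ orientedDomain vol y) :
    ContinuousOn (cutoffComponent β ρ y 0) (range I) ∧
    ∫ x, cutoffRatio vol β f ρ x ∂(volMeasure I vol) = ∫ z : Fin k → ℝ,
      -chartSign vol y *
        cutoffComponent β ρ y 0 (WithLp.toLp 2 (Fin.cons 0 z : Fin (k + 1) → ℝ)) := by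
  obtain ⟨D, K, hK, hD, hc, hd, hdiv, hz, hint⟩ := cutoff_fields hvol hβ hf hC hβC hfC hρ
    (hρs.trans inter_subset_left) (fun z hz => abs_topCoeff_of_mem_orientedDomain (hρs hz))
  refine ⟨hc 0, ?_⟩
  have hpos : ∀ p : EuclideanSpace ℝ (Fin (k + 1)), 0 < p 0 → p ∈ interior (range I) := by
    intro p hp
    refine mem_interior.2 ⟨{q | 0 < q 0}, ?_, ?_, hp⟩
    · rw [hI]
      exact fun q (hq : 0 < q 0) => hq.le
    · exact isOpen_lt continuous_const (EuclideanSpace.proj (𝕜 := ℝ) (0 : Fin (k + 1))).continuous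
  rw [hI] at hD hc
  rw [hint, hI, setIntegral_halfSpace_divergence hK hc (fun p hp => hd p (hpos p hp)) hD
    (fun p hp => hdiv p (hpos p hp)) hz, integral_const_mul]
  ring

end GlobalStokes

/-! ### The boundary of the world volume -/

section HalfSpaceCharts

variable {N : Type*} [TopologicalSpace N] [ChartedSpace (EuclideanHalfSpace 3) N]
  [IsManifold (𝓡∂ 3) ∞ N]

/-- Every chart, not only the preferred one at `y`, detects the boundary points. -/
lemma mem_boundary_iff {y₀ y : N} (hy : y ∈ (extChartAt (𝓡∂ 3) y₀).source) :
    y ∈ (𝓡∂ 3).boundary N ↔ extChartAt (𝓡∂ 3) y₀ y 0 = 0 := by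
  have hr : 0 ≤ extChartAt (𝓡∂ 3) y₀ y 0 := by
    have : extChartAt (𝓡∂ 3) y₀ y ∈ range (𝓡∂ 3) :=
      extChartAt_target_subset_range y₀ ((extChartAt (𝓡∂ 3) y₀).map_source hy)
    rw [range_modelWithCornersEuclideanHalfSpace] at this
    exact this
  have h1 : (𝓡∂ 3).IsInteriorPoint y ↔
      extChartAt (𝓡∂ 3) y₀ y ∈ interior (extChartAt (𝓡∂ 3) y₀).target :=
    (𝓡∂ 3).isInteriorPoint_iff_of_mem_atlas (n := ∞) (by norm_num) (chart_mem_atlas _ y₀)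
      (by rwa [extChartAt_source] at hy)
  have h2 : extChartAt (𝓡∂ 3) y₀ y ∈ interior (extChartAt (𝓡∂ 3) y₀).target ↔
      0 < extChartAt (𝓡∂ 3) y₀ y 0 := by
    have hint := interior_range_modelWithCornersEuclideanHalfSpace 3
    constructor
    · intro h
      have h3 := interior_mono (extChartAt_target_subset_range y₀) h
      rw [hint] at h3
      exact h3
    · intro h
      have h3 : extChartAt (𝓡∂ 3) y₀ y ∈ interior (range (𝓡∂ 3)) := by
        rw [hint]; exact h
      rw [mem_interior_iff_mem_nhds] at h3 ⊢
      have h4 := extChartAt_target_mem_nhdsWithin_of_mem ((extChartAt (𝓡∂ 3) y₀).map_source hy)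
      rwa [nhdsWithin_eq_nhds.2 h3] at h4
  have h3 : y ∈ (𝓡∂ 3).boundary N ↔ ¬ (𝓡∂ 3).IsInteriorPoint y :=
    (not_congr ((𝓡∂ 3).isInteriorPoint_iff_not_isBoundaryPoint y)).trans not_not |>.symm
  rw [h3, h1, h2, not_lt]
  exact ⟨fun h => le_antisymm h hr, fun h => h.le⟩

/-- A vector at the boundary that points inward in one chart does not point outward in another. -/
lemma coord_frameAt_nonneg {y₀ y : N} (hy : y ∈ (extChartAt (𝓡∂ 3) y₀).source)
    (hb : y ∈ (𝓡∂ 3).boundary N) {v : EuclideanSpace ℝ (Fin 3)} (hv : 0 ≤ v 0) :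
    0 ≤ coord (𝓡∂ 3) y
      (frameAt (𝓡∂ 3) y₀ (extChartAt (𝓡∂ 3) y₀ y) v : TangentSpace (𝓡∂ 3) y) 0 := by
  set p := extChartAt (𝓡∂ 3) y₀ y with hp
  have hpt : p ∈ (extChartAt (𝓡∂ 3) y₀).target := (extChartAt (𝓡∂ 3) y₀).map_source hy
  have hyp : (extChartAt (𝓡∂ 3) y₀).symm p = y := (extChartAt (𝓡∂ 3) y₀).left_inv hy
  have h1 := hasFDerivWithinAt_chart_change (x₀ := y) hpt
    (by rw [hyp]; exact mem_extChartAt_source y)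
  have h2 := (EuclideanSpace.proj (𝕜 := ℝ) (0 : Fin 3)).hasFDerivAt.comp_hasFDerivWithinAt p h1
  -- The normal coordinate of one chart, as a function of the other, is minimal at the boundary.
  have hmin : IsLocalMinOn (EuclideanSpace.proj (𝕜 := ℝ) (0 : Fin 3) ∘
      (extChartAt (𝓡∂ 3) y ∘ (extChartAt (𝓡∂ 3) y₀).symm)) (range (𝓡∂ 3)) p := by
    refine Filter.Eventually.of_forall fun q => ?_
    have h3 : (EuclideanSpace.proj (𝕜 := ℝ) (0 : Fin 3) ∘
        (extChartAt (𝓡∂ 3) y ∘ (extChartAt (𝓡∂ 3) y₀).symm)) p = 0 := by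
      simp only [Function.comp_apply, hyp]
      exact (mem_boundary_iff (mem_extChartAt_source y)).1 hb
    rw [h3]
    have h4 : extChartAt (𝓡∂ 3) y ((extChartAt (𝓡∂ 3) y₀).symm q) ∈ range (𝓡∂ 3) :=
      mem_range_self _
    rw [range_modelWithCornersEuclideanHalfSpace] at h4
    exact h4
  have hp0 : p 0 = 0 := (mem_boundary_iff hy).1 hb
  have hcone : v ∈ posTangentConeAt (range (𝓡∂ 3)) p := by
    refine mem_posTangentConeAt_of_segment_subset ?_
    rintro _ ⟨a, b, ha, hb', hab, rfl⟩
    rw [range_modelWithCornersEuclideanHalfSpace]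
    have : (a • p + b • (p + v)) 0 = b * v 0 := by simp [hp0]
    exact (mul_nonneg hb' hv).trans_eq this.symm
  have h5 := hmin.hasFDerivWithinAt_nonneg h2 hcone
  rw [hyp] at h5
  exact h5

/-- The inward coordinate vector of one chart points inward in every other chart. -/
lemma coord_frameAt_pos {y₀ y : N} (hy : y ∈ (extChartAt (𝓡∂ 3) y₀).source)
    (hb : y ∈ (𝓡∂ 3).boundary N) :
    0 < coord (𝓡∂ 3) y (frameAt (𝓡∂ 3) y₀ (extChartAt (𝓡∂ 3) y₀ y)
      (EuclideanSpace.single 0 1) : TangentSpace (𝓡∂ 3) y) 0 := by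
  let T : EuclideanSpace ℝ (Fin 3) →L[ℝ] TangentSpace (𝓡∂ 3) y :=
    (frameAt (𝓡∂ 3) y₀ (extChartAt (𝓡∂ 3) y₀ y) :
      EuclideanSpace ℝ (Fin 3) →L[ℝ] EuclideanSpace ℝ (Fin 3))
  have hT : ∀ v : EuclideanSpace ℝ (Fin 3), 0 ≤ v 0 → 0 ≤ coframe (𝓡∂ 3) y y (T v) 0 :=
    fun v hv => coord_frameAt_nonneg hy hb hv
  have htan : ∀ v : EuclideanSpace ℝ (Fin 3), v 0 = 0 → coframe (𝓡∂ 3) y y (T v) 0 = 0 := by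
    intro v hv
    refine le_antisymm ?_ (hT v hv.ge)
    have := hT (-v) (by simp [hv])
    rw [map_neg, map_neg] at this
    simpa using this
  refine lt_of_le_of_ne (hT _ (by simp)) fun h0 => ?_
  have hall : ∀ v : EuclideanSpace ℝ (Fin 3), coframe (𝓡∂ 3) y y (T v) 0 = 0 := by
    intro v
    let ℓ : EuclideanSpace ℝ (Fin 3) →L[ℝ] ℝ :=
      (EuclideanSpace.proj (𝕜 := ℝ) (0 : Fin 3)).comp ((coframe (𝓡∂ 3) y y).comp T)
    have h2 : ℓ (v - v 0 • EuclideanSpace.single 0 1) = 0 := htan _ (by simp)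
    have h3 : ℓ (EuclideanSpace.single 0 1) = 0 := h0.symm
    rw [map_sub, map_smul, h3, smul_zero, sub_zero] at h2
    exact h2
  -- This contradicts that the differential of the change of charts is onto.
  have h4 := hall (coframe (𝓡∂ 3) y₀ y (basisVec (𝓡∂ 3) y 0))
  have h5 : T (coframe (𝓡∂ 3) y₀ y (basisVec (𝓡∂ 3) y 0)) = basisVec (𝓡∂ 3) y 0 :=
    frameAt_coframe' (𝓡∂ 3) y₀ hy _
  rw [h5, coframe_basisVec] at h4
  simp at h4

end HalfSpaceCharts

/-! ### Stokes' theorem on the world volume -/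

section BoundaryFlux

/-- The inclusion of the boundary of the half-space. -/
noncomputable def boundaryInclusion : EuclideanSpace ℝ (Fin 2) →L[ℝ] EuclideanSpace ℝ (Fin 3) :=
  (PiLp.continuousLinearEquiv 2 ℝ fun _ : Fin 3 => ℝ).symm.toContinuousLinearMap.comp
    (ContinuousLinearMap.pi ![0, EuclideanSpace.proj 0, EuclideanSpace.proj 1])

/-- The projection of the half-space to its boundary. -/
noncomputable def boundaryProjection : EuclideanSpace ℝ (Fin 3) →L[ℝ] EuclideanSpace ℝ (Fin 2) :=
  (PiLp.continuousLinearEquiv 2 ℝ fun _ : Fin 2 => ℝ).symm.toContinuousLinearMap.comp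
    (ContinuousLinearMap.pi ![EuclideanSpace.proj 1, EuclideanSpace.proj 2])

lemma boundaryInclusion_apply (z : Fin 2 → ℝ) :
    boundaryInclusion (WithLp.toLp 2 z) = WithLp.toLp 2 (Fin.cons 0 z : Fin 3 → ℝ) := by
  ext i
  fin_cases i <;> rfl

lemma boundaryInclusion_apply_zero (v : EuclideanSpace ℝ (Fin 2)) : boundaryInclusion v 0 = 0 := rfl

lemma boundaryInclusion_single (i : Fin 2) :
    boundaryInclusion (EuclideanSpace.single i 1) = EuclideanSpace.single i.succ 1 := by
  ext j
  fin_cases i <;> fin_cases j <;> simp [boundaryInclusion]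

lemma boundaryProjection_inclusion (v : EuclideanSpace ℝ (Fin 2)) :
    boundaryProjection (boundaryInclusion v) = v := by
  ext i
  fin_cases i <;> rfl

lemma boundaryInclusion_projection {v : EuclideanSpace ℝ (Fin 3)} (hv : v 0 = 0) :
    boundaryInclusion (boundaryProjection v) = v := by
  ext i
  fin_cases i
  · exact hv.symm
  · rfl
  · rfl

variable {S : Type*} [TopologicalSpace S] [ChartedSpace (EuclideanSpace ℝ (Fin 2)) S]
  [IsManifold (𝓡 2) ∞ S] {L : LorentzianSurface S}
  {N : Type*} [TopologicalSpace N] [ChartedSpace (EuclideanHalfSpace 3) N]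
  [IsManifold (𝓡∂ 3) ∞ N]
  {vol : ∀ y : N, TangentSpace (𝓡∂ 3) y [⋀^Fin 3]→L[ℝ] ℝ} {ι : S → N}

lemma isVolumeForm_areaForm (L : LorentzianSurface S) :
    IsVolumeForm (I := 𝓡 2) L.areaForm where
  alternating σ := by
    refine ⟨
      { toFun := fun w => L.area σ (w 0) (w 1)
        map_update_add' := fun m i x y => ?_
        map_update_smul' := fun m i c x => ?_
        map_eq_zero_of_eq' := fun v i j hij hne => ?_ }, fun w => rfl⟩
    · fin_cases i <;> simp
    · fin_cases i <;> simp
    · have h : v 0 = v 1 := by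
        fin_cases i <;> fin_cases j
        · exact absurd rfl hne
        · exact hij
        · exact hij.symm
        · exact absurd rfl hne
      rw [h, L.area_self]
  ne_zero s₀ p hp := L.areaCoeff_ne_zero hp
  continuousOn s₀ := L.contDiffOn_areaCoeff.continuousOn

lemma isVolumeForm_vol (hN : IsFilling L vol ι) :
    IsVolumeForm (I := 𝓡∂ 3) fun y w => vol y w where
  alternating y := ⟨(vol y).toAlternatingMap, fun _ => rfl⟩
  ne_zero y₀ p hp h := by
    refine hN.vol_ne_zero ((extChartAt (𝓡∂ 3) y₀).symm p) ?_
    have h1 : (vol ((extChartAt (𝓡∂ 3) y₀).symm p)).toAlternatingMap = 0 :=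
      Module.Basis.ext_alternating (frameBasis (𝓡∂ 3) y₀ hp) fun v hv => by
        have h2 := AlternatingMap.map_perm (vol ((extChartAt (𝓡∂ 3) y₀).symm p)).toAlternatingMap
          (frameBasis (𝓡∂ 3) y₀ hp) (Equiv.ofBijective v (Finite.injective_iff_bijective.1 hv))
        have h3 : (vol ((extChartAt (𝓡∂ 3) y₀).symm p)).toAlternatingMap
            (frameBasis (𝓡∂ 3) y₀ hp) = 0 := by
          rw [← h]
          exact congrArg (vol ((extChartAt (𝓡∂ 3) y₀).symm p))
            (funext fun i => frameBasis_apply (𝓡∂ 3) y₀ hp i)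
        rw [h3, smul_zero] at h2
        exact h2
    ext w
    exact DFunLike.congr_fun h1 w
  continuousOn y₀ := (hN.vol_smooth y₀).continuousOn

/-- The sign in Stokes' theorem: with `τ = vol(∂₀, ∂₁, ∂₂)`, `a` the area form and `d` the Jacobian
of the inclusion, the orientation convention says `a (-d τ) > 0`. -/
lemma boundary_sign {a d τ s : ℝ} (h : 0 < a * (-(d * τ))) (hs : |τ| = s * τ) :
    d / a * |a| = -s * |d| := by
  have hcase : ∀ d' : ℝ, a * d' < 0 → d' / a * |a| = -|d'| := by
    intro d' h'
    rcases mul_neg_iff.1 h' with ⟨h1, h2⟩ | ⟨h1, h2⟩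
    · rw [abs_of_pos h1, abs_of_neg h2, div_mul_cancel₀ _ h1.ne', neg_neg]
    · rw [abs_of_neg h1, abs_of_pos h2, mul_neg, div_mul_cancel₀ _ h1.ne]
  have hτ : τ ≠ 0 := by rintro rfl; simp at h
  rcases lt_or_gt_of_ne hτ with h1 | h1
  · have hs' : s = -1 := by
      rw [abs_of_neg h1] at hs
      exact mul_right_cancel₀ hτ (by linarith)
    have h2 := hcase (-d) (by
      have : 0 < (a * d) * (-τ) := by linarith
      have := (mul_pos_iff_of_pos_right (neg_pos.2 h1)).1 this
      linarith)
    rw [abs_neg, neg_div, neg_mul] at h2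
    rw [hs']
    linarith
  · have hs' : s = 1 := by
      rw [abs_of_pos h1] at hs
      exact mul_right_cancel₀ hτ (by linarith)
    have h2 := hcase d (by
      have : 0 < (-(a * d)) * τ := by linarith
      have := (mul_pos_iff_of_pos_right h1).1 this
      linarith)
    rw [hs']
    linarith

end BoundaryFlux

section BoundaryStokes

variable {S : Type*} [TopologicalSpace S] [ChartedSpace (EuclideanSpace ℝ (Fin 2)) S]
  [IsManifold (𝓡 2) ∞ S] {L : LorentzianSurface S}
  {N : Type*} [TopologicalSpace N] [ChartedSpace (EuclideanHalfSpace 3) N]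
  [IsManifold (𝓡∂ 3) ∞ N]
  {vol : ∀ y : N, TangentSpace (𝓡∂ 3) y [⋀^Fin 3]→L[ℝ] ℝ} {ι : S → N}

/-- The coordinates on the boundary that are induced by the chart around `y₀`. -/
noncomputable def boundaryChart (ι : S → N) (y₀ : N) (σ : S) : EuclideanSpace ℝ (Fin 2) :=
  boundaryProjection (extChartAt (𝓡∂ 3) y₀ (ι σ))

/-- The differential of `ι : S → N` in coordinates. -/
noncomputable def boundaryJacobian (ι : S → N) (y₀ : N) (σ₀ : S) (p : EuclideanSpace ℝ (Fin 2)) :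
    EuclideanSpace ℝ (Fin 2) →L[ℝ] EuclideanSpace ℝ (Fin 3) :=
  (coframe (𝓡∂ 3) y₀ (ι ((extChartAt (𝓡 2) σ₀).symm p))).comp
    ((mfderiv (𝓡 2) (𝓡∂ 3) ι ((extChartAt (𝓡 2) σ₀).symm p)).comp (frameAt (𝓡 2) σ₀ p))

lemma boundary_chart_zero (hN : IsFilling L vol ι) {y₀ : N} {σ : S}
    (hσ : ι σ ∈ (extChartAt (𝓡∂ 3) y₀).source) : extChartAt (𝓡∂ 3) y₀ (ι σ) 0 = 0 :=
  (mem_boundary_iff hσ).1 (hN.range_eq ▸ mem_range_self σ)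

lemma boundaryInclusion_boundaryChart (hN : IsFilling L vol ι) {y₀ : N} {σ : S}
    (hσ : ι σ ∈ (extChartAt (𝓡∂ 3) y₀).source) :
    boundaryInclusion (boundaryChart ι y₀ σ) = extChartAt (𝓡∂ 3) y₀ (ι σ) :=
  boundaryInclusion_projection (boundary_chart_zero hN hσ)

lemma hasFDerivWithinAt_boundary (hN : IsFilling L vol ι) {y₀ : N} {σ₀ : S}
    {p : EuclideanSpace ℝ (Fin 2)} (hp : p ∈ (extChartAt (𝓡 2) σ₀).target)
    (hσ : ι ((extChartAt (𝓡 2) σ₀).symm p) ∈ (extChartAt (𝓡∂ 3) y₀).source) :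
    HasFDerivWithinAt (extChartAt (𝓡∂ 3) y₀ ∘ ι ∘ (extChartAt (𝓡 2) σ₀).symm)
      (boundaryJacobian ι y₀ σ₀ p) (range (𝓡 2)) p := by
  have : IsManifold (𝓡 2) 1 S := IsManifold.of_le (n := ∞) (by norm_num)
  have : IsManifold (𝓡∂ 3) 1 N := IsManifold.of_le (n := ∞) (by norm_num)
  have h1 : MDifferentiableAt (𝓡∂ 3) 𝓘(ℝ, EuclideanSpace ℝ (Fin 3)) (extChartAt (𝓡∂ 3) y₀)
      (ι ((extChartAt (𝓡 2) σ₀).symm p)) :=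
    mdifferentiableAt_extChartAt (by rwa [extChartAt_source] at hσ)
  have h2 : MDifferentiableAt (𝓡 2) (𝓡∂ 3) ι ((extChartAt (𝓡 2) σ₀).symm p) :=
    (hN.smooth _).mdifferentiableAt (by norm_num)
  have h3 := (h1.hasMFDerivAt.comp _ h2.hasMFDerivAt).comp_hasMFDerivWithinAt p
    (mdifferentiableWithinAt_extChartAt_symm hp).hasMFDerivWithinAt
  exact h3.hasFDerivWithinAt

/-- The image of `ι` lies in the boundary, so the normal component of its differential vanishes. -/
lemma boundaryJacobian_zero (hN : IsFilling L vol ι) {y₀ : N} {σ₀ : S}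
    {p : EuclideanSpace ℝ (Fin 2)} (hp : p ∈ (extChartAt (𝓡 2) σ₀).target)
    (hσ : ι ((extChartAt (𝓡 2) σ₀).symm p) ∈ (extChartAt (𝓡∂ 3) y₀).source)
    (v : EuclideanSpace ℝ (Fin 2)) : boundaryJacobian ι y₀ σ₀ p v 0 = 0 := by
  have h1 := hasFDerivWithinAt_boundary hN hp hσ
  have hr : range (𝓡 2) = univ := by simp
  rw [hr, hasFDerivWithinAt_univ] at h1
  have h2 := (EuclideanSpace.proj (𝕜 := ℝ) (0 : Fin 3)).hasFDerivAt.comp p h1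
  have hc : ContinuousAt (fun q => ι ((extChartAt (𝓡 2) σ₀).symm q)) p :=
    ContinuousAt.comp (g := ι) hN.smooth.continuous.continuousAt
      ((continuousOn_extChartAt_symm σ₀).continuousAt ((isOpen_extChartAt_target σ₀).mem_nhds hp))
  have h3 : (EuclideanSpace.proj (𝕜 := ℝ) (0 : Fin 3)) ∘
      (extChartAt (𝓡∂ 3) y₀ ∘ ι ∘ (extChartAt (𝓡 2) σ₀).symm) =ᶠ[nhds p] fun _ => (0 : ℝ) := by
    filter_upwards [hc ((isOpen_extChartAt_source y₀).mem_nhds hσ)] with q hq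
    exact boundary_chart_zero hN hq
  have h4 := h2.unique ((hasFDerivAt_const (0 : ℝ) p).congr_of_eventuallyEq h3)
  exact DFunLike.congr_fun h4 v

/-- The pull-back of a form to the boundary, in coordinates. -/
lemma alternating_boundary (hN : IsFilling L vol ι) {y₀ : N} {σ₀ : S}
    {p : EuclideanSpace ℝ (Fin 2)} (hp : p ∈ (extChartAt (𝓡 2) σ₀).target)
    (hσ : ι ((extChartAt (𝓡 2) σ₀).symm p) ∈ (extChartAt (𝓡∂ 3) y₀).source)
    (γ : TangentSpace (𝓡∂ 3) (ι ((extChartAt (𝓡 2) σ₀).symm p)) [⋀^Fin 2]→ₗ[ℝ] ℝ) :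
    γ (fun i => mfderiv (𝓡 2) (𝓡∂ 3) ι ((extChartAt (𝓡 2) σ₀).symm p) (frameVec σ₀ p i))
      = (boundaryProjection.comp (boundaryJacobian ι y₀ σ₀ p)).det * γ fun i =>
        (frameAt (𝓡∂ 3) y₀ (extChartAt (𝓡∂ 3) y₀ (ι ((extChartAt (𝓡 2) σ₀).symm p)))
          (EuclideanSpace.single i.succ 1) :
            TangentSpace (𝓡∂ 3) (ι ((extChartAt (𝓡 2) σ₀).symm p))) := by
  let T : EuclideanSpace ℝ (Fin 3) →L[ℝ] TangentSpace (𝓡∂ 3) (ι ((extChartAt (𝓡 2) σ₀).symm p)) :=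
    (frameAt (𝓡∂ 3) y₀ (extChartAt (𝓡∂ 3) y₀ (ι ((extChartAt (𝓡 2) σ₀).symm p))) :
      EuclideanSpace ℝ (Fin 3) →L[ℝ] EuclideanSpace ℝ (Fin 3))
  have h := alternating_comp_frame γ (T.comp boundaryInclusion).toLinearMap
    (boundaryProjection.comp (boundaryJacobian ι y₀ σ₀ p))
  refine Eq.trans (congrArg γ (funext fun i => ?_)) (h.trans ?_)
  · have h1 : T (boundaryJacobian ι y₀ σ₀ p (EuclideanSpace.single i 1))
        = mfderiv (𝓡 2) (𝓡∂ 3) ι ((extChartAt (𝓡 2) σ₀).symm p) (frameVec σ₀ p i) :=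
      frameAt_coframe' (𝓡∂ 3) y₀ hσ _
    rw [← h1, ← boundaryInclusion_projection (boundaryJacobian_zero hN hp hσ _)]
    rfl
  · congr 2
    funext i
    exact congrArg T (boundaryInclusion_single i)

/-- The pull-back to the boundary of a form, divided by the area form. -/
noncomputable def boundaryRatio (L : LorentzianSurface S) (ι : S → N)
    (β : ∀ y : N, TangentSpace (𝓡∂ 3) y [⋀^Fin 2]→ₗ[ℝ] ℝ) (σ : S) : ℝ :=
  β (ι σ) (fun i => mfderiv (𝓡 2) (𝓡∂ 3) ι σ (basisVec (𝓡 2) σ i))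
    / L.areaForm σ (basisVec (𝓡 2) σ)

lemma boundaryRatio_eq (L : LorentzianSurface S)
    (β : ∀ y : N, TangentSpace (𝓡∂ 3) y [⋀^Fin 2]→ₗ[ℝ] ℝ) {σ₀ : S}
    {p : EuclideanSpace ℝ (Fin 2)} (hp : p ∈ (extChartAt (𝓡 2) σ₀).target) :
    boundaryRatio L ι β ((extChartAt (𝓡 2) σ₀).symm p)
      = β (ι ((extChartAt (𝓡 2) σ₀).symm p)) (fun i =>
          mfderiv (𝓡 2) (𝓡∂ 3) ι ((extChartAt (𝓡 2) σ₀).symm p) (frameVec σ₀ p i))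
        / L.areaCoeff σ₀ p :=
  ratio_eq_topCoeff_ratio (I := 𝓡 2)
    (α := fun σ w => β (ι σ) fun i => mfderiv (𝓡 2) (𝓡∂ 3) ι σ (w i)) (vol := L.areaForm) σ₀ hp
    ⟨(β (ι ((extChartAt (𝓡 2) σ₀).symm p))).compLinearMap
      (mfderiv (𝓡 2) (𝓡∂ 3) ι ((extChartAt (𝓡 2) σ₀).symm p)).toLinearMap, fun _ => rfl⟩
    ((isVolumeForm_areaForm L).alternating _)

lemma formComponent_zero_apply (β : ∀ y : N, TangentSpace (𝓡∂ 3) y [⋀^Fin 2]→ₗ[ℝ] ℝ) {y₀ y : N}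
    (hy : y ∈ (extChartAt (𝓡∂ 3) y₀).source) :
    formComponent β y₀ 0 (extChartAt (𝓡∂ 3) y₀ y) = β y fun i =>
      (frameAt (𝓡∂ 3) y₀ (extChartAt (𝓡∂ 3) y₀ y) (EuclideanSpace.single i.succ 1) :
        TangentSpace (𝓡∂ 3) y) := by
  unfold formComponent
  rw [(extChartAt (𝓡∂ 3) y₀).left_inv hy]
  simp

/-- The orientation convention for the boundary, "outward normal first", in coordinates. The
outward normal is minus the first coordinate vector of a chart of the world volume. -/
lemma area_mul_jacobian_pos (hN : IsFilling L vol ι) {y₀ : N} {σ₀ : S}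
    {p : EuclideanSpace ℝ (Fin 2)} (hp : p ∈ (extChartAt (𝓡 2) σ₀).target)
    (hσ : ι ((extChartAt (𝓡 2) σ₀).symm p) ∈ (extChartAt (𝓡∂ 3) y₀).source) :
    0 < L.areaCoeff σ₀ p * (-((boundaryProjection.comp (boundaryJacobian ι y₀ σ₀ p)).det *
      topCoeff (𝓡∂ 3) (fun y w => vol y w) y₀
        (extChartAt (𝓡∂ 3) y₀ (ι ((extChartAt (𝓡 2) σ₀).symm p))))) := by
  set σ := (extChartAt (𝓡 2) σ₀).symm p with hσdef
  let T : EuclideanSpace ℝ (Fin 3) →L[ℝ] TangentSpace (𝓡∂ 3) (ι σ) :=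
    (frameAt (𝓡∂ 3) y₀ (extChartAt (𝓡∂ 3) y₀ (ι σ)) :
      EuclideanSpace ℝ (Fin 3) →L[ℝ] EuclideanSpace ℝ (Fin 3))
  have hb : ι σ ∈ (𝓡∂ 3).boundary N := hN.range_eq ▸ mem_range_self σ
  have hw : coord (𝓡∂ 3) (ι σ) (-T (EuclideanSpace.single 0 1)) 0 < 0 := by
    have h1 := coord_frameAt_pos hσ hb
    unfold coord at h1 ⊢
    rw [map_neg]
    exact neg_neg_of_pos h1
  let γ : TangentSpace (𝓡∂ 3) (ι σ) [⋀^Fin 2]→ₗ[ℝ] ℝ :=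
    (vol (ι σ)).toAlternatingMap.curryLeft (T (EuclideanSpace.single 0 1))
  have hγ : ∀ u v, vol (ι σ) ![-T (EuclideanSpace.single 0 1), u, v] = -γ ![u, v] := by
    intro u v
    exact DFunLike.congr_fun (map_neg (vol (ι σ)).toAlternatingMap.curryLeft
      (T (EuclideanSpace.single 0 1))) ![u, v]
  set u := mfderiv (𝓡 2) (𝓡∂ 3) ι σ (frameVec σ₀ p 0) with hu
  set v := mfderiv (𝓡 2) (𝓡∂ 3) ι σ (frameVec σ₀ p 1) with hv
  have hdet : γ ![u, v] = (boundaryProjection.comp (boundaryJacobian ι y₀ σ₀ p)).det *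
      topCoeff (𝓡∂ 3) (fun y w => vol y w) y₀ (extChartAt (𝓡∂ 3) y₀ (ι σ)) := by
    have h1 := alternating_boundary hN hp hσ γ
    have h2 : (fun i => mfderiv (𝓡 2) (𝓡∂ 3) ι σ (frameVec σ₀ p i)) = ![u, v] := by
      funext i
      fin_cases i <;> rfl
    rw [← h2]
    refine h1.trans ?_
    congr 1
    rw [topCoeff_apply_chart _ hσ]
    refine congrArg (vol (ι σ)) ?_
    funext i
    refine Fin.cases rfl (fun j => rfl) i
  have hswap : γ ![v, u] = -γ ![u, v] := by
    have h1 := γ.map_swap ![u, v] (i := 0) (j := 1) (by decide)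
    rw [← h1]
    congr 1
    funext i
    fin_cases i <;> rfl
  rw [← hdet]
  have harea : L.areaCoeff σ₀ p = L.area σ (frameVec σ₀ p 0) (frameVec σ₀ p 1) := rfl
  -- The coordinate vectors of the world sheet may be negatively ordered.
  rcases lt_or_gt_of_ne (L.areaCoeff_ne_zero hp) with ha | ha
  · have h1 := hN.orientation σ (-T (EuclideanSpace.single 0 1)) (frameVec σ₀ p 1) (frameVec σ₀ p 0)
      hw (by rw [L.area_swap, ← harea]; linarith)
    rw [hγ, hswap, neg_neg] at h1
    exact mul_pos_of_neg_of_neg ha (neg_neg_of_pos h1)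
  · have h1 := hN.orientation σ (-T (EuclideanSpace.single 0 1)) (frameVec σ₀ p 0) (frameVec σ₀ p 1)
      hw ha
    rw [hγ] at h1
    exact mul_pos ha h1

end BoundaryStokes

section StokesWithBoundary

variable {S : Type*} [TopologicalSpace S] [ChartedSpace (EuclideanSpace ℝ (Fin 2)) S]
  [IsManifold (𝓡 2) ∞ S] [SecondCountableTopology S] [MeasurableSpace S] [BorelSpace S]
  {L : LorentzianSurface S}
  {N : Type*} [TopologicalSpace N] [ChartedSpace (EuclideanHalfSpace 3) N]
  [IsManifold (𝓡∂ 3) ∞ N]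
  {vol : ∀ y : N, TangentSpace (𝓡∂ 3) y [⋀^Fin 3]→L[ℝ] ℝ} {ι : S → N}
  {β : ∀ y : N, TangentSpace (𝓡∂ 3) y [⋀^Fin 2]→ₗ[ℝ] ℝ}

/-- The flux through the boundary, as an integral over the world sheet. -/
lemma integral_flux_eq (hN : IsFilling L vol ι) (hκ : Continuous (boundaryRatio L ι β)) {ρ : N → ℝ}
    (hρ : Continuous ρ) {y₀ : N} (hρs : tsupport ρ ⊆ orientedDomain (fun y w => vol y w) y₀)
    (hc : ContinuousOn (cutoffComponent β ρ y₀ 0) (range (𝓡∂ 3))) :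
    ∫ z : Fin 2 → ℝ, -chartSign (fun y w => vol y w) y₀ *
      cutoffComponent β ρ y₀ 0 (WithLp.toLp 2 (Fin.cons 0 z : Fin 3 → ℝ))
      = ∫ σ, ρ (ι σ) * boundaryRatio L ι β σ ∂(volMeasure (𝓡 2) L.areaForm) := by
  set s := chartSign (fun y w => vol y w) y₀
  set W := orientedDomain (fun y w => vol y w) y₀ with hW
  have hWo : IsOpen W := (isOpen_orientedDomain (isVolumeForm_vol hN) y₀).1
  set G : EuclideanSpace ℝ (Fin 2) → ℝ :=
    fun z => -s * cutoffComponent β ρ y₀ 0 (boundaryInclusion z) with hG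
  have hGc : Continuous G := by
    refine continuous_const.mul ?_
    rw [← continuousOn_univ]
    refine hc.comp boundaryInclusion.continuous.continuousOn fun z _ => ?_
    rw [range_modelWithCornersEuclideanHalfSpace]
    exact (boundaryInclusion_apply_zero z).ge
  have hinj : InjOn (boundaryChart ι y₀) (ι ⁻¹' W) := by
    intro σ hσ σ' hσ' h
    have h1 := congrArg boundaryInclusion h
    rw [boundaryInclusion_boundaryChart hN hσ.1, boundaryInclusion_boundaryChart hN hσ'.1] at h1
    exact hN.isEmbedding.injective ((extChartAt (𝓡∂ 3) y₀).injOn hσ.1 hσ'.1 h1)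
  have h1 := (setIntegral_volMeasure_eq (I := 𝓡 2) (vol := L.areaForm)
    (isVolumeForm_areaForm L).continuousOn
    (hWo.preimage hN.smooth.continuous).measurableSet hinj
    (F := fun σ => ρ (ι σ) * boundaryRatio L ι β σ)
    ((hρ.comp hN.smooth.continuous).mul hκ).measurable (G := G) hGc.continuousOn ?_).2
  · rw [setIntegral_eq_integral_of_forall_compl_eq_zero,
      setIntegral_eq_integral_of_forall_compl_eq_zero] at h1
    · rw [h1, ← (PiLp.volume_preserving_toLp (Fin 2)).integral_comp
        (MeasurableEquiv.toLp 2 (Fin 2 → ℝ)).measurableEmbedding]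
      simp only [hG, boundaryInclusion_apply]
    · -- A boundary point of the chart domain lies on the world sheet.
      intro z hz
      by_contra h0
      have h2 : cutoffComponent β ρ y₀ 0 (boundaryInclusion z) ≠ 0 := right_ne_zero_of_mul h0
      have ht : boundaryInclusion z ∈ (extChartAt (𝓡∂ 3) y₀).target := by
        by_contra h
        exact h2 (indicator_of_notMem h _)
      rw [cutoffComponent, indicator_of_mem ht] at h2
      have hmem : (extChartAt (𝓡∂ 3) y₀).symm (boundaryInclusion z) ∈ W :=
        hρs (subset_tsupport ρ (left_ne_zero_of_mul h2))
      have hb : (extChartAt (𝓡∂ 3) y₀).symm (boundaryInclusion z) ∈ (𝓡∂ 3).boundary N := by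
        rw [mem_boundary_iff hmem.1, (extChartAt (𝓡∂ 3) y₀).right_inv ht]
        exact boundaryInclusion_apply_zero z
      rw [← hN.range_eq] at hb
      obtain ⟨σ, hσ⟩ := hb
      refine hz ⟨σ, by rw [mem_preimage, hσ]; exact hmem, ?_⟩
      rw [boundaryChart, hσ, (extChartAt (𝓡∂ 3) y₀).right_inv ht, boundaryProjection_inclusion]
    · intro σ hσ
      have : ι σ ∉ tsupport ρ := fun h => hσ (hρs h)
      rw [image_eq_zero_of_notMem_tsupport this, zero_mul]
  · intro σ₀ p hp hσ
    refine ⟨boundaryProjection.comp (boundaryJacobian ι y₀ σ₀ p),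
      boundaryProjection.hasFDerivAt.comp_hasFDerivWithinAt p
        (hasFDerivWithinAt_boundary hN hp hσ.1), ?_⟩
    have hsgn := boundary_sign (area_mul_jacobian_pos hN hp hσ.1)
      (abs_topCoeff_of_mem_orientedDomain hσ)
    have hα := alternating_boundary hN hp hσ.1 (β (ι ((extChartAt (𝓡 2) σ₀).symm p)))
    have hcut : cutoffComponent β ρ y₀ 0
        (extChartAt (𝓡∂ 3) y₀ (ι ((extChartAt (𝓡 2) σ₀).symm p)))
        = ρ (ι ((extChartAt (𝓡 2) σ₀).symm p)) *
          formComponent β y₀ 0 (extChartAt (𝓡∂ 3) y₀ (ι ((extChartAt (𝓡 2) σ₀).symm p))) := by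
      rw [cutoffComponent, indicator_of_mem ((extChartAt (𝓡∂ 3) y₀).map_source hσ.1),
        (extChartAt (𝓡∂ 3) y₀).left_inv hσ.1]
    rw [boundaryRatio_eq L β hp, hα, hG]
    simp only
    rw [boundaryInclusion_boundaryChart hN hσ.1, hcut, formComponent_zero_apply β hσ.1]
    set b := β (ι ((extChartAt (𝓡 2) σ₀).symm p)) fun i =>
        (frameAt (𝓡∂ 3) y₀ (extChartAt (𝓡∂ 3) y₀ (ι ((extChartAt (𝓡 2) σ₀).symm p)))
          (EuclideanSpace.single i.succ 1) :
            TangentSpace (𝓡∂ 3) (ι ((extChartAt (𝓡 2) σ₀).symm p)))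
    have harea : topCoeff (𝓡 2) L.areaForm σ₀ p = L.areaCoeff σ₀ p := rfl
    rw [harea]
    calc _ = ρ (ι ((extChartAt (𝓡 2) σ₀).symm p)) * b *
          ((boundaryProjection.comp (boundaryJacobian ι y₀ σ₀ p)).det / L.areaCoeff σ₀ p
            * |L.areaCoeff σ₀ p|) := by ring
      _ = _ := by rw [hsgn]; ring

variable [T2Space S] [T2Space N] [SecondCountableTopology N] [MeasurableSpace N] [BorelSpace N]
  {f : N → ℝ}

/-- Stokes' theorem on the world volume. -/
theorem integral_eq_integral_boundaryRatio (hN : IsFilling L vol ι)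
    (hβ : IsPrimitive (fun y w => vol y w) β f) (hf : Continuous f) {C : Set N} (hC : IsCompact C)
    (hβC : ∀ x ∉ C, β x = 0) (hfC : ∀ x ∉ C, f x = 0)
    (hκ : Continuous (boundaryRatio L ι β)) {K : Set S} (hK : IsCompact K)
    (hκK : ∀ σ ∉ K, boundaryRatio L ι β σ = 0) :
    ∫ y, f y ∂(volMeasure (𝓡∂ 3) fun y w => vol y w)
      = ∫ σ, boundaryRatio L ι β σ ∂(volMeasure (𝓡 2) L.areaForm) := by
  have hvol := isVolumeForm_vol hN
  have := isFiniteMeasureOnCompacts_volMeasure (isVolumeForm_areaForm L)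
  obtain ⟨J, ρ, U, hρ, hρs, hU, hCU, hsum⟩ := exists_finite_cutoffs (𝓡∂ 3) hC
    (fun y => (isOpen_orientedDomain hvol y).1) (fun y => (isOpen_orientedDomain hvol y).2)
  rw [integral_eq_sum_cutoffRatio hvol hβ.contDiffOn hf hC hβC hfC hρ hU hCU hsum]
  have h1 : ∀ y, ∫ x, cutoffRatio (fun y w => vol y w) β f (ρ y) x
      ∂(volMeasure (𝓡∂ 3) fun y w => vol y w)
      = ∫ σ, ρ y (ι σ) * boundaryRatio L ι β σ ∂(volMeasure (𝓡 2) L.areaForm) := by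
    intro y
    obtain ⟨h2, h3⟩ := integral_cutoffRatio_halfSpace (range_modelWithCornersEuclideanHalfSpace 3)
      hvol hβ hf hC hβC hfC (hρ y) (hρs y)
    rw [h3]
    exact integral_flux_eq hN hκ (hρ y).continuous (hρs y) h2
  simp only [h1]
  rw [← integral_finsetSum]
  · congr 1
    funext σ
    by_cases hσ : ι σ ∈ C
    · rw [← Finset.sum_mul, hsum _ (hCU hσ), one_mul]
    · have h0 : boundaryRatio L ι β σ = 0 := by
        rw [boundaryRatio, hβC _ hσ, AlternatingMap.zero_apply, zero_div]
      simp [h0]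
  · intro y _
    refine Continuous.integrable_of_hasCompactSupport
      (((hρ y).continuous.comp hN.smooth.continuous).mul hκ) ?_
    refine HasCompactSupport.intro hK fun σ hσ => ?_
    rw [hκK σ hσ, mul_zero]

end StokesWithBoundary

/-! ### Differentiation under the integral sign -/

section SmoothFamilies

variable {d : ℕ} {B : Type*} [TopologicalSpace B]
  {I : ModelWithCorners ℝ (EuclideanSpace ℝ (Fin d)) B}
  {Q : Type*} [TopologicalSpace Q] [ChartedSpace B Q]

variable (I) in
/-- A family of functions that is jointly smooth in the parameter and the point, in charts. -/
def IsSmoothFamily (Φ : ℝ → Q → ℝ) : Prop :=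
  ∀ x₀ : Q, ∀ p ∈ (extChartAt I x₀).target, ∀ t : ℝ,
    ContDiffWithinAt ℝ ∞ (fun q : ℝ × EuclideanSpace ℝ (Fin d) =>
      Φ q.1 ((extChartAt I x₀).symm q.2)) (timeRange I) (t, p)

variable {Φ : ℝ → Q → ℝ}

lemma IsSmoothFamily.hasDerivAt (hΦ : IsSmoothFamily I Φ) {x₀ y : Q}
    (hy : y ∈ (extChartAt I x₀).source) (t : ℝ) :
    HasDerivAt (fun t => Φ t y) (fderivWithin ℝ (fun q : ℝ × EuclideanSpace ℝ (Fin d) =>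
      Φ q.1 ((extChartAt I x₀).symm q.2)) (timeRange I) (t, extChartAt I x₀ y) (1, 0)) t := by
  have hp := (extChartAt I x₀).map_source hy
  have h4 := ((hΦ x₀ _ hp t).differentiableWithinAt (by norm_num)).hasFDerivWithinAt
  have h5 : HasFDerivWithinAt (fun t' : ℝ => (t', extChartAt I x₀ y))
      (ContinuousLinearMap.inl ℝ ℝ (EuclideanSpace ℝ (Fin d))) univ t :=
    (hasFDerivAt_prodMk_left t _).hasFDerivWithinAt
  have h6 := HasFDerivWithinAt.comp t h4 h5
    (fun t' _ => (mem_timeRange hp : (t', extChartAt I x₀ y) ∈ timeRange I))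
  rw [hasFDerivWithinAt_univ] at h6
  have h7 := h6.hasDerivAt
  simp only [Function.comp_def, (extChartAt I x₀).left_inv hy] at h7
  exact h7

lemma IsSmoothFamily.continuous_deriv (hΦ : IsSmoothFamily I Φ) :
    Continuous fun q : ℝ × Q => deriv (fun t => Φ t q.2) q.1 := by
  refine continuous_iff_continuousAt.2 fun ⟨t₀, y₀⟩ => ?_
  have h1 : ContinuousOn (fun q : ℝ × Q => fderivWithin ℝ
      (fun q : ℝ × EuclideanSpace ℝ (Fin d) => Φ q.1 ((extChartAt I y₀).symm q.2)) (timeRange I)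
      (q.1, extChartAt I y₀ q.2) (1, 0)) (univ ×ˢ (extChartAt I y₀).source) := by
    rintro ⟨t, y⟩ ⟨-, hy⟩
    have hp := (extChartAt I y₀).map_source hy
    have h2 := ((hΦ y₀ _ hp t).fderivWithin_right (m := 0) uniqueDiffOn_timeRange
      (by norm_num) (mem_timeRange hp)).continuousWithinAt
    have h3 : ContinuousWithinAt (fun q : ℝ × Q => (q.1, extChartAt I y₀ q.2))
        (univ ×ˢ (extChartAt I y₀).source) (t, y) :=
      continuousWithinAt_fst.prodMk
        ((continuousOn_extChartAt y₀ y hy).comp continuousWithinAt_snd fun q hq => hq.2)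
    exact (ContinuousWithinAt.comp (t := timeRange I) (x := (t, y))
      (f := fun q : ℝ × Q => ((q.1, extChartAt I y₀ q.2) : ℝ × EuclideanSpace ℝ (Fin d)))
      h2 h3 fun q hq => mem_timeRange
      ((extChartAt I y₀).map_source hq.2)).clm_apply continuousWithinAt_const
  have h2 : univ ×ˢ (extChartAt I y₀).source ∈ nhds (t₀, y₀) :=
    prod_mem_nhds Filter.univ_mem (extChartAt_source_mem_nhds y₀)
  refine (h1.continuousAt h2).congr ?_
  filter_upwards [h2] with q hq
  exact (hΦ.hasDerivAt hq.2 q.1).deriv.symm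

lemma IsSmoothFamily.continuous (hΦ : IsSmoothFamily I Φ) (t : ℝ) : Continuous (Φ t) := by
  refine continuous_iff_continuousAt.2 fun y₀ => ?_
  have h1 : ContinuousOn (fun y : Q => Φ t ((extChartAt I y₀).symm (extChartAt I y₀ y)))
      (extChartAt I y₀).source := by
    intro y hy
    have hp := (extChartAt I y₀).map_source hy
    exact ContinuousWithinAt.comp (t := timeRange I)
      (f := fun y : Q => ((t, extChartAt I y₀ y) : ℝ × EuclideanSpace ℝ (Fin d)))
      (hΦ y₀ _ hp t).continuousWithinAt
      (continuousWithinAt_const.prodMk (continuousOn_extChartAt y₀ y hy))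
      fun y' hy' => mem_timeRange ((extChartAt I y₀).map_source hy')
  refine (h1.continuousAt (extChartAt_source_mem_nhds y₀)).congr ?_
  filter_upwards [extChartAt_source_mem_nhds (I := I) y₀] with y hy
  rw [(extChartAt I y₀).left_inv hy]

lemma IsSmoothFamily.differentiable (hΦ : IsSmoothFamily I Φ) (y : Q) (t : ℝ) :
    HasDerivAt (fun t => Φ t y) (deriv (fun t => Φ t y) t) t :=
  (hΦ.hasDerivAt (mem_extChartAt_source y) t).differentiableAt.hasDerivAt

/-- Differentiation under the integral over a compact set: the integrand's derivative is bounded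
on `[-1, 1] × K`. -/
lemma IsSmoothFamily.hasDerivAt_integral [SecondCountableTopology Q] [T2Space Q]
    [MeasurableSpace Q] [BorelSpace Q]
    (hΦ : IsSmoothFamily I Φ) {μ : Measure Q} [IsFiniteMeasureOnCompacts μ] {K : Set Q}
    (hK : IsCompact K) :
    HasDerivAt (fun t => ∫ y in K, Φ t y ∂μ) (∫ y in K, deriv (fun t => Φ t y) 0 ∂μ) 0 := by
  obtain ⟨C, hC⟩ := ((isCompact_Icc (a := (-1 : ℝ)) (b := 1)).prod hK).exists_bound_of_continuousOn
    hΦ.continuous_deriv.continuousOn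
  have hfin : IsFiniteMeasure (μ.restrict K) := ⟨by
    rw [Measure.restrict_apply_univ]; exact hK.measure_lt_top⟩
  refine (hasDerivAt_integral_of_dominated_loc_of_deriv_le (μ := μ.restrict K)
    (F := Φ) (F' := fun t y => deriv (fun t => Φ t y) t) (bound := fun _ => C)
    (Metric.ball_mem_nhds (0 : ℝ) one_pos)
    (Filter.Eventually.of_forall fun t => (hΦ.continuous t).aestronglyMeasurable)
    ((hΦ.continuous 0).continuousOn.integrableOn_compact hK)
    (hΦ.continuous_deriv.comp (continuous_const.prodMk continuous_id)).aestronglyMeasurable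
    ?_ (integrable_const C) (Filter.Eventually.of_forall fun y t _ => hΦ.differentiable y t)).2
  refine ae_restrict_of_forall_mem hK.measurableSet fun y hy t ht => hC (t, y) ⟨?_, hy⟩
  rw [Metric.mem_ball, dist_zero_right, Real.norm_eq_abs, abs_lt] at ht
  exact ⟨ht.1.le, ht.2.le⟩

end SmoothFamilies

/-! ### The Wess-Zumino term -/

lemma contDiffWithinAt_alternating_apply {V W : Type*} [NormedAddCommGroup V] [NormedSpace ℝ V]
    [NormedAddCommGroup W] [NormedSpace ℝ W] {m : WithTop ℕ∞} {s : Set V} {x : V} :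
    ∀ {k : ℕ} {f : V → W [⋀^Fin k]→L[ℝ] ℝ} {v : V → Fin k → W}, ContDiffWithinAt ℝ m f s x →
      (∀ i, ContDiffWithinAt ℝ m (fun y => v y i) s x) →
      ContDiffWithinAt ℝ m (fun y => f y (v y)) s x
  | 0, f, v, hf, _ => by
    have h := ((ContinuousMultilinearMap.apply ℝ (fun _ : Fin 0 => W) ℝ
      (fun i => i.elim0)).contDiff (n := m)).comp_contDiffWithinAt
      (((ContinuousAlternatingMap.toContinuousMultilinearMapLI (𝕜 := ℝ) (E := W) (F := ℝ)
        (ι := Fin 0)).contDiff (n := m)).comp_contDiffWithinAt hf)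
    convert h using 1
    funext y
    exact congrArg (f y) (Subsingleton.elim _ _)
  | k + 1, f, v, hf, hv => by
    let e : (W [⋀^Fin (k + 1)]→L[ℝ] ℝ) →L[ℝ] W →L[ℝ] W [⋀^Fin k]→L[ℝ] ℝ :=
      ContinuousAlternatingMap.curryLeftLI.toContinuousLinearMap
    have h1 := (ContinuousLinearMap.contDiff (𝕜 := ℝ) (E := W [⋀^Fin (k + 1)]→L[ℝ] ℝ)
      (F := W →L[ℝ] W [⋀^Fin k]→L[ℝ] ℝ) (n := m) e).comp_contDiffWithinAt hf
    have h2 := contDiffWithinAt_alternating_apply (h1.clm_apply (hv 0)) fun i => hv i.succ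
    convert h2 using 1
    funext y
    exact congrArg (f y) (Fin.cons_self_tail (v y)).symm

/-- The pull-back of a closed form along a map on `ℝ × ℝ^(k+1)` is closed: the time derivative of
its spatial part is the divergence of its mixed part. -/
lemma fderiv_pullback_of_closed {k : ℕ} {F : Type*} [NormedAddCommGroup F] [NormedSpace ℝ F]
    {Ω : F → F [⋀^Fin (k + 1)]→L[ℝ] ℝ} {Y : ℝ × EuclideanSpace ℝ (Fin (k + 1)) → F}
    {q : ℝ × EuclideanSpace ℝ (Fin (k + 1))} (hΩ : DifferentiableAt ℝ Ω (Y q))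
    (hd : extDeriv Ω (Y q) = 0) (hY : ContDiffAt ℝ ∞ Y q) :
    fderiv ℝ (fun x => Ω (Y x) fun i => fderiv ℝ Y x (0, EuclideanSpace.single i 1)) q (1, 0)
      = ∑ j : Fin (k + 1), (-1) ^ (j : ℕ) * fderiv ℝ (fun x => Ω (Y x)
        (Fin.cons (fderiv ℝ Y x (1, 0))
          fun i => fderiv ℝ Y x (0, EuclideanSpace.single (j.succAbove i) 1))) q
        (0, EuclideanSpace.single j 1) := by
  have h1 : DifferentiableAt ℝ (fun x => (Ω (Y x)).compContinuousLinearMap (fderiv ℝ Y x)) q := by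
    refine DifferentiableAt.continuousAlternatingMapCompContinuousLinearMap
      (hΩ.comp q (hY.differentiableAt (by norm_num))) ?_
    exact (hY.fderiv_right (m := 1) (by
      rw [one_add_one_eq_two]; exact ENat.LEInfty.out)).differentiableAt (by norm_num)
  have h2 := extDeriv_pullback hΩ hY (by
    rw [minSmoothness_of_isRCLikeNormedField]; exact ENat.LEInfty.out)
  rw [hd] at h2
  have h3 := extDeriv_apply h1 (Fin.cons (1, 0) fun i => (0, EuclideanSpace.single i 1))
  rw [h2, Fin.sum_univ_succ] at h3
  have h4 : ((0 : F [⋀^Fin (k + 1 + 1)]→L[ℝ] ℝ).compContinuousLinearMap (fderiv ℝ Y q))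
      (Fin.cons (1, 0) fun i => (0, EuclideanSpace.single i 1)) = 0 := rfl
  rw [h4] at h3
  have h5 : ∀ j : Fin (k + 1), (fun x => ((Ω (Y x)).compContinuousLinearMap (fderiv ℝ Y x))
      (j.succ.removeNth (Fin.cons (1, 0) fun i => (0, EuclideanSpace.single i 1) :
        Fin (k + 2) → ℝ × EuclideanSpace ℝ (Fin (k + 1)))))
      = fun x => Ω (Y x) (Fin.cons (fderiv ℝ Y x (1, 0))
          fun i => fderiv ℝ Y x (0, EuclideanSpace.single (j.succAbove i) 1)) := by
    intro j
    funext x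
    refine congrArg (Ω (Y x)) ?_
    funext i
    refine Fin.cases ?_ (fun i' => ?_) i
    · rfl
    · simp [Fin.removeNth]
  simp only [h5, Fin.val_succ, Fin.cons_succ] at h3
  simp only [Fin.val_zero, pow_zero, one_smul, Fin.cons_zero, pow_succ, mul_neg, mul_one] at h3
  have h6 : (fun x => ((Ω (Y x)).compContinuousLinearMap (fderiv ℝ Y x))
      ((0 : Fin (k + 2)).removeNth (Fin.cons (1, 0) fun i => (0, EuclideanSpace.single i 1) :
        Fin (k + 2) → ℝ × EuclideanSpace ℝ (Fin (k + 1)))))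
      = fun x => Ω (Y x) fun i => fderiv ℝ Y x (0, EuclideanSpace.single i 1) := rfl
  rw [h6] at h3
  simp only [zsmul_eq_mul] at h3
  push_cast at h3
  simp only [neg_mul, Finset.sum_neg_distrib] at h3
  linarith

section WessZumino

variable {n : ℕ} {M : Type*} [TopologicalSpace M] [ChartedSpace (EuclideanSpace ℝ (Fin n)) M]
  [IsManifold (𝓡 n) ∞ M]
  (H : ∀ x : M, TangentSpace (𝓡 n) x [⋀^Fin 3]→L[ℝ] ℝ)
  {B : Type*} [TopologicalSpace B] {I : ModelWithCorners ℝ (EuclideanSpace ℝ (Fin 3)) B}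
  {Q : Type*} [TopologicalSpace Q] [ChartedSpace B Q] [IsManifold I ∞ Q]
  {X : ℝ → Q → M}
  (hX : ContMDiff (𝓘(ℝ, ℝ).prod I) (𝓡 n) ∞ (fun q : ℝ × Q => X q.1 q.2))

variable (I) in
/-- The pull-back of `H` by `X`, as a form on `ℝ × ℝ³`. -/
noncomputable def pullbackCoord (X : ℝ → Q → M) (x₀ : Q) (x₁ : M)
    (q : ℝ × EuclideanSpace ℝ (Fin 3)) (w : Fin 3 → ℝ × EuclideanSpace ℝ (Fin 3)) : ℝ :=
  formCoord H x₁ (chartMap (n := n) I X x₀ x₁ q) fun i =>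
    fderivWithin ℝ (chartMap (n := n) I X x₀ x₁) (timeRange I) q (w i)

variable (I) in
/-- The 3-form `(X t)^* H`. -/
noncomputable def pullbackForm (X : ℝ → Q → M) (t : ℝ) (y : Q) (w : Fin 3 → TangentSpace I y) : ℝ :=
  H (X t y) fun i => mfderiv I (𝓡 n) (X t) y (w i)

variable (I) in
/-- The 2-form `H(δX, dX, dX)`, where `δX` is the velocity of `X` at time `0`. -/
noncomputable def fluxForm (X : ℝ → Q → M) (y : Q) : TangentSpace I y [⋀^Fin 2]→ₗ[ℝ] ℝ :=
  ((H (X 0 y)).toAlternatingMap.curryLeft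
    (mfderiv 𝓘(ℝ, ℝ) (𝓡 n) (fun t => X t y) 0 (1 : ℝ))).compLinearMap
      (mfderiv I (𝓡 n) (X 0) y).toLinearMap

variable {x₀ : Q} {x₁ : M} {t : ℝ} {p : EuclideanSpace ℝ (Fin 3)}

include hX

lemma contDiffWithinAt_pullbackCoord (hH : IsClosedThreeForm H)
    (hp : p ∈ (extChartAt I x₀).target)
    (h1 : X t ((extChartAt I x₀).symm p) ∈ (extChartAt (𝓡 n) x₁).source)
    (w : Fin 3 → ℝ × EuclideanSpace ℝ (Fin 3)) :
    ContDiffWithinAt ℝ ∞ (fun q => pullbackCoord H I X x₀ x₁ q w) (timeRange I) (t, p) := by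
  have hY := contDiffWithinAt_chartMap hX x₀ x₁ hp h1
  refine contDiffWithinAt_alternating_apply ?_ fun i => ?_
  · have h2 : ContDiffAt ℝ ∞ (formCoord H x₁) (chartMap (n := n) I X x₀ x₁ (t, p)) :=
      (hH.smooth x₁).contDiffAt ((isOpen_extChartAt_target x₁).mem_nhds
        ((extChartAt (𝓡 n) x₁).map_source h1))
    exact h2.comp_contDiffWithinAt (t, p) hY
  · exact (hY.fderivWithin_right (m := ∞) uniqueDiffOn_timeRange (by norm_num)
      (mem_timeRange hp)).clm_apply contDiffWithinAt_const

lemma topCoeff_pullbackForm (hp : p ∈ (extChartAt I x₀).target)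
    (h1 : X t ((extChartAt I x₀).symm p) ∈ (extChartAt (𝓡 n) x₁).source) :
    topCoeff I (pullbackForm H I X t) x₀ p
      = pullbackCoord H I X x₀ x₁ (t, p) fun i => (0, EuclideanSpace.single i 1) := by
  rw [topCoeff, pullbackForm, form_eq_formCoord H h1, pullbackCoord]
  simp only [coframe_mfderiv_frameAt hX x₀ x₁ hp h1]
  rfl

lemma formComponent_fluxForm (hp : p ∈ (extChartAt I x₀).target)
    (h1 : X 0 ((extChartAt I x₀).symm p) ∈ (extChartAt (𝓡 n) x₁).source) (j : Fin 3) :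
    formComponent (fluxForm H I X) x₀ j p
      = (-1) ^ (j : ℕ) * pullbackCoord H I X x₀ x₁ (0, p) (Fin.cons (1, 0)
        fun i => (0, EuclideanSpace.single (j.succAbove i) 1)) := by
  rw [formComponent]
  congr 1
  have h2 : fluxForm H I X ((extChartAt I x₀).symm p)
      (fun i => frameAt I x₀ p (EuclideanSpace.single (j.succAbove i) 1))
      = H (X 0 ((extChartAt I x₀).symm p)) (Fin.cons
        (mfderiv 𝓘(ℝ, ℝ) (𝓡 n) (fun t => X t ((extChartAt I x₀).symm p)) 0 (1 : ℝ))
        fun i => mfderiv I (𝓡 n) (X 0) ((extChartAt I x₀).symm p)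
          (frameAt I x₀ p (EuclideanSpace.single (j.succAbove i) 1))) := rfl
  rw [h2, form_eq_formCoord H h1, pullbackCoord]
  refine congrArg (formCoord H x₁ (extChartAt (𝓡 n) x₁ (X 0 ((extChartAt I x₀).symm p)))) ?_
  funext i
  refine Fin.cases ?_ (fun i' => ?_) i
  · exact coframe_mfderiv_time hX x₀ x₁ hp h1
  · exact coframe_mfderiv_frameAt hX x₀ x₁ hp h1 _

lemma eventually_timeRange (hp : p ∈ (extChartAt I x₀).target)
    (h1 : X t ((extChartAt I x₀).symm p) ∈ (extChartAt (𝓡 n) x₁).source) :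
    ∀ᶠ q : ℝ × EuclideanSpace ℝ (Fin 3) in nhdsWithin (t, p) (timeRange I),
      q.2 ∈ (extChartAt I x₀).target ∧
      X q.1 ((extChartAt I x₀).symm q.2) ∈ (extChartAt (𝓡 n) x₁).source := by
  have h2 : ∀ᶠ q : ℝ × EuclideanSpace ℝ (Fin 3) in nhdsWithin (t, p) (timeRange I),
      q.2 ∈ (extChartAt I x₀).target := by
    have h3 := extChartAt_target_mem_nhdsWithin_of_mem hp
    have h4 : Filter.Tendsto (fun q : ℝ × EuclideanSpace ℝ (Fin 3) => q.2)
        (nhdsWithin (t, p) (timeRange I)) (nhdsWithin p (range I)) :=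
      tendsto_nhdsWithin_iff.2 ⟨(continuous_snd.tendsto _).mono_left nhdsWithin_le_nhds,
        eventually_mem_nhdsWithin.mono fun q hq => hq.2⟩
    exact h4 h3
  refine h2.and ?_
  have h5 : ContinuousWithinAt (fun q : ℝ × EuclideanSpace ℝ (Fin 3) =>
      X q.1 ((extChartAt I x₀).symm q.2)) (timeRange I) (t, p) := by
    have h6 := (hX (t, (extChartAt I x₀).symm p)).comp_contMDiffWithinAt (t, p)
      (contMDiffWithinAt_id_prod_symm x₀ hp)
    exact h6.continuousWithinAt
  exact h5 ((isOpen_extChartAt_source x₁).mem_nhds h1)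

/-- The quotient of `(X t)^* H` by a volume form. -/
lemma pullback_ratio_eq {vol : ∀ x : Q, (Fin 3 → TangentSpace I x) → ℝ} (hvol : IsVolumeForm vol)
    (hp : p ∈ (extChartAt I x₀).target)
    (h1 : X t ((extChartAt I x₀).symm p) ∈ (extChartAt (𝓡 n) x₁).source) :
    pullbackForm H I X t ((extChartAt I x₀).symm p) (basisVec I _)
        / vol ((extChartAt I x₀).symm p) (basisVec I _)
      = (pullbackCoord H I X x₀ x₁ (t, p) fun i => (0, EuclideanSpace.single i 1))
        / topCoeff I vol x₀ p := by
  rw [← topCoeff_pullbackForm H hX hp h1]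
  exact ratio_eq_topCoeff_ratio (α := pullbackForm H I X t) x₀ hp
    ⟨(H (X t ((extChartAt I x₀).symm p))).toAlternatingMap.compLinearMap
      (mfderiv I (𝓡 n) (X t) ((extChartAt I x₀).symm p)).toLinearMap, fun _ => rfl⟩
    (hvol.alternating _)

lemma isSmoothFamily_pullback (hH : IsClosedThreeForm H)
    {vol : ∀ x : Q, (Fin 3 → TangentSpace I x) → ℝ} (hvol : IsVolumeForm vol)
    (hsmooth : ∀ x₀ : Q, ContDiffOn ℝ ∞ (topCoeff I vol x₀) (extChartAt I x₀).target) :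
    IsSmoothFamily I fun t y => pullbackForm H I X t y (basisVec I y) / vol y (basisVec I y) := by
  intro x₀ p hp t
  have h1 := mem_extChartAt_source (I := 𝓡 n) (X t ((extChartAt I x₀).symm p))
  have h2 : ContDiffWithinAt ℝ ∞ (fun q : ℝ × EuclideanSpace ℝ (Fin 3) => topCoeff I vol x₀ q.2)
      (timeRange I) (t, p) :=
    ((hsmooth x₀ p hp).mono_of_mem_nhdsWithin (extChartAt_target_mem_nhdsWithin_of_mem hp)).comp
      (t, p) contDiff_snd.contDiffWithinAt fun q hq => hq.2
  refine ((contDiffWithinAt_pullbackCoord H hX hH hp h1 _).div h2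
    (hvol.ne_zero x₀ p hp)).congr_of_eventuallyEq ?_ (pullback_ratio_eq H hX hvol hp h1)
  filter_upwards [eventually_timeRange hX hp h1] with q hq
  exact pullback_ratio_eq H hX hvol hq.1 hq.2

/-- The variation of `X^* H` is the differential of `H(δX, dX, dX)`, since `H` is closed. -/
theorem isPrimitive_fluxForm (hH : IsClosedThreeForm H)
    {vol : ∀ x : Q, (Fin 3 → TangentSpace I x) → ℝ} (hvol : IsVolumeForm vol) :
    IsPrimitive vol (fluxForm H I X) fun y =>
      deriv (fun t => pullbackForm H I X t y (basisVec I y) / vol y (basisVec I y)) 0 where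
  contDiffOn x₀ j := by
    intro p hp
    have h1 := mem_extChartAt_source (I := 𝓡 n) (X 0 ((extChartAt I x₀).symm p))
    have h2 := (contDiffWithinAt_pullbackCoord H hX hH hp h1 (Fin.cons (1, 0)
      fun i => (0, EuclideanSpace.single (j.succAbove i) 1))).comp (s := range I)
      (f := fun p' => ((0 : ℝ), p')) p
      (contDiff_const.prodMk contDiff_id).contDiffWithinAt fun p' hp' => ⟨mem_univ _, hp'⟩
    have h3 : ContDiffWithinAt ℝ 1 (formComponent (fluxForm H I X) x₀ j) (range I) p := by
      refine ((contDiffWithinAt_const (c := (-1 : ℝ) ^ (j : ℕ))).mul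
        (h2.of_le (by norm_num))).congr_of_eventuallyEq ?_ (formComponent_fluxForm H hX hp h1 j)
      have h4 : Filter.Tendsto (fun p' : EuclideanSpace ℝ (Fin 3) => ((0 : ℝ), p'))
          (nhdsWithin p (range I)) (nhdsWithin (0, p) (timeRange I)) :=
        tendsto_nhdsWithin_iff.2 ⟨((by fun_prop : Continuous fun p' : EuclideanSpace ℝ (Fin 3) =>
          ((0 : ℝ), p')).tendsto p).mono_left nhdsWithin_le_nhds,
          eventually_mem_nhdsWithin.mono fun q hq => ⟨mem_univ _, hq⟩⟩
      filter_upwards [h4.eventually (eventually_timeRange hX hp h1)] with p' hp'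
      exact formComponent_fluxForm H hX hp'.1 hp'.2 j
    exact h3.mono (extChartAt_target_subset_range x₀)
  divergence x₀ p hp hint := by
    have h1 := mem_extChartAt_source (I := 𝓡 n) (X 0 ((extChartAt I x₀).symm p))
    set x₁ := X 0 ((extChartAt I x₀).symm p) with hx₁
    have hT : timeRange I ∈ nhds ((0 : ℝ), p) :=
      prod_mem_nhds Filter.univ_mem (mem_interior_iff_mem_nhds.1 hint)
    have hev := eventually_timeRange hX hp h1
    rw [nhdsWithin_eq_nhds.2 hT] at hev
    have hcurve : ContinuousAt (fun t : ℝ => (t, p)) 0 := by fun_prop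
    have hslice : ContinuousAt (fun p' : EuclideanSpace ℝ (Fin 3) => ((0 : ℝ), p')) p := by fun_prop
    have hcd := fun w => (contDiffWithinAt_pullbackCoord H hX hH hp h1 w).contDiffAt hT
    have hY := (contDiffWithinAt_chartMap hX x₀ x₁ hp h1).contDiffAt hT
    have hmem := (extChartAt (𝓡 n) x₁).map_source h1
    have hΩ : DifferentiableAt ℝ (formCoord H x₁) (chartMap (n := n) I X x₀ x₁ (0, p)) :=
      ((hH.smooth x₁).contDiffAt ((isOpen_extChartAt_target x₁).mem_nhds hmem)).differentiableAt
        (by norm_num)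
    have hclosed := fderiv_pullback_of_closed hΩ (hH.closed x₁ _ hmem) hY
    have hpull : ∀ w, (fun q => pullbackCoord H I X x₀ x₁ q w) =ᶠ[nhds (0, p)] fun q =>
        formCoord H x₁ (chartMap (n := n) I X x₀ x₁ q) fun i =>
          fderiv ℝ (chartMap (n := n) I X x₀ x₁) q (w i) := by
      intro w
      filter_upwards [eventually_mem_nhds_iff.2 hT] with q hq
      simp only [pullbackCoord, fderivWithin_of_mem_nhds hq]
    -- The left-hand side, as a sum of derivatives of the pull-back.
    have hlhs : ∀ j : Fin 3, fderiv ℝ (formComponent (fluxForm H I X) x₀ j) p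
        (EuclideanSpace.single j 1) = (-1) ^ (j : ℕ) * fderiv ℝ (fun q =>
          formCoord H x₁ (chartMap (n := n) I X x₀ x₁ q)
            (Fin.cons (fderiv ℝ (chartMap (n := n) I X x₀ x₁) q (1, 0)) fun i =>
              fderiv ℝ (chartMap (n := n) I X x₀ x₁) q
                (0, EuclideanSpace.single (j.succAbove i) 1))) (0, p)
          (0, EuclideanSpace.single j 1) := by
      intro j
      set w : Fin 3 → ℝ × EuclideanSpace ℝ (Fin 3) := Fin.cons (1, 0)
        fun i => (0, EuclideanSpace.single (j.succAbove i) 1) with hw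
      have e1 : formComponent (fluxForm H I X) x₀ j =ᶠ[nhds p]
          fun p' => (-1) ^ (j : ℕ) * pullbackCoord H I X x₀ x₁ (0, p') w := by
        filter_upwards [hslice.eventually hev] with p' hp'
        exact formComponent_fluxForm H hX hp'.1 hp'.2 j
      have e2 := ((hcd w).differentiableAt (by norm_num)).hasFDerivAt
      have e3 := (HasFDerivAt.comp p e2 (hasFDerivAt_prodMk_right (0 : ℝ) p)).const_mul
        ((-1 : ℝ) ^ (j : ℕ))
      have e4 : fderiv ℝ (formComponent (fluxForm H I X) x₀ j) p = _ :=
        e1.fderiv_eq.trans e3.fderiv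
      have e5 : (fun q => formCoord H x₁ (chartMap (n := n) I X x₀ x₁ q)
            (Fin.cons (fderiv ℝ (chartMap (n := n) I X x₀ x₁) q (1, 0)) fun i =>
              fderiv ℝ (chartMap (n := n) I X x₀ x₁) q
                (0, EuclideanSpace.single (j.succAbove i) 1)))
          = fun q => formCoord H x₁ (chartMap (n := n) I X x₀ x₁ q) fun i =>
            fderiv ℝ (chartMap (n := n) I X x₀ x₁) q (w i) := by
        funext q
        refine congrArg (formCoord H x₁ (chartMap (n := n) I X x₀ x₁ q)) ?_
        funext i
        exact Fin.cases rfl (fun i' => rfl) i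
      rw [e4, e5, ← (hpull w).fderiv_eq]
      rfl
    rw [Finset.sum_congr rfl fun j _ => hlhs j, ← hclosed, ← (hpull _).fderiv_eq]
    -- The right-hand side.
    have f1 := ((hcd fun i => (0, EuclideanSpace.single i 1)).differentiableAt
      (by norm_num)).hasFDerivAt
    have f2 := (HasFDerivAt.comp (0 : ℝ) f1
      (hasFDerivAt_prodMk_left (0 : ℝ) p)).hasDerivAt.div_const (topCoeff I vol x₀ p)
    have f3 : (fun t => pullbackForm H I X t ((extChartAt I x₀).symm p) (basisVec I _)
        / vol ((extChartAt I x₀).symm p) (basisVec I _)) =ᶠ[nhds 0] _ :=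
      (hcurve.eventually hev).mono fun t ht => pullback_ratio_eq H hX hvol ht.1 ht.2
    rw [f3.deriv_eq]
    refine Eq.trans ?_ (congrArg (· * topCoeff I vol x₀ p) f2.deriv).symm
    rw [div_mul_cancel₀ _ (hvol.ne_zero x₀ p hp)]
    rfl

end WessZumino

/-! ### Invariance of the action -/

section Primitives

variable {k : ℕ} {B : Type*} [TopologicalSpace B]
  {I : ModelWithCorners ℝ (EuclideanSpace ℝ (Fin (k + 1))) B}
  {Q : Type*} [TopologicalSpace Q] [ChartedSpace B Q] [IsManifold I ∞ Q]
  {vol : ∀ x : Q, (Fin (k + 1) → TangentSpace I x) → ℝ}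
  {β : ∀ x : Q, TangentSpace I x [⋀^Fin k]→ₗ[ℝ] ℝ} {f : Q → ℝ}

lemma IsPrimitive.eq_div (hβ : IsPrimitive vol β f) (hI : range I = univ) (hvol : IsVolumeForm vol)
    {x₀ : Q} {p : EuclideanSpace ℝ (Fin (k + 1))} (hp : p ∈ (extChartAt I x₀).target) :
    f ((extChartAt I x₀).symm p)
      = (∑ i, fderiv ℝ (formComponent β x₀ i) p (EuclideanSpace.single i 1))
        / topCoeff I vol x₀ p := by
  rw [hβ.divergence x₀ p hp (by rw [hI, interior_univ]; trivial),
    mul_div_cancel_right₀ _ (hvol.ne_zero x₀ p hp)]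

lemma isOpen_target_of_range_eq_univ (hI : range I = univ) (x₀ : Q) :
    IsOpen (extChartAt I x₀).target := by
  rw [extChartAt_target, hI, inter_univ]
  exact (chartAt B x₀).open_target.preimage I.continuous_symm

lemma IsPrimitive.continuous (hβ : IsPrimitive vol β f) (hI : range I = univ)
    (hvol : IsVolumeForm vol) : Continuous f := by
  refine continuous_iff_continuousAt.2 fun x₀ => ?_
  have ho := isOpen_target_of_range_eq_univ hI x₀
  have h1 : ContinuousOn (fun p =>
      (∑ i, fderiv ℝ (formComponent β x₀ i) p (EuclideanSpace.single i 1))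
        / topCoeff I vol x₀ p) (extChartAt I x₀).target := by
    refine ContinuousOn.div (continuousOn_finsetSum _ fun i _ => ?_) (hvol.continuousOn x₀)
      (hvol.ne_zero x₀)
    exact ((hβ.contDiffOn x₀ i).continuousOn_fderiv_of_isOpen ho le_rfl).clm_apply
      continuousOn_const
  have h2 := (h1.comp (continuousOn_extChartAt x₀) (extChartAt I x₀).mapsTo).continuousAt
    (extChartAt_source_mem_nhds x₀)
  refine h2.congr ?_
  filter_upwards [extChartAt_source_mem_nhds (I := I) x₀] with y hy
  have h3 := hβ.eq_div hI hvol ((extChartAt I x₀).map_source hy)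
  rw [(extChartAt I x₀).left_inv hy] at h3
  exact h3.symm

lemma IsPrimitive.eq_zero_of_notMem (hβ : IsPrimitive vol β f) (hI : range I = univ)
    (hvol : IsVolumeForm vol) {C : Set Q} (hC : IsClosed C) (hβC : ∀ x ∉ C, β x = 0) :
    ∀ x ∉ C, f x = 0 := by
  intro x hx
  have hx' := mem_extChartAt_source (I := I) x
  have h1 := hβ.eq_div hI hvol ((extChartAt I x).map_source hx')
  rw [(extChartAt I x).left_inv hx'] at h1
  rw [h1, Finset.sum_eq_zero, zero_div]
  intro i _
  have h2 : formComponent β x i =ᶠ[nhds (extChartAt I x x)] fun _ => 0 := by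
    have h3 : ContinuousAt (extChartAt I x).symm (extChartAt I x x) :=
      continuousAt_extChartAt_symm x
    have h4 : Cᶜ ∈ nhds ((extChartAt I x).symm (extChartAt I x x)) := by
      rw [(extChartAt I x).left_inv hx']
      exact hC.isOpen_compl.mem_nhds hx
    filter_upwards [h3 h4] with p hp
    rw [formComponent, hβC _ hp, AlternatingMap.zero_apply, mul_zero]
  rw [h2.fderiv_eq, fderiv_fun_const]
  rfl

end Primitives

section WorldSheet

variable {n : ℕ} {M : Type*} [TopologicalSpace M] [ChartedSpace (EuclideanSpace ℝ (Fin n)) M]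
  [IsManifold (𝓡 n) ∞ M]
  (g : Bundle.ContMDiffRiemannianMetric (𝓡 n) ∞ (EuclideanSpace ℝ (Fin n))
    (fun x : M => TangentSpace (𝓡 n) x))
  (H : ∀ x : M, TangentSpace (𝓡 n) x [⋀^Fin 3]→L[ℝ] ℝ)
  (O : ∀ x : M, TangentSpace (𝓡 n) x →L[ℝ] TangentSpace (𝓡 n) x)
  {S : Type*} [TopologicalSpace S] [ChartedSpace (EuclideanSpace ℝ (Fin 2)) S]
  [IsManifold (𝓡 2) ∞ S] (L : LorentzianSurface S)

lemma exists_alternating_wedge {σ : S} {x : M}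
    (A A' : TangentSpace (𝓡 2) σ →L[ℝ] TangentSpace (𝓡 n) x) :
    ∃ f : TangentSpace (𝓡 2) σ [⋀^Fin 2]→ₗ[ℝ] ℝ, ∀ w, wedge g A A' w = f w := by
  refine ⟨
    { toFun := fun w => wedge g A A' w
      map_update_add' := fun m i u v => ?_
      map_update_smul' := fun m i c u => ?_
      map_eq_zero_of_eq' := fun v i j hij hne => ?_ }, fun w => rfl⟩
  · fin_cases i <;> simp [wedge] <;> ring
  · fin_cases i <;> simp [wedge] <;> ring
  · have h : v 0 = v 1 := by
      fin_cases i <;> fin_cases j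
      · exact absurd rfl hne
      · exact hij
      · exact hij.symm
      · exact absurd rfl hne
    rw [wedge, h, sub_self]

lemma exists_alternating_lagrangian (X : S → M)
    (a : ∀ σ, TangentSpace (𝓡 2) σ →L[ℝ] TangentSpace (𝓡 n) (X σ)) (σ : S) :
    ∃ f : TangentSpace (𝓡 2) σ [⋀^Fin 2]→ₗ[ℝ] ℝ, ∀ w, lagrangian L g O X a σ w = f w := by
  set D : TangentSpace (𝓡 2) σ →L[ℝ] TangentSpace (𝓡 n) (X σ) :=
    mfderiv (𝓡 2) (𝓡 n) X σ - (a σ - (O (X σ)).comp (a σ))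
  set J : TangentSpace (𝓡 2) σ →L[ℝ] TangentSpace (𝓡 2) σ :=
    -(L.metric σ).inverse.comp (L.area σ)
  obtain ⟨f₁, h₁⟩ := exists_alternating_wedge g D (D.comp J)
  obtain ⟨f₂, h₂⟩ := exists_alternating_wedge g (a σ + (O (X σ)).comp (a σ))
    (mfderiv (𝓡 2) (𝓡 n) X σ)
  obtain ⟨f₃, h₃⟩ := exists_alternating_wedge g (a σ + (O (X σ)).comp (a σ))
    (a σ - (O (X σ)).comp (a σ))
  refine ⟨(1 / 2 : ℝ) • f₁ + f₂ - (1 / 2 : ℝ) • f₃, fun w => ?_⟩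
  rw [AlternatingMap.sub_apply, AlternatingMap.add_apply, AlternatingMap.smul_apply,
    AlternatingMap.smul_apply, ← h₁, ← h₂, ← h₃]
  rfl

/-- The Lagrangian, divided by the area form. -/
noncomputable def lagrangianDensity (X : ℝ → S → M)
    (a : ∀ t σ, TangentSpace (𝓡 2) σ →L[ℝ] TangentSpace (𝓡 n) (X t σ)) (t : ℝ) (σ : S) : ℝ :=
  lagrangian L g O (X t) (a t) σ (basisVec (𝓡 2) σ) / L.areaForm σ (basisVec (𝓡 2) σ)

/-- The 1-form `g((id + O) ε, dX)`, as an alternating map. -/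
noncomputable def gaugeForm (X : S → M) (ε : ∀ σ, TangentSpace (𝓡 n) (X σ)) (σ : S) :
    TangentSpace (𝓡 2) σ [⋀^Fin 1]→ₗ[ℝ] ℝ :=
  AlternatingMap.ofSubsingleton ℝ _ ℝ (0 : Fin 1) (gaugeOneForm g O X ε σ).toLinearMap

variable {X : ℝ → S → M}
  (hX : ContMDiff (𝓘(ℝ, ℝ).prod (𝓡 2)) (𝓡 n) ∞ (fun q : ℝ × S => X q.1 q.2))
  {a : ∀ t σ, TangentSpace (𝓡 2) σ →L[ℝ] TangentSpace (𝓡 n) (X t σ)}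
  (ha : ContMDiff (𝓘(ℝ, ℝ).prod (𝓡 2).tangent) (𝓡 n).tangent ∞
    (fun q : ℝ × TangentBundle (𝓡 2) S =>
      (⟨X q.1 q.2.proj, a q.1 q.2.proj q.2.snd⟩ : TangentBundle (𝓡 n) M)))

lemma lagrangianDensity_symm {s₀ : S} {p : EuclideanSpace ℝ (Fin 2)}
    (hp : p ∈ (extChartAt (𝓡 2) s₀).target) (t : ℝ) :
    lagrangianDensity g O L X a t ((extChartAt (𝓡 2) s₀).symm p)
      = topCoeff (𝓡 2) (lagrangian L g O (X t) (a t)) s₀ p / L.areaCoeff s₀ p :=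
  ratio_eq_topCoeff_ratio (α := lagrangian L g O (X t) (a t)) (vol := L.areaForm) s₀ hp
    (exists_alternating_lagrangian g O L (X t) (a t) _) ((isVolumeForm_areaForm L).alternating _)

include hX ha in
lemma isSmoothFamily_lagrangianDensity (hO : IsSmoothEnd O) :
    IsSmoothFamily (𝓡 2) (lagrangianDensity g O L X a) := by
  intro s₀ p hp t
  have ho := (isOpen_extChartAt_target (I := 𝓡 2) s₀).mem_nhds hp
  have h1 := contDiffAt_topCoeff_lagrangian g O L hX ha hO t hp
  have h2 : ContDiffAt ℝ ∞ (fun q : ℝ × EuclideanSpace ℝ (Fin 2) => L.areaCoeff s₀ q.2) (t, p) :=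
    ((L.contDiffOn_areaCoeff).contDiffAt ho).comp (t, p) contDiffAt_snd
  refine ContDiffAt.contDiffWithinAt
    ((h1.div h2 (L.areaCoeff_ne_zero hp)).congr_of_eventuallyEq ?_)
  have h3 : ContinuousAt (fun q : ℝ × EuclideanSpace ℝ (Fin 2) => q.2) (t, p) := continuousAt_snd
  filter_upwards [h3 ho] with q hq
  exact lagrangianDensity_symm g O L hq q.1

lemma formComponent_gaugeForm (X : S → M) (ε : ∀ σ, TangentSpace (𝓡 n) (X σ)) (s₀ : S) :
    formComponent (gaugeForm g O X ε) s₀ 0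
      = (fun p => gaugeOneForm g O X ε ((extChartAt (𝓡 2) s₀).symm p) (frameVec s₀ p 1)) ∧
    formComponent (gaugeForm g O X ε) s₀ 1
      = (fun p => -gaugeOneForm g O X ε ((extChartAt (𝓡 2) s₀).symm p) (frameVec s₀ p 0)) := by
  constructor <;> funext p
  · exact one_mul _
  · exact (congrArg₂ (· * ·) (pow_one (-1 : ℝ)) rfl).trans (neg_one_mul _)

variable {ε : ∀ σ, TangentSpace (𝓡 n) (X 0 σ)}
  (hε : ContMDiff (𝓡 2) (𝓡 n).tangent ∞
    (fun σ : S => (⟨X 0 σ, ε σ⟩ : TangentBundle (𝓡 n) M)))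
  (hO : IsSmoothEnd O)
  (hOg : ∀ (x : M) (u v : TangentSpace (𝓡 n) x), g.inner x (O x u) (O x v) = g.inner x u v)
  (hD : IsDirac H (graph g O))
  (hvel : ∀ σ, mfderiv 𝓘(ℝ, ℝ) (𝓡 n) (fun t => X t σ) 0 (1 : ℝ) = ε σ - O (X 0 σ) (ε σ))
  (hcov : ∀ (σ : S) (v : TangentSpace (𝓡 2) σ),
    covAlong g (fun t => X t σ) (fun t => a t σ v) = gaugeVar L g H O (X 0) (a 0) ε σ v)

include hX ha hε hO hOg hD hvel hcov in
/-- Under a gauge transformation, the variation of the Lagrangian is exact up to the 2-form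
`H((id - O) ε, dX, dX) = κ area`. -/
theorem isPrimitive_gaugeForm {κ : S → ℝ}
    (hκ : ∀ (s₀ : S), ∀ p ∈ (extChartAt (𝓡 2) s₀).target,
      κ ((extChartAt (𝓡 2) s₀).symm p) * L.areaCoeff s₀ p
        = H (X 0 ((extChartAt (𝓡 2) s₀).symm p)) ![ε _ - O _ (ε _),
          mfderiv (𝓡 2) (𝓡 n) (X 0) _ (frameVec s₀ p 0),
          mfderiv (𝓡 2) (𝓡 n) (X 0) _ (frameVec s₀ p 1)]) :
    IsPrimitive L.areaForm (gaugeForm g O (X 0) ε) fun σ =>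
      deriv (fun t => lagrangianDensity g O L X a t σ) 0 + κ σ where
  contDiffOn s₀ i := by
    intro p hp
    have h := fun c => (gaugeOneForm_frameAt g O hX hε hO hp (mem_extChartAt_source _) c).2
    obtain ⟨h0, h1⟩ := formComponent_gaugeForm g O (X 0) ε s₀
    refine ContDiffAt.contDiffWithinAt (ContDiffAt.of_le (n := ∞) ?_ (by norm_num))
    fin_cases i
    · exact h0.symm ▸ h _
    · exact h1.symm ▸ (h _).neg
  divergence s₀ p hp _ := by
    obtain ⟨h0, h1⟩ := formComponent_gaugeForm g O (X 0) ε s₀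
    have hd := (hasDerivAt_topCoeff_lagrangian g H O L hX ha hε hO hOg hD hvel hcov hp).div_const
      (L.areaCoeff s₀ p)
    have hd' := (congrArg (fun f : ℝ → ℝ => deriv f 0)
      (funext fun t => lagrangianDensity_symm g O L (X := X) (a := a) hp t)).trans hd.deriv
    have hne := L.areaCoeff_ne_zero hp
    have harea : topCoeff (𝓡 2) L.areaForm s₀ p = L.areaCoeff s₀ p := rfl
    rw [hd', harea, add_mul, hκ s₀ p hp, div_mul_cancel₀ _ hne, Fin.sum_univ_two, h0, h1,
      fderiv_fun_neg, sub_add_cancel, neg_apply, ← sub_eq_add_neg]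

end WorldSheet

lemma IsSmoothFamily.continuous_deriv_apply {d : ℕ} {B : Type*} [TopologicalSpace B]
    {I : ModelWithCorners ℝ (EuclideanSpace ℝ (Fin d)) B} {Q : Type*} [TopologicalSpace Q]
    [ChartedSpace B Q] {Φ : ℝ → Q → ℝ} (hΦ : IsSmoothFamily I Φ) (t : ℝ) :
    Continuous fun y => deriv (fun t => Φ t y) t :=
  hΦ.continuous_deriv.comp (f := fun y : Q => (t, y)) (continuous_const.prodMk continuous_id)

section Invariance

variable {n : ℕ} {M : Type*} [TopologicalSpace M] [ChartedSpace (EuclideanSpace ℝ (Fin n)) M]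
  [IsManifold (𝓡 n) ∞ M]
  (g : Bundle.ContMDiffRiemannianMetric (𝓡 n) ∞ (EuclideanSpace ℝ (Fin n))
    (fun x : M => TangentSpace (𝓡 n) x))
  (H : ∀ x : M, TangentSpace (𝓡 n) x [⋀^Fin 3]→L[ℝ] ℝ)
  (O : ∀ x : M, TangentSpace (𝓡 n) x →L[ℝ] TangentSpace (𝓡 n) x)
  {S : Type*} [TopologicalSpace S] [ChartedSpace (EuclideanSpace ℝ (Fin 2)) S]
  [IsManifold (𝓡 2) ∞ S] {L : LorentzianSurface S}
  {N : Type*} [TopologicalSpace N] [ChartedSpace (EuclideanHalfSpace 3) N]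
  [IsManifold (𝓡∂ 3) ∞ N]
  {vol : ∀ y : N, TangentSpace (𝓡∂ 3) y [⋀^Fin 3]→L[ℝ] ℝ} {ι : S → N}
  {X : ℝ → N → M}

lemma contMDiff_restrict (hN : IsFilling L vol ι)
    (hX : ContMDiff (𝓘(ℝ, ℝ).prod (𝓡∂ 3)) (𝓡 n) ∞ (fun q : ℝ × N => X q.1 q.2)) :
    ContMDiff (𝓘(ℝ, ℝ).prod (𝓡 2)) (𝓡 n) ∞ (fun q : ℝ × S => X q.1 (ι q.2)) := by
  have h : ContMDiff (𝓘(ℝ, ℝ).prod (𝓡 2)) (𝓘(ℝ, ℝ).prod (𝓡∂ 3)) ∞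
      (fun q : ℝ × S => (q.1, ι q.2)) :=
    contMDiff_fst.prodMk (hN.smooth.comp contMDiff_snd)
  exact hX.comp h

/-- The flux of `H(δX, dX, dX)` through the world sheet. -/
lemma boundaryRatio_fluxForm (hN : IsFilling L vol ι)
    (hX : ContMDiff (𝓘(ℝ, ℝ).prod (𝓡∂ 3)) (𝓡 n) ∞ (fun q : ℝ × N => X q.1 q.2))
    {s₀ : S} {p : EuclideanSpace ℝ (Fin 2)} (hp : p ∈ (extChartAt (𝓡 2) s₀).target) :
    boundaryRatio L ι (fluxForm H (𝓡∂ 3) X) ((extChartAt (𝓡 2) s₀).symm p) * L.areaCoeff s₀ p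
      = H (X 0 (ι ((extChartAt (𝓡 2) s₀).symm p)))
        ![mfderiv 𝓘(ℝ, ℝ) (𝓡 n) (fun t => X t (ι ((extChartAt (𝓡 2) s₀).symm p))) 0 (1 : ℝ),
          mfderiv (𝓡 2) (𝓡 n) (fun σ => X 0 (ι σ)) _ (frameVec s₀ p 0),
          mfderiv (𝓡 2) (𝓡 n) (fun σ => X 0 (ι σ)) _ (frameVec s₀ p 1)] := by
  rw [boundaryRatio_eq L _ hp, div_mul_cancel₀ _ (L.areaCoeff_ne_zero hp)]
  have hX0 : ContMDiff (𝓡∂ 3) (𝓡 n) ∞ (X 0) := by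
    have h : ContMDiff (𝓡∂ 3) (𝓘(ℝ, ℝ).prod (𝓡∂ 3)) ∞ (fun y : N => ((0 : ℝ), y)) :=
      contMDiff_const.prodMk contMDiff_id
    exact hX.comp h
  have hc : ∀ v, mfderiv (𝓡 2) (𝓡 n) (fun σ => X 0 (ι σ)) ((extChartAt (𝓡 2) s₀).symm p) v
      = mfderiv (𝓡∂ 3) (𝓡 n) (X 0) (ι ((extChartAt (𝓡 2) s₀).symm p))
        (mfderiv (𝓡 2) (𝓡∂ 3) ι ((extChartAt (𝓡 2) s₀).symm p) v) := by
    intro v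
    exact DFunLike.congr_fun (mfderiv_comp ((extChartAt (𝓡 2) s₀).symm p)
      (hX0.mdifferentiable (by norm_num) _) (hN.smooth.mdifferentiable (by norm_num) _)) v
  rw [hc, hc]
  refine congrArg (H (X 0 (ι ((extChartAt (𝓡 2) s₀).symm p)))) ?_
  funext i
  fin_cases i <;> rfl

lemma pullbackForm_congr {t : ℝ} {y : N} (h : X t =ᶠ[nhds y] X 0)
    (w : Fin 3 → TangentSpace (𝓡∂ 3) y) :
    pullbackForm H (𝓡∂ 3) X t y w = pullbackForm H (𝓡∂ 3) X 0 y w := by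
  have key : ∀ F G : N → M, F =ᶠ[nhds y] G →
      (H (F y) fun i => mfderiv (𝓡∂ 3) (𝓡 n) F y (w i))
        = H (G y) fun i => mfderiv (𝓡∂ 3) (𝓡 n) G y (w i) := by
    intro F G hFG
    -- The type of the differential depends on the image point, so both are generalized together.
    have h1 : ∀ x, ∀ A : TangentSpace (𝓡∂ 3) y →L[ℝ] TangentSpace (𝓡 n) x, G y = x →
        mfderiv (𝓡∂ 3) (𝓡 n) F y = A → (H (F y) fun i => mfderiv (𝓡∂ 3) (𝓡 n) F y (w i))
          = H x fun i => A (w i) := by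
      intro x A hx hA
      have hFx : F y = x := hFG.eq_of_nhds.trans hx
      subst hFx
      rw [hA]
    exact h1 (G y) _ rfl (hFG.mfderiv_eq)
  exact key (X t) (X 0) h

lemma fluxForm_eq_zero {y : N}
    (h : mfderiv 𝓘(ℝ, ℝ) (𝓡 n) (fun t => X t y) 0 (1 : ℝ) = 0) : fluxForm H (𝓡∂ 3) X y = 0 := by
  ext w
  simp only [fluxForm, h, map_zero]
  rfl

lemma deriv_pullback_eq_zero {y : N} (h : ∀ t, X t =ᶠ[nhds y] X 0) :
    deriv (fun t => pullbackForm H (𝓡∂ 3) X t y (basisVec (𝓡∂ 3) y)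
      / vol y (basisVec (𝓡∂ 3) y)) 0 = 0 := by
  rw [funext fun t => congrArg (· / vol y (basisVec (𝓡∂ 3) y))
    (pullbackForm_congr H (h t) (basisVec (𝓡∂ 3) y)), deriv_const]

lemma gaugeForm_eq_zero {Y : S → M} {ε : ∀ σ, TangentSpace (𝓡 n) (Y σ)} {σ : S} (h : ε σ = 0) :
    gaugeForm g O Y ε σ = 0 := by
  ext w
  simp [gaugeForm, gaugeOneForm, h]

variable [T2Space S] [SecondCountableTopology S] [MeasurableSpace S] [BorelSpace S]
  [T2Space N] [SecondCountableTopology N] [MeasurableSpace N] [BorelSpace N]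

/-- The variations of the two terms of the action, computed by Stokes' theorem, cancel. -/
theorem hasDerivAt_action (hH : IsClosedThreeForm H) (hO : IsSmoothEnd O)
    (hOg : ∀ (x : M) (u v : TangentSpace (𝓡 n) x), g.inner x (O x u) (O x v) = g.inner x u v)
    (hD : IsDirac H (graph g O)) (hN : IsFilling L vol ι)
    {K : Set S} {K' : Set N} (hK : IsCompact K) (hK' : IsCompact K')
    {a : ∀ (t : ℝ) (σ : S), TangentSpace (𝓡 2) σ →L[ℝ] TangentSpace (𝓡 n) (X t (ι σ))}
    {ε : ∀ σ : S, TangentSpace (𝓡 n) (X 0 (ι σ))}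
    (hX : ContMDiff (𝓘(ℝ, ℝ).prod (𝓡∂ 3)) (𝓡 n) ∞ (fun q : ℝ × N => X q.1 q.2))
    (ha : ContMDiff (𝓘(ℝ, ℝ).prod (𝓡 2).tangent) (𝓡 n).tangent ∞
      (fun q : ℝ × TangentBundle (𝓡 2) S =>
        (⟨X q.1 (ι q.2.proj), a q.1 q.2.proj q.2.snd⟩ : TangentBundle (𝓡 n) M)))
    (hε : ContMDiff (𝓡 2) (𝓡 n).tangent ∞
      (fun σ : S => (⟨X 0 (ι σ), ε σ⟩ : TangentBundle (𝓡 n) M)))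
    (hεK : ∀ σ ∉ K, ε σ = 0) (hXK : ∀ t, ∀ y ∉ K', X t y = X 0 y)
    (hvel : ∀ σ, mfderiv 𝓘(ℝ, ℝ) (𝓡 n) (fun t => X t (ι σ)) 0 (1 : ℝ)
      = ε σ - O (X 0 (ι σ)) (ε σ))
    (hcov : ∀ (σ : S) (v : TangentSpace (𝓡 2) σ),
      covAlong g (fun t => X t (ι σ)) (fun t => a t σ v)
        = gaugeVar L g H O (fun τ => X 0 (ι τ)) (a 0) ε σ v) :
    HasDerivAt (fun t => action g H O L vol ι K K' (X t) (a t)) 0 0 := by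
  have hY := contMDiff_restrict hN hX
  have hvS := isVolumeForm_areaForm L
  have hvN := isVolumeForm_vol hN
  have hI : range (𝓡 2) = univ := ModelWithCorners.range_eq_univ _
  have := isFiniteMeasureOnCompacts_volMeasure hvS
  have := isFiniteMeasureOnCompacts_volMeasure hvN
  set μ := volMeasure (𝓡 2) L.areaForm with hμ
  set ν := volMeasure (𝓡∂ 3) fun y w => vol y w with hν
  -- The variation of the two densities, and their primitives.
  have hs := isSmoothFamily_lagrangianDensity (X := fun t σ => X t (ι σ)) (a := a) g O L hY ha hO
  have hs' := isSmoothFamily_pullback H hX hH hvN hN.vol_smooth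
  set κ := boundaryRatio L ι (fluxForm H (𝓡∂ 3) X) with hκdef
  have hκ : ∀ (s₀ : S), ∀ p ∈ (extChartAt (𝓡 2) s₀).target,
      κ ((extChartAt (𝓡 2) s₀).symm p) * L.areaCoeff s₀ p
        = H (X 0 (ι ((extChartAt (𝓡 2) s₀).symm p))) ![ε _ - O _ (ε _),
          mfderiv (𝓡 2) (𝓡 n) (fun σ => X 0 (ι σ)) _ (frameVec s₀ p 0),
          mfderiv (𝓡 2) (𝓡 n) (fun σ => X 0 (ι σ)) _ (frameVec s₀ p 1)] := by
    intro s₀ p hp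
    rw [hκdef, boundaryRatio_fluxForm H hN hX hp, hvel]
  have hβ := isPrimitive_gaugeForm (X := fun t σ => X t (ι σ)) g H O L hY ha hε hO hOg hD hvel
    hcov hκ
  have hβ' := isPrimitive_fluxForm H hX hH hvN
  set lag := lagrangianDensity g O L (fun t σ => X t (ι σ)) a with hlag
  set wz : ℝ → N → ℝ := fun t y => pullbackForm H (𝓡∂ 3) X t y (basisVec (𝓡∂ 3) y)
    / vol y (basisVec (𝓡∂ 3) y) with hwz
  -- Supports.
  have hβK : ∀ σ ∉ K, gaugeForm g O (fun σ => X 0 (ι σ)) ε σ = 0 := by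
    exact fun σ hσ => gaugeForm_eq_zero (Y := fun σ => X 0 (ι σ)) (ε := ε) g O (hεK σ hσ)
  have hfK := hβ.eq_zero_of_notMem hI hvS hK.isClosed hβK
  have hκK : ∀ σ ∉ K, κ σ = 0 := by
    intro σ hσ
    have h1 : fluxForm H (𝓡∂ 3) X (ι σ) = 0 :=
      fluxForm_eq_zero H (by rw [hvel, hεK σ hσ, map_zero, sub_zero])
    rw [hκdef, boundaryRatio, h1, AlternatingMap.zero_apply, zero_div]
  have hβK' : ∀ y ∉ K', fluxForm H (𝓡∂ 3) X y = 0 := by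
    intro y hy
    refine fluxForm_eq_zero H ?_
    rw [funext fun t => hXK t y hy, mfderiv_const]
    rfl
  have hfK' : ∀ y ∉ K', deriv (fun t => wz t y) 0 = 0 := by
    intro y hy
    have h1 : ∀ t, X t =ᶠ[nhds y] X 0 := fun t => by
      filter_upwards [hK'.isClosed.isOpen_compl.mem_nhds hy] with z hz using hXK t z hz
    exact deriv_pullback_eq_zero (vol := vol) H h1
  -- Continuity.
  have hfc := hβ.continuous hI hvS
  have hlagc : Continuous fun σ => deriv (fun t => lag t σ) 0 :=
    hs.continuous_deriv_apply 0
  have hκc : Continuous κ := by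
    have h1 : κ = fun σ => deriv (fun t => lag t σ) 0 + κ σ - deriv (fun t => lag t σ) 0 :=
      funext fun σ => (add_sub_cancel_left _ _).symm
    rw [h1]
    exact hfc.sub hlagc
  have hwzc : Continuous fun y => deriv (fun t => wz t y) 0 :=
    hs'.continuous_deriv_apply 0
  -- Stokes' theorem on the world sheet and on the world volume.
  have st := integral_eq_zero_of_isPrimitive hI hvS hβ hfc hK hβK hfK
  have st' := integral_eq_integral_boundaryRatio hN hβ' hwzc hK' hβK' hfK' hκc hK hκK
  have hlagK : ∀ σ ∉ K, deriv (fun t => lag t σ) 0 = 0 := by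
    intro σ hσ
    have h1 := hfK σ hσ
    rwa [hκK σ hσ, add_zero] at h1
  have hsum : ∫ σ in K, deriv (fun t => lag t σ) 0 ∂μ + ∫ y in K', deriv (fun t => wz t y) 0 ∂ν
      = 0 := by
    rw [setIntegral_eq_integral_of_forall_compl_eq_zero hlagK,
      setIntegral_eq_integral_of_forall_compl_eq_zero hfK', st']
    refine (integral_add ?_ ?_).symm.trans st
    · exact hlagc.integrable_of_hasCompactSupport (HasCompactSupport.intro hK hlagK)
    · exact hκc.integrable_of_hasCompactSupport (HasCompactSupport.intro hK hκK)
  have hder := (hs.hasDerivAt_integral (μ := μ) hK).add (hs'.hasDerivAt_integral (μ := ν) hK')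
  rw [hsum] at hder
  exact hder

end Invariance

end DiracSigma

theorem mainTheorem4 {n : ℕ}
    -- the target space with its metric, closed 3-form and Dirac structure
    {M : Type*} [TopologicalSpace M] [ChartedSpace (EuclideanSpace ℝ (Fin n)) M]
    [IsManifold (𝓡 n) ∞ M] [T2Space M] [SecondCountableTopology M]
    (g : Bundle.ContMDiffRiemannianMetric (𝓡 n) ∞ (EuclideanSpace ℝ (Fin n))
      (fun x : M => TangentSpace (𝓡 n) x))
    (H : ∀ x : M, TangentSpace (𝓡 n) x [⋀^Fin 3]→L[ℝ] ℝ)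
    (hH : DiracSigma.IsClosedThreeForm H)
    (O : ∀ x : M, TangentSpace (𝓡 n) x →L[ℝ] TangentSpace (𝓡 n) x)
    (hO : DiracSigma.IsSmoothEnd O)
    (hOg : ∀ (x : M) (u v : TangentSpace (𝓡 n) x), g.inner x (O x u) (O x v) = g.inner x u v)
    (hD : DiracSigma.IsDirac H (DiracSigma.graph g O))
    -- the world sheet
    {S : Type*} [TopologicalSpace S] [ChartedSpace (EuclideanSpace ℝ (Fin 2)) S]
    [IsManifold (𝓡 2) ∞ S] [T2Space S] [SecondCountableTopology S]
    [MeasurableSpace S] [BorelSpace S]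
    (L : DiracSigma.LorentzianSurface S)
    -- the membrane world volume, whose boundary is the world sheet
    {N : Type*} [TopologicalSpace N] [ChartedSpace (EuclideanHalfSpace 3) N]
    [IsManifold (𝓡∂ 3) ∞ N] [T2Space N] [SecondCountableTopology N]
    [MeasurableSpace N] [BorelSpace N]
    (vol : ∀ y : N, TangentSpace (𝓡∂ 3) y [⋀^Fin 3]→L[ℝ] ℝ) (ι : S → N)
    (hN : DiracSigma.IsFilling L vol ι) :
    -- `Θ` is the inverse of `(id + O) + (id - O) ∗`
    (∀ (σ : S) (x : M) (β : TangentSpace (𝓡 2) σ →L[ℝ] TangentSpace (𝓡 n) x),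
      DiracSigma.opT L O σ x (DiracSigma.opTheta L O σ x β) = β ∧
      DiracSigma.opTheta L O σ x (DiracSigma.opT L O σ x β) = β) ∧
    -- `[u_j, u_k] = C^i_jk u_i` for the twisted Courant bracket
    (∀ (x₀ : M), ∀ p ∈ (extChartAt (𝓡 n) x₀).target, ∀ j k : Fin n,
      VectorField.lieBracket ℝ (DiracSigma.secVec O x₀ j) (DiracSigma.secVec O x₀ k) p
          = ∑ i, DiracSigma.structureFun g H O x₀ p i j k • DiracSigma.secVec O x₀ i p ∧
      DiracSigma.courantForm (DiracSigma.formCoord H x₀)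
          (DiracSigma.secVec O x₀ j) (DiracSigma.secForm g O x₀ j)
          (DiracSigma.secVec O x₀ k) (DiracSigma.secForm g O x₀ k) p
          = ∑ i, DiracSigma.structureFun g H O x₀ p i j k • DiracSigma.secForm g O x₀ i p) ∧
    -- the action is invariant under `δX = (id - O) ε`, `δ𝔞 = gaugeVar`
    (∀ (K : Set S) (K' : Set N), IsCompact K → IsCompact K' →
      ∀ (X : ℝ → N → M)
        (a : ∀ (t : ℝ) (σ : S), TangentSpace (𝓡 2) σ →L[ℝ] TangentSpace (𝓡 n) (X t (ι σ)))
        (ε : ∀ σ : S, TangentSpace (𝓡 n) (X 0 (ι σ))),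
      ContMDiff (𝓘(ℝ, ℝ).prod (𝓡∂ 3)) (𝓡 n) ∞ (fun q : ℝ × N => X q.1 q.2) →
      ContMDiff (𝓘(ℝ, ℝ).prod (𝓡 2).tangent) (𝓡 n).tangent ∞
        (fun q : ℝ × TangentBundle (𝓡 2) S =>
          (⟨X q.1 (ι q.2.proj), a q.1 q.2.proj q.2.snd⟩ : TangentBundle (𝓡 n) M)) →
      ContMDiff (𝓡 2) (𝓡 n).tangent ∞
        (fun σ : S => (⟨X 0 (ι σ), ε σ⟩ : TangentBundle (𝓡 n) M)) →
      (∀ σ ∉ K, ε σ = 0) →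
      (∀ t, ∀ y ∉ K', X t y = X 0 y) →
      (∀ σ, mfderiv 𝓘(ℝ, ℝ) (𝓡 n) (fun t => X t (ι σ)) 0 (1 : ℝ)
        = ε σ - O (X 0 (ι σ)) (ε σ)) →
      (∀ (σ : S) (v : TangentSpace (𝓡 2) σ),
        DiracSigma.covAlong g (fun t => X t (ι σ)) (fun t => a t σ v)
          = DiracSigma.gaugeVar L g H O (fun τ => X 0 (ι τ)) (a 0) ε σ v) →
      HasDerivAt (fun t => DiracSigma.action g H O L vol ι K K' (X t) (a t)) 0 0) := by
  refine ⟨fun σ x β => ⟨DiracSigma.opT_opTheta g O hOg L σ x β,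
    DiracSigma.opTheta_opT g O hOg L σ x β⟩, fun x₀ p hp j k =>
    DiracSigma.bracket_eq_structureFun g H O hO hOg hD hp j k, ?_⟩
  intro K K' hK hK' X a ε hX ha hε hεK hXK hvel hcov
  exact DiracSigma.hasDerivAt_action g H O hH hO hOg hD hN hK hK' hX ha hε hεK hXK hvel hcov
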